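/- **Setting.** For $N\ge 1$ let $\mathbb{GT}_N$ be the set of signatures $\lambda=(\lambda_1\ge\dots\ge\lambda_N)$, $\lambda_i\in\mathbb{Z}$, and let $$s_\lambda(x_1,\dots,x_N)=\frac{\det[x_i^{\lambda_j+N-j}]_{i,j=1}^N}{\prod_{i<j}(x_i-x_j)}$$ be the Schur (Laurent) polynomials. Let $\rho_N$, $N\ge1$, be probability measures on $\mathbb{GT}_N$ such that, for every $N$, the Schur generating function $$S_{\rho_N}(x_1,\dots,x_N)=\sum_{\lambda\in\mathbb{GT}_N}\rho_N(\lambda)\,\frac{s_\lambda(x_1,\dots,x_N)}{s_\lambda(1^N)}$$ converges in a complex neighborhood of $1^N=(1,\dots,1)$. Let $m[\rho_N]=\frac1N\sum_{i=1}^N\delta\big(\frac{\lambda_i+N-i}{N}\big)$, with $\lambda$ distributed according to $\rho_N$, be the random empirical measure. Assume that there are symmetric functions $F_k(z_1,\dots,z_k)$, $k\ge1$, analytic in a complex neighborhood of $1^k$, such that for every fixed $k\ge 1$ $$\lim_{N\to\infty}\sqrt[N]{S_{\rho_N}(u_1,\dots,u_k,1^{N-k})}=F_k(u_1,\dots,u_k)$$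 uniformly in a complex neighborhood of $1^k$ that does not depend on $N$; here, for all large $N$, the series converges on this neighborhood and the root is a holomorphic branch on it that equals $1$ at $1^k$. We say that $m[\rho_N]$ converges in probability, in the sense of moments, to a probability measure $\mu$ on $\mathbb{R}$ with finite moments of all orders if, for every $k$, the random variable $\int x^k\,m[\rho_N](dx)$ converges in probability to $\int x^k\,\mu(dx)$ as $N\to\infty$. **Proposition.** There is a probability measure $\mu$ on $\mathbb{R}$ to which $m[\rho_N]$ converges in probability, in the sense of moments. For every such $\mu$ and every $k\ge1$, put $w_{k+1}=\exp\big(\tfrac{2\pi\sqrt{-1}}{k+1}\big)$ and $$H_k(v)=\frac{e^v}{e^v-1}-\frac1v+e^v\,\partial_1F_{k+1}\big(e^v,\,1-w_{k+1}+w_{k+1}e^v,\,\dots,\,1-w_{k+1}^k+w_{k+1}^ke^v\big),$$ where $\partial_1$ is the partial derivative in the first variable and the removable singularity of $\frac{e^v}{e^v-1}-\frac1v$ at $v=0$ is filled in with the value $\frac12$. Then the moments $\mu_k=\int x^k\,\mu(dx)$ are $$\mu_k=\sum_{l=0}^{k}\binom{k}{l}\frac{1}{(l+1)!}\,\partial_v^{\,l}\Big(H_k(v)^{k-l}\Big)\Big|_{v=0},$$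 and the free cumulants $c_k$ of $\mu$, that is, the numbers determined by $\mu_n=\sum_{\pi}\prod_{B\in\pi}c_{|B|}$ for $n\ge1$ (sum over the non-crossing set partitions $\pi$ of $\{1,\dots,n\}$), are $$c_k=\frac{1}{(k-1)!}\,\partial_v^{\,k-1}H_k(v)\Big|_{v=0}.$$ -/

import Mathlib

open Filter Topology MeasureTheory

/-- Signatures of length `N`: non-increasing `N`-tuples of integers. -/
def Signature (N : ℕ) : Type := {l : Fin N → ℤ // Antitone l}

namespace Signature

/-- The shifted coordinate `λ_i + N - i` for `i = 1, …, N` (the index `i : Fin N` starts at `0`). -/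
def shifted {N : ℕ} (l : Signature N) (i : Fin N) : ℤ := l.1 i + ((N : ℤ) - 1 - (i : ℤ))

/-- The ratio `det [x_i ^ (λ_j + N - j)] / ∏_{i < j} (x_i - x_j)`, meaningful at points with pairwise
distinct nonzero coordinates. -/
noncomputable def schurRatio {N : ℕ} (l : Signature N) (x : Fin N → ℂ) : ℂ :=
  (Matrix.of fun i j : Fin N => x i ^ l.shifted j).det /
    ∏ i : Fin N, ∏ j ∈ Finset.Ioi i, (x i - x j)

/-- The Schur function `s_λ (x_1, …, x_N)`. It is a Laurent polynomial, so its value at a point with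
nonzero coordinates, some of which may coincide, is the limit of the defining ratio along points with
pairwise distinct nonzero coordinates. -/
noncomputable def schur {N : ℕ} (l : Signature N) (x : Fin N → ℂ) : ℂ :=
  limUnder (𝓝[{y : Fin N → ℂ | Function.Injective y ∧ ∀ i, y i ≠ 0}] x) l.schurRatio

/-- The empirical measure `(1 / N) ∑_i δ ((λ_i + N - i) / N)` of a signature. -/
noncomputable def empiricalMeasure {N : ℕ} (l : Signature N) : Measure ℝ :=
  (N : ENNReal)⁻¹ • ∑ i : Fin N, Measure.dirac ((l.shifted i : ℝ) / (N : ℝ))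

end Signature

/-- The term of the Schur generating function of `ρ` that corresponds to the signature `l`. -/
noncomputable def sgfTerm {N : ℕ} (ρ : PMF (Signature N)) (x : Fin N → ℂ) (l : Signature N) : ℂ :=
  ((ρ l).toReal : ℂ) * (l.schur x / l.schur 1)

/-- The Schur generating function of `ρ`. -/
noncomputable def sgf {N : ℕ} (ρ : PMF (Signature N)) (x : Fin N → ℂ) : ℂ :=
  ∑' l : Signature N, sgfTerm ρ x l

/-- The point `(u_1, …, u_k, 1^{N - k})`, for `k ≤ N`. -/
def padOnes {k : ℕ} (N : ℕ) (u : Fin k → ℂ) : Fin N → ℂ :=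
  fun i => if h : (i : ℕ) < k then u ⟨i, h⟩ else 1

/-- The `N`-th root of `S_{ρ_N} (u_1, …, u_k, 1^{N - k})` converges to `f (u_1, …, u_k)` as `N → ∞`,
uniformly in a complex neighborhood `U` of `1^k` (which does not depend on `N`). The root is the
holomorphic branch `G N` that equals `1` at `1^k`, and for large `N` the series that defines the Schur
generating function converges at the points in question. -/
def RootLimit (ρ : ∀ N : ℕ, PMF (Signature N)) {k : ℕ} (f : (Fin k → ℂ) → ℂ) : Prop :=
  ∃ U : Set (Fin k → ℂ), IsOpen U ∧ 1 ∈ U ∧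
    ∃ G : ℕ → (Fin k → ℂ) → ℂ,
      (∀ᶠ N in atTop, AnalyticOnNhd ℂ (G N) U ∧ G N 1 = 1 ∧
        ∀ u ∈ U, Summable (sgfTerm (ρ N) (padOnes N u)) ∧ G N u ^ N = sgf (ρ N) (padOnes N u)) ∧
      TendstoUniformlyOn G f atTop U

/-- The probability measure `μ` on `ℝ` is a limit of the random empirical measures `m[ρ_N]` in
probability, in the sense of moments: every moment of `m[ρ_N]`, which is a random variable, converges
in probability to the (finite) moment of `μ`. -/
def IsLimitInMoments (ρ : ∀ N : ℕ, PMF (Signature N)) (μ : Measure ℝ) : Prop :=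
  IsProbabilityMeasure μ ∧ (∀ k : ℕ, Integrable (fun x : ℝ => x ^ k) μ) ∧
    ∀ k : ℕ, ∀ ε : ℝ, 0 < ε →
      Tendsto
        (fun N : ℕ => (ρ N).toOuterMeasure
          {l | ε ≤ |(∫ x, x ^ k ∂l.empiricalMeasure) - ∫ x, x ^ k ∂μ|})
        atTop (𝓝 0)

/-- A set partition of `Fin n` is non-crossing if there are no `a < b < c < d` with `a, c` in one block
and `b, d` in another block. -/
def IsNonCrossing {n : ℕ} (π : Finpartition (Finset.univ : Finset (Fin n))) : Prop :=
  ∀ B ∈ π.parts, ∀ C ∈ π.parts, ∀ a ∈ B, ∀ b ∈ C, ∀ c ∈ B, ∀ d ∈ C,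
    a < b → b < c → c < d → B = C

open Classical in
/-- The free cumulants of a sequence of moments `m`, by the recursion that solves the free
moment-cumulant formula `m n = ∑_π ∏_{B ∈ π} c_{|B|}` (sum over the non-crossing partitions of
`{1, …, n}`) for `c n`, the contribution of the partition with a single block. See
`moment_eq_sum_freeCumulant`. -/
noncomputable def freeCumulant (m : ℕ → ℝ) (n : ℕ) : ℝ :=
  m n - ∑ π : Finpartition (Finset.univ : Finset (Fin n)) with
      IsNonCrossing π ∧ ∀ B ∈ π.parts, B.card < n,
    ∏ B ∈ π.parts, if _h : B.card < n then freeCumulant m B.card else 0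
termination_by n

open Classical in
/-- The free moment-cumulant formula, which determines the free cumulants `c_1, c_2, …`. -/
theorem moment_eq_sum_freeCumulant (m : ℕ → ℝ) (n : ℕ) (hn : 1 ≤ n) :
    m n = ∑ π : Finpartition (Finset.univ : Finset (Fin n)) with IsNonCrossing π,
      ∏ B ∈ π.parts, freeCumulant m B.card := by
  have hne : (Finset.univ : Finset (Fin n)) ≠ ⊥ := by
    have : Nonempty (Fin n) := ⟨⟨0, hn⟩⟩
    exact Finset.univ_nonempty.ne_empty
  set τ : Finpartition (Finset.univ : Finset (Fin n)) := Finpartition.indiscrete hne with hτ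
  have hτp : τ.parts = {Finset.univ} := rfl
  have hτnc : IsNonCrossing τ := by
    intro B hB C hC a _ b _ c _ d _ _ _ _
    rw [hτp, Finset.mem_singleton] at hB hC
    rw [hB, hC]
  have hone : ∀ π : Finpartition (Finset.univ : Finset (Fin n)),
      (∀ B ∈ π.parts, B.card < n) ↔ π ≠ τ := by
    intro π
    constructor
    · rintro h rfl
      have := h Finset.univ (by rw [hτp]; exact Finset.mem_singleton_self _)
      simp at this
    · intro h B hB
      by_contra hlt
      apply h
      have hBu : B = Finset.univ := by
        rw [← Finset.card_eq_iff_eq_univ, Fintype.card_fin]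
        have := Finset.card_le_univ B
        rw [Fintype.card_fin] at this
        omega
      subst hBu
      apply Finpartition.ext
      rw [hτp, Finset.eq_singleton_iff_unique_mem]
      refine ⟨hB, fun C hC => ?_⟩
      by_contra hCne
      have hd := π.disjoint hC hB hCne
      have : C = ∅ := by
        simpa using disjoint_top.mp hd
      rw [this] at hC; exact π.bot_notMem hC
  have hsplit : (Finset.univ.filter fun π : Finpartition (Finset.univ : Finset (Fin n)) =>
      IsNonCrossing π) = insert τ (Finset.univ.filter fun π => IsNonCrossing π ∧
        ∀ B ∈ π.parts, B.card < n) := by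
    ext π
    simp only [Finset.mem_filter, Finset.mem_univ, true_and, Finset.mem_insert, hone]
    by_cases h : π = τ
    · simp [h, hτnc]
    · simp [h]
  have hrest : ∑ π : Finpartition (Finset.univ : Finset (Fin n)) with
      IsNonCrossing π ∧ ∀ B ∈ π.parts, B.card < n,
      ∏ B ∈ π.parts, (if _h : B.card < n then freeCumulant m B.card else 0) =
      ∑ π : Finpartition (Finset.univ : Finset (Fin n)) with
      IsNonCrossing π ∧ ∀ B ∈ π.parts, B.card < n,
      ∏ B ∈ π.parts, freeCumulant m B.card := by
    refine Finset.sum_congr rfl fun π hπ => Finset.prod_congr rfl fun B hB => ?_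
    rw [dif_pos ((Finset.mem_filter.mp hπ).2.2 B hB)]
  have hc := freeCumulant.eq_1 m n
  rw [hsplit, Finset.sum_insert (by simp [hone]), hτp, Finset.prod_singleton, ← hrest,
    Finset.card_univ, Fintype.card_fin]
  linarith

/-- The function `e^v / (e^v - 1) - 1 / v`, with its removable singularity at `0` filled in. -/
noncomputable def expKernel : ℂ → ℂ :=
  Function.update (fun v => Complex.exp v / (Complex.exp v - 1) - 1 / v) 0 (1 / 2)

/-- The primitive root of unity `w_m = exp (2 π i / m)`. -/
noncomputable def rootW (m : ℕ) : ℂ := Complex.exp (2 * Real.pi * Complex.I / m)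

/-- The partial derivative of `f` with respect to its first variable. -/
noncomputable def partialFirst {k : ℕ} (f : (Fin (k + 1) → ℂ) → ℂ) (u : Fin (k + 1) → ℂ) : ℂ :=
  deriv (fun z => f (Function.update u 0 z)) (u 0)

/-- The function
`e^v / (e^v - 1) - 1 / v + e^v ∂_1 f (e^v, 1 - w + w e^v, …, 1 - w^k + w^k e^v)`, `w = w_{k+1}`. -/
noncomputable def cumulantFunction {k : ℕ} (f : (Fin (k + 1) → ℂ) → ℂ) (v : ℂ) : ℂ :=
  expKernel v + Complex.exp v *
    partialFirst f
      (fun j => 1 - rootW (k + 1) ^ (j : ℕ) + rootW (k + 1) ^ (j : ℕ) * Complex.exp v)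

/-!
The argument extracts the moments of `m[ρ_N]` from the Schur generating function by a `q`-difference
operator, and expresses them as residues at `z = 1`.

*Moments as contour integrals.* A Schur function is an eigenfunction of
`f ↦ ∑ i, ∏_{j ≠ i} (q x_i - x_j) / (x_i - x_j) f (x_1, …, q x_i, …, x_N)` with eigenvalue
`∑_j q ^ (λ_j + N - j)` (`Signature.sum_qShift_schurSum`). With `q = exp (τ / N)`, the coefficient of
`τ ^ k` in the eigenvalue is `N / k!` times the `k`-th moment of the empirical measure. The sum over
the coordinates that are equal to `1` is a sum of residues of a kernel which has, as a function of
`z`, a pole at `1` whose order grows with `N`. By Ryser's formula a Schur function is a linear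
combination of products `∏_j A (x_j)`, on which the operator acts by the factor `A (q z) / A z`. The
products `∏_j A (1 + (z - 1) w ^ j)` over a root-of-unity cluster, `w = w_{K+1}`, are constant up to
`O ((z - 1) ^ (K + 1))`. Since the kernel is a sum of terms of order `τ ^ (m - 1) / (z - 1) ^ m`, this error
does not contribute to the coefficients of `τ ^ k` with `k ≤ K`
(`circleIntegral_qShiftKernel_mul_pow_eq_zero`). Therefore the `k`-th moment is a double contour
integral of the Schur function at points of which all but `K + 1` coordinates (and finitely many
others, held fixed) are equal to `1` (`Signature.sum_pow_mul_schurSum`), a formula that can be summed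
over `λ` (`hasSum_momentFunctional`).

*The limit of the averages.* By the same cancellation, the generating function `S (z, q)` of the
cluster with first point `q z` can be replaced by `S (z, q) / S (z, 1)`. When the `N`-th root converges
to `F`, this ratio tends to `exp (τ z ∂₁F / F)` and the averaged moments tend to
`(k + 1)⁻¹` times the residue of `z⁻¹ (z / (z - 1) + z ∂₁F / F) ^ (k + 1)` (`tendsto_moment`).
The denominator `F` is `1 + O ((z - 1) ^ (K + 1))` on the cluster and may be dropped, and the
substitution `z = exp v` turns the residue into `(k + 1)⁻¹ [v ^ k] (1 + v H v) ^ (k + 1)`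
(`eventually_limitMoment_eq`).

*Concentration.* The weights `ρ_N (λ)` multiplied by a moment have a generating function as well, and
its quotient by the original one is bounded uniformly in `N` (`norm_moment_le`). By the Schwarz lemma
a displacement of order `1 / N` changes the quotient by `O (1 / N)`, which bounds the variance of the
moments by `O (1 / N)` (`exists_variance_le`). Chebyshev's inequality gives convergence in
probability, and tightness gives a limit measure (`isLimitInMoments_of_tendsto`).

*Moments and cumulants.* The binomial theorem gives the formula for the moments. For the cumulants,
all moments of order `k ≤ K` are computed with the same function `H = H_K`, so that
`m_k = (k + 1)⁻¹ [v ^ k] C ^ (k + 1)` with `C = 1 + v H`. By Lagrange inversion the `m_k` are the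
coefficients of the solution of `M = C (z M)`. The coefficients of its powers satisfy the same
recursion as the sums over non-crossing partitions with weights `[v ^ |B|] C` (`nonCrossingSum_eq`),
so the free cumulants are the coefficients of `C` (`freeCumulant_eq_coeff`).
-/

/-! ### Schur functions as Laurent polynomials -/

/-- An alternant with strictly decreasing exponents is the Vandermonde product times a sum of Laurent
monomials. The proof is by induction on the number of variables: column operations clear the first
row except for its first entry, and each remaining entry is divisible by `x 0 - x i`. -/
theorem det_eq_vandermonde_mul_laurent_sum (n : ℕ) (L : Fin n → ℤ) (hL : StrictAnti L) :
    ∃ (ι : Type) (_ : Fintype ι) (_ : Nonempty ι) (e : ι → Fin n → ℤ),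
      ∀ x : Fin n → ℂ, (∀ i, x i ≠ 0) →
        (Matrix.of fun i j : Fin n => x i ^ L j).det =
          (∏ i : Fin n, ∏ j ∈ Finset.Ioi i, (x i - x j)) * ∑ a, ∏ i, x i ^ e a i := by
  induction n with
  | zero => exact ⟨Unit, inferInstance, inferInstance, fun _ i => i.elim0, fun x _ => by simp⟩
  | succ n ih =>
    -- the gaps between consecutive exponents
    set d : Fin n → ℕ := fun j => (L j.castSucc - L j.succ).toNat with hd
    have hdL : ∀ j, (d j : ℤ) = L j.castSucc - L j.succ := fun j => by
      have := hL (Fin.castSucc_lt_succ (i := j))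
      simp only [hd]; omega
    have hdpos : ∀ j, 0 < d j := fun j => by
      have := hL (Fin.castSucc_lt_succ (i := j)); have := hdL j; omega
    -- a choice of one exponent in each gap, for the remaining variables (branching rule)
    have hanti : ∀ m : (j : Fin n) → Fin (d j),
        StrictAnti fun j : Fin n => L j.succ + ((m j : ℕ) : ℤ) := by
      intro m j j' hjj
      have h1 := hdL j'
      have h2 := (m j').2
      have h3 : L j'.castSucc ≤ L j.succ := hL.antitone (by
        rw [Fin.le_def]; simpa using hjj)
      simp only
      omega
    choose ι hι hne e he using fun m : (j : Fin n) → Fin (d j) => ih _ (hanti m)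
    refine ⟨(Σ m, ι m), inferInstance, ⟨⟨fun j => ⟨0, hdpos j⟩, Classical.choice (hne _)⟩⟩,
      fun p => Fin.cons (L 0 + ∑ j, (-1 - ((p.1 j : ℕ) : ℤ))) (e p.1 p.2), fun x hx => ?_⟩
    -- the matrix after subtracting multiples of the preceding columns
    set B : Matrix (Fin (n + 1)) (Fin (n + 1)) ℂ := Matrix.of fun i =>
      Fin.cons (x i ^ L 0) fun j : Fin n =>
        x i ^ L j.succ - x 0 ^ (L j.succ - L j.castSucc) * x i ^ L j.castSucc with hB
    have h1 : (Matrix.of fun i j : Fin (n + 1) => x i ^ L j).det = B.det := by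
      refine Matrix.det_eq_of_forall_col_eq_smul_add_pred
        (fun j => x 0 ^ (L j.succ - L j.castSucc)) (fun i => by simp [hB]) fun i j => by simp [hB]
    have h2 : ∀ j : Fin n, B 0 j.succ = 0 := fun j => by
      simp [hB, ← zpow_add₀ (hx 0)]
    have h3 : ∀ i j : Fin n, B i.succ j.succ = (x 0 - x i.succ) *
        ∑ m : Fin (d j), x 0 ^ (-1 - ((m : ℕ) : ℤ)) * x i.succ ^ (L j.succ + ((m : ℕ) : ℤ)) := by
      intro i j
      have h0 := hx 0
      have hi := hx i.succ
      have hg := (Commute.all (x 0) (x i.succ)).mul_geom_sum₂ (d j)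
      have e1 : L j.castSucc = L j.succ + d j := by rw [hdL]; ring
      have e2 : L j.succ - L j.castSucc = -(d j : ℤ) := by rw [hdL]; ring
      simp only [hB, Matrix.of_apply, Fin.cons_succ]
      rw [e2, e1, zpow_add₀ hi, zpow_neg, zpow_natCast, zpow_natCast]
      have : ∀ m : Fin (d j), x 0 ^ (-1 - ((m : ℕ) : ℤ)) * x i.succ ^ (L j.succ + ((m : ℕ) : ℤ)) =
          (x i.succ ^ L j.succ * (x 0 ^ d j)⁻¹) *
            (x i.succ ^ (m : ℕ) * x 0 ^ (d j - 1 - (m : ℕ))) := by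
        intro m
        have hm := m.2
        have e3 : x 0 ^ (-1 - ((m : ℕ) : ℤ)) = (x 0 ^ d j)⁻¹ * x 0 ^ (d j - 1 - (m : ℕ)) := by
          rw [← zpow_natCast, ← zpow_neg, ← zpow_natCast, ← zpow_add₀ h0]
          congr 1; omega
        rw [e3, zpow_add₀ hi, zpow_natCast]; ring
      rw [Finset.sum_congr rfl fun m _ => this m, ← Finset.mul_sum,
        Fin.sum_univ_eq_sum_range (fun m => x i.succ ^ m * x 0 ^ (d j - 1 - m)) (d j)]
      have hg' : (x 0 - x i.succ) * ∑ m ∈ Finset.range (d j),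
          x i.succ ^ m * x 0 ^ (d j - 1 - m) = x 0 ^ d j - x i.succ ^ d j := by
        rw [← neg_sub (x i.succ), neg_mul, (Commute.all (x i.succ) (x 0)).mul_geom_sum₂]; ring
      have hd0 : x 0 ^ d j ≠ 0 := pow_ne_zero _ h0
      calc _ = x i.succ ^ L j.succ * (x 0 ^ d j)⁻¹ * (x 0 ^ d j - x i.succ ^ d j) := by
            field_simp
        _ = _ := by rw [← hg']; ring
    have h4 : B.det = x 0 ^ L 0 * ((∏ i : Fin n, (x 0 - x i.succ)) *
        ∑ m : (j : Fin n) → Fin (d j), (∏ j, x 0 ^ (-1 - ((m j : ℕ) : ℤ))) *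
          (Matrix.of fun i j : Fin n => x i.succ ^ (L j.succ + ((m j : ℕ) : ℤ))).det) := by
      rw [Matrix.det_succ_row_zero, Fin.sum_univ_succ]
      simp only [h2]
      simp only [mul_zero, zero_mul, Finset.sum_const_zero, add_zero]
      have e1 : (B.submatrix Fin.succ (Fin.succAbove 0)) = Matrix.of fun i j : Fin n =>
          (x 0 - x i.succ) * (Matrix.of fun i j : Fin n => ∑ m : Fin (d j),
            x 0 ^ (-1 - ((m : ℕ) : ℤ)) * x i.succ ^ (L j.succ + ((m : ℕ) : ℤ))) i j := by
        ext i j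
        simp [h3]
      have e2 : (Matrix.of fun i j : Fin n => ∑ m : Fin (d j),
            x 0 ^ (-1 - ((m : ℕ) : ℤ)) * x i.succ ^ (L j.succ + ((m : ℕ) : ℤ))).det =
          ∑ m : (j : Fin n) → Fin (d j), (∏ j, x 0 ^ (-1 - ((m j : ℕ) : ℤ))) *
          (Matrix.of fun i j : Fin n => x i.succ ^ (L j.succ + ((m j : ℕ) : ℤ))).det := by
        rw [← Matrix.det_transpose]
        have := (Matrix.detRowAlternating (n := Fin n) (R := ℂ)).toMultilinearMap.map_sum
          (fun (j : Fin n) (m : Fin (d j)) (i : Fin n) =>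
            x 0 ^ (-1 - ((m : ℕ) : ℤ)) * x i.succ ^ (L j.succ + ((m : ℕ) : ℤ)))
        have e3 : (Matrix.of fun i j : Fin n => ∑ m : Fin (d j),
            x 0 ^ (-1 - ((m : ℕ) : ℤ)) * x i.succ ^ (L j.succ + ((m : ℕ) : ℤ))).transpose =
            fun j => ∑ m : Fin (d j), fun i : Fin n =>
            x 0 ^ (-1 - ((m : ℕ) : ℤ)) * x i.succ ^ (L j.succ + ((m : ℕ) : ℤ)) := by
          ext j i
          simp [Finset.sum_apply]
        rw [e3]
        refine this.trans (Finset.sum_congr rfl fun m _ => ?_)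
        rw [← Matrix.det_mul_row, ← Matrix.det_transpose]
        rfl
      rw [e1, Matrix.det_mul_column, e2]
      simp [hB]
    rw [h1, h4]
    have hV : (∏ i : Fin (n + 1), ∏ j ∈ Finset.Ioi i, (x i - x j)) =
        (∏ i : Fin n, (x 0 - x i.succ)) *
          ∏ i : Fin n, ∏ j ∈ Finset.Ioi i, (x i.succ - x j.succ) := by
      rw [Fin.prod_univ_succ, Fin.prod_Ioi_zero]
      congr 1
      exact Finset.prod_congr rfl fun i _ => Fin.prod_Ioi_succ (fun j => x i.succ - x j) i
    rw [hV, Fintype.sum_sigma]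
    simp only [Fin.prod_univ_succ, Fin.cons_zero, Fin.cons_succ]
    rw [Finset.mul_sum, Finset.mul_sum, Finset.mul_sum]
    refine Finset.sum_congr rfl fun m _ => ?_
    rw [he m (fun i => x i.succ) fun i => hx i.succ, zpow_add₀ (hx 0), ← Finset.mul_sum]
    have : x 0 ^ (∑ j, (-1 - ((m j : ℕ) : ℤ))) = ∏ j, x 0 ^ (-1 - ((m j : ℕ) : ℤ)) := by
      induction (Finset.univ : Finset (Fin n)) using Finset.induction_on with
      | empty => simp
      | insert a s ha ih => rw [Finset.sum_insert ha, Finset.prod_insert ha, zpow_add₀ (hx 0), ih]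
    rw [this]; ring

namespace Signature

theorem strictAnti_shifted {N : ℕ} (l : Signature N) : StrictAnti l.shifted := by
  intro i j hij
  have h := l.2 hij.le
  have : (i : ℤ) < j := by exact_mod_cast hij
  simp only [shifted]
  omega

theorem exists_schur_exponents {N : ℕ} (l : Signature N) :
    ∃ (ι : Type) (_ : Fintype ι) (_ : Nonempty ι) (e : ι → Fin N → ℤ),
      ∀ x : Fin N → ℂ, (∀ i, x i ≠ 0) →
        (Matrix.of fun i j : Fin N => x i ^ l.shifted j).det =
          (∏ i : Fin N, ∏ j ∈ Finset.Ioi i, (x i - x j)) * ∑ a, ∏ i, x i ^ e a i :=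
  det_eq_vandermonde_mul_laurent_sum N l.shifted l.strictAnti_shifted

/-- An index set for the monomials, counted with multiplicity, of a Schur function. -/
def MonomialIndex {N : ℕ} (l : Signature N) : Type := l.exists_schur_exponents.choose

noncomputable instance {N : ℕ} (l : Signature N) : Fintype l.MonomialIndex :=
  l.exists_schur_exponents.choose_spec.choose

instance {N : ℕ} (l : Signature N) : Nonempty l.MonomialIndex :=
  l.exists_schur_exponents.choose_spec.choose_spec.choose

/-- The exponents of the monomials of a Schur function. -/
noncomputable def exponent {N : ℕ} (l : Signature N) : l.MonomialIndex → Fin N → ℤ :=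
  l.exists_schur_exponents.choose_spec.choose_spec.choose_spec.choose

/-- The Schur function as an explicit sum of Laurent monomials with coefficient one. -/
noncomputable def schurSum {N : ℕ} (l : Signature N) (x : Fin N → ℂ) : ℂ :=
  ∑ a, ∏ i, x i ^ l.exponent a i

theorem det_eq_vandermonde_mul_schurSum {N : ℕ} (l : Signature N) {x : Fin N → ℂ}
    (hx : ∀ i, x i ≠ 0) :
    (Matrix.of fun i j : Fin N => x i ^ l.shifted j).det =
      (∏ i : Fin N, ∏ j ∈ Finset.Ioi i, (x i - x j)) * l.schurSum x :=
  l.exists_schur_exponents.choose_spec.choose_spec.choose_spec.choose_spec x hx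

theorem vandermonde_ne_zero {N : ℕ} {x : Fin N → ℂ} (hx : Function.Injective x) :
    (∏ i : Fin N, ∏ j ∈ Finset.Ioi i, (x i - x j)) ≠ 0 :=
  Finset.prod_ne_zero_iff.2 fun _ _ => Finset.prod_ne_zero_iff.2 fun _ hj =>
    sub_ne_zero.2 fun h => (Finset.mem_Ioi.1 hj).ne (hx h)

theorem schurRatio_eq_schurSum {N : ℕ} (l : Signature N) {x : Fin N → ℂ}
    (hx : ∀ i, x i ≠ 0) (hinj : Function.Injective x) : l.schurRatio x = l.schurSum x := by
  rw [schurRatio, det_eq_vandermonde_mul_schurSum l hx,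
    mul_div_cancel_left₀ _ (vandermonde_ne_zero hinj)]

theorem continuousAt_schurSum {N : ℕ} (l : Signature N) {x : Fin N → ℂ}
    (hx : ∀ i, x i ≠ 0) : ContinuousAt l.schurSum x := by
  unfold schurSum
  refine tendsto_finsetSum _ fun a _ => tendsto_finsetProd _ fun i _ => ?_
  exact ((continuous_apply i).continuousAt (x := x)).zpow₀ _ (Or.inl (hx i))

/-- Every point with nonzero coordinates is a limit of points with distinct nonzero coordinates. -/
theorem tendsto_add_mul_index {N : ℕ} {x : Fin N → ℂ} (hx : ∀ i, x i ≠ 0) :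
    Tendsto (fun (ε : ℂ) (i : Fin N) => x i + ε * (i : ℕ)) (𝓝[≠] 0)
      (𝓝[{y : Fin N → ℂ | Function.Injective y ∧ ∀ i, y i ≠ 0}] x) := by
  have h0 : Tendsto (fun (ε : ℂ) (i : Fin N) => x i + ε * (i : ℕ)) (𝓝 0) (𝓝 x) := by
    have : Continuous (fun (ε : ℂ) (i : Fin N) => x i + ε * (i : ℕ)) := by fun_prop
    simpa using this.tendsto 0
  refine tendsto_nhdsWithin_iff.2 ⟨h0.mono_left nhdsWithin_le_nhds, ?_⟩
  have h1 : ∀ᶠ ε : ℂ in 𝓝[≠] 0, ∀ i : Fin N, x i + ε * (i : ℕ) ≠ 0 := by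
    refine eventually_all.2 fun i => ?_
    have : Tendsto (fun ε : ℂ => x i + ε * (i : ℕ)) (𝓝[≠] 0) (𝓝 (x i)) :=
      ((tendsto_pi_nhds.1 h0) i).mono_left nhdsWithin_le_nhds
    exact this.eventually_ne (hx i)
  have h2 : ∀ᶠ ε : ℂ in 𝓝[≠] 0, ∀ i j : Fin N, i ≠ j →
      x i + ε * (i : ℕ) ≠ x j + ε * (j : ℕ) := by
    refine eventually_all.2 fun i => eventually_all.2 fun j => ?_
    by_cases hij : i = j
    · simp [hij]
    have hc : ((i : ℕ) : ℂ) - (j : ℕ) ≠ 0 := by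
      rw [sub_ne_zero]; exact_mod_cast fun h => hij (Fin.ext h)
    by_cases hxx : x i = x j
    · filter_upwards [self_mem_nhdsWithin] with ε hε _ h
      have : ε * (((i : ℕ) : ℂ) - (j : ℕ)) = 0 := by linear_combination h - hxx
      rcases mul_eq_zero.1 this with h | h
      · exact hε h
      · exact hc h
    · have : Tendsto (fun ε : ℂ => (x i + ε * (i : ℕ)) - (x j + ε * (j : ℕ))) (𝓝[≠] 0)
          (𝓝 (x i - x j)) := (((tendsto_pi_nhds.1 h0) i).sub
            ((tendsto_pi_nhds.1 h0) j)).mono_left nhdsWithin_le_nhds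
      filter_upwards [this.eventually_ne (sub_ne_zero.2 hxx)] with ε hε _ h
      exact hε (sub_eq_zero.2 h)
  filter_upwards [h1, h2] with ε h1 h2
  exact ⟨fun i j h => by_contra fun hij => h2 i j hij h, h1⟩

theorem schur_eq_schurSum {N : ℕ} (l : Signature N) {x : Fin N → ℂ} (hx : ∀ i, x i ≠ 0) :
    l.schur x = l.schurSum x := by
  have : (𝓝[{y : Fin N → ℂ | Function.Injective y ∧ ∀ i, y i ≠ 0}] x).NeBot :=
    (tendsto_add_mul_index hx).neBot
  refine Tendsto.limUnder_eq ?_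
  refine ((l.continuousAt_schurSum hx).tendsto.mono_left nhdsWithin_le_nhds).congr' ?_
  filter_upwards [self_mem_nhdsWithin] with y hy
  exact (schurRatio_eq_schurSum l hy.2 hy.1).symm

theorem vandermonde_comp_perm {N : ℕ} (σ : Equiv.Perm (Fin N)) (x : Fin N → ℂ) :
    (∏ i : Fin N, ∏ j ∈ Finset.Ioi i, (x (σ i) - x (σ j))) =
      ((Equiv.Perm.sign σ : ℤ) : ℂ) * ∏ i : Fin N, ∏ j ∈ Finset.Ioi i, (x i - x j) := by
  have h : ∀ y : Fin N → ℂ, (∏ i : Fin N, ∏ j ∈ Finset.Ioi i, (y i - y j)) =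
      (Matrix.vandermonde fun i => - y i).det := fun y => by
    rw [Matrix.det_vandermonde]
    exact Finset.prod_congr rfl fun i _ => Finset.prod_congr rfl fun j _ => by ring
  rw [h x, h fun i => x (σ i), ← Matrix.det_permute]
  rfl

theorem schurSum_comp_perm {N : ℕ} (l : Signature N) (σ : Equiv.Perm (Fin N)) {x : Fin N → ℂ}
    (hx : ∀ i, x i ≠ 0) : l.schurSum (x ∘ σ) = l.schurSum x := by
  have hinj : ∀ y : Fin N → ℂ, Function.Injective y → (∀ i, y i ≠ 0) →
      l.schurSum (y ∘ σ) = l.schurSum y := by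
    intro y hy hy0
    rw [← schurRatio_eq_schurSum l hy0 hy, ← schurRatio_eq_schurSum l (x := y ∘ σ)
      (fun i => hy0 _) (hy.comp σ.injective), schurRatio, schurRatio]
    have e1 : (∏ i : Fin N, ∏ j ∈ Finset.Ioi i, ((y ∘ σ) i - (y ∘ σ) j)) = _ :=
      vandermonde_comp_perm σ y
    have e2 : (Matrix.of fun i j : Fin N => (y ∘ σ) i ^ l.shifted j).det =
        ((Equiv.Perm.sign σ : ℤ) : ℂ) * (Matrix.of fun i j : Fin N => y i ^ l.shifted j).det := by
      rw [← Matrix.det_permute]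
      rfl
    rw [e1, e2, mul_div_mul_left]
    exact_mod_cast (Equiv.Perm.sign σ).ne_zero
  have : (𝓝[{y : Fin N → ℂ | Function.Injective y ∧ ∀ i, y i ≠ 0}] x).NeBot :=
    (tendsto_add_mul_index hx).neBot
  have hle := nhdsWithin_le_nhds (a := x)
    (s := {y : Fin N → ℂ | Function.Injective y ∧ ∀ i, y i ≠ 0})
  have h1 := (l.continuousAt_schurSum hx).tendsto.mono_left hle
  have hc : Continuous fun y : Fin N → ℂ => y ∘ σ := by fun_prop
  have h2 := (ContinuousAt.comp (f := fun y : Fin N → ℂ => y ∘ σ) (x := x)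
    (l.continuousAt_schurSum (x := x ∘ σ) fun i => hx _) hc.continuousAt).tendsto.mono_left
    hle
  refine tendsto_nhds_unique (h2.congr' ?_) h1
  filter_upwards [self_mem_nhdsWithin] with y hy
  exact hinj y hy.1 hy.2

/-- Schur functions are eigenfunctions of the `q`-difference operator
`f ↦ ∑ i, ∏_{j ≠ i} (q x_i - x_j) / (x_i - x_j) f (x_1, …, q x_i, …, x_N)`. -/
theorem sum_qShift_schurSum {N : ℕ} (l : Signature N) {x : Fin N → ℂ} (hx : ∀ i, x i ≠ 0)
    (hinj : Function.Injective x) {q : ℂ} (hq : q ≠ 0) :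
    ∑ i, (∏ j ∈ Finset.univ.erase i, (q * x i - x j) / (x i - x j)) *
        l.schurSum (Function.update x i (q * x i)) =
      (∑ j, q ^ l.shifted j) * l.schurSum x := by
  have hV := vandermonde_ne_zero hinj
  -- the effect of the replacement of `x i` by `q * x i` on the Vandermonde product
  have hVu : ∀ i, (∏ a : Fin N, ∏ j ∈ Finset.Ioi a,
      (Function.update x i (q * x i) a - Function.update x i (q * x i) j)) =
      (∏ j ∈ Finset.univ.erase i, (q * x i - x j) / (x i - x j)) *
        ∏ a : Fin N, ∏ j ∈ Finset.Ioi a, (x a - x j) := by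
    intro i
    -- the factors of the Vandermonde product that contain `y i`
    have key : ∀ y : Fin N → ℂ, (∏ a : Fin N, ∏ j ∈ Finset.Ioi a, (y a - y j)) =
        ((-1) ^ (i : ℕ) * ∏ j ∈ Finset.univ.erase i, (y i - y j)) *
          ∏ a ∈ Finset.univ.erase i, ∏ j ∈ (Finset.Ioi a).erase i, (y a - y j) := by
      intro y
      have h1 : ∀ a ∈ Finset.univ.erase i, ∏ j ∈ Finset.Ioi a, (y a - y j) =
          (if a < i then (y a - y i) else 1) * ∏ j ∈ (Finset.Ioi a).erase i, (y a - y j) := by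
        intro a _
        split_ifs with h
        · rw [Finset.mul_prod_erase _ (fun j => y a - y j) (Finset.mem_Ioi.2 h)]
        · rw [Finset.erase_eq_of_notMem (by simpa using h), one_mul]
      rw [← Finset.mul_prod_erase _ _ (Finset.mem_univ i), Finset.prod_congr rfl h1,
        Finset.prod_mul_distrib, ← mul_assoc]
      congr 1
      have h2 : Finset.univ.erase i = Finset.Ioi i ∪ Finset.Iio i := by
        ext a; simp [lt_or_lt_iff_ne, eq_comm]
      have hdis : Disjoint (Finset.Ioi i) (Finset.Iio i) := by
        rw [Finset.disjoint_left]; intro a h1 h2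
        exact lt_asymm (Finset.mem_Ioi.1 h1) (Finset.mem_Iio.1 h2)
      rw [h2, Finset.prod_union hdis, Finset.prod_union hdis]
      have h3 : ∏ a ∈ Finset.Ioi i, (if a < i then (y a - y i) else 1) = 1 :=
        Finset.prod_eq_one fun a ha => if_neg (not_lt.2 (Finset.mem_Ioi.1 ha).le)
      have h4 : ∏ a ∈ Finset.Iio i, (if a < i then (y a - y i) else 1) =
          (-1) ^ (i : ℕ) * ∏ a ∈ Finset.Iio i, (y i - y a) := by
        rw [← Fin.card_Iio i, ← Finset.prod_const, ← Finset.prod_mul_distrib]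
        exact Finset.prod_congr rfl fun a ha => by
          rw [if_pos (Finset.mem_Iio.1 ha)]; ring
      rw [h3, h4]; ring
    rw [key, key x]
    have e1 : ∏ j ∈ Finset.univ.erase i, (Function.update x i (q * x i) i -
        Function.update x i (q * x i) j) = ∏ j ∈ Finset.univ.erase i, (q * x i - x j) :=
      Finset.prod_congr rfl fun j hj => by
        rw [Function.update_self, Function.update_of_ne (Finset.ne_of_mem_erase hj)]
    have e2 : ∏ a ∈ Finset.univ.erase i, ∏ j ∈ (Finset.Ioi a).erase i,
        (Function.update x i (q * x i) a - Function.update x i (q * x i) j) =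
        ∏ a ∈ Finset.univ.erase i, ∏ j ∈ (Finset.Ioi a).erase i, (x a - x j) :=
      Finset.prod_congr rfl fun a ha => Finset.prod_congr rfl fun j hj => by
        rw [Function.update_of_ne (Finset.ne_of_mem_erase ha),
          Function.update_of_ne (Finset.ne_of_mem_erase hj)]
    rw [e1, e2, Finset.prod_div_distrib]
    have : ∏ j ∈ Finset.univ.erase i, (x i - x j) ≠ 0 :=
      Finset.prod_ne_zero_iff.2 fun j hj =>
        sub_ne_zero.2 fun h => (Finset.ne_of_mem_erase hj) (hinj h).symm
    field_simp
  have hxu : ∀ i a, Function.update x i (q * x i) a ≠ 0 := fun i a => by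
    by_cases h : a = i
    · subst h; simp [hq, hx]
    · simp [h, hx]
  apply mul_left_cancel₀ hV
  -- the effect of the replacement on each term of the alternant
  have hdet : ∀ i, (Matrix.of fun a j : Fin N =>
      Function.update x i (q * x i) a ^ l.shifted j).det =
      ∑ σ : Equiv.Perm (Fin N), ((Equiv.Perm.sign σ : ℤ) : ℂ) *
        (q ^ l.shifted (σ⁻¹ i) * ∏ a, x (σ a) ^ l.shifted a) := by
    intro i
    rw [Matrix.det_apply']
    refine Finset.sum_congr rfl fun σ _ => ?_
    congr 1
    have : ∀ a, (Matrix.of fun a j : Fin N =>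
        Function.update x i (q * x i) a ^ l.shifted j) (σ a) a =
        (if a = σ⁻¹ i then q ^ l.shifted (σ⁻¹ i) else 1) * x (σ a) ^ l.shifted a := by
      intro a
      simp only [Matrix.of_apply]
      by_cases h : a = σ⁻¹ i
      · subst h; simp [mul_zpow]
      · have : σ a ≠ i := fun h' => h (by rw [← h']; simp)
        simp only [if_neg h, one_mul, Function.update_of_ne this]
    rw [Finset.prod_congr rfl fun a _ => this a, Finset.prod_mul_distrib]
    simp
  calc _ = ∑ i, (∏ a : Fin N, ∏ j ∈ Finset.Ioi a,
      (Function.update x i (q * x i) a - Function.update x i (q * x i) j)) *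
        l.schurSum (Function.update x i (q * x i)) := by
        rw [Finset.mul_sum]
        refine Finset.sum_congr rfl fun i _ => ?_
        rw [hVu]; ring
    _ = ∑ i, ∑ σ : Equiv.Perm (Fin N), ((Equiv.Perm.sign σ : ℤ) : ℂ) *
        (q ^ l.shifted (σ⁻¹ i) * ∏ a, x (σ a) ^ l.shifted a) := by
        refine Finset.sum_congr rfl fun i _ => ?_
        rw [← det_eq_vandermonde_mul_schurSum l (hxu i), hdet]
    _ = ∑ σ : Equiv.Perm (Fin N), (∑ j, q ^ l.shifted j) * (((Equiv.Perm.sign σ : ℤ) : ℂ) *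
         ∏ a, x (σ a) ^ l.shifted a) := by
        rw [Finset.sum_comm]
        refine Finset.sum_congr rfl fun σ _ => ?_
        rw [← Equiv.sum_comp σ⁻¹ fun j => q ^ l.shifted j, Finset.sum_mul]
        refine Finset.sum_congr rfl fun i _ => by ring
    _ = _ := by
        rw [← Finset.mul_sum, mul_left_comm, ← det_eq_vandermonde_mul_schurSum l hx,
          Matrix.det_apply']
        rfl

/-- Ryser's formula for permanents, by inclusion and exclusion. -/
theorem sum_perm_prod_eq_sum_powerset {N : ℕ} (b : Fin N → Fin N → ℂ) :
    ∑ σ : Equiv.Perm (Fin N), ∏ j, b (σ j) j =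
      ∑ S : Finset (Fin N), (-1) ^ (Finset.univ \ S).card * ∏ j, ∑ i ∈ S, b i j := by
  classical
  -- expand the product of sums; the weight of `g` vanishes unless `S` contains the range of `g`
  have h1 : ∀ S : Finset (Fin N), (-1 : ℂ) ^ (Finset.univ \ S).card * ∏ j, ∑ i ∈ S, b i j =
      ∑ g : Fin N → Fin N, (∏ i ∈ Finset.univ \ S,
        (if i ∈ Set.range g then (0 : ℂ) else -1)) * ∏ j, b (g j) j := by
    intro S
    rw [Finset.prod_univ_sum, Finset.mul_sum, ← Finset.sum_subset (Finset.subset_univ _)]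
    · refine Finset.sum_congr rfl fun g hg => ?_
      congr 1
      rw [← Finset.prod_const]
      refine Finset.prod_congr rfl fun i hi => ?_
      rw [if_neg]
      rintro ⟨j, rfl⟩
      exact (Finset.mem_sdiff.1 hi).2 (Fintype.mem_piFinset.1 hg j)
    · intro g _ hg
      have : ∃ j, g j ∉ S := by
        by_contra! h
        exact hg (Fintype.mem_piFinset.2 h)
      obtain ⟨j, hj⟩ := this
      rw [Finset.prod_eq_zero (i := g j) (by simp [hj]) (by simp), zero_mul]
  simp_rw [h1]
  rw [Finset.sum_comm]
  -- inclusion and exclusion: only the surjective `g` survive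
  have h2 : ∀ g : Fin N → Fin N, ∑ S : Finset (Fin N), (∏ i ∈ Finset.univ \ S,
        (if i ∈ Set.range g then (0 : ℂ) else -1)) * ∏ j, b (g j) j =
      if Function.Bijective g then ∏ j, b (g j) j else 0 := by
    intro g
    rw [← Finset.sum_mul]
    have := Finset.prod_add (fun _ : Fin N => (1 : ℂ))
      (fun i => if i ∈ Set.range g then (0 : ℂ) else -1) Finset.univ
    simp only [Finset.prod_const_one, one_mul, Finset.powerset_univ] at this
    rw [← this]
    split_ifs with hb
    · rw [Finset.prod_eq_one, one_mul]
      intro i _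
      have hi : i ∈ Set.range g := hb.2 i
      rw [if_pos hi, add_zero]
    · have : ∃ i, i ∉ Set.range g := by
        by_contra! h
        exact hb (Finite.surjective_iff_bijective.1 h)
      obtain ⟨i, hi⟩ := this
      rw [Finset.prod_eq_zero (Finset.mem_univ i) (by rw [if_neg hi]; ring), zero_mul]
  simp_rw [h2]
  rw [← Finset.sum_filter]
  refine Finset.sum_bij (fun σ _ => σ) (fun σ _ => Finset.mem_filter.2 ⟨Finset.mem_univ _, σ.bijective⟩)
    (fun σ _ τ _ h => DFunLike.coe_injective h)
    (fun g hg => ⟨Equiv.ofBijective g (Finset.mem_filter.1 hg).2, Finset.mem_univ _, rfl⟩)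
    fun σ _ => rfl

/-- A Schur function is a finite linear combination of functions `∏ j, A (x j)`. -/
theorem exists_sum_prod_eq_schurSum {N : ℕ} (hN : 0 < N) (l : Signature N) :
    ∃ (β : Type) (_ : Fintype β) (κ : β → ℂ) (A : β → ℂ → ℂ), (∀ b, A b 1 ≠ 0) ∧
      (∀ b z, z ≠ 0 → DifferentiableAt ℂ (A b) z) ∧
      ∀ x : Fin N → ℂ, (∀ i, x i ≠ 0) → l.schurSum x = ∑ b, κ b * ∏ j, A b (x j) := by
  -- only nonempty sets `S` are used in Ryser's formula, so that no function `A` vanishes at `1`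
  refine ⟨l.MonomialIndex × {S : Finset (Fin N) // S.Nonempty}, inferInstance,
    fun b => (N.factorial : ℂ)⁻¹ * (-1) ^ (Finset.univ \ b.2.1).card,
    fun b z => ∑ i ∈ b.2.1, z ^ l.exponent b.1 i, fun b => ?_, fun b z hz => ?_, fun x hx => ?_⟩
  · simp [b.2.2.ne_empty]
  · exact DifferentiableAt.fun_sum fun i _ => (differentiableAt_zpow.2 (Or.inl hz))
  · have hfac : (N.factorial : ℂ) ≠ 0 := by exact_mod_cast N.factorial_ne_zero
    have h1 : (N.factorial : ℂ) * l.schurSum x =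
        ∑ σ : Equiv.Perm (Fin N), l.schurSum (x ∘ σ) := by
      rw [Finset.sum_congr rfl fun σ _ => l.schurSum_comp_perm σ hx]
      simp [Fintype.card_perm]
    have h2 : ∑ σ : Equiv.Perm (Fin N), l.schurSum (x ∘ σ) = ∑ a,
        ∑ S : Finset (Fin N), (-1) ^ (Finset.univ \ S).card *
          ∏ j, ∑ i ∈ S, x j ^ l.exponent a i := by
      unfold schurSum
      rw [Finset.sum_comm]
      refine Finset.sum_congr rfl fun a _ => ?_
      rw [← sum_perm_prod_eq_sum_powerset fun i j => x j ^ l.exponent a i]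
      rw [← Equiv.sum_comp (Equiv.inv (Equiv.Perm (Fin N)))]
      refine Finset.sum_congr rfl fun σ _ => ?_
      rw [← Equiv.prod_comp σ]
      simp
    have h3 : l.schurSum x = (N.factorial : ℂ)⁻¹ * ∑ a,
        ∑ S : Finset (Fin N), (-1) ^ (Finset.univ \ S).card *
          ∏ j, ∑ i ∈ S, x j ^ l.exponent a i := by
      rw [← h2, ← h1, inv_mul_cancel_left₀ hfac]
    have h4 : ∀ a, ∑ S : Finset (Fin N), (-1 : ℂ) ^ (Finset.univ \ S).card *
          ∏ j, ∑ i ∈ S, x j ^ l.exponent a i =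
        ∑ S : {S : Finset (Fin N) // S.Nonempty}, (-1) ^ (Finset.univ \ S.1).card *
          ∏ j, ∑ i ∈ S.1, x j ^ l.exponent a i := by
      intro a
      rw [← Finset.sum_subtype (Finset.univ.filter fun S : Finset (Fin N) => S.Nonempty)
        (by simp) fun S => (-1 : ℂ) ^ (Finset.univ \ S).card *
          ∏ j, ∑ i ∈ S, x j ^ l.exponent a i]
      refine (Finset.sum_filter_of_ne fun S _ hS => ?_).symm
      rw [Finset.nonempty_iff_ne_empty]
      rintro rfl
      exact hS (by simp [hN.ne'])
    rw [h3, Fintype.sum_prod_type, Finset.mul_sum]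
    refine Finset.sum_congr rfl fun a _ => ?_
    rw [h4, Finset.mul_sum]
    exact Finset.sum_congr rfl fun S _ => by ring

end Signature

/-! ### Circle integrals -/

section CircleIntegrals

open Metric Set

theorem continuousOn_circleIntegral {X : Type*} [TopologicalSpace X] {s : Set X}
    {f : X → ℂ → ℂ} {b : ℂ} {R : ℝ} (hR : 0 ≤ R)
    (hf : ContinuousOn (Function.uncurry f) (s ×ˢ sphere b R)) :
    ContinuousOn (fun x => ∮ z in C(b, R), f x z) s := by
  rw [continuousOn_iff_continuous_domRestrict]
  unfold circleIntegral
  refine intervalIntegral.continuous_parametric_intervalIntegral_of_continuous'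
    (f := fun (x : s) (θ : ℝ) => deriv (circleMap b R) θ • f x (circleMap b R θ)) ?_ 0 _
  have h1 : Continuous fun p : s × ℝ => f p.1 (circleMap b R p.2) := by
    refine hf.comp_continuous (f := fun p : s × ℝ => ((p.1 : X), circleMap b R p.2))
      (by fun_prop) fun p => ⟨p.1.2, ?_⟩
    exact circleMap_mem_sphere b hR p.2
  simp only [deriv_circleMap]
  have h2 : Continuous fun p : s × ℝ => circleMap 0 R p.2 * Complex.I := by fun_prop
  exact h2.smul h1

theorem circleIntegral_swap {f : ℂ → ℂ → ℂ} {a b : ℂ} {r R : ℝ} (hr : 0 ≤ r) (hR : 0 ≤ R)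
    (hf : ContinuousOn (Function.uncurry f) (sphere a r ×ˢ sphere b R)) :
    (∮ w in C(a, r), ∮ z in C(b, R), f w z) = ∮ z in C(b, R), ∮ w in C(a, r), f w z := by
  unfold circleIntegral
  simp_rw [← intervalIntegral.integral_smul]
  rw [intervalIntegral_intervalIntegral_swap]
  · refine intervalIntegral.integral_congr fun θ _ => intervalIntegral.integral_congr fun φ _ => ?_
    exact smul_comm _ _ _
  · have h1 : Continuous fun p : ℝ × ℝ => f (circleMap a r p.1) (circleMap b R p.2) :=
      hf.comp_continuous (f := fun p : ℝ × ℝ => (circleMap a r p.1, circleMap b R p.2))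
        (by fun_prop) fun p => ⟨circleMap_mem_sphere a hr p.1, circleMap_mem_sphere b hR p.2⟩
    have h2 : Continuous (Function.uncurry fun x y : ℝ => deriv (circleMap a r) x •
        deriv (circleMap b R) y • f (circleMap a r x) (circleMap b R y)) := by
      simp only [deriv_circleMap]
      have h3 : Continuous fun p : ℝ × ℝ => circleMap 0 r p.1 * Complex.I := by fun_prop
      have h4 : Continuous fun p : ℝ × ℝ => circleMap 0 R p.2 * Complex.I := by fun_prop
      exact h3.smul (h4.smul h1)
    exact (h2.continuousOn.integrableOn_compact
      (isCompact_uIcc.prod isCompact_uIcc)).mono_set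
      (prod_mono uIoc_subset_uIcc uIoc_subset_uIcc)

theorem prod_inv_sub_eq_sum {ι : Type*} [DecidableEq ι] {t : Finset ι} {x : ι → ℂ}
    (hx : Set.InjOn x t) (ht : t.Nonempty) {z : ℂ} (hz : ∀ i ∈ t, z ≠ x i) :
    ∏ i ∈ t, (z - x i)⁻¹ = ∑ i ∈ t, (∏ j ∈ t.erase i, (x i - x j))⁻¹ * (z - x i)⁻¹ := by
  have h := congrArg (Polynomial.eval z) (Lagrange.sum_basis hx ht)
  rw [Polynomial.eval_finsetSum, Polynomial.eval_one] at h
  have h1 : ∀ i ∈ t, (Lagrange.basis t x i).eval z =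
      (∏ j ∈ t, (z - x j)) * ((∏ j ∈ t.erase i, (x i - x j))⁻¹ * (z - x i)⁻¹) := by
    intro i hi
    rw [Lagrange.eval_basis_not_at_node hi (hz i hi), Lagrange.eval_nodal, Lagrange.nodalWeight,
      Finset.prod_inv_distrib]
  rw [Finset.sum_congr rfl h1, ← Finset.mul_sum] at h
  rw [Finset.prod_inv_distrib]
  exact inv_eq_of_mul_eq_one_right h

/-- The residue theorem for finitely many simple poles inside a circle. -/
theorem circleIntegral_mul_prod_inv_sub {ι : Type*} [DecidableEq ι] {t : Finset ι} {x : ι → ℂ}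
    (hx : Set.InjOn x t) {c : ℂ} {R : ℝ} (hR : 0 < R) (hxR : ∀ i ∈ t, x i ∈ ball c R) {P : ℂ → ℂ}
    (hP : DifferentiableOn ℂ P (closedBall c R)) :
    (2 * Real.pi * Complex.I : ℂ)⁻¹ * (∮ z in C(c, R), P z * ∏ i ∈ t, (z - x i)⁻¹) =
      ∑ i ∈ t, P (x i) * (∏ j ∈ t.erase i, (x i - x j))⁻¹ := by
  have hPd : DiffContOnCl ℂ P (ball c R) :=
    (hP.mono closure_ball_subset_closedBall).diffContOnCl
  rcases t.eq_empty_or_nonempty with rfl | ht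
  · simp [hPd.circleIntegral_eq_zero hR.le]
  have h1 : (∮ z in C(c, R), P z * ∏ i ∈ t, (z - x i)⁻¹) =
      ∮ z in C(c, R), ∑ i ∈ t, (∏ j ∈ t.erase i, (x i - x j))⁻¹ * ((z - x i)⁻¹ • P z) := by
    refine circleIntegral.integral_congr hR.le fun z hz => ?_
    have hzx : ∀ i ∈ t, z ≠ x i := by
      rintro i hi rfl
      have h1 := mem_ball.1 (hxR i hi)
      rw [mem_sphere.1 hz] at h1
      exact lt_irrefl _ h1
    rw [prod_inv_sub_eq_sum hx ht hzx, Finset.mul_sum]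
    exact Finset.sum_congr rfl fun i _ => by rw [smul_eq_mul]; ring
  have hint : ∀ i ∈ t, CircleIntegrable (fun z => (∏ j ∈ t.erase i, (x i - x j))⁻¹ *
      ((z - x i)⁻¹ • P z)) c R := by
    intro i hi
    refine ContinuousOn.circleIntegrable hR.le (continuousOn_const.mul (ContinuousOn.smul
      (ContinuousOn.inv₀ (f := fun z => z - x i) (by fun_prop) fun z hz => sub_ne_zero.2 ?_)
      (hP.continuousOn.mono sphere_subset_closedBall)))
    rintro rfl
    have h1 := mem_ball.1 (hxR i hi)
    rw [mem_sphere.1 hz] at h1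
    exact lt_irrefl _ h1
  rw [h1, circleIntegral.integral_fun_sum hint, Finset.mul_sum]
  refine Finset.sum_congr rfl fun i hi => ?_
  rw [circleIntegral.integral_const_mul, hPd.circleIntegral_sub_inv_smul (hxR i hi), smul_eq_mul]
  have : (2 * Real.pi * Complex.I : ℂ) ≠ 0 := Complex.two_pi_I_ne_zero
  field_simp

theorem circleIntegral_exp_coeff (a : ℂ) (k : ℕ) :
    (2 * Real.pi * Complex.I : ℂ)⁻¹ * (∮ τ in C(0, 1), (τ ^ (k + 1))⁻¹ * Complex.exp (τ * a)) =
      a ^ k / k.factorial := by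
  have hd : DifferentiableOn ℂ (fun τ : ℂ => Complex.exp (τ * a)) (closedBall 0 1) := by fun_prop
  have h := hd.circleIntegral_one_div_sub_center_pow_smul one_pos k
  simp only [sub_zero, smul_eq_mul, one_div] at h
  have e1 : iteratedDeriv k (fun τ : ℂ => Complex.exp (τ * a)) 0 = a ^ k := by
    have : (fun τ : ℂ => Complex.exp (τ * a)) = fun τ => Complex.exp (a * τ) := by
      ext τ; rw [mul_comm]
    rw [this, iteratedDeriv_cexp_const_mul]; simp
  rw [h, e1]
  have : (2 * Real.pi * Complex.I : ℂ) ≠ 0 := Complex.two_pi_I_ne_zero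
  field_simp

end CircleIntegrals

/-! ### Functions invariant under a rotation of finite order -/

section Rotation

open Metric Set

theorem isPrimitiveRoot_rootW (K : ℕ) : IsPrimitiveRoot (rootW (K + 1)) (K + 1) :=
  Complex.isPrimitiveRoot_exp (K + 1) K.succ_ne_zero

theorem norm_rootW (K : ℕ) : ‖rootW (K + 1)‖ = 1 :=
  (isPrimitiveRoot_rootW K).norm'_eq_one K.succ_ne_zero

/-- An analytic function that is invariant under the rotation by `2 π / (K + 1)` about `c` differs
from its value at `c` by a multiple of `(z - c) ^ (K + 1)`. -/
theorem exists_eq_add_pow_mul_of_rotation_invariant {K : ℕ} {c : ℂ} {R : ℝ} {h : ℂ → ℂ}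
    (hR : 0 < R) (hd : DifferentiableOn ℂ h (ball c R))
    (hrot : ∀ z ∈ ball c R, h (c + (z - c) * rootW (K + 1)) = h z) :
    ∃ g : ℂ → ℂ, DifferentiableOn ℂ g (ball c R) ∧
      ∀ z ∈ ball c R, h z = h c + (z - c) ^ (K + 1) * g z := by
  set w := rootW (K + 1) with hw
  have hprim : IsPrimitiveRoot w (K + 1) := isPrimitiveRoot_rootW K
  set f : ℂ → ℂ := fun z => h z - h c with hf
  have hfd : DifferentiableOn ℂ f (ball c R) := hd.sub_const _
  have hfa : AnalyticAt ℂ f c := hfd.analyticAt (ball_mem_nhds c hR)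
  have hord : ((K + 1 : ℕ) : ℕ∞) ≤ analyticOrderAt f c := by
    by_cases htop : analyticOrderAt f c = ⊤
    · rw [htop]; exact le_top
    obtain ⟨m, hm⟩ := ENat.ne_top_iff_exists.1 htop
    obtain ⟨g, hga, hg0, hg⟩ := (hfa.analyticOrderAt_eq_natCast).1 hm.symm
    have hm0 : m ≠ 0 := by
      rintro rfl
      have := hg.self_of_nhds
      simp [hf] at this
      exact hg0 this.symm
    have hT : Tendsto (fun z => c + (z - c) * w) (𝓝 c) (𝓝 c) := by
      have : Continuous fun z : ℂ => c + (z - c) * w := by fun_prop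
      simpa using this.tendsto c
    have hw1 : w ^ m = 1 := by
      have h1 : ∀ᶠ z in 𝓝[≠] c, w ^ m * g (c + (z - c) * w) = g z := by
        filter_upwards [nhdsWithin_le_nhds hg, nhdsWithin_le_nhds (hT.eventually hg),
          nhdsWithin_le_nhds (ball_mem_nhds c hR), self_mem_nhdsWithin] with z h1 h2 h3 h4
        have h5 : f (c + (z - c) * w) = f z := by simp only [hf]; rw [hrot z h3]
        have h6 : (z - c) ^ m ≠ 0 := pow_ne_zero _ (sub_ne_zero.2 h4)
        rw [h1, h2] at h5
        simp only [smul_eq_mul, add_sub_cancel_left, mul_pow] at h5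
        apply mul_left_cancel₀ h6
        linear_combination h5
      have h2 : Tendsto (fun z => w ^ m * g (c + (z - c) * w)) (𝓝[≠] c) (𝓝 (w ^ m * g c)) :=
        ((hga.continuousAt.tendsto.comp hT).const_mul _).mono_left nhdsWithin_le_nhds
      have h3 := tendsto_nhds_unique (h2.congr' h1)
        (hga.continuousAt.tendsto.mono_left nhdsWithin_le_nhds)
      exact mul_right_cancel₀ hg0 (by rw [h3, one_mul])
    rw [← hm]
    exact_mod_cast Nat.le_of_dvd (Nat.pos_of_ne_zero hm0) ((hprim.pow_eq_one_iff_dvd m).1 hw1)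
  obtain ⟨g₀, hg₀, hg⟩ := (natCast_le_analyticOrderAt hfa).1 hord
  refine ⟨Function.update (fun z => f z / (z - c) ^ (K + 1)) c (g₀ c), fun z hz => ?_,
    fun z hz => ?_⟩
  · by_cases hzc : z = c
    · subst hzc
      refine (hg₀.differentiableAt.congr_of_eventuallyEq ?_).differentiableWithinAt
      filter_upwards [hg] with y hy
      by_cases hyz : y = z
      · simp [hyz]
      · rw [Function.update_of_ne hyz, hy, smul_eq_mul,
          mul_div_cancel_left₀ _ (pow_ne_zero _ (sub_ne_zero.2 hyz))]
    · have h1 : DifferentiableAt ℂ f z := hfd.differentiableAt (isOpen_ball.mem_nhds hz)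
      have h2 : DifferentiableAt ℂ (fun z => f z / (z - c) ^ (K + 1)) z :=
        h1.div (by fun_prop) (pow_ne_zero _ (sub_ne_zero.2 hzc))
      refine (h2.congr_of_eventuallyEq ?_).differentiableWithinAt
      filter_upwards [isOpen_ne.mem_nhds hzc] with y hy
      rw [Function.update_of_ne hy]
  · by_cases hzc : z = c
    · subst hzc; simp
    · rw [Function.update_of_ne hzc, mul_div_cancel₀ _ (pow_ne_zero _ (sub_ne_zero.2 hzc))]
      simp [hf]

end Rotation

/-! ### A contour formula for the eigenvalue of the `q`-difference operator -/

section Contour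

open Metric Set

/-- The coefficient `∏_{j ≠ i} (q x_i - x_j) / (x_i - x_j)` of the `q`-difference operator. -/
noncomputable def qShiftWeight {N : ℕ} (q : ℂ) (x : Fin N → ℂ) (i : Fin N) : ℂ :=
  ∏ j ∈ Finset.univ.erase i, (q * x i - x j) / (x i - x j)

/-- The function of `z` whose residue at `z = x_i` is `qShiftWeight q x i`. -/
noncomputable def qShiftKernel {N : ℕ} (q : ℂ) (x : Fin N → ℂ) (z : ℂ) : ℂ :=
  (∏ j, (q * z - x j) / (z - x j)) / ((q - 1) * z)

theorem prod_update_mul {N : ℕ} (A : ℂ → ℂ) (x : Fin N → ℂ) (i : Fin N) (y : ℂ)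
    (hA : A (x i) ≠ 0) :
    ∏ j, A (Function.update x i y j) = (∏ j, A (x j)) * (A y / A (x i)) := by
  rw [← Finset.mul_prod_erase _ _ (Finset.mem_univ i),
    ← Finset.mul_prod_erase _ (fun j => A (x j)) (Finset.mem_univ i), Function.update_self,
    Finset.prod_congr rfl fun j hj => by
      rw [Function.update_of_ne (Finset.ne_of_mem_erase hj)]]
  field_simp

/-- The part of the `q`-difference operator that acts on the coordinates inside a circle, applied to a
product `∏ j, A (x j)`, is a contour integral: the poles of the kernel inside the circle are the points
`x i`, `i ∈ t`. -/
theorem circleIntegral_qShiftKernel_mul_prod {N : ℕ} {q : ℂ} (hq0 : q ≠ 0) (hq1 : q ≠ 1)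
    {x : Fin N → ℂ} {t : Finset (Fin N)} (hx : Set.InjOn x t)
    {R : ℝ} (hR : 0 < R) (hR1 : R < 1) (hxt : ∀ i ∈ t, x i ∈ ball 1 R)
    (hxtc : ∀ i ∉ t, x i ∉ closedBall 1 R) {A : ℂ → ℂ}
    (hA : ∀ z ∈ closedBall (1 : ℂ) R, A z ≠ 0) (hAd : ∀ z, z ≠ 0 → DifferentiableAt ℂ A z) :
    (2 * Real.pi * Complex.I : ℂ)⁻¹ * (∮ z in C(1, R),
      qShiftKernel q x z * ((∏ j, A (x j)) * (A (q * z) / A z))) =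
      ∑ i ∈ t, qShiftWeight q x i * ∏ j, A (Function.update x i (q * x i) j) := by
  classical
  have hz0 : ∀ z ∈ closedBall (1 : ℂ) R, z ≠ 0 := by
    rintro z hz rfl
    rw [mem_closedBall, dist_comm, dist_zero_right, norm_one] at hz
    linarith
  have hq1' : q - 1 ≠ 0 := sub_ne_zero.2 hq1
  -- the integrand without its poles at the points `x j`, `j ∈ t`
  set P : ℂ → ℂ := fun z => (∏ j ∈ t, (q * z - x j)) * (∏ j ∈ tᶜ, (q * z - x j) / (z - x j)) /
    ((q - 1) * z) * ((∏ j, A (x j)) * (A (q * z) / A z)) with hP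
  have hzx : ∀ z ∈ closedBall (1 : ℂ) R, ∀ j ∈ tᶜ, z - x j ≠ 0 := by
    intro z hz j hj h
    rw [sub_eq_zero.1 h] at hz
    exact hxtc j (Finset.mem_compl.1 hj) hz
  have hPd : DifferentiableOn ℂ P (closedBall 1 R) := by
    intro z hz
    have h1 : DifferentiableAt ℂ (fun z => A (q * z)) z :=
      (hAd (q * z) (mul_ne_zero hq0 (hz0 z hz))).comp z (by fun_prop)
    have h2 : DifferentiableAt ℂ (fun z => ∏ j ∈ tᶜ, (q * z - x j) / (z - x j)) z := by
      refine DifferentiableAt.fun_finsetProd fun j hj => ?_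
      exact DifferentiableAt.div (by fun_prop) (by fun_prop) (hzx z hz j hj)
    have h3 : DifferentiableAt ℂ (fun z => ∏ j ∈ t, (q * z - x j)) z := by fun_prop
    refine DifferentiableAt.differentiableWithinAt ?_
    refine ((h3.mul h2).div (by fun_prop) (mul_ne_zero hq1' (hz0 z hz))).mul
      ((h1.div (hAd z (hz0 z hz)) (hA z hz)).const_mul _)
  have h := circleIntegral_mul_prod_inv_sub hx hR hxt hPd
  have hsplit : ∀ f : Fin N → ℂ, ∏ j, f j = (∏ j ∈ t, f j) * ∏ j ∈ tᶜ, f j := fun f =>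
    (Finset.prod_mul_prod_compl t f).symm
  have e1 : (∮ z in C(1, R), qShiftKernel q x z * ((∏ j, A (x j)) * (A (q * z) / A z))) =
      ∮ z in C(1, R), P z * ∏ i ∈ t, (z - x i)⁻¹ := by
    refine circleIntegral.integral_congr hR.le fun z hz => ?_
    simp only [qShiftKernel, hP, hsplit fun j => (q * z - x j) / (z - x j)]
    rw [Finset.prod_div_distrib (s := t), Finset.prod_inv_distrib]
    ring
  rw [e1, h]
  refine Finset.sum_congr rfl fun i hi => ?_
  have hib := ball_subset_closedBall (hxt i hi)
  have hxi := hz0 _ hib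
  have e2 : Finset.univ.erase i = t.erase i ∪ tᶜ := by
    ext j
    simp only [Finset.mem_erase, Finset.mem_univ, and_true, Finset.mem_union, Finset.mem_compl]
    by_cases hj : j = i
    · subst hj; simp [hi]
    · simp [hj, em]
  have e3 : Disjoint (t.erase i) tᶜ :=
    Finset.disjoint_of_subset_left (Finset.erase_subset _ _) disjoint_compl_right
  rw [prod_update_mul A x i _ (hA _ hib), qShiftWeight, e2, Finset.prod_union e3,
    Finset.prod_div_distrib (s := t.erase i)]
  simp only [hP]
  rw [← Finset.mul_prod_erase _ _ hi]
  have : q * x i - x i = (q - 1) * x i := by ring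
  rw [this]
  field_simp

/-- The eigenvalue equation of the `q`-difference operator, where the terms of the coordinates inside a
circle are replaced by a contour integral. In this form the equation extends by continuity to points
whose coordinates inside the circle coincide. -/
theorem Signature.sum_zpow_mul_schurSum {N : ℕ} (l : Signature N) {q : ℂ} (hq0 : q ≠ 0)
    (hq1 : q ≠ 1) {β : Type} [Fintype β] {κ : β → ℂ} {A : β → ℂ → ℂ}
    (hκ : ∀ x : Fin N → ℂ, (∀ i, x i ≠ 0) → l.schurSum x = ∑ b, κ b * ∏ j, A b (x j))
    (hAd : ∀ b z, z ≠ 0 → DifferentiableAt ℂ (A b) z)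
    {R : ℝ} (hR : 0 < R) (hR1 : R < 1) (hA : ∀ b, ∀ z ∈ closedBall (1 : ℂ) R, A b z ≠ 0)
    {x : Fin N → ℂ} {t : Finset (Fin N)} (hx0 : ∀ i, x i ≠ 0)
    (hx : ∀ i ∉ t, ∀ j, j ≠ i → x i ≠ x j) (hxt : ∀ i ∈ t, x i ∈ ball 1 R)
    (hxtc : ∀ i ∉ t, x i ∉ closedBall 1 R) :
    (∑ j, q ^ l.shifted j) * l.schurSum x =
      (∑ i ∈ tᶜ, qShiftWeight q x i * l.schurSum (Function.update x i (q * x i))) +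
      (2 * Real.pi * Complex.I : ℂ)⁻¹ * ∮ z in C(1, R),
        qShiftKernel q x z * ∑ b, κ b * ((∏ j, A b (x j)) * (A b (q * z) / A b z)) := by
  classical
  have hz0 : ∀ z ∈ closedBall (1 : ℂ) R, z ≠ 0 := by
    rintro z hz rfl
    rw [mem_closedBall, dist_comm, dist_zero_right, norm_one] at hz
    linarith
  have hq1' : q - 1 ≠ 0 := sub_ne_zero.2 hq1
  -- the open set of configurations with the prescribed positions relative to the circle
  set O : Set (Fin N → ℂ) := {y | (∀ i, y i ≠ 0) ∧ (∀ i ∉ t, ∀ j, j ≠ i → y i ≠ y j) ∧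
    (∀ i ∈ t, y i ∈ ball 1 R) ∧ ∀ i ∉ t, y i ∉ closedBall 1 R} with hO
  have hOopen : IsOpen O := by
    have hc : ∀ i : Fin N, Continuous fun y : Fin N → ℂ => y i := fun i => continuous_apply i
    have e : O = (⋂ i, {y | y i ≠ 0}) ∩ ((⋂ i, ⋂ (_ : i ∉ t), ⋂ j, ⋂ (_ : j ≠ i),
        {y | y i ≠ y j}) ∩ ((⋂ i, ⋂ (_ : i ∈ t), {y | y i ∈ ball 1 R}) ∩
        ⋂ i, ⋂ (_ : i ∉ t), {y | y i ∈ (closedBall 1 R)ᶜ})) := by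
      ext y; simp [hO]
    rw [e]
    refine IsOpen.inter (isOpen_iInter_of_finite fun i => isOpen_ne_fun (hc i) continuous_const)
      (IsOpen.inter ?_ (IsOpen.inter ?_ ?_))
    · exact isOpen_iInter_of_finite fun i => isOpen_iInter_of_finite fun _ =>
        isOpen_iInter_of_finite fun j => isOpen_iInter_of_finite fun _ =>
          isOpen_ne_fun (hc i) (hc j)
    · exact isOpen_iInter_of_finite fun i => isOpen_iInter_of_finite fun _ =>
        isOpen_ball.preimage (hc i)
    · exact isOpen_iInter_of_finite fun i => isOpen_iInter_of_finite fun _ =>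
        isClosed_closedBall.isOpen_compl.preimage (hc i)
  have hxO : x ∈ O := ⟨hx0, hx, hxt, hxtc⟩
  have hAc : ∀ b z, z ≠ 0 → ContinuousAt (A b) z := fun b z hz => (hAd b z hz).continuousAt
  have hupd : ∀ y ∈ O, ∀ i a, Function.update y i (q * y i) a ≠ 0 := fun y hy i a => by
    by_cases h : a = i
    · subst h; simp [hq0, hy.1]
    · simp [h, hy.1]
  -- the identity at configurations with distinct coordinates
  have hinj : ∀ y ∈ O, Function.Injective y → (∑ j, q ^ l.shifted j) * l.schurSum y =
      (∑ i ∈ tᶜ, qShiftWeight q y i * l.schurSum (Function.update y i (q * y i))) +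
      (2 * Real.pi * Complex.I : ℂ)⁻¹ * ∮ z in C(1, R),
        qShiftKernel q y z * ∑ b, κ b * ((∏ j, A b (y j)) * (A b (q * z) / A b z)) := by
    intro y hy hyinj
    rw [← l.sum_qShift_schurSum hy.1 hyinj hq0, ← Finset.sum_compl_add_sum t]
    congr 1
    have e1 : ∀ i ∈ t, (∏ j ∈ Finset.univ.erase i, (q * y i - y j) / (y i - y j)) *
        l.schurSum (Function.update y i (q * y i)) =
        ∑ b, κ b * (qShiftWeight q y i * ∏ j, A b (Function.update y i (q * y i) j)) := by
      intro i _
      rw [hκ _ (hupd y hy i), Finset.mul_sum]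
      exact Finset.sum_congr rfl fun b _ => by rw [qShiftWeight]; ring
    rw [Finset.sum_congr rfl e1, Finset.sum_comm]
    have e2 : (∮ z in C(1, R),
        qShiftKernel q y z * ∑ b, κ b * ((∏ j, A b (y j)) * (A b (q * z) / A b z))) =
        ∮ z in C(1, R), ∑ b, κ b * (qShiftKernel q y z *
          ((∏ j, A b (y j)) * (A b (q * z) / A b z))) := by
      refine circleIntegral.integral_congr hR.le fun z _ => ?_
      simp only [Finset.mul_sum]
      exact Finset.sum_congr rfl fun b _ => by ring
    have hzy : ∀ z ∈ sphere (1 : ℂ) R, ∀ j, z - y j ≠ 0 := by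
      intro z hz j h
      rw [sub_eq_zero.1 h] at hz
      by_cases hj : j ∈ t
      · have h1 := mem_ball.1 (hy.2.2.1 j hj)
        rw [mem_sphere.1 hz] at h1
        exact lt_irrefl _ h1
      · exact hy.2.2.2 j hj (sphere_subset_closedBall hz)
    rw [e2, circleIntegral.integral_fun_sum, Finset.mul_sum]
    · refine Finset.sum_congr rfl fun b _ => ?_
      rw [circleIntegral.integral_const_mul, ← Finset.mul_sum,
        ← circleIntegral_qShiftKernel_mul_prod hq0 hq1 hyinj.injOn hR hR1 hy.2.2.1 hy.2.2.2
          (hA b) (hAd b)]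
      ring
    · intro b _
      refine ContinuousOn.circleIntegrable hR.le fun z hz => ContinuousAt.continuousWithinAt ?_
      have hzc := sphere_subset_closedBall hz
      have h1 : ContinuousAt (fun z => A b (q * z)) z :=
        ContinuousAt.comp (f := fun z => q * z) (hAc b _ (mul_ne_zero hq0 (hz0 z hzc)))
          (by fun_prop)
      have h2 : ContinuousAt (fun z => qShiftKernel q y z) z := by
        unfold qShiftKernel
        refine ContinuousAt.div (tendsto_finsetProd _ fun j _ => ?_) (by fun_prop)
          (mul_ne_zero hq1' (hz0 z hzc))
        exact ContinuousAt.div (f := fun z => q * z - y j) (g := fun z => z - y j)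
          (by fun_prop) (by fun_prop) (hzy z hz j)
      exact continuousAt_const.mul (h2.mul (continuousAt_const.mul
        (h1.div (hAc b z (hz0 z hzc)) (hA b z hzc))))
  -- both sides are continuous
  have hc1 : ContinuousOn (fun y => (∑ j, q ^ l.shifted j) * l.schurSum y) O := fun y hy =>
    (continuousAt_const.mul (l.continuousAt_schurSum hy.1)).continuousWithinAt
  have hc2 : ContinuousOn (fun y => ∑ i ∈ tᶜ, qShiftWeight q y i *
      l.schurSum (Function.update y i (q * y i))) O := by
    refine continuousOn_finsetSum _ fun i hi y hy => ContinuousAt.continuousWithinAt ?_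
    refine ContinuousAt.mul ?_ ?_
    · refine tendsto_finsetProd _ fun j hj => ?_
      exact ContinuousAt.div (f := fun y : Fin N → ℂ => q * y i - y j)
        (g := fun y : Fin N → ℂ => y i - y j) (by fun_prop) (by fun_prop)
        (sub_ne_zero.2 (hy.2.1 i (Finset.mem_compl.1 hi) j (Finset.ne_of_mem_erase hj)))
    · refine ContinuousAt.comp (f := fun y : Fin N → ℂ => Function.update y i (q * y i))
        (l.continuousAt_schurSum (hupd y hy i)) ?_
      exact Continuous.continuousAt (continuous_id.update i (by fun_prop))
  have hc3 : ContinuousOn (fun y => (2 * Real.pi * Complex.I : ℂ)⁻¹ * ∮ z in C(1, R),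
      qShiftKernel q y z * ∑ b, κ b * ((∏ j, A b (y j)) * (A b (q * z) / A b z))) O := by
    refine continuousOn_const.mul (continuousOn_circleIntegral hR.le ?_)
    rintro ⟨y, z⟩ ⟨hy, hz⟩
    have hzc := sphere_subset_closedBall hz
    have hzy : ∀ j, z - y j ≠ 0 := by
      intro j h
      simp only at hz hy
      rw [sub_eq_zero.1 h] at hz
      by_cases hj : j ∈ t
      · have h1 := mem_ball.1 (hy.2.2.1 j hj)
        rw [mem_sphere.1 hz] at h1
        exact lt_irrefl _ h1
      · exact hy.2.2.2 j hj (sphere_subset_closedBall hz)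
    refine ContinuousAt.continuousWithinAt (ContinuousAt.mul ?_ ?_)
    · unfold qShiftKernel
      refine ContinuousAt.div (tendsto_finsetProd _ fun j _ => ?_) (by fun_prop)
          (mul_ne_zero hq1' (hz0 z hzc))
      exact ContinuousAt.div (f := fun p : (Fin N → ℂ) × ℂ => q * p.2 - p.1 j)
        (g := fun p : (Fin N → ℂ) × ℂ => p.2 - p.1 j)
          (by fun_prop) (by fun_prop) (hzy j)
    · refine tendsto_finsetSum _ fun b _ => continuousAt_const.mul (ContinuousAt.mul ?_ ?_)
      · refine tendsto_finsetProd _ fun j _ => ?_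
        exact ContinuousAt.comp (f := fun p : (Fin N → ℂ) × ℂ => p.1 j) (hAc b _ (hy.1 j))
          (by fun_prop)
      · refine ContinuousAt.div ?_ ?_ (hA b z hzc)
        · exact ContinuousAt.comp (f := fun p : (Fin N → ℂ) × ℂ => q * p.2)
            (hAc b _ (mul_ne_zero hq0 (hz0 z hzc))) (by fun_prop)
        · exact ContinuousAt.comp (f := fun p : (Fin N → ℂ) × ℂ => p.2)
            (hAc b _ (hz0 z hzc)) (by fun_prop)
  have hlim := Signature.tendsto_add_mul_index hx0
  have hlim' := tendsto_nhds_of_tendsto_nhdsWithin hlim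
  have hev : ∀ᶠ ε : ℂ in 𝓝[≠] 0, (fun i : Fin N => x i + ε * (i : ℕ)) ∈ O :=
    hlim'.eventually (hOopen.mem_nhds hxO)
  refine tendsto_nhds_unique (((hc1.continuousAt (hOopen.mem_nhds hxO)).tendsto.comp hlim').congr'
    ?_) (((hc2.add hc3).continuousAt (hOopen.mem_nhds hxO)).tendsto.comp hlim')
  filter_upwards [hev, hlim (self_mem_nhdsWithin)] with ε h1 h2
  exact hinj _ h1 h2.1

end Contour

/-! ### Clusters of points around a root-of-unity configuration -/

section Cluster

open Metric Set

/-- The points `1 + (z - 1) w^j`, `j = 0, …, K`, with `w = w_{K+1}`. -/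
noncomputable def rootCluster (K : ℕ) (z : ℂ) : Fin (K + 1) → ℂ :=
  fun j => 1 + (z - 1) * rootW (K + 1) ^ (j : ℕ)

/-- The points of `rootCluster K z`, with the first one `z` replaced by `q z`. -/
noncomputable def shiftedCluster (K : ℕ) (q z : ℂ) : Fin (K + 1) → ℂ :=
  Function.update (rootCluster K z) 0 (q * z)

@[simp] theorem rootCluster_zero (K : ℕ) (z : ℂ) : rootCluster K z 0 = z := by
  simp [rootCluster]

@[simp] theorem rootCluster_one (K : ℕ) : rootCluster K 1 = 1 := by
  ext j; simp [rootCluster]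

@[simp] theorem shiftedCluster_one (K : ℕ) (z : ℂ) : shiftedCluster K 1 z = rootCluster K z := by
  simp [shiftedCluster]

theorem norm_rootCluster_sub_one (K : ℕ) (z : ℂ) (j : Fin (K + 1)) :
    ‖rootCluster K z j - 1‖ = ‖z - 1‖ := by
  simp [rootCluster, norm_rootW]

theorem rootCluster_ne_zero {K : ℕ} {z : ℂ} (hz : ‖z - 1‖ < 1) (j : Fin (K + 1)) :
    rootCluster K z j ≠ 0 := by
  intro h
  have := norm_rootCluster_sub_one K z j
  rw [h] at this
  simp at this
  linarith

theorem ne_zero_of_norm_sub_one_lt {z : ℂ} (hz : ‖z - 1‖ < 1) : z ≠ 0 := by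
  rintro rfl; simp at hz

theorem shiftedCluster_ne_zero {K : ℕ} {q z : ℂ} (hq : q ≠ 0) (hz : ‖z - 1‖ < 1)
    (j : Fin (K + 1)) : shiftedCluster K q z j ≠ 0 := by
  by_cases hj : j = 0
  · subst hj
    simp [shiftedCluster, hq, ne_zero_of_norm_sub_one_lt hz]
  · simp [shiftedCluster, hj, rootCluster_ne_zero hz]

theorem rootCluster_rotate (K : ℕ) (z : ℂ) :
    rootCluster K (1 + (z - 1) * rootW (K + 1)) = rootCluster K z ∘ finRotate (K + 1) := by
  ext j
  have hw : rootW (K + 1) ^ (K + 1) = 1 := (isPrimitiveRoot_rootW K).pow_eq_one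
  simp only [rootCluster, Function.comp_apply, finRotate_apply]
  rw [Fin.val_add_one]
  split_ifs with h
  · subst h
    simp only [Fin.val_last, pow_zero, add_sub_cancel_left]
    rw [mul_assoc, ← pow_succ', hw]
  · rw [pow_succ']; ring

theorem prod_padOnes {k N : ℕ} (hk : k ≤ N) (A : ℂ → ℂ) (u : Fin k → ℂ) :
    ∏ j, A (padOnes N u j) = (∏ i, A (u i)) * A 1 ^ (N - k) := by
  obtain ⟨m, rfl⟩ := Nat.exists_eq_add_of_le hk
  rw [Fin.prod_univ_add]
  congr 1
  · exact Finset.prod_congr rfl fun i _ => by simp [padOnes]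
  · simp [padOnes]

theorem padOnes_ne_zero {k N : ℕ} {u : Fin k → ℂ} (hu : ∀ i, u i ≠ 0) (j : Fin N) :
    padOnes N u j ≠ 0 := by
  unfold padOnes
  split_ifs
  · exact hu _
  · exact one_ne_zero

theorem append_ne_zero {k m : ℕ} {u : Fin k → ℂ} {v : Fin m → ℂ} (hu : ∀ i, u i ≠ 0)
    (hv : ∀ i, v i ≠ 0) (j : Fin (k + m)) : Fin.append u v j ≠ 0 := by
  refine Fin.addCases (fun i => ?_) (fun i => ?_) j
  · rw [Fin.append_left]; exact hu i
  · rw [Fin.append_right]; exact hv i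

theorem exists_exp_sub_one_eq_mul :
    ∃ E : ℂ → ℂ, Differentiable ℂ E ∧ ∀ z, Complex.exp z - 1 = z * E z := by
  refine ⟨dslope Complex.exp 0, ?_, fun z => ?_⟩
  · rw [← differentiableOn_univ]
    exact (Complex.differentiableOn_dslope univ_mem).2 Complex.differentiable_exp.differentiableOn
  · have := sub_smul_dslope Complex.exp 0 z
    simpa using this.symm

theorem exp_ne_one_of_norm_le_one {z : ℂ} (hz0 : z ≠ 0) (hz : ‖z‖ ≤ 1) : Complex.exp z ≠ 1 := by
  intro h
  obtain ⟨n, hn⟩ := Complex.exp_eq_one_iff.1 h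
  have h1 : ‖z‖ = |(n : ℝ)| * (2 * Real.pi) := by
    rw [hn]; simp [abs_of_pos Real.pi_pos]
  have hn0 : n ≠ 0 := by
    rintro rfl; simp at hn; exact hz0 hn
  have h2 : (1 : ℝ) ≤ |(n : ℝ)| := by exact_mod_cast Int.one_le_abs hn0
  have := Real.pi_gt_three
  nlinarith

theorem norm_div_natCast_le_one {τ : ℂ} (hτ : ‖τ‖ ≤ 1) {N : ℕ} (hN : 1 ≤ N) : ‖τ / N‖ ≤ 1 := by
  rw [norm_div, Complex.norm_natCast, div_le_one (by positivity)]
  exact hτ.trans (by exact_mod_cast hN)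

theorem exp_div_ne_one {τ : ℂ} (hτ : τ ∈ sphere (0 : ℂ) 1) {N : ℕ} (hN : 1 ≤ N) :
    Complex.exp (τ / N) ≠ 1 := by
  have h1 : ‖τ‖ = 1 := by simpa using hτ
  refine exp_ne_one_of_norm_le_one (div_ne_zero ?_ (Nat.cast_ne_zero.2 (by omega)))
    (norm_div_natCast_le_one h1.le hN)
  rintro rfl; simp at h1

theorem qShiftKernel_padOnes {r N : ℕ} (hr : r ≤ N) (q : ℂ) (c : Fin r → ℂ) (z : ℂ) :
    qShiftKernel q (padOnes N c) z =
      (∏ i, (q * z - c i) / (z - c i)) * ((q * z - 1) / (z - 1)) ^ (N - r) / ((q - 1) * z) := by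
  rw [qShiftKernel, prod_padOnes hr fun y => (q * z - y) / (z - y)]

/-- A multiple of `(z - 1) ^ (K + 1)` does not contribute to the coefficient of `τ ^ k`, `k ≤ K`,
of the contour integral against the kernel: the terms of the binomial expansion of the kernel at
`z = 1` have either a pole of order at most `K + 1` there, or a zero of order more than `k` at
`τ = 0`. -/
theorem circleIntegral_qShiftKernel_mul_pow_eq_zero {N r k K : ℕ} (hN : 1 ≤ N) (hr : r ≤ N)
    (hk : k ≤ K) {R : ℝ} (hR : 0 < R) (hR1 : R < 1) {c : Fin r → ℂ}
    (hc : ∀ i, c i ∉ closedBall (1 : ℂ) R) {h : ℂ → ℂ → ℂ}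
    (hcont : ContinuousOn (Function.uncurry h) (sphere 0 1 ×ˢ sphere 1 R))
    (hz : ∀ τ ∈ sphere (0 : ℂ) 1, DifferentiableOn ℂ (h τ) (closedBall 1 R))
    (hτ : ∀ z ∈ sphere (1 : ℂ) R, DifferentiableOn ℂ (fun τ => h τ z) (closedBall 0 1)) :
    (∮ τ in C(0, 1), (τ ^ (k + 1))⁻¹ * ∮ z in C(1, R),
      qShiftKernel (Complex.exp (τ / N)) (padOnes N c) z * ((z - 1) ^ (K + 1) * h τ z)) = 0 := by
  set Q : ℂ → ℂ := fun τ => Complex.exp (τ / N) with hQ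
  have hQd : Differentiable ℂ Q := by fun_prop
  have hN0 : (N : ℂ) ≠ 0 := Nat.cast_ne_zero.2 (by omega)
  have hQ1 : ∀ τ ∈ sphere (0 : ℂ) 1, Q τ - 1 ≠ 0 := fun τ hτ =>
    sub_ne_zero.2 (exp_div_ne_one hτ hN)
  have hz0 : ∀ z ∈ closedBall (1 : ℂ) R, z ≠ 0 := fun z hz =>
    ne_zero_of_norm_sub_one_lt ((mem_closedBall_iff_norm.1 hz).trans_lt hR1)
  have hz1 : ∀ z ∈ sphere (1 : ℂ) R, z - 1 ≠ 0 := fun z hz h => by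
    rw [mem_sphere_iff_norm, h, norm_zero] at hz; exact hR.ne hz
  have hzc : ∀ z ∈ closedBall (1 : ℂ) R, ∀ i, z - c i ≠ 0 := fun z hz i h =>
    hc i (by rwa [← sub_eq_zero.1 h])
  have hτ0 : ∀ τ ∈ sphere (0 : ℂ) 1, τ ≠ 0 := by
    rintro τ hτ rfl; simp at hτ
  have hss : sphere (1 : ℂ) R ⊆ closedBall 1 R := sphere_subset_closedBall
  set n := N - r with hn
  set B : ℂ → ℂ → ℂ := fun τ z => ∏ i, (Q τ * z - c i) / (z - c i) with hB
  -- the terms of the binomial expansion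
  set T : ℕ → ℂ → ℂ → ℂ := fun m τ z => (τ ^ (k + 1))⁻¹ *
    (B τ z * (((Q τ - 1) * z) / (z - 1)) ^ m / ((Q τ - 1) * z) * (n.choose m : ℂ) *
      ((z - 1) ^ (K + 1) * h τ z)) with hT
  have hTc : ∀ m, ContinuousOn (Function.uncurry (T m)) (sphere 0 1 ×ˢ sphere 1 R) := by
    rintro m ⟨τ, z⟩ ⟨hτs, hzs⟩
    have h1 : ContinuousAt (fun p : ℂ × ℂ => Q p.1) (τ, z) := by fun_prop
    have h2 : ContinuousAt (fun p : ℂ × ℂ => B p.1 p.2) (τ, z) := by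
      refine tendsto_finsetProd _ fun i _ => ContinuousAt.div
        (f := fun p : ℂ × ℂ => Q p.1 * p.2 - c i) (g := fun p : ℂ × ℂ => p.2 - c i)
        (by fun_prop) (by fun_prop) (hzc z (hss hzs) i)
    have h3 : ContinuousAt (fun p : ℂ × ℂ => (((Q p.1 - 1) * p.2) / (p.2 - 1)) ^ m) (τ, z) := by
      refine ContinuousAt.pow (ContinuousAt.div (f := fun p : ℂ × ℂ => (Q p.1 - 1) * p.2)
        (g := fun p : ℂ × ℂ => p.2 - 1) (by fun_prop) (by fun_prop) (hz1 z hzs)) m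
    have h4 : ContinuousAt (fun p : ℂ × ℂ => (p.1 ^ (k + 1))⁻¹) (τ, z) :=
      ContinuousAt.inv₀ (by fun_prop) (pow_ne_zero _ (hτ0 τ hτs))
    have h5 : ContinuousAt (fun p : ℂ × ℂ => B p.1 p.2 * (((Q p.1 - 1) * p.2) / (p.2 - 1)) ^ m /
        ((Q p.1 - 1) * p.2)) (τ, z) :=
      (h2.mul h3).div (by fun_prop) (mul_ne_zero (hQ1 τ hτs) (hz0 z (hss hzs)))
    have h6 : ContinuousAt (fun p : ℂ × ℂ => (p.2 - 1) ^ (K + 1)) (τ, z) := by fun_prop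
    exact h4.continuousWithinAt.mul ((h5.mul continuousAt_const).continuousWithinAt.mul
      (h6.continuousWithinAt.mul (hcont (τ, z) ⟨hτs, hzs⟩)))
  have hTint : ∀ τ ∈ sphere (0 : ℂ) 1, ∀ m, CircleIntegrable (T m τ) 1 R := fun τ hτs m =>
    ContinuousOn.circleIntegrable hR.le
      ((hTc m).comp (f := fun z => (τ, z)) (by fun_prop) fun z hz => ⟨hτs, hz⟩)
  have e1 : (∮ τ in C(0, 1), (τ ^ (k + 1))⁻¹ * ∮ z in C(1, R),
      qShiftKernel (Q τ) (padOnes N c) z * ((z - 1) ^ (K + 1) * h τ z)) =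
      ∮ τ in C(0, 1), ∑ m ∈ Finset.range (n + 1), ∮ z in C(1, R), T m τ z := by
    refine circleIntegral.integral_congr zero_le_one fun τ hτs => ?_
    rw [← circleIntegral.integral_const_mul, ← circleIntegral.integral_fun_sum
      fun m _ => hTint τ hτs m]
    refine circleIntegral.integral_congr hR.le fun z hzs => ?_
    have e2 : (Q τ * z - 1) / (z - 1) = ((Q τ - 1) * z) / (z - 1) + 1 := by
      have := hz1 z hzs
      field_simp
      ring
    simp only [hT]
    rw [qShiftKernel_padOnes hr, e2, add_pow, Finset.mul_sum, Finset.sum_div, Finset.sum_mul,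
      Finset.mul_sum]
    refine Finset.sum_congr rfl fun m _ => ?_
    simp only [one_pow, mul_one, hB]
    ring
  have hTz : ∀ m, (∮ τ in C(0, 1), ∮ z in C(1, R), T m τ z) = 0 := by
    intro m
    rcases le_or_gt m (K + 1) with hm | hm
    · -- the factor `(z - 1) ^ (K + 1)` cancels the pole in `z`
      have : ∀ τ ∈ sphere (0 : ℂ) 1, (∮ z in C(1, R), T m τ z) = 0 := by
        intro τ hτs
        have e3 : (∮ z in C(1, R), T m τ z) = ∮ z in C(1, R), (τ ^ (k + 1))⁻¹ *
            (B τ z * ((Q τ - 1) * z) ^ m / ((Q τ - 1) * z) * (n.choose m : ℂ) *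
            ((z - 1) ^ (K + 1 - m) * h τ z)) := by
          refine circleIntegral.integral_congr hR.le fun z hzs => ?_
          have h1 := hz1 z hzs
          have h2 : (z - 1) ^ (K + 1) = (z - 1) ^ (K + 1 - m) * (z - 1) ^ m := by
            rw [← pow_add]; congr 1; omega
          simp only [hT, div_pow]
          rw [h2]
          field_simp
        rw [e3]
        refine DiffContOnCl.circleIntegral_eq_zero hR.le
          (DifferentiableOn.diffContOnCl (DifferentiableOn.mono (t := closedBall 1 R) ?_
            closure_ball_subset_closedBall))
        have h2 : DifferentiableOn ℂ (B τ) (closedBall 1 R) := by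
          refine DifferentiableOn.fun_finsetProd fun i _ z hzs =>
            DifferentiableAt.differentiableWithinAt ?_
          exact DifferentiableAt.div (by fun_prop) (by fun_prop) (hzc z hzs i)
        refine DifferentiableOn.const_mul (DifferentiableOn.mul (DifferentiableOn.mul_const
          (DifferentiableOn.div (h2.mul (by fun_prop)) (by fun_prop) fun z hzs =>
            mul_ne_zero (hQ1 τ hτs) (hz0 z hzs)) _)
          (DifferentiableOn.mul (by fun_prop) (hz τ hτs))) _
      rw [circleIntegral.integral_congr (g := fun _ => 0) zero_le_one fun τ hτs => this τ hτs]
      simp [circleIntegral]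
    · -- the zero of order `m - 1 > k` of `(Q τ - 1) ^ (m - 1)` cancels the pole in `τ`
      rw [circleIntegral_swap zero_le_one hR.le (hTc m)]
      obtain ⟨E, hEd, hE⟩ := exists_exp_sub_one_eq_mul
      have : ∀ z ∈ sphere (1 : ℂ) R, (∮ τ in C(0, 1), T m τ z) = 0 := by
        intro z hzs
        have e3 : (∮ τ in C(0, 1), T m τ z) = ∮ τ in C(0, 1), (τ ^ (m - 1 - (k + 1)) *
            (1 / N * E (τ / N)) ^ (m - 1)) * (B τ z * (z / (z - 1)) ^ m / z * (n.choose m : ℂ) *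
            ((z - 1) ^ (K + 1) * h τ z)) := by
          refine circleIntegral.integral_congr zero_le_one fun τ hτs => ?_
          have h1 := hτ0 τ hτs
          have h2 : Q τ - 1 = τ * (1 / N * E (τ / N)) := by
            rw [hQ]; simp only; rw [hE]; ring
          have h3 : ((Q τ - 1) * z / (z - 1)) ^ m / ((Q τ - 1) * z) =
              (Q τ - 1) ^ (m - 1) * ((z / (z - 1)) ^ m / z) := by
            have h4 := hQ1 τ hτs
            have h5 := hz0 z (hss hzs)
            obtain ⟨m', rfl⟩ : ∃ m', m = m' + 1 := ⟨m - 1, by omega⟩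
            rw [mul_div_assoc, mul_pow, Nat.add_sub_cancel]
            rw [pow_succ (Q τ - 1)]
            field_simp
          have h4 : (τ ^ (k + 1))⁻¹ * τ ^ (m - 1) = τ ^ (m - 1 - (k + 1)) := by
            have : τ ^ (m - 1) = τ ^ (m - 1 - (k + 1)) * τ ^ (k + 1) := by
              rw [← pow_add]; congr 1; omega
            rw [this]; field_simp
          simp only [hT]
          rw [mul_div_assoc, h3, ← h4, h2, mul_pow]
          ring
        rw [e3]
        refine DiffContOnCl.circleIntegral_eq_zero zero_le_one
          (DifferentiableOn.diffContOnCl (DifferentiableOn.mono (t := closedBall 0 1) ?_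
            closure_ball_subset_closedBall))
        have h2 : DifferentiableOn ℂ (fun τ => B τ z) (closedBall 0 1) := by
          refine DifferentiableOn.fun_finsetProd fun i _ => ?_
          exact DifferentiableOn.div_const (by fun_prop) _
        have h3 : DifferentiableOn ℂ (fun τ => τ ^ (m - 1 - (k + 1)) *
            (1 / N * E (τ / N)) ^ (m - 1)) (closedBall 0 1) := by
          refine Differentiable.differentiableOn ?_
          have : Differentiable ℂ fun τ : ℂ => E (τ / N) := hEd.comp (by fun_prop)
          fun_prop
        exact h3.mul (((((h2.mul_const _).div_const _).mul_const _)).mul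
          ((hτ z hzs).const_mul _))
      rw [circleIntegral.integral_congr (g := fun _ => 0) hR.le fun z hzs => this z hzs]
      simp [circleIntegral]
  rw [e1, circleIntegral.integral_fun_sum]
  · exact Finset.sum_eq_zero fun m _ => hTz m
  · exact fun m _ => ContinuousOn.circleIntegrable zero_le_one
      (continuousOn_circleIntegral hR.le (hTc m))

end Cluster

/-! ### Power sums of the shifted coordinates as contour integrals -/

section MomentFunctional

open Metric Set

/-- The coefficient of the `q`-difference operator at the point `padOnes N c` for the `i`-th
coordinate of `c`. -/
noncomputable def padWeight (N : ℕ) {r : ℕ} (q : ℂ) (c : Fin r → ℂ) (i : Fin r) : ℂ :=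
  (∏ j ∈ Finset.univ.erase i, (q * c i - c j) / (c i - c j)) *
    ((q * c i - 1) / (c i - 1)) ^ (N - r)

/-- The coefficient of `τ ^ k` of the `q`-difference operator, `q = exp (τ / N)`, applied to `f` at
the point `padOnes N c`. The residues at the coordinates of `c` are written out, the contribution
of the coordinates equal to `1` is a contour integral. -/
noncomputable def momentFunctional (N K k : ℕ) (R : ℝ) {r : ℕ} (c : Fin r → ℂ)
    (f : (Fin N → ℂ) → ℂ) : ℂ :=
  (2 * Real.pi * Complex.I : ℂ)⁻¹ * ∮ τ in C(0, 1), (τ ^ (k + 1))⁻¹ *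
    ((∑ i, padWeight N (Complex.exp (τ / N)) c i *
        f (padOnes N (Function.update c i (Complex.exp (τ / N) * c i)))) +
      (2 * Real.pi * Complex.I : ℂ)⁻¹ * ∮ z in C(1, R),
        qShiftKernel (Complex.exp (τ / N)) (padOnes N c) z *
          f (padOnes N (Fin.append c (shiftedCluster K (Complex.exp (τ / N)) z))))

theorem padOnes_update {r N : ℕ} (hr : r ≤ N) (c : Fin r → ℂ) (i : Fin r) (y : ℂ) :
    Function.update (padOnes N c) (Fin.castLE hr i) y = padOnes N (Function.update c i y) := by
  ext j
  by_cases hj : (j : ℕ) < r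
  · have e1 : j = Fin.castLE hr ⟨j, hj⟩ := Fin.ext rfl
    by_cases hji : (⟨j, hj⟩ : Fin r) = i
    · subst hji
      rw [← e1, Function.update_self]
      simp [padOnes, hj]
    · have : j ≠ Fin.castLE hr i := fun h => hji (by ext; simp [h])
      rw [Function.update_of_ne this]
      simp [padOnes, hj, Function.update_of_ne hji]
  · have : j ≠ Fin.castLE hr i := fun h => hj (by rw [h]; exact i.2)
    rw [Function.update_of_ne this]
    simp [padOnes, hj]

theorem padOnes_castLE {r N : ℕ} (hr : r ≤ N) (c : Fin r → ℂ) (i : Fin r) :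
    padOnes N c (Fin.castLE hr i) = c i := by
  simp [padOnes]

theorem qShiftWeight_padOnes {r N : ℕ} (hr : r ≤ N) (q : ℂ) (c : Fin r → ℂ) (i : Fin r) :
    qShiftWeight q (padOnes N c) (Fin.castLE hr i) = padWeight N q c i := by
  have key : ∀ {M : ℕ} (a : Fin M) (g : Fin M → ℂ),
      ∏ j ∈ Finset.univ.erase a, g j = ∏ j, if j = a then 1 else g j := by
    intro M a g
    rw [← Finset.mul_prod_erase Finset.univ _ (Finset.mem_univ a), if_pos rfl, one_mul]
    exact Finset.prod_congr rfl fun j hj => (if_neg (Finset.ne_of_mem_erase hj)).symm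
  obtain ⟨m, rfl⟩ := Nat.exists_eq_add_of_le hr
  rw [qShiftWeight, padWeight, padOnes_castLE, key, key, Fin.prod_univ_add]
  congr 1
  · refine Finset.prod_congr rfl fun j _ => ?_
    have : (Fin.castAdd m j = Fin.castLE hr i) ↔ j = i := by
      simp [Fin.ext_iff]
    simp only [this]
    simp [padOnes]
  · have h1 : ∀ j : Fin m, Fin.natAdd r j ≠ Fin.castLE hr i := fun j h => by
      have h2 := congrArg Fin.val h
      have := i.2
      simp only [Fin.val_natAdd, Fin.val_castLE] at h2
      omega
    simp [h1, padOnes, div_pow]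

theorem sum_qShiftWeight_padOnes {r N : ℕ} (hr : r ≤ N) (q : ℂ) (c : Fin r → ℂ)
    (f : (Fin N → ℂ) → ℂ) :
    ∑ i ∈ (Finset.univ.filter fun i : Fin N => r ≤ i)ᶜ, qShiftWeight q (padOnes N c) i *
      f (Function.update (padOnes N c) i (q * padOnes N c i)) =
      ∑ i, padWeight N q c i * f (padOnes N (Function.update c i (q * c i))) := by
  symm
  refine Finset.sum_bij (fun i _ => Fin.castLE hr i) (fun i _ => by simp)
    (fun i _ j _ h => Fin.castLE_injective hr h) (fun j hj => ?_) fun i _ => ?_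
  · simp only [Finset.compl_filter, not_le, Finset.mem_filter, Finset.mem_univ, true_and] at hj
    exact ⟨⟨j, hj⟩, Finset.mem_univ _, rfl⟩
  · rw [qShiftWeight_padOnes, padOnes_castLE, padOnes_update]

theorem differentiableAt_prod_comp {N : ℕ} {A : ℂ → ℂ} (hA : ∀ z, z ≠ 0 → DifferentiableAt ℂ A z)
    {u : ℂ → Fin N → ℂ} {z : ℂ} (hu : DifferentiableAt ℂ u z) (hz : ∀ i, u z i ≠ 0) :
    DifferentiableAt ℂ (fun z => ∏ j, A (u z j)) z :=
  DifferentiableAt.fun_finsetProd fun j _ =>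
    (hA _ (hz j)).comp (f := fun z => u z j) z (differentiableAt_pi.1 hu j)

theorem Signature.differentiableAt_schurSum_comp {N : ℕ} (l : Signature N) {u : ℂ → Fin N → ℂ}
    {z : ℂ} (hu : DifferentiableAt ℂ u z) (hz : ∀ i, u z i ≠ 0) :
    DifferentiableAt ℂ (fun z => l.schurSum (u z)) z := by
  unfold Signature.schurSum
  refine DifferentiableAt.fun_sum fun a _ => DifferentiableAt.fun_finsetProd fun j _ => ?_
  exact DifferentiableAt.comp (g := fun y : ℂ => y ^ l.exponent a j) (f := fun z => u z j) z
    (differentiableAt_zpow.2 (Or.inl (hz j))) (differentiableAt_pi.1 hu j)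

theorem differentiable_shiftedCluster (K : ℕ) (q : ℂ) : Differentiable ℂ (shiftedCluster K q) := by
  refine differentiable_pi.2 fun j => ?_
  by_cases hj : j = 0
  · subst hj; simp only [shiftedCluster, Function.update_self]; fun_prop
  · simp only [shiftedCluster, Function.update_of_ne hj, rootCluster]; fun_prop

theorem differentiable_padOnes (N k : ℕ) : Differentiable ℂ (padOnes (k := k) N) := by
  refine differentiable_pi.2 fun j => ?_
  by_cases hj : (j : ℕ) < k
  · simp only [padOnes, hj, dite_true]; fun_prop
  · simp only [padOnes, hj, dite_false]; fun_prop

theorem differentiable_append {r m : ℕ} (c : Fin r → ℂ) :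
    Differentiable ℂ fun u : Fin m → ℂ => Fin.append c u := by
  refine differentiable_pi.2 fun j => ?_
  refine Fin.addCases (fun i => ?_) (fun i => ?_) j
  · simp only [Fin.append_left]; fun_prop
  · simp only [Fin.append_right]; fun_prop

theorem continuousOn_qShiftKernel_padOnes {N r : ℕ} (hN : 1 ≤ N) {R : ℝ} (hR : 0 < R)
    (hR1 : R < 1) {c : Fin r → ℂ} (hc : ∀ i, c i ∉ sphere (1 : ℂ) R) :
    ContinuousOn (fun p : ℂ × ℂ => qShiftKernel (Complex.exp (p.1 / N)) (padOnes N c) p.2)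
      (sphere 0 1 ×ˢ sphere 1 R) := by
  rintro ⟨τ, z⟩ ⟨hτ, hz⟩
  have hz0 : z ≠ 0 := ne_zero_of_norm_sub_one_lt ((mem_sphere_iff_norm.1 hz).le.trans_lt hR1)
  have hz1 : z - 1 ≠ 0 := fun h => by
    simp only at hz
    rw [mem_sphere_iff_norm, h, norm_zero] at hz; exact hR.ne hz
  refine ContinuousAt.continuousWithinAt ?_
  unfold qShiftKernel
  refine ContinuousAt.div (tendsto_finsetProd _ fun j _ => ?_) (by fun_prop)
    (mul_ne_zero (sub_ne_zero.2 (exp_div_ne_one hτ hN)) hz0)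
  refine ContinuousAt.div (f := fun p : ℂ × ℂ => Complex.exp (p.1 / N) * p.2 - padOnes N c j)
    (g := fun p : ℂ × ℂ => p.2 - padOnes N c j) (by fun_prop) (by fun_prop) ?_
  unfold padOnes
  split_ifs with h
  · exact fun h' => hc ⟨j, h⟩ (by rwa [← sub_eq_zero.1 h'])
  · exact hz1

/-- The power sums of the shifted coordinates as contour integrals of the Schur function. -/
theorem Signature.sum_pow_mul_schurSum {N K k r : ℕ} (hN : 1 ≤ N) (hk : k ≤ K)
    (hr : r + (K + 1) ≤ N) (l : Signature N) {R : ℝ} (hR : 0 < R) (hR1 : R < 1) {c : Fin r → ℂ}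
    (hc0 : ∀ i, c i ≠ 0) (hcinj : Function.Injective c) (hc : ∀ i, c i ∉ closedBall (1 : ℂ) R) :
    (∑ j, ((l.shifted j : ℂ) / N) ^ k) / k.factorial * l.schurSum (padOnes N c) =
      momentFunctional N K k R c l.schurSum := by
  classical
  obtain ⟨β, _, κ, A, hA1, hAd, hκ⟩ := l.exists_sum_prod_eq_schurSum (by omega)
  have hrN : r ≤ N := by omega
  have hAc : ∀ b z, z ≠ 0 → ContinuousAt (A b) z := fun b z hz => (hAd b z hz).continuousAt
  have hpi : (2 * Real.pi * Complex.I : ℂ) ≠ 0 := Complex.two_pi_I_ne_zero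
  -- a small circle inside of which the functions `A b` have no zero
  obtain ⟨S, hS, hSR, hA⟩ : ∃ S : ℝ, 0 < S ∧ S ≤ R ∧ ∀ b, ∀ z ∈ closedBall (1 : ℂ) S,
      A b z ≠ 0 := by
    have : ∀ᶠ z in 𝓝 (1 : ℂ), ∀ b, A b z ≠ 0 :=
      eventually_all.2 fun b => (hAc b 1 one_ne_zero).eventually_ne (hA1 b)
    obtain ⟨ε, hε, h⟩ := Metric.eventually_nhds_iff_ball.1 this
    refine ⟨min (ε / 2) R, by positivity, min_le_right _ _, fun b z hz => h z ?_ b⟩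
    have := mem_closedBall.1 hz
    have h2 := min_le_left (ε / 2) R
    exact mem_ball.2 (by linarith)
  have hS1 : S < 1 := hSR.trans_lt hR1
  have hcS : ∀ i, c i ∉ closedBall (1 : ℂ) S := fun i h => hc i (closedBall_subset_closedBall hSR h)
  set Q : ℂ → ℂ := fun τ => Complex.exp (τ / N) with hQ
  have hQ0 : ∀ τ, Q τ ≠ 0 := fun τ => Complex.exp_ne_zero _
  have hlt : ∀ z ∈ closedBall (1 : ℂ) R, ‖z - 1‖ < 1 := fun z hz =>
    (mem_closedBall_iff_norm.1 hz).trans_lt hR1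
  have hz0 : ∀ z ∈ closedBall (1 : ℂ) R, z ≠ 0 := fun z hz => ne_zero_of_norm_sub_one_lt (hlt z hz)
  have hzS0 : ∀ z ∈ closedBall (1 : ℂ) S, z ≠ 0 := fun z hz =>
    hz0 z (closedBall_subset_closedBall hSR hz)
  have happ0 : ∀ τ, ∀ z ∈ closedBall (1 : ℂ) R, ∀ j,
      padOnes N (Fin.append c (shiftedCluster K (Q τ) z)) j ≠ 0 := fun τ z hz j =>
    padOnes_ne_zero (append_ne_zero hc0 (shiftedCluster_ne_zero (hQ0 τ) (hlt z hz))) j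
  -- the products over the root-of-unity cluster are constant up to order `K + 1`
  have hrot : ∀ b, ∃ g : ℂ → ℂ, DifferentiableOn ℂ g (ball 1 1) ∧ ∀ z ∈ ball (1 : ℂ) 1,
      ∏ j, A b (rootCluster K z j) = A b 1 ^ (K + 1) + (z - 1) ^ (K + 1) * g z := by
    intro b
    obtain ⟨g, hg1, hg2⟩ := exists_eq_add_pow_mul_of_rotation_invariant (K := K) (c := 1) (R := 1)
      (h := fun z => ∏ j, A b (rootCluster K z j)) one_pos (fun z hz => by
        refine (differentiableAt_prod_comp (hAd b) ?_
          (rootCluster_ne_zero (mem_ball_iff_norm.1 hz))).differentiableWithinAt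
        simpa using (differentiable_shiftedCluster K 1) z) (fun z _ => by
        rw [rootCluster_rotate]
        exact Equiv.prod_comp (finRotate (K + 1)) fun j => A b (rootCluster K z j))
    exact ⟨g, hg1, fun z hz => by rw [hg2 z hz]; simp⟩
  choose g hgd hg using hrot
  -- the error of the replacement of `A b 1` by the values on the cluster, divided by
  -- `(z - 1) ^ (K + 1)`
  set h : ℂ → ℂ → ℂ := fun τ z => ∑ b, κ b * ((∏ i, A b (c i)) * A b 1 ^ (N - (r + (K + 1))) *
    (A b (Q τ * z) / A b z) * g b z) with hh
  have hSb : closedBall (1 : ℂ) S ⊆ ball 1 1 := closedBall_subset_ball hS1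
  have hhd : ∀ τ, ∀ z ∈ closedBall (1 : ℂ) S, DifferentiableAt ℂ (h τ) z := by
    intro τ z hz
    refine DifferentiableAt.fun_sum fun b _ => ?_
    have h1 : DifferentiableAt ℂ (fun z => A b (Q τ * z)) z :=
      (hAd b _ (mul_ne_zero (hQ0 τ) (hzS0 z hz))).comp z (by fun_prop)
    exact (((h1.div (hAd b z (hzS0 z hz)) (hA b z hz)).const_mul _).mul
      ((hgd b).differentiableAt (isOpen_ball.mem_nhds (hSb hz)))).const_mul _
  -- this error does not contribute to the coefficient of `τ ^ k`
  have hkill := circleIntegral_qShiftKernel_mul_pow_eq_zero (h := h) hN hrN hk hS hS1 hcS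
    (by
      rintro ⟨τ, z⟩ ⟨_, hz⟩
      have hz' := sphere_subset_closedBall hz
      simp only at hz'
      refine ContinuousAt.continuousWithinAt (tendsto_finsetSum _ fun b _ => ?_)
      refine continuousAt_const.mul (ContinuousAt.mul (continuousAt_const.mul
        (ContinuousAt.div ?_ ?_ (hA b z hz'))) ?_)
      · exact ContinuousAt.comp (f := fun p : ℂ × ℂ => Q p.1 * p.2)
          (hAc b _ (mul_ne_zero (hQ0 τ) (hzS0 z hz'))) (by fun_prop)
      · exact ContinuousAt.comp (f := fun p : ℂ × ℂ => p.2) (hAc b _ (hzS0 z hz')) (by fun_prop)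
      · exact ContinuousAt.comp (f := fun p : ℂ × ℂ => p.2)
          ((hgd b).differentiableAt (isOpen_ball.mem_nhds (hSb hz'))).continuousAt (by fun_prop))
    (fun τ _ z hz => (hhd τ z hz).differentiableWithinAt)
    (fun z hz τ _ => by
      have hz' := sphere_subset_closedBall hz
      refine DifferentiableAt.differentiableWithinAt (DifferentiableAt.fun_sum fun b _ => ?_)
      have h1 : DifferentiableAt ℂ (fun τ => A b (Q τ * z)) τ :=
        (hAd b _ (mul_ne_zero (hQ0 τ) (hzS0 z hz'))).comp τ (by fun_prop)
      exact (((h1.div_const _).const_mul _).mul_const _).const_mul _)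
  -- the eigenvalue equation for each `τ`
  set W : ℂ → ℂ := fun τ => ∑ i, padWeight N (Q τ) c i *
        l.schurSum (padOnes N (Function.update c i (Q τ * c i))) with hW
  set J : ℂ → ℂ := fun τ => ∮ z in C(1, R), qShiftKernel (Q τ) (padOnes N c) z *
    l.schurSum (padOnes N (Fin.append c (shiftedCluster K (Q τ) z))) with hJ
  set D : ℂ → ℂ := fun τ => ∮ z in C(1, S),
    qShiftKernel (Q τ) (padOnes N c) z * ((z - 1) ^ (K + 1) * h τ z) with hD
  have hkerd : ∀ τ, ∀ z ∈ closedBall (1 : ℂ) R, z ≠ 1 → τ ∈ sphere (0 : ℂ) 1 →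
      DifferentiableAt ℂ (qShiftKernel (Q τ) (padOnes N c)) z := by
    intro τ z hz hz1 hτ
    have : qShiftKernel (Q τ) (padOnes N c) = fun z =>
        (∏ j, (Q τ * z - padOnes N c j) / (z - padOnes N c j)) / ((Q τ - 1) * z) := rfl
    rw [this]
    refine DifferentiableAt.div (DifferentiableAt.fun_finsetProd fun j _ => ?_) (by fun_prop)
      (mul_ne_zero (sub_ne_zero.2 (exp_div_ne_one hτ hN)) (hz0 z hz))
    refine DifferentiableAt.div (by fun_prop) (by fun_prop) ?_
    unfold padOnes
    split_ifs with h
    · exact fun h' => hc ⟨j, h⟩ (by rwa [← sub_eq_zero.1 h'])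
    · exact sub_ne_zero.2 hz1
  have hsphS : ∀ z ∈ sphere (1 : ℂ) S, z ≠ 1 := by
    rintro z hz rfl
    simp at hz; exact hS.ne hz
  have hprodd : ∀ τ, ∀ z ∈ closedBall (1 : ℂ) R, DifferentiableAt ℂ (fun z =>
      l.schurSum (padOnes N (Fin.append c (shiftedCluster K (Q τ) z)))) z := by
    intro τ z hz
    refine l.differentiableAt_schurSum_comp ?_ (happ0 τ z hz)
    exact ((differentiable_padOnes N _).comp ((differentiable_append c).comp
      (differentiable_shiftedCluster K (Q τ)))) z
  have hdiff : ∀ τ ∈ sphere (0 : ℂ) 1, W τ + (2 * Real.pi * Complex.I : ℂ)⁻¹ * J τ =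
      (∑ j, Complex.exp (τ * (l.shifted j / N))) * l.schurSum (padOnes N c) +
      (2 * Real.pi * Complex.I : ℂ)⁻¹ * D τ := by
    intro τ hτ
    have hq1 : Q τ ≠ 1 := exp_div_ne_one hτ hN
    have hL1 := l.sum_zpow_mul_schurSum (hQ0 τ) hq1 hκ hAd hS hS1 hA
      (x := padOnes N c) (t := Finset.univ.filter fun i : Fin N => r ≤ i)
      (padOnes_ne_zero hc0) (fun i hi j hij => by
        have hi' : (i : ℕ) < r := by simpa using hi
        simp only [padOnes, hi', dite_true]
        split_ifs with hj
        · exact fun h => hij (Fin.ext (by simpa using (Fin.ext_iff.1 (hcinj h)).symm))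
        · intro h
          exact hc ⟨i, hi'⟩ (by rw [h]; simp [hR.le]))
      (fun i hi => by
        have hi' : ¬ (i : ℕ) < r := by simpa using hi
        simp [padOnes, hi', hS])
      (fun i hi => by
        have hi' : (i : ℕ) < r := by simpa using hi
        simp only [padOnes, hi', dite_true]
        exact hcS _)
    rw [sum_qShiftWeight_padOnes hrN] at hL1
    have e1 : ∑ j, Q τ ^ l.shifted j = ∑ j, Complex.exp (τ * (l.shifted j / N)) := by
      refine Finset.sum_congr rfl fun j _ => ?_
      rw [hQ]
      simp only
      rw [← Complex.exp_int_mul]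
      congr 1; ring
    rw [e1] at hL1
    -- the Schur function is holomorphic up to the larger circle
    have e2 : J τ = ∮ z in C(1, S), qShiftKernel (Q τ) (padOnes N c) z *
        l.schurSum (padOnes N (Fin.append c (shiftedCluster K (Q τ) z))) := by
      refine Complex.circleIntegral_eq_of_differentiable_on_annulus_off_countable hS hSR
        countable_empty (fun z hz => ?_) (fun z hz => ?_)
      · have hz1 : z ≠ 1 := by
          rintro rfl; exact hz.2 (mem_ball_self hS)
        exact ((hkerd τ z hz.1 hz1 hτ).mul (hprodd τ z hz.1)).continuousAt.continuousWithinAt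
      · have hz1 : z ≠ 1 := by
          rintro rfl; exact hz.1.2 (mem_closedBall_self hS.le)
        have hzR := ball_subset_closedBall hz.1.1
        exact (hkerd τ z hzR hz1 hτ).mul (hprodd τ z hzR)
    have hi1 : CircleIntegrable (fun z => qShiftKernel (Q τ) (padOnes N c) z *
        ∑ b, κ b * ((∏ j, A b (padOnes N c j)) * (A b (Q τ * z) / A b z))) 1 S := by
      refine ContinuousOn.circleIntegrable hS.le fun z hz => ContinuousAt.continuousWithinAt ?_
      have hzS := sphere_subset_closedBall hz
      refine (hkerd τ z (closedBall_subset_closedBall hSR hzS)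
        (hsphS z hz) hτ).continuousAt.mul (tendsto_finsetSum _ fun b _ =>
          continuousAt_const.mul (continuousAt_const.mul (ContinuousAt.div ?_
            (hAc b _ (hzS0 z hzS)) (hA b z hzS))))
      exact ContinuousAt.comp (f := fun z => Q τ * z)
          (hAc b _ (mul_ne_zero (hQ0 τ) (hzS0 z hzS))) (by fun_prop)
    have hi2 : CircleIntegrable (fun z => qShiftKernel (Q τ) (padOnes N c) z *
        ((z - 1) ^ (K + 1) * h τ z)) 1 S := by
      refine ContinuousOn.circleIntegrable hS.le fun z hz => ContinuousAt.continuousWithinAt ?_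
      have hzS := sphere_subset_closedBall hz
      exact (hkerd τ z (closedBall_subset_closedBall hSR hzS) (hsphS z hz) hτ).continuousAt.mul
        (ContinuousAt.mul (by fun_prop) (hhd τ z hzS).continuousAt)
    have e3 : J τ = (∮ z in C(1, S), qShiftKernel (Q τ) (padOnes N c) z *
        ∑ b, κ b * ((∏ j, A b (padOnes N c j)) * (A b (Q τ * z) / A b z))) + D τ := by
      rw [e2, hD, ← circleIntegral.integral_add hi1 hi2]
      refine circleIntegral.integral_congr hS.le fun z hz => ?_
      have hzS := sphere_subset_closedBall hz
      rw [hκ _ (happ0 τ z (closedBall_subset_closedBall hSR hzS)), ← mul_add]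
      congr 1
      simp only [hh, Finset.mul_sum]
      rw [← Finset.sum_add_distrib]
      refine Finset.sum_congr rfl fun b _ => ?_
      rw [prod_padOnes hr, prod_padOnes hrN, Fin.prod_univ_add]
      simp only [Fin.append_left, Fin.append_right]
      have e4 : ∏ i, A b (shiftedCluster K (Q τ) z i) =
          (A b 1 ^ (K + 1) + (z - 1) ^ (K + 1) * g b z) * (A b (Q τ * z) / A b z) := by
        rw [← hg b z (hSb hzS)]
        have := prod_update_mul (A b) (rootCluster K z) 0 (Q τ * z)
          (by rw [rootCluster_zero]; exact hA b z hzS)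
        rw [rootCluster_zero] at this
        exact this
      have e5 : A b 1 ^ (N - r) = A b 1 ^ (K + 1) * A b 1 ^ (N - (r + (K + 1))) := by
        rw [← pow_add]; congr 1; omega
      rw [e4, e5]
      ring
    rw [e3, mul_add, ← add_assoc, ← hL1]
  have hDc : ContinuousOn D (sphere 0 1) := by
    refine continuousOn_circleIntegral hS.le ?_
    have h1 := continuousOn_qShiftKernel_padOnes hN hS hS1 (c := c) fun i hi =>
      hcS i (sphere_subset_closedBall hi)
    refine h1.mul (ContinuousOn.mul (by fun_prop) ?_)
    rintro ⟨τ, z⟩ ⟨_, hz⟩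
    have hz' := sphere_subset_closedBall hz
    simp only at hz'
    refine ContinuousAt.continuousWithinAt (tendsto_finsetSum _ fun b _ => ?_)
    refine continuousAt_const.mul (ContinuousAt.mul (continuousAt_const.mul
      (ContinuousAt.div ?_ ?_ (hA b z hz'))) ?_)
    · exact ContinuousAt.comp (f := fun p : ℂ × ℂ => Q p.1 * p.2)
        (hAc b _ (mul_ne_zero (hQ0 τ) (hzS0 z hz'))) (by fun_prop)
    · exact ContinuousAt.comp (f := fun p : ℂ × ℂ => p.2) (hAc b _ (hzS0 z hz')) (by fun_prop)
    · exact ContinuousAt.comp (f := fun p : ℂ × ℂ => p.2)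
        ((hgd b).differentiableAt (isOpen_ball.mem_nhds (hSb hz'))).continuousAt (by fun_prop)
  have hτinv : ContinuousOn (fun τ : ℂ => (τ ^ (k + 1))⁻¹) (sphere 0 1) :=
    ContinuousOn.inv₀ (by fun_prop) fun τ hτ => pow_ne_zero _ (by rintro rfl; simp at hτ)
  have hexp : ContinuousOn (fun τ : ℂ => ∑ j, Complex.exp (τ * (l.shifted j / N)))
    (sphere 0 1) := by fun_prop
  -- the coefficient of `τ ^ k` of both sides of the eigenvalue equation
  have e6 : momentFunctional N K k R c l.schurSum = (2 * Real.pi * Complex.I : ℂ)⁻¹ *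
      ∮ τ in C(0, 1), ((∑ j, l.schurSum (padOnes N c) * ((τ ^ (k + 1))⁻¹ *
        Complex.exp (τ * (l.shifted j / N)))) +
        (2 * Real.pi * Complex.I : ℂ)⁻¹ * ((τ ^ (k + 1))⁻¹ * D τ)) := by
    unfold momentFunctional
    congr 1
    refine circleIntegral.integral_congr zero_le_one fun τ hτ => ?_
    have := hdiff τ hτ
    simp only [hW, hJ] at this
    rw [this, mul_add, Finset.sum_mul, Finset.mul_sum]
    congr 1
    · exact Finset.sum_congr rfl fun j _ => by ring
    · ring
  rw [e6, circleIntegral.integral_add, circleIntegral.integral_fun_sum,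
    circleIntegral.integral_const_mul, hkill, mul_zero, add_zero, Finset.mul_sum, Finset.sum_div,
    Finset.sum_mul]
  · refine Finset.sum_congr rfl fun j _ => ?_
    rw [circleIntegral.integral_const_mul, ← circleIntegral_exp_coeff]
    ring
  · exact fun j _ => ContinuousOn.circleIntegrable zero_le_one
      (continuousOn_const.mul (hτinv.mul (by fun_prop)))
  · exact ContinuousOn.circleIntegrable zero_le_one (continuousOn_finsetSum _ fun j _ =>
      continuousOn_const.mul (hτinv.mul (by fun_prop)))
  · exact ContinuousOn.circleIntegrable zero_le_one (continuousOn_const.mul (hτinv.mul hDc))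

end MomentFunctional

/-! ### Weighted sums of normalized Schur functions -/

section WeightedSum

open Metric Set

instance (N : ℕ) : Countable (Signature N) :=
  inferInstanceAs (Countable {l : Fin N → ℤ // Antitone l})

namespace Signature

theorem schurSum_one_ne_zero {N : ℕ} (l : Signature N) : l.schurSum 1 ≠ 0 := by
  simp [schurSum, Fintype.card_ne_zero]

/-- The Schur function divided by its value at `(1, …, 1)`. -/
noncomputable def normalizedSchur {N : ℕ} (l : Signature N) (x : Fin N → ℂ) : ℂ :=
  l.schurSum x / l.schurSum 1

theorem normalizedSchur_one {N : ℕ} (l : Signature N) : l.normalizedSchur 1 = 1 :=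
  div_self l.schurSum_one_ne_zero

theorem normalizedSchur_comp_perm {N : ℕ} (l : Signature N) (σ : Equiv.Perm (Fin N))
    {x : Fin N → ℂ} (hx : ∀ i, x i ≠ 0) : l.normalizedSchur (x ∘ σ) = l.normalizedSchur x := by
  rw [normalizedSchur, normalizedSchur, l.schurSum_comp_perm σ hx]

theorem continuousAt_normalizedSchur {N : ℕ} (l : Signature N) {x : Fin N → ℂ}
    (hx : ∀ i, x i ≠ 0) : ContinuousAt l.normalizedSchur x :=
  (l.continuousAt_schurSum hx).div_const _

/-- The mean `(1 / N) ∑_j ((λ_j + N - j) / N) ^ k`. -/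
noncomputable def powerMean {N : ℕ} (l : Signature N) (k : ℕ) : ℝ :=
  (∑ j, ((l.shifted j : ℝ) / N) ^ k) / N

end Signature

theorem _root_.Real.exp_mul_intCast (x : ℝ) (n : ℤ) : Real.exp (x * n) = Real.exp x ^ n := by
  rw [Real.exp_mul, Real.rpow_intCast]

/-- The points with coordinates `exp (± δ i)`; the sign is positive for `i ∈ s`. -/
noncomputable def cornerPoint {k : ℕ} (δ : Fin k → ℝ) (s : Finset (Fin k)) (i : Fin k) : ℂ :=
  if i ∈ s then (Real.exp (δ i) : ℂ) else (Real.exp (-δ i) : ℂ)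

theorem prod_padOnes_apply {k N : ℕ} (hk : k ≤ N) {M : Type*} [CommMonoid M] (B : Fin N → ℂ → M)
    (hB : ∀ j, B j 1 = 1) (u : Fin k → ℂ) :
    ∏ j, B j (padOnes N u j) = ∏ i, B (Fin.castLE hk i) (u i) := by
  obtain ⟨m, rfl⟩ := Nat.exists_eq_add_of_le hk
  rw [Fin.prod_univ_add]
  simp only [padOnes, Fin.val_castAdd, Fin.is_lt, dite_true, Fin.val_natAdd,
    add_lt_iff_neg_left, not_lt_zero, dite_false, hB, Finset.prod_const_one, mul_one]
  rfl

/-- A Laurent polynomial with nonnegative coefficients is bounded on a poly-annulus by the sum of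
its values at the corners. -/
theorem Signature.norm_schurSum_le {k N : ℕ} (hk : k ≤ N) (l : Signature N) {δ : Fin k → ℝ}
    {u : Fin k → ℂ} (hu0 : ∀ i, u i ≠ 0) (hu : ∀ i, |Real.log ‖u i‖| ≤ δ i) :
    ‖l.schurSum (padOnes N u)‖ ≤ ∑ s, ‖l.schurSum (padOnes N (cornerPoint δ s))‖ := by
  have hcorner : ∀ s, ‖l.schurSum (padOnes N (cornerPoint δ s))‖ =
      ∑ a, ∏ i : Fin k, (if i ∈ s then Real.exp (δ i * l.exponent a (Fin.castLE hk i))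
        else Real.exp (-δ i * l.exponent a (Fin.castLE hk i))) := by
    intro s
    have : l.schurSum (padOnes N (cornerPoint δ s)) =
      ((∑ a, ∏ i : Fin k, (if i ∈ s then Real.exp (δ i * l.exponent a (Fin.castLE hk i))
        else Real.exp (-δ i * l.exponent a (Fin.castLE hk i))) : ℝ) : ℂ) := by
      rw [Signature.schurSum, Complex.ofReal_sum]
      refine Finset.sum_congr rfl fun a _ => ?_
      rw [prod_padOnes_apply hk (fun j y => y ^ l.exponent a j) (fun j => one_zpow _),
        Complex.ofReal_prod]
      refine Finset.prod_congr rfl fun i _ => ?_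
      simp only [cornerPoint]
      split_ifs
      · rw [Real.exp_mul_intCast]; push_cast; rfl
      · rw [Real.exp_mul_intCast]; push_cast; rfl
    rw [this, Complex.norm_real, Real.norm_of_nonneg]
    exact Finset.sum_nonneg fun a _ => Finset.prod_nonneg fun i _ => by
      split_ifs <;> positivity
  simp_rw [hcorner]
  rw [Finset.sum_comm, Signature.schurSum]
  refine (norm_sum_le _ _).trans (Finset.sum_le_sum fun a _ => ?_)
  rw [prod_padOnes_apply hk (fun j y => y ^ l.exponent a j) (fun j => one_zpow _), norm_prod]
  have h1 : ∀ i : Fin k, ‖u i ^ l.exponent a (Fin.castLE hk i)‖ ≤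
      Real.exp (δ i * l.exponent a (Fin.castLE hk i)) +
        Real.exp (-δ i * l.exponent a (Fin.castLE hk i)) := by
    intro i
    set e := l.exponent a (Fin.castLE hk i)
    have h2 : ‖u i ^ e‖ = Real.exp (Real.log ‖u i‖ * e) := by
      rw [norm_zpow, Real.exp_mul_intCast, Real.exp_log (norm_pos_iff.2 (hu0 i))]
    have h3 := abs_le.1 (hu i)
    rw [h2]
    rcases le_total (0 : ℝ) (e : ℝ) with he | he
    · have : Real.log ‖u i‖ * e ≤ δ i * e := mul_le_mul_of_nonneg_right h3.2 he
      exact (Real.exp_le_exp.2 this).trans (le_add_of_nonneg_right (Real.exp_pos _).le)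
    · have : Real.log ‖u i‖ * e ≤ -δ i * e := mul_le_mul_of_nonpos_right h3.1 he
      exact (Real.exp_le_exp.2 this).trans (le_add_of_nonneg_left (Real.exp_pos _).le)
  refine (Finset.prod_le_prod (fun i _ => norm_nonneg _) fun i _ => h1 i).trans ?_
  rw [Finset.prod_add, Finset.powerset_univ]
  refine Finset.sum_le_sum fun s _ => le_of_eq ?_
  rw [Finset.prod_ite, Finset.filter_mem_eq_inter, Finset.univ_inter, Finset.filter_notMem_eq_sdiff]

/-- The sum of the normalized Schur functions with the weights `a`. -/
noncomputable def weightedSum {N : ℕ} (a : Signature N → ℂ) (x : Fin N → ℂ) : ℂ :=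
  ∑' l, a l * l.normalizedSchur x

/-- The terms of `weightedSum a`, as functions of the first `m` variables, have a summable
majorant near the point `1`. -/
def DominatedNear {N : ℕ} (a : Signature N → ℂ) (m : ℕ) (ε : ℝ) : Prop :=
  ∃ M : Signature N → ℝ, Summable M ∧ ∀ l, ∀ u : Fin m → ℂ, (∀ i, ‖u i - 1‖ ≤ ε) →
    ‖a l * l.normalizedSchur (padOnes N u)‖ ≤ M l

theorem abs_log_norm_le {u : ℂ} {δ ε : ℝ} (hu : ‖u - 1‖ ≤ ε) (hε : ε ≤ 1 - Real.exp (-δ)) :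
    u ≠ 0 ∧ |Real.log ‖u‖| ≤ δ := by
  have h1 : Real.exp (-δ) ≤ ‖u‖ := by
    have := norm_sub_norm_le 1 u
    rw [norm_one, norm_sub_rev] at this
    linarith
  have hpos : 0 < ‖u‖ := (Real.exp_pos _).trans_le h1
  have h2 : ‖u‖ ≤ Real.exp δ := by
    have h3 := norm_sub_norm_le u 1
    rw [norm_one] at h3
    have h4 := Real.add_one_le_exp δ
    have h5 := Real.add_one_le_exp (-δ)
    linarith
  refine ⟨norm_pos_iff.1 hpos, abs_le.2 ⟨?_, ?_⟩⟩
  · exact (Real.le_log_iff_exp_le hpos).2 h1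
  · exact (Real.log_le_iff_le_exp hpos).2 h2

/-- By positivity of the coefficients of Schur functions, summability at the finitely many points with
coordinates `exp (± δ i)` implies domination in a polydisc. -/
theorem dominatedNear_of_summable_corner {m N : ℕ} (hm : m ≤ N) {a : Signature N → ℂ}
    {δ : Fin m → ℝ} {ε : ℝ} (hε : ∀ i, ε ≤ 1 - Real.exp (-δ i))
    (h : ∀ s, Summable fun l => a l * l.normalizedSchur (padOnes N (cornerPoint δ s))) :
    DominatedNear a m ε := by
  refine ⟨fun l => ∑ s, ‖a l * l.normalizedSchur (padOnes N (cornerPoint δ s))‖,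
    summable_sum fun s _ => (h s).norm, fun l u hu => ?_⟩
  have h1 := l.norm_schurSum_le hm (fun i => (abs_log_norm_le (hu i) (hε i)).1)
    fun i => (abs_log_norm_le (hu i) (hε i)).2
  simp only [Signature.normalizedSchur, norm_mul, norm_div]
  rw [← Finset.mul_sum, ← Finset.sum_div]
  gcongr

theorem padOnes_append_one {r m : ℕ} (N : ℕ) (u : Fin r → ℂ) :
    padOnes N (Fin.append u (1 : Fin m → ℂ)) = padOnes N u := by
  ext j
  by_cases hj : (j : ℕ) < r
  · have h2 : (j : ℕ) < r + m := by omega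
    have : (⟨j, h2⟩ : Fin (r + m)) = Fin.castAdd m ⟨j, hj⟩ := rfl
    simp only [padOnes, hj, h2, dite_true]
    rw [this, Fin.append_left]
  · by_cases h2 : (j : ℕ) < r + m
    · have : (⟨j, h2⟩ : Fin (r + m)) = Fin.natAdd r ⟨j - r, by omega⟩ := by
        ext; simp; omega
      simp only [padOnes, hj, h2, dite_true, dite_false]
      rw [this, Fin.append_right]
      rfl
    · simp [padOnes, hj, h2]

theorem padOnes_one (N k : ℕ) : padOnes N (1 : Fin k → ℂ) = 1 := by
  ext j; simp [padOnes]

theorem ne_zero_of_norm_sub_one_le {u : ℂ} {ε : ℝ} (hε : ε < 1) (hu : ‖u - 1‖ ≤ ε) : u ≠ 0 :=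
  ne_zero_of_norm_sub_one_lt (hu.trans_lt hε)

section

variable {N m : ℕ} {a : Signature N → ℂ} {ε : ℝ}

theorem DominatedNear.summable (h : DominatedNear a m ε) {u : Fin m → ℂ}
    (hu : ∀ i, ‖u i - 1‖ ≤ ε) : Summable fun l => a l * l.normalizedSchur (padOnes N u) := by
  obtain ⟨M, hM, hle⟩ := h
  exact Summable.of_norm_bounded hM fun l => hle l u hu

theorem DominatedNear.mono_radius (h : DominatedNear a m ε) {ε' : ℝ} (hε : ε' ≤ ε) :
    DominatedNear a m ε' := by
  obtain ⟨M, hM, hle⟩ := h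
  exact ⟨M, hM, fun l u hu => hle l u fun i => (hu i).trans hε⟩

theorem DominatedNear.of_append {r k : ℕ} (h : DominatedNear a (r + k) ε) (hε : 0 ≤ ε) :
    DominatedNear a r ε := by
  obtain ⟨M, hM, hle⟩ := h
  refine ⟨M, hM, fun l u hu => ?_⟩
  rw [← padOnes_append_one (m := k)]
  refine hle l _ fun i => ?_
  refine Fin.addCases (fun i => ?_) (fun i => ?_) i
  · rw [Fin.append_left]; exact hu i
  · rw [Fin.append_right]; simpa using hε

theorem DominatedNear.continuousOn (h : DominatedNear a m ε) (hε : ε < 1) :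
    ContinuousOn (fun u : Fin m → ℂ => weightedSum a (padOnes N u)) {u | ∀ i, ‖u i - 1‖ ≤ ε} := by
  obtain ⟨M, hM, hle⟩ := h
  refine continuousOn_tsum (fun l => ?_) hM fun l u hu => hle l u hu
  refine fun u hu => ContinuousAt.continuousWithinAt ?_
  refine continuousAt_const.mul (ContinuousAt.comp (f := fun u : Fin m → ℂ => padOnes N u)
    (l.continuousAt_normalizedSchur (padOnes_ne_zero fun i =>
      ne_zero_of_norm_sub_one_le hε (hu i))) ?_)
  exact (differentiable_padOnes N m).continuous.continuousAt

theorem DominatedNear.differentiableOn (h : DominatedNear a m ε) (hε : ε < 1) {V : Set ℂ}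
    (hV : IsOpen V) {u : ℂ → Fin m → ℂ} (hu : DifferentiableOn ℂ u V)
    (huε : ∀ z ∈ V, ∀ i, ‖u z i - 1‖ ≤ ε) :
    DifferentiableOn ℂ (fun z => weightedSum a (padOnes N (u z))) V := by
  obtain ⟨M, hM, hle⟩ := h
  refine Complex.differentiableOn_tsum_of_summable_norm hM (fun l z hz => ?_) hV
    fun l z hz => hle l _ (huε z hz)
  refine (DifferentiableAt.const_mul (DifferentiableAt.div_const
    (l.differentiableAt_schurSum_comp ?_ (padOnes_ne_zero fun i =>
      ne_zero_of_norm_sub_one_le hε (huε z hz i))) _) _).differentiableWithinAt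
  exact (differentiable_padOnes N m (u z)).comp z (hu.differentiableAt (hV.mem_nhds hz))

end

theorem weightedSum_comp_perm {N : ℕ} (a : Signature N → ℂ) (σ : Equiv.Perm (Fin N))
    {x : Fin N → ℂ} (hx : ∀ i, x i ≠ 0) : weightedSum a (x ∘ σ) = weightedSum a x := by
  simp only [weightedSum, Signature.normalizedSchur_comp_perm _ σ hx]

theorem hasSum_circleIntegral {ι : Type*} [Countable ι] {F : ι → ℂ → ℂ} {M : ι → ℝ} {c : ℂ} {R : ℝ}
    (hR : 0 ≤ R) (hF : ∀ i, ContinuousOn (F i) (sphere c R)) (hM : Summable M)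
    (hle : ∀ i, ∀ z ∈ sphere c R, ‖F i z‖ ≤ M i) :
    HasSum (fun i => ∮ z in C(c, R), F i z) (∮ z in C(c, R), ∑' i, F i z) := by
  unfold circleIntegral
  have hmem : ∀ θ, circleMap c R θ ∈ sphere c R := fun θ => circleMap_mem_sphere c hR θ
  refine intervalIntegral.hasSum_integral_of_dominated_convergence
    (fun i _ => R * M i) (fun i => ?_) (fun i => ?_) (ae_of_all _ fun θ _ => hM.mul_left R)
    intervalIntegrable_const (ae_of_all _ fun θ _ => ?_)
  · have h1 : Continuous fun θ => circleMap 0 R θ * Complex.I := by fun_prop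
    have h2 := (hF i).comp_continuous (continuous_circleMap c R) hmem
    simp only [deriv_circleMap]
    exact (h1.smul h2).aestronglyMeasurable
  · refine ae_of_all _ fun θ _ => ?_
    rw [norm_smul]
    have : ‖deriv (circleMap c R) θ‖ = R := by simp [abs_of_nonneg hR]
    rw [this]
    exact mul_le_mul_of_nonneg_left (hle i _ (hmem θ)) hR
  · exact (Summable.of_norm_bounded hM fun i => hle i _ (hmem θ)).hasSum.const_smul _

theorem momentFunctional_const_mul (N K k : ℕ) (R : ℝ) {r : ℕ} (c : Fin r → ℂ) (b : ℂ)
    (f : (Fin N → ℂ) → ℂ) :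
    momentFunctional N K k R c (fun x => b * f x) = b * momentFunctional N K k R c f := by
  unfold momentFunctional
  have : ∀ τ : ℂ, (τ ^ (k + 1))⁻¹ *
      ((∑ i, padWeight N (Complex.exp (τ / N)) c i *
        (b * f (padOnes N (Function.update c i (Complex.exp (τ / N) * c i))))) +
      (2 * Real.pi * Complex.I : ℂ)⁻¹ * ∮ z in C(1, R),
        qShiftKernel (Complex.exp (τ / N)) (padOnes N c) z *
          (b * f (padOnes N (Fin.append c (shiftedCluster K (Complex.exp (τ / N)) z))))) =
      b * ((τ ^ (k + 1))⁻¹ *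
      ((∑ i, padWeight N (Complex.exp (τ / N)) c i *
        f (padOnes N (Function.update c i (Complex.exp (τ / N) * c i)))) +
      (2 * Real.pi * Complex.I : ℂ)⁻¹ * ∮ z in C(1, R),
        qShiftKernel (Complex.exp (τ / N)) (padOnes N c) z *
          f (padOnes N (Fin.append c (shiftedCluster K (Complex.exp (τ / N)) z))))) := by
    intro τ
    simp only [mul_left_comm _ b, ← Finset.mul_sum, circleIntegral.integral_const_mul]
    ring
  simp only [this, circleIntegral.integral_const_mul]
  ring

theorem norm_exp_div_sub_one_le {τ : ℂ} (hτ : ‖τ‖ ≤ 1) {N : ℕ} (hN : 1 ≤ N) :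
    ‖Complex.exp (τ / N) - 1‖ ≤ 2 / N := by
  refine (Complex.norm_exp_sub_one_le (norm_div_natCast_le_one hτ hN)).trans ?_
  rw [norm_div, Complex.norm_natCast, ← mul_div_assoc]
  gcongr
  linarith

theorem norm_mul_sub_one_le {q y : ℂ} {a b : ℝ} (hq : ‖q - 1‖ ≤ a) (hy : ‖y - 1‖ ≤ b) :
    ‖q * y - 1‖ ≤ a * (1 + b) + b := by
  have e : q * y - 1 = (q - 1) * y + (y - 1) := by ring
  have h1 : ‖y‖ ≤ 1 + b := by
    have := norm_le_norm_add_norm_sub' y 1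
    rw [norm_one] at this
    linarith
  rw [e]
  refine (norm_add_le _ _).trans ?_
  rw [norm_mul]
  have := norm_nonneg (q - 1)
  gcongr
  linarith

theorem norm_shiftedCluster_sub_one_le {K : ℕ} {q z : ℂ} {a b : ℝ} (hq : ‖q - 1‖ ≤ a)
    (hz : ‖z - 1‖ ≤ b) (j : Fin (K + 1)) : ‖shiftedCluster K q z j - 1‖ ≤ a * (1 + b) + b := by
  by_cases hj : j = 0
  · subst hj
    simpa [shiftedCluster] using norm_mul_sub_one_le hq hz
  · simp only [shiftedCluster, Function.update_of_ne hj]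
    rw [norm_rootCluster_sub_one]
    have : 0 ≤ a := (norm_nonneg _).trans hq
    have : 0 ≤ b := (norm_nonneg _).trans hz
    nlinarith

theorem continuous_shiftedCluster (K : ℕ) :
    Continuous fun p : ℂ × ℂ => shiftedCluster K p.1 p.2 := by
  refine continuous_pi fun j => ?_
  by_cases hj : j = 0
  · subst hj; simp only [shiftedCluster, Function.update_self]; fun_prop
  · simp only [shiftedCluster, Function.update_of_ne hj, rootCluster]; fun_prop

theorem continuous_append {r m : ℕ} (c : Fin r → ℂ) :
    Continuous fun u : Fin m → ℂ => Fin.append c u :=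
  (differentiable_append c).continuous

theorem continuous_padWeight (N : ℕ) {r : ℕ} (c : Fin r → ℂ) (i : Fin r) :
    Continuous fun q => padWeight N q c i := by
  unfold padWeight
  refine Continuous.mul (continuous_finsetProd _ fun j _ => ?_) ?_
  · exact Continuous.div_const (by fun_prop) _
  · exact Continuous.pow (Continuous.div_const (by fun_prop) _) _

/-- The functional `momentFunctional` may be applied term by term to a dominated series. -/
theorem hasSum_momentFunctional_of_dominated {ι : Type*} [Countable ι] {N K k r : ℕ} {R : ℝ}
    {c : Fin r → ℂ} (hN : 1 ≤ N) (hR : 0 < R) (hR1 : R < 1) (hc : ∀ i, c i ∉ sphere (1 : ℂ) R)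
    {F : ι → (Fin N → ℂ) → ℂ} {M : ι → ℝ} (hM : Summable M)
    (hF1 : ∀ l i, ContinuousOn
      (fun τ => F l (padOnes N (Function.update c i (Complex.exp (τ / N) * c i)))) (sphere 0 1))
    (hF2 : ∀ l, ContinuousOn (fun p : ℂ × ℂ =>
      F l (padOnes N (Fin.append c (shiftedCluster K (Complex.exp (p.1 / N)) p.2))))
      (sphere 0 1 ×ˢ sphere 1 R))
    (hle1 : ∀ l i, ∀ τ ∈ sphere (0 : ℂ) 1,
      ‖F l (padOnes N (Function.update c i (Complex.exp (τ / N) * c i)))‖ ≤ M l)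
    (hle2 : ∀ l, ∀ τ ∈ sphere (0 : ℂ) 1, ∀ z ∈ sphere (1 : ℂ) R,
      ‖F l (padOnes N (Fin.append c (shiftedCluster K (Complex.exp (τ / N)) z)))‖ ≤ M l) :
    HasSum (fun l => momentFunctional N K k R c (F l))
      (momentFunctional N K k R c fun x => ∑' l, F l x) := by
  have hkerc := continuousOn_qShiftKernel_padOnes hN hR hR1 hc
  obtain ⟨C₁, hC₁⟩ := ((isCompact_sphere (0 : ℂ) 1).prod
    (isCompact_sphere (1 : ℂ) R)).exists_bound_of_continuousOn hkerc
  have hwci : ∀ i, Continuous fun τ : ℂ => padWeight N (Complex.exp (τ / N)) c i := fun i =>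
    (continuous_padWeight N c i).comp (by fun_prop)
  have hwc : Continuous fun τ : ℂ => ∑ i, ‖padWeight N (Complex.exp (τ / N)) c i‖ :=
    continuous_finsetSum _ fun i _ => (hwci i).norm
  obtain ⟨C₂, hC₂⟩ := (isCompact_sphere (0 : ℂ) 1).exists_bound_of_continuousOn
    hwc.continuousOn
  have hM0 : ∀ l, 0 ≤ M l := fun l => (norm_nonneg _).trans
    (hle2 l 1 (by simp) (1 + R) (by simp [abs_of_pos hR]))
  have hprodle : ∀ l, ∀ τ ∈ sphere (0 : ℂ) 1, ∀ z ∈ sphere (1 : ℂ) R,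
      ‖qShiftKernel (Complex.exp (τ / N)) (padOnes N c) z *
        F l (padOnes N (Fin.append c (shiftedCluster K (Complex.exp (τ / N)) z)))‖ ≤
        C₁ * M l := by
    intro l τ hτ z hz
    rw [norm_mul]
    exact mul_le_mul (hC₁ (τ, z) ⟨hτ, hz⟩) (hle2 l τ hτ z hz) (norm_nonneg _)
      ((norm_nonneg _).trans (hC₁ (τ, z) ⟨hτ, hz⟩))
  have hprodc : ∀ l, ContinuousOn (Function.uncurry fun τ z : ℂ =>
      qShiftKernel (Complex.exp (τ / N)) (padOnes N c) z *
        F l (padOnes N (Fin.append c (shiftedCluster K (Complex.exp (τ / N)) z))))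
      (sphere 0 1 ×ˢ sphere 1 R) := fun l => hkerc.mul (hF2 l)
  have hinner : ∀ τ ∈ sphere (0 : ℂ) 1, HasSum
      (fun l => ∮ z in C(1, R), qShiftKernel (Complex.exp (τ / N)) (padOnes N c) z *
        F l (padOnes N (Fin.append c (shiftedCluster K (Complex.exp (τ / N)) z))))
      (∮ z in C(1, R), qShiftKernel (Complex.exp (τ / N)) (padOnes N c) z *
        ∑' l, F l (padOnes N (Fin.append c (shiftedCluster K (Complex.exp (τ / N)) z)))) := by
    intro τ hτ
    have h := hasSum_circleIntegral hR.le (fun l => (hprodc l).uncurry_left τ hτ)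
      (hM.mul_left C₁) fun l z hz => hprodle l τ hτ z hz
    simp only [tsum_mul_left] at h
    exact h
  have hτinv : ContinuousOn (fun τ : ℂ => (τ ^ (k + 1))⁻¹) (sphere 0 1) :=
    ContinuousOn.inv₀ (by fun_prop) fun τ hτ => pow_ne_zero _ (by rintro rfl; simp at hτ)
  have hIc : ∀ l, ContinuousOn (fun τ : ℂ =>
      ∮ z in C(1, R), qShiftKernel (Complex.exp (τ / N)) (padOnes N c) z *
        F l (padOnes N (Fin.append c (shiftedCluster K (Complex.exp (τ / N)) z))))
      (sphere 0 1) := fun l => continuousOn_circleIntegral hR.le (hprodc l)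
  have hIle : ∀ l, ∀ τ ∈ sphere (0 : ℂ) 1, ‖∮ z in C(1, R),
      qShiftKernel (Complex.exp (τ / N)) (padOnes N c) z *
        F l (padOnes N (Fin.append c (shiftedCluster K (Complex.exp (τ / N)) z)))‖ ≤
        2 * Real.pi * R * (C₁ * M l) := fun l τ hτ =>
    circleIntegral.norm_integral_le_of_norm_le_const hR.le fun z hz => hprodle l τ hτ z hz
  have hterm : ∀ τ ∈ sphere (0 : ℂ) 1, HasSum (fun l => (τ ^ (k + 1))⁻¹ *
      ((∑ i, padWeight N (Complex.exp (τ / N)) c i *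
        F l (padOnes N (Function.update c i (Complex.exp (τ / N) * c i)))) +
      (2 * Real.pi * Complex.I : ℂ)⁻¹ * ∮ z in C(1, R),
        qShiftKernel (Complex.exp (τ / N)) (padOnes N c) z *
          F l (padOnes N (Fin.append c (shiftedCluster K (Complex.exp (τ / N)) z)))))
      ((τ ^ (k + 1))⁻¹ *
      ((∑ i, padWeight N (Complex.exp (τ / N)) c i *
        ∑' l, F l (padOnes N (Function.update c i (Complex.exp (τ / N) * c i)))) +
      (2 * Real.pi * Complex.I : ℂ)⁻¹ * ∮ z in C(1, R),
        qShiftKernel (Complex.exp (τ / N)) (padOnes N c) z *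
          ∑' l, F l (padOnes N (Fin.append c (shiftedCluster K (Complex.exp (τ / N)) z))))) :=
    fun τ hτ => HasSum.mul_left _ (HasSum.add (hasSum_sum fun i _ =>
      (Summable.of_norm_bounded hM fun l => hle1 l i τ hτ).hasSum.mul_left _)
      ((hinner τ hτ).mul_left _))
  unfold momentFunctional
  rw [← circleIntegral.integral_congr zero_le_one fun τ hτ => (hterm τ hτ).tsum_eq]
  refine HasSum.mul_left _ (hasSum_circleIntegral (M := fun l => C₂ * M l +
      ‖(2 * Real.pi * Complex.I : ℂ)⁻¹‖ * (2 * Real.pi * R * (C₁ * M l))) zero_le_one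
    (fun l => hτinv.mul ((continuousOn_finsetSum _ fun i _ =>
      (hwci i).continuousOn.mul (hF1 l i)).add (continuousOn_const.mul (hIc l))))
    ((hM.mul_left C₂).add (((hM.mul_left C₁).mul_left _).mul_left _)) fun l τ hτ => ?_)
  have h1 : ‖τ‖ = 1 := by simpa using hτ
  rw [norm_mul, norm_inv, norm_pow, h1, one_pow, inv_one, one_mul]
  refine (norm_add_le _ _).trans (add_le_add ?_ ?_)
  · refine (norm_sum_le _ _).trans ?_
    refine (Finset.sum_le_sum (g := fun i => ‖padWeight N (Complex.exp (τ / N)) c i‖ * M l)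
      fun i _ => ?_).trans ?_
    · rw [norm_mul]
      exact mul_le_mul_of_nonneg_left (hle1 l i τ hτ) (norm_nonneg _)
    · rw [← Finset.sum_mul]
      exact mul_le_mul_of_nonneg_right ((le_abs_self _).trans (hC₂ τ hτ)) (hM0 l)
  · rw [norm_mul]
    exact mul_le_mul_of_nonneg_left (hIle l τ hτ) (norm_nonneg _)

/-- The power sums of the shifted coordinates, averaged over signatures, as contour integrals of a
weighted sum of Schur functions. -/
theorem hasSum_momentFunctional {N K k r : ℕ} (hk : k ≤ K) (hr : r + (K + 1) ≤ N)
    {a : Signature N → ℂ} {ε : ℝ} (hε : 0 < ε) (hε2 : ε ≤ 1 / 2)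
    (hdom : DominatedNear a (r + (K + 1)) ε) (hNε : 8 ≤ ε * N) {R : ℝ} (hR : 0 < R)
    (hRε : R ≤ ε / 4) {c : Fin r → ℂ} (hcinj : Function.Injective c)
    (hcε : ∀ i, ‖c i - 1‖ ≤ ε / 4) (hcR : ∀ i, R < ‖c i - 1‖) :
    HasSum (fun l => a l * ((N : ℂ) * (l.powerMean k : ℂ) / k.factorial *
      l.normalizedSchur (padOnes N c))) (momentFunctional N K k R c (weightedSum a)) := by
  have hN : 1 ≤ N := by omega
  have hN' : (0 : ℝ) < N := by exact_mod_cast hN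
  have hR1 : R < 1 := by linarith
  have hε1 : ε < 1 := by linarith
  have hc0 : ∀ i, c i ≠ 0 := fun i => ne_zero_of_norm_sub_one_le (by linarith) (hcε i)
  have hcb : ∀ i, c i ∉ closedBall (1 : ℂ) R := fun i h =>
    absurd (mem_closedBall_iff_norm.1 h) (not_le.2 (hcR i))
  have hQε : ∀ τ ∈ sphere (0 : ℂ) 1, ‖Complex.exp (τ / N) - 1‖ ≤ ε / 4 := by
    intro τ hτ
    have hτ1 : ‖τ‖ ≤ 1 := (mem_sphere_zero_iff_norm.1 hτ).le
    refine (norm_exp_div_sub_one_le hτ1 hN).trans ?_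
    rw [div_le_iff₀ hN']; linarith
  have hQc : Continuous fun τ : ℂ => Complex.exp (τ / N) := by fun_prop
  have hp1 : ∀ τ ∈ sphere (0 : ℂ) 1, ∀ i j,
      ‖Function.update c i (Complex.exp (τ / N) * c i) j - 1‖ ≤ ε := by
    intro τ hτ i j
    by_cases hj : j = i
    · subst hj
      rw [Function.update_self]
      refine (norm_mul_sub_one_le (hQε τ hτ) (hcε j)).trans ?_
      nlinarith
    · rw [Function.update_of_ne hj]
      exact (hcε j).trans (by linarith)
  have hp2 : ∀ τ ∈ sphere (0 : ℂ) 1, ∀ z ∈ sphere (1 : ℂ) R, ∀ j,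
      ‖Fin.append c (shiftedCluster K (Complex.exp (τ / N)) z) j - 1‖ ≤ ε := by
    intro τ hτ z hz j
    refine Fin.addCases (fun i => ?_) (fun i => ?_) j
    · rw [Fin.append_left]; exact (hcε i).trans (by linarith)
    · rw [Fin.append_right]
      refine (norm_shiftedCluster_sub_one_le (hQε τ hτ)
        ((mem_sphere_iff_norm.1 hz).le.trans hRε) i).trans ?_
      nlinarith
  obtain ⟨M, hM, hle⟩ := hdom
  have hFc : ∀ (l : Signature N) {x : Fin N → ℂ}, (∀ j, x j ≠ 0) →
      ContinuousAt (fun x => a l * l.normalizedSchur x) x := fun l x hx =>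
    continuousAt_const.mul (l.continuousAt_normalizedSchur hx)
  have hmain := hasSum_momentFunctional_of_dominated (K := K) (k := k) hN hR hR1
    (fun i hi => hcb i (sphere_subset_closedBall hi))
    (F := fun l x => a l * Signature.normalizedSchur l x) hM
    (fun l i τ hτ => ContinuousAt.continuousWithinAt (ContinuousAt.comp
      (f := fun τ : ℂ => padOnes N (Function.update c i (Complex.exp (τ / N) * c i)))
      (hFc l (padOnes_ne_zero fun j => ne_zero_of_norm_sub_one_le hε1 (hp1 τ hτ i j)))
      (((differentiable_padOnes N r).continuous.comp
        (continuous_const.update i (hQc.mul continuous_const))).continuousAt)))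
    (fun l p hp => ContinuousAt.continuousWithinAt (ContinuousAt.comp
      (f := fun p : ℂ × ℂ =>
        padOnes N (Fin.append c (shiftedCluster K (Complex.exp (p.1 / N)) p.2)))
      (hFc l (padOnes_ne_zero fun j =>
        ne_zero_of_norm_sub_one_le hε1 (hp2 p.1 hp.1 p.2 hp.2 j)))
      (((differentiable_padOnes N _).continuous.comp ((continuous_append c).comp
        ((continuous_shiftedCluster K).comp
          ((hQc.comp continuous_fst).prodMk continuous_snd)))).continuousAt)))
    (fun l i τ hτ => by
      rw [← padOnes_append_one (m := K + 1)]
      refine hle l _ fun i => ?_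
      refine Fin.addCases (fun i => ?_) (fun i => ?_) i
      · rw [Fin.append_left]; exact hp1 τ hτ _ _
      · rw [Fin.append_right]; simpa using hε.le)
    (fun l τ hτ z hz => hle l _ (hp2 τ hτ z hz))
  refine hmain.congr_fun fun l => ?_
  have e4 : (fun x => a l * l.normalizedSchur x) =
      fun x => (a l / l.schurSum 1) * l.schurSum x := by
    ext x; simp only [Signature.normalizedSchur]; ring
  rw [e4, momentFunctional_const_mul, ← l.sum_pow_mul_schurSum hN hk hr hR hR1 hc0 hcinj hcb,
    Signature.normalizedSchur, Signature.powerMean]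
  push_cast
  have : (N : ℂ) ≠ 0 := Nat.cast_ne_zero.2 (by omega)
  field_simp

end WeightedSum

/-! ### The contour functional of a function of two variables -/

section ContourMean

open Metric Set

/-- A function continuous and holomorphic in each variable on the product of two discs of radius `ε`
around `1`. -/
structure SeparatelyHolomorphic (h : ℂ → ℂ → ℂ) (ε : ℝ) : Prop where
  continuousOn : ContinuousOn (Function.uncurry h) (ball 1 ε ×ˢ ball 1 ε)
  left : ∀ z ∈ ball (1 : ℂ) ε, DifferentiableOn ℂ (fun q => h q z) (ball 1 ε)
  right : ∀ q ∈ ball (1 : ℂ) ε, DifferentiableOn ℂ (h q) (ball 1 ε)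

namespace SeparatelyHolomorphic

variable {h g : ℂ → ℂ → ℂ} {ε : ℝ}

theorem mul (hh : SeparatelyHolomorphic h ε) (hg : SeparatelyHolomorphic g ε) :
    SeparatelyHolomorphic (fun q z => h q z * g q z) ε :=
  ⟨hh.continuousOn.mul hg.continuousOn, fun z hz => (hh.left z hz).mul (hg.left z hz),
    fun q hq => (hh.right q hq).mul (hg.right q hq)⟩

theorem sub (hh : SeparatelyHolomorphic h ε) (hg : SeparatelyHolomorphic g ε) :
    SeparatelyHolomorphic (fun q z => h q z - g q z) ε :=
  ⟨hh.continuousOn.sub hg.continuousOn, fun z hz => (hh.left z hz).sub (hg.left z hz),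
    fun q hq => (hh.right q hq).sub (hg.right q hq)⟩

theorem inv (hh : SeparatelyHolomorphic h ε)
    (h0 : ∀ q ∈ ball (1 : ℂ) ε, ∀ z ∈ ball (1 : ℂ) ε, h q z ≠ 0) :
    SeparatelyHolomorphic (fun q z => (h q z)⁻¹) ε :=
  ⟨hh.continuousOn.inv₀ fun p hp => h0 p.1 hp.1 p.2 hp.2,
    fun z hz => (hh.left z hz).inv fun q hq => h0 q hq z hz,
    fun q hq => (hh.right q hq).inv fun z hz => h0 q hq z hz⟩

theorem const (b : ℂ) (ε : ℝ) : SeparatelyHolomorphic (fun _ _ => b) ε :=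
  ⟨continuousOn_const, fun _ _ => differentiableOn_const _, fun _ _ => differentiableOn_const _⟩

theorem of_right {φ : ℂ → ℂ} (hφ : DifferentiableOn ℂ φ (ball 1 ε)) :
    SeparatelyHolomorphic (fun _ z => φ z) ε :=
  ⟨hφ.continuousOn.comp continuousOn_snd fun _ hp => hp.2, fun _ _ => differentiableOn_const _,
    fun _ _ => hφ⟩

theorem at_one (hh : SeparatelyHolomorphic h ε) (hε : 0 < ε) :
    SeparatelyHolomorphic (fun _ z => h 1 z) ε :=
  of_right (hh.right 1 (mem_ball_self hε))

theorem comp_exp (hh : SeparatelyHolomorphic h ε) {N : ℕ} (hN : 1 ≤ N) (hNε : 2 < ε * N) {R : ℝ}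
    (hR : R < ε) :
    ContinuousOn (Function.uncurry fun τ z : ℂ => h (Complex.exp (τ / N)) z)
      (closedBall 0 1 ×ˢ closedBall 1 R) := by
  have hN' : (0 : ℝ) < N := by exact_mod_cast hN
  refine hh.continuousOn.comp (f := fun p : ℂ × ℂ => (Complex.exp (p.1 / N), p.2))
    (by fun_prop) fun p hp => ⟨?_, ?_⟩
  · rw [mem_ball_iff_norm]
    refine (norm_exp_div_sub_one_le (mem_closedBall_zero_iff.1 hp.1) hN).trans_lt ?_
    rwa [div_lt_iff₀ hN']
  · exact (mem_closedBall.1 hp.2).trans_lt hR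

end SeparatelyHolomorphic

theorem exp_div_mem_ball {τ : ℂ} (hτ : τ ∈ closedBall (0 : ℂ) 1) {N : ℕ} (hN : 1 ≤ N) {ε : ℝ}
    (hNε : 2 < ε * N) : Complex.exp (τ / N) ∈ ball (1 : ℂ) ε := by
  have hN' : (0 : ℝ) < N := by exact_mod_cast hN
  rw [mem_ball_iff_norm]
  refine (norm_exp_div_sub_one_le (mem_closedBall_zero_iff.1 hτ) hN).trans_lt ?_
  rwa [div_lt_iff₀ hN']

/-- The coefficient of `τ ^ k` of the contour integral of `h q z`, `q = exp (τ / N)`, against the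
kernel of the `q`-difference operator at the point `padOnes N c`. -/
noncomputable def contourMean (N k : ℕ) (R : ℝ) {r : ℕ} (c : Fin r → ℂ) (h : ℂ → ℂ → ℂ) : ℂ :=
  (2 * Real.pi * Complex.I : ℂ)⁻¹ * ∮ τ in C(0, 1), (τ ^ (k + 1))⁻¹ *
    ((2 * Real.pi * Complex.I : ℂ)⁻¹ * ∮ z in C(1, R),
      qShiftKernel (Complex.exp (τ / N)) (padOnes N c) z * h (Complex.exp (τ / N)) z)

section

variable {N k r : ℕ} {R ε : ℝ} {c : Fin r → ℂ} {h g : ℂ → ℂ → ℂ}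

theorem SeparatelyHolomorphic.continuousOn_kernel_mul (hh : SeparatelyHolomorphic h ε) (hN : 1 ≤ N)
    (hNε : 2 < ε * N) (hR : 0 < R) (hR1 : R < 1) (hRε : R < ε)
    (hc : ∀ i, c i ∉ sphere (1 : ℂ) R) :
    ContinuousOn (Function.uncurry fun τ z : ℂ =>
      qShiftKernel (Complex.exp (τ / N)) (padOnes N c) z * h (Complex.exp (τ / N)) z)
      (sphere 0 1 ×ˢ sphere 1 R) :=
  (continuousOn_qShiftKernel_padOnes hN hR hR1 hc).mul
    ((hh.comp_exp hN hNε hRε).mono (prod_mono sphere_subset_closedBall sphere_subset_closedBall))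

theorem SeparatelyHolomorphic.circleIntegrable_inner (hh : SeparatelyHolomorphic h ε) (hN : 1 ≤ N)
    (hNε : 2 < ε * N) (hR : 0 < R) (hR1 : R < 1) (hRε : R < ε)
    (hc : ∀ i, c i ∉ sphere (1 : ℂ) R) :
    CircleIntegrable (fun τ : ℂ => (τ ^ (k + 1))⁻¹ *
      ((2 * Real.pi * Complex.I : ℂ)⁻¹ * ∮ z in C(1, R),
      qShiftKernel (Complex.exp (τ / N)) (padOnes N c) z * h (Complex.exp (τ / N)) z)) 0 1 := by
  refine ContinuousOn.circleIntegrable zero_le_one (ContinuousOn.mul ?_ (continuousOn_const.mul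
    (continuousOn_circleIntegral hR.le (hh.continuousOn_kernel_mul hN hNε hR hR1 hRε hc))))
  exact ContinuousOn.inv₀ (by fun_prop) fun τ hτ => pow_ne_zero _ (by rintro rfl; simp at hτ)

theorem contourMean_sub (hh : SeparatelyHolomorphic h ε) (hg : SeparatelyHolomorphic g ε)
    (hN : 1 ≤ N) (hNε : 2 < ε * N) (hR : 0 < R) (hR1 : R < 1) (hRε : R < ε)
    (hc : ∀ i, c i ∉ sphere (1 : ℂ) R) :
    contourMean N k R c (fun q z => h q z - g q z) =
      contourMean N k R c h - contourMean N k R c g := by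
  unfold contourMean
  rw [← mul_sub, ← circleIntegral.integral_sub
    (hh.circleIntegrable_inner hN hNε hR hR1 hRε hc)
    (hg.circleIntegrable_inner hN hNε hR hR1 hRε hc)]
  congr 1
  refine circleIntegral.integral_congr zero_le_one fun τ hτ => ?_
  simp only [mul_sub]
  rw [circleIntegral.integral_sub, mul_sub, mul_sub]
  · exact ((hh.continuousOn_kernel_mul hN hNε hR hR1 hRε hc).uncurry_left τ hτ).circleIntegrable
      hR.le
  · exact ((hg.continuousOn_kernel_mul hN hNε hR hR1 hRε hc).uncurry_left τ hτ).circleIntegrable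
      hR.le

theorem contourMean_const_mul (b : ℂ) :
    contourMean N k R c (fun q z => b * h q z) = b * contourMean N k R c h := by
  unfold contourMean
  have : ∀ τ : ℂ, (τ ^ (k + 1))⁻¹ * ((2 * Real.pi * Complex.I : ℂ)⁻¹ * ∮ z in C(1, R),
      qShiftKernel (Complex.exp (τ / N)) (padOnes N c) z * (b * h (Complex.exp (τ / N)) z)) =
      b * ((τ ^ (k + 1))⁻¹ * ((2 * Real.pi * Complex.I : ℂ)⁻¹ * ∮ z in C(1, R),
      qShiftKernel (Complex.exp (τ / N)) (padOnes N c) z * h (Complex.exp (τ / N)) z)) := by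
    intro τ
    simp only [mul_left_comm _ b, circleIntegral.integral_const_mul]
  simp only [this, circleIntegral.integral_const_mul]
  ring

theorem norm_contourMean_le (hR : 0 < R) {C : ℝ}
    (hC : ∀ τ ∈ sphere (0 : ℂ) 1, ∀ z ∈ sphere (1 : ℂ) R,
      ‖qShiftKernel (Complex.exp (τ / N)) (padOnes N c) z * h (Complex.exp (τ / N)) z‖ ≤ C) :
    ‖contourMean N k R c h‖ ≤ R * C := by
  have h1 : ∀ τ ∈ sphere (0 : ℂ) 1, ‖(τ ^ (k + 1))⁻¹ *
      ((2 * Real.pi * Complex.I : ℂ)⁻¹ * ∮ z in C(1, R),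
      qShiftKernel (Complex.exp (τ / N)) (padOnes N c) z * h (Complex.exp (τ / N)) z)‖ ≤
      R * C := by
    intro τ hτ
    have hτ1 : ‖τ‖ = 1 := by simpa using hτ
    rw [norm_mul, norm_inv, norm_pow, hτ1, one_pow, inv_one, one_mul]
    exact circleIntegral.norm_two_pi_i_inv_smul_integral_le_of_norm_le_const hR.le
      fun z hz => hC τ hτ z hz
  have h2 := circleIntegral.norm_two_pi_i_inv_smul_integral_le_of_norm_le_const zero_le_one h1
  rw [one_mul] at h2
  exact h2

/-- A function with a zero at `z = 1` that does not change when `z - 1` is multiplied by the root of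
unity of order `K + 1` does not contribute to `contourMean`. -/
theorem contourMean_mul_eq_zero {K : ℕ} (hN : 1 ≤ N) (hr : r ≤ N) (hk : k ≤ K) (hNε : 2 < ε * N)
    (hR : 0 < R) (hR1 : R < 1) (hRε : R < ε) (hc : ∀ i, c i ∉ closedBall (1 : ℂ) R) {φ : ℂ → ℂ}
    (hφ : DifferentiableOn ℂ φ (ball 1 ε)) (hφ1 : φ 1 = 0)
    (hrot : ∀ z ∈ ball (1 : ℂ) ε, φ (1 + (z - 1) * rootW (K + 1)) = φ z)
    (hh : SeparatelyHolomorphic h ε) :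
    contourMean N k R c (fun q z => φ z * h q z) = 0 := by
  have hε : 0 < ε := hR.trans hRε
  obtain ⟨g, hg, hφg⟩ := exists_eq_add_pow_mul_of_rotation_invariant hε hφ hrot
  have hgh := (SeparatelyHolomorphic.of_right hg).mul hh
  have hsub : closedBall (1 : ℂ) R ⊆ ball 1 ε := closedBall_subset_ball hRε
  have h0 := circleIntegral_qShiftKernel_mul_pow_eq_zero hN hr hk hR hR1 hc
    (h := fun τ z => g z * h (Complex.exp (τ / N)) z)
    ((hgh.comp_exp hN hNε hRε).mono (prod_mono sphere_subset_closedBall sphere_subset_closedBall))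
    (fun τ hτ => (hgh.right _ (exp_div_mem_ball (sphere_subset_closedBall hτ) hN hNε)).mono hsub)
    (fun z hz => (hgh.left z (hsub (sphere_subset_closedBall hz))).comp
      (f := fun τ : ℂ => Complex.exp (τ / N)) (Differentiable.differentiableOn (by fun_prop))
      fun τ hτ => exp_div_mem_ball hτ hN hNε)
  have h1 : ∀ τ ∈ sphere (0 : ℂ) 1, (τ ^ (k + 1))⁻¹ *
      ((2 * Real.pi * Complex.I : ℂ)⁻¹ * ∮ z in C(1, R),
        qShiftKernel (Complex.exp (τ / N)) (padOnes N c) z *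
          (φ z * h (Complex.exp (τ / N)) z)) =
      (2 * Real.pi * Complex.I : ℂ)⁻¹ * ((τ ^ (k + 1))⁻¹ * ∮ z in C(1, R),
        qShiftKernel (Complex.exp (τ / N)) (padOnes N c) z *
          ((z - 1) ^ (K + 1) * (g z * h (Complex.exp (τ / N)) z))) := by
    intro τ _
    rw [mul_left_comm]
    congr 2
    refine circleIntegral.integral_congr hR.le fun z hz => ?_
    rw [hφg z (hsub (sphere_subset_closedBall hz)), hφ1]
    ring
  unfold contourMean
  rw [circleIntegral.integral_congr zero_le_one h1, circleIntegral.integral_const_mul, h0,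
    mul_zero, mul_zero]

/-- In `contourMean`, a function may be multiplied by `s 1 1 / s 1 z` if `s 1` does not change when
`z - 1` is multiplied by the root of unity of order `K + 1`. -/
theorem contourMean_normalize {K : ℕ} (hN : 1 ≤ N) (hr : r ≤ N) (hk : k ≤ K) (hNε : 2 < ε * N)
    (hR : 0 < R) (hR1 : R < 1) (hRε : R < ε) (hc : ∀ i, c i ∉ closedBall (1 : ℂ) R) {s : ℂ → ℂ}
    (hs : DifferentiableOn ℂ s (ball 1 ε)) (hs0 : ∀ z ∈ ball (1 : ℂ) ε, s z ≠ 0)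
    (hrot : ∀ z ∈ ball (1 : ℂ) ε, s (1 + (z - 1) * rootW (K + 1)) = s z)
    (hh : SeparatelyHolomorphic h ε) :
    contourMean N k R c h = s 1 * contourMean N k R c (fun q z => h q z * (s z)⁻¹) := by
  have hinv : SeparatelyHolomorphic (fun q z => h q z * (s z)⁻¹) ε :=
    hh.mul (.of_right (hs.inv hs0))
  have h0 := contourMean_mul_eq_zero (k := k) hN hr hk hNε hR hR1 hRε hc (φ := fun z => s z - s 1)
    (hs.sub_const _) (sub_self _) (fun z hz => by simp only [hrot z hz]) hinv
  have hc' : ∀ i, c i ∉ sphere (1 : ℂ) R := fun i hi => hc i (sphere_subset_closedBall hi)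
  have h1 : contourMean N k R c (fun q z => (s z - s 1) * (h q z * (s z)⁻¹)) =
      contourMean N k R c (fun q z => h q z - s 1 * (h q z * (s z)⁻¹)) := by
    unfold contourMean
    congr 1
    refine circleIntegral.integral_congr zero_le_one fun τ hτ => ?_
    congr 2
    refine circleIntegral.integral_congr hR.le fun z hz => ?_
    have := hs0 z (closedBall_subset_ball hRε (sphere_subset_closedBall hz))
    simp only
    field_simp
  rw [h1, contourMean_sub hh ((SeparatelyHolomorphic.const (s 1) ε).mul hinv) hN hNε hR hR1 hRε hc',
    contourMean_const_mul, sub_eq_zero] at h0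
  exact h0

end

end ContourMean

/-! ### Bounds for roots of generating functions -/

section RootBounds

open Metric Set

theorem norm_pow_le_exp {x : ℂ} {b : ℝ} {N n : ℕ} (hN : 1 ≤ N) (hn : n ≤ N) (hb : 0 ≤ b)
    (hx : ‖x - 1‖ ≤ b / N) : ‖x‖ ^ n ≤ Real.exp b := by
  have hN' : (0 : ℝ) < N := by exact_mod_cast hN
  have h1 : ‖x‖ ≤ Real.exp (b / N) := by
    have h2 := norm_le_norm_add_norm_sub' x 1
    rw [norm_one] at h2
    have := Real.add_one_le_exp (b / N)
    linarith
  calc ‖x‖ ^ n ≤ Real.exp (b / N) ^ n := by gcongr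
    _ = Real.exp (n * (b / N)) := (Real.exp_nat_mul _ _).symm
    _ ≤ Real.exp b := Real.exp_le_exp.2 (by
        rw [mul_div_left_comm]
        exact mul_le_of_le_one_right hb (div_le_one_of_le₀ (by exact_mod_cast hn) hN'.le))

theorem norm_mul_sub_one_div_pow_le {q w : ℂ} {N n : ℕ} (hN : 1 ≤ N) (hn : n ≤ N) {R : ℝ}
    (hR : 0 < R) (hq : ‖q - 1‖ ≤ 2 / N) (hw : R ≤ ‖w - 1‖) (hw1 : ‖w - 1‖ ≤ 1 / 2) :
    ‖(q * w - 1) / (w - 1)‖ ^ n ≤ Real.exp (3 / R) := by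
  refine norm_pow_le_exp hN hn (by positivity) ?_
  have hw0 : 0 < ‖w - 1‖ := hR.trans_le hw
  have hne : w - 1 ≠ 0 := norm_pos_iff.1 hw0
  have e : (q * w - 1) / (w - 1) - 1 = (q - 1) * w / (w - 1) := by field_simp; ring
  have h1 : ‖w‖ ≤ 3 / 2 := by
    have := norm_le_norm_add_norm_sub' w 1
    rw [norm_one] at this; linarith
  rw [e, norm_div, norm_mul]
  calc ‖q - 1‖ * ‖w‖ / ‖w - 1‖ ≤ 2 / N * (3 / 2) / R := by gcongr
    _ = 3 / R / N := by ring

theorem le_norm_exp_div_sub_one {τ : ℂ} (hτ : τ ∈ sphere (0 : ℂ) 1) {N : ℕ} (hN : 2 ≤ N) :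
    1 / (2 * N : ℝ) ≤ ‖Complex.exp (τ / N) - 1‖ := by
  have hτ1 : ‖τ‖ = 1 := by simpa using hτ
  have hN' : (2 : ℝ) ≤ N := by exact_mod_cast hN
  have h1 := Complex.norm_exp_sub_one_sub_id_le (norm_div_natCast_le_one hτ1.le (by omega : 1 ≤ N))
  have h2 := norm_sub_norm_le (τ / N : ℂ) (-(Complex.exp (τ / N) - 1 - τ / N))
  have e : (τ / N : ℂ) - -(Complex.exp (τ / N) - 1 - τ / N) = Complex.exp (τ / N) - 1 := by ring
  rw [e, norm_neg] at h2
  rw [norm_div, Complex.norm_natCast, hτ1] at h1 h2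
  have h3 : (1 / N : ℝ) ^ 2 ≤ 1 / 2 * (1 / N) := by
    rw [sq]
    gcongr
  have h4 : (1 : ℝ) / (2 * N) = 1 / N - 1 / 2 * (1 / N) := by field_simp; ring
  linarith

/-- On a fixed circle around `1`, the kernel with `q = exp (τ / N)` is of order `N`: the factors that
belong to the coordinates equal to `1` are `1 + O (1 / N)`, and the factor `(q - 1)⁻¹` is of order
`N`. -/
theorem norm_qShiftKernel_padOnes_le {r N : ℕ} (hr : r ≤ N) (hN : 2 ≤ N) {R d : ℝ} (hR : 0 < R)
    (hR1 : R ≤ 1 / 2) (hd : 0 < d) {c : Fin r → ℂ} (hc : ∀ i, R + d ≤ ‖c i - 1‖)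
    (hc1 : ∀ i, ‖c i - 1‖ ≤ 1 / 2) {τ z : ℂ} (hτ : τ ∈ sphere (0 : ℂ) 1)
    (hz : z ∈ sphere (1 : ℂ) R) :
    ‖qShiftKernel (Complex.exp (τ / N)) (padOnes N c) z‖ ≤
      (4 / d) ^ r * Real.exp (3 / R) * (4 * N) := by
  have hN' : (2 : ℝ) ≤ N := by exact_mod_cast hN
  have hz' : ‖z - 1‖ = R := mem_sphere_iff_norm.1 hz
  have hτ1 : ‖τ‖ = 1 := by simpa using hτ
  have hq := norm_exp_div_sub_one_le hτ1.le (by omega : 1 ≤ N)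
  have hq1 : ‖Complex.exp (τ / N) - 1‖ ≤ 1 := hq.trans (by rw [div_le_one] <;> linarith)
  have hz2 : 1 / 2 ≤ ‖z‖ := by
    have := norm_sub_norm_le 1 z
    rw [norm_one, norm_sub_rev] at this; linarith
  have h1 : ∀ i, ‖(Complex.exp (τ / N) * z - c i) / (z - c i)‖ ≤ 4 / d := by
    intro i
    have h2 : d ≤ ‖z - c i‖ := by
      have := norm_sub_norm_le (c i - 1) (z - 1)
      rw [sub_sub_sub_cancel_right, norm_sub_rev (c i) z] at this
      linarith [hc i]
    have h3 : ‖Complex.exp (τ / N) * z - c i‖ ≤ 4 := by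
      have h4 := norm_mul_sub_one_le hq1 hz'.le
      have h5 := norm_sub_le (Complex.exp (τ / N) * z - 1) (c i - 1)
      rw [sub_sub_sub_cancel_right] at h5
      linarith [hc1 i]
    rw [norm_div]
    gcongr
  rw [qShiftKernel_padOnes hr, norm_div, norm_mul, norm_prod, norm_pow, norm_mul]
  have h6 : ∏ i, ‖(Complex.exp (τ / N) * z - c i) / (z - c i)‖ ≤ (4 / d) ^ r := by
    refine (Finset.prod_le_prod (fun i _ => norm_nonneg _) fun i _ => h1 i).trans ?_
    rw [Finset.prod_const, Finset.card_univ, Fintype.card_fin]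
  have h7 := norm_mul_sub_one_div_pow_le (n := N - r) (by omega : 1 ≤ N) (by omega) hR hq hz'.ge
    (by linarith)
  have h8 : 1 / (2 * N : ℝ) * (1 / 2) ≤ ‖Complex.exp (τ / N) - 1‖ * ‖z‖ := by
    have := le_norm_exp_div_sub_one hτ hN
    gcongr
  have h9 : 1 / (2 * N : ℝ) * (1 / 2) = (4 * N : ℝ)⁻¹ := by field_simp; norm_num
  rw [h9] at h8
  calc _ ≤ (4 / d) ^ r * Real.exp (3 / R) / ((4 * N : ℝ)⁻¹) := by gcongr
    _ = _ := by rw [div_inv_eq_mul]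

/-- Near the point `1`, the weighted sum of normalized Schur functions as a function of its first `m`
variables is the `N`-th power of a holomorphic function `g` close to `1`. -/
structure IsRootOn {N : ℕ} (a : Signature N → ℂ) (m : ℕ) (ε : ℝ) (g : (Fin m → ℂ) → ℂ) : Prop where
  dominated : DominatedNear a m ε
  differentiableAt : ∀ u, (∀ i, ‖u i - 1‖ ≤ ε) → DifferentiableAt ℂ g u
  pow_eq : ∀ u, (∀ i, ‖u i - 1‖ ≤ ε) → g u ^ N = weightedSum a (padOnes N u)
  norm_sub_le : ∀ u, (∀ i, ‖u i - 1‖ ≤ ε) → ‖g u - 1‖ ≤ 1 / 2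

theorem norm_append_sub_one_le {r m : ℕ} {ε : ℝ} {u : Fin r → ℂ} {v : Fin m → ℂ}
    (hu : ∀ i, ‖u i - 1‖ ≤ ε) (hv : ∀ i, ‖v i - 1‖ ≤ ε) (i : Fin (r + m)) :
    ‖Fin.append u v i - 1‖ ≤ ε := by
  refine Fin.addCases (fun i => ?_) (fun i => ?_) i
  · rw [Fin.append_left]; exact hu i
  · rw [Fin.append_right]; exact hv i

namespace IsRootOn

variable {N m : ℕ} {a : Signature N → ℂ} {ε : ℝ} {g : (Fin m → ℂ) → ℂ}

theorem of_append {r k : ℕ} {g : (Fin (r + k) → ℂ) → ℂ} (h : IsRootOn a (r + k) ε g) (hε : 0 ≤ ε) :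
    IsRootOn a r ε fun u => g (Fin.append u 1) := by
  have hu1 : ∀ u : Fin r → ℂ, (∀ i, ‖u i - 1‖ ≤ ε) →
      ∀ i, ‖Fin.append u (1 : Fin k → ℂ) i - 1‖ ≤ ε := fun u hu =>
    norm_append_sub_one_le hu fun i => by simpa using hε
  refine ⟨h.dominated.of_append hε, fun u hu => ?_, fun u hu => ?_,
    fun u hu => h.norm_sub_le _ (hu1 u hu)⟩
  · have hd : Differentiable ℂ fun u : Fin r → ℂ => Fin.append u (1 : Fin k → ℂ) := by
      refine differentiable_pi.2 fun j => ?_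
      refine Fin.addCases (fun i => ?_) (fun i => ?_) j
      · simp only [Fin.append_left]; fun_prop
      · simp only [Fin.append_right]; fun_prop
    exact (h.differentiableAt _ (hu1 u hu)).comp u (hd u)
  · rw [h.pow_eq _ (hu1 u hu), padOnes_append_one]

theorem half_le_norm (h : IsRootOn a m ε g) {u : Fin m → ℂ} (hu : ∀ i, ‖u i - 1‖ ≤ ε) :
    1 / 2 ≤ ‖g u‖ := by
  have h1 := norm_sub_norm_le 1 (1 - g u)
  rw [norm_one, norm_sub_rev 1 (g u), sub_sub_cancel] at h1
  linarith [h.norm_sub_le u hu]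

theorem weightedSum_ne_zero (h : IsRootOn a m ε g) {u : Fin m → ℂ} (hu : ∀ i, ‖u i - 1‖ ≤ ε) :
    weightedSum a (padOnes N u) ≠ 0 := by
  rw [← h.pow_eq u hu]
  have := h.half_le_norm hu
  exact pow_ne_zero _ (norm_pos_iff.1 (by linarith))

/-- A displacement of order `1 / N` of one variable changes the weighted sum at most by a bounded
factor. -/
theorem norm_weightedSum_update_le (h : IsRootOn a m ε g) (hN : 1 ≤ N) (hε : 0 < ε) {u : Fin m → ℂ}
    (hu : ∀ i, ‖u i - 1‖ ≤ ε / 2) {b : ℝ} (hb : 0 ≤ b) (hbN : b / N < ε / 2) (i : Fin m) {t : ℂ}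
    (ht : ‖t - u i‖ ≤ b / N) :
    ‖weightedSum a (padOnes N (Function.update u i t))‖ ≤
      Real.exp (4 * b / ε) * ‖weightedSum a (padOnes N u)‖ := by
  have hmem : ∀ s ∈ ball (u i) (ε / 2), ∀ j, ‖Function.update u i s j - 1‖ ≤ ε := by
    intro s hs j
    by_cases hj : j = i
    · subst hj
      rw [Function.update_self]
      have h1 := norm_add_le (s - u j) (u j - 1)
      rw [sub_add_sub_cancel] at h1
      have h2 := mem_ball_iff_norm.1 hs
      linarith [hu j]
    · rw [Function.update_of_ne hj]
      linarith [hu j]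
  have hui : ∀ j, ‖u j - 1‖ ≤ ε := fun j => by linarith [hu j]
  have hd : DifferentiableOn ℂ (fun s => g (Function.update u i s)) (ball (u i) (ε / 2)) := by
    intro s hs
    refine DifferentiableAt.differentiableWithinAt ?_
    exact (h.differentiableAt _ (hmem s hs)).comp s (hasFDerivAt_update u s).differentiableAt
  have htm : t ∈ ball (u i) (ε / 2) := mem_ball_iff_norm.2 (ht.trans_lt hbN)
  have hmaps : MapsTo (fun s => g (Function.update u i s)) (ball (u i) (ε / 2))
      (closedBall (g (Function.update u i (u i))) 1) := by
    intro s hs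
    rw [Function.update_eq_self, mem_closedBall_iff_norm]
    have h1 := _root_.norm_sub_le (g (Function.update u i s) - 1) (g u - 1)
    rw [sub_sub_sub_cancel_right] at h1
    linarith [h.norm_sub_le _ (hmem s hs), h.norm_sub_le u hui]
  have h1 := Complex.dist_le_div_mul_dist_of_mapsTo_ball hd hmaps htm
  rw [Function.update_eq_self, dist_eq_norm, dist_eq_norm] at h1
  have h2 := h.half_le_norm hui
  have hg0 : g u ≠ 0 := norm_pos_iff.1 (by linarith)
  have h3 : ‖g (Function.update u i t) / g u - 1‖ ≤ (4 * b / ε) / N := by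
    have e : g (Function.update u i t) / g u - 1 = (g (Function.update u i t) - g u) / g u := by
      field_simp
    rw [e, norm_div]
    calc _ ≤ 1 / (ε / 2) * (b / N) / (1 / 2) := by
          gcongr
          exact h1.trans (by gcongr)
      _ = _ := by field_simp; ring
  have h4 := norm_pow_le_exp hN le_rfl (by positivity) h3
  rw [← h.pow_eq u hui, ← h.pow_eq _ (hmem t htm), norm_pow, norm_pow]
  rw [norm_div, div_pow, div_le_iff₀ (by positivity)] at h4
  exact h4

end IsRootOn

/-- The value of `f` at the point `c` completed by the cluster of the point `z` and by ones. -/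
noncomputable def clusterValue {N : ℕ} (K : ℕ) {r : ℕ} (c : Fin r → ℂ) (f : (Fin N → ℂ) → ℂ)
    (q z : ℂ) : ℂ :=
  f (padOnes N (Fin.append c (shiftedCluster K q z)))

theorem padOnes_elim0_append {N m : ℕ} (c : Fin 0 → ℂ) (u : Fin m → ℂ) :
    padOnes N (Fin.append c u) = padOnes N u := by
  ext j
  rw [Fin.append_left_nil _ _ rfl]
  simp [padOnes]

/-- A permutation of the block `u` in `(c, u, 1, …, 1)` is a permutation of all coordinates. -/
theorem exists_perm_padOnes_append {N r m : ℕ} (hN : r + m ≤ N) (σ : Equiv.Perm (Fin m)) :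
    ∃ σ' : Equiv.Perm (Fin N), ∀ (c : Fin r → ℂ) (u : Fin m → ℂ),
      padOnes N (Fin.append c (u ∘ σ)) = padOnes N (Fin.append c u) ∘ σ' := by
  let f : Fin m ↪ Fin N := ⟨fun i => Fin.castLE hN (Fin.natAdd r i), fun i j hij => by
    simpa using hij⟩
  have hf : ∀ (c : Fin r → ℂ) (u : Fin m → ℂ) i, padOnes N (Fin.append c u) (f i) = u i := by
    intro c u i
    change padOnes N (Fin.append c u) (Fin.castLE hN (Fin.natAdd r i)) = u i
    rw [padOnes_castLE, Fin.append_right]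
  refine ⟨σ.viaFintypeEmbedding f, fun c u => funext fun j => ?_⟩
  by_cases hj : j ∈ Set.range f
  · obtain ⟨i, rfl⟩ := hj
    rw [Function.comp_apply, Equiv.Perm.viaFintypeEmbedding_apply_image, hf, hf, Function.comp]
  · rw [Function.comp_apply, Equiv.Perm.viaFintypeEmbedding_apply_notMem_range _ _ hj]
    by_cases h1 : (j : ℕ) < r
    · have : j = Fin.castLE hN (Fin.castAdd m ⟨j, h1⟩) := rfl
      rw [this, padOnes_castLE, padOnes_castLE, Fin.append_left, Fin.append_left]
    · by_cases h2 : (j : ℕ) < r + m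
      · exact absurd ⟨⟨j - r, by omega⟩, Fin.ext (show r + (j - r) = (j : ℕ) by omega)⟩ hj
      · simp [padOnes, h2]

section ClusterValue

variable {N K r : ℕ} {a : Signature N → ℂ} {ε : ℝ} {c : Fin r → ℂ}

theorem norm_shiftedCluster_sub_one_le_of_mem_ball {η : ℝ} (hε1 : η ≤ 1 / 4) {q z : ℂ}
    (hq : q ∈ ball (1 : ℂ) η) (hz : z ∈ ball (1 : ℂ) η) (j : Fin (K + 1)) :
    ‖shiftedCluster K q z j - 1‖ ≤ 3 * η := by
  have h0 : 0 < η := dist_nonneg.trans_lt (mem_ball.1 hq)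
  refine (norm_shiftedCluster_sub_one_le (mem_ball_iff_norm.1 hq).le
    (mem_ball_iff_norm.1 hz).le j).trans ?_
  nlinarith

theorem norm_append_shiftedCluster_sub_one_le (hε1 : ε ≤ 1) (hc : ∀ i, ‖c i - 1‖ ≤ ε) {q z : ℂ}
    (hq : q ∈ ball (1 : ℂ) (ε / 4)) (hz : z ∈ ball (1 : ℂ) (ε / 4)) (j : Fin (r + (K + 1))) :
    ‖Fin.append c (shiftedCluster K q z) j - 1‖ ≤ ε := by
  have h0 : 0 < ε / 4 := dist_nonneg.trans_lt (mem_ball.1 hq)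
  exact norm_append_sub_one_le hc (fun j =>
    (norm_shiftedCluster_sub_one_le_of_mem_ball (by linarith) hq hz j).trans (by linarith)) j

theorem DominatedNear.separatelyHolomorphic_clusterValue (h : DominatedNear a (r + (K + 1)) ε)
    (hε1 : ε < 1) (hc : ∀ i, ‖c i - 1‖ ≤ ε) :
    SeparatelyHolomorphic (clusterValue K c (weightedSum a)) (ε / 4) where
  continuousOn := (h.continuousOn hε1).comp
    (f := fun p : ℂ × ℂ => Fin.append c (shiftedCluster K p.1 p.2))
    (((continuous_append c).comp (continuous_shiftedCluster K)).continuousOn)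
    fun p hp j => norm_append_shiftedCluster_sub_one_le hε1.le hc hp.1 hp.2 j
  left z hz := h.differentiableOn hε1 isOpen_ball
    (u := fun q => Fin.append c (shiftedCluster K q z))
    (((differentiable_append c).comp (by
      refine differentiable_pi.2 fun j => ?_
      by_cases hj : j = 0
      · subst hj; simp only [shiftedCluster, Function.update_self]; fun_prop
      · simp only [shiftedCluster, Function.update_of_ne hj, rootCluster]; fun_prop)
      ).differentiableOn)
    fun q hq j => norm_append_shiftedCluster_sub_one_le hε1.le hc hq hz j
  right q hq := h.differentiableOn hε1 isOpen_ball
    (u := fun z => Fin.append c (shiftedCluster K q z))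
    ((differentiable_append c).comp (differentiable_shiftedCluster K q)).differentiableOn
    fun z hz j => norm_append_shiftedCluster_sub_one_le hε1.le hc hq hz j

/-- Multiplication of `z - 1` by the root of unity permutes the points of the cluster, which does not
change the value of a symmetric function. -/
theorem clusterValue_rotate (hr : r + (K + 1) ≤ N) (hc : ∀ i, c i ≠ 0) {z : ℂ} (hz : ‖z - 1‖ < 1) :
    clusterValue K c (weightedSum a) 1 (1 + (z - 1) * rootW (K + 1)) =
      clusterValue K c (weightedSum a) 1 z := by
  obtain ⟨σ', hσ'⟩ := exists_perm_padOnes_append hr (finRotate (K + 1))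
  rw [clusterValue, clusterValue, shiftedCluster_one, shiftedCluster_one, rootCluster_rotate, hσ',
    weightedSum_comp_perm]
  refine padOnes_ne_zero fun i => ?_
  refine Fin.addCases (fun i => ?_) (fun i => ?_) i
  · rw [Fin.append_left]; exact hc i
  · rw [Fin.append_right]; exact rootCluster_ne_zero hz i

theorem clusterValue_one_one (f : (Fin N → ℂ) → ℂ) : clusterValue K c f 1 1 = f (padOnes N c) := by
  rw [clusterValue, shiftedCluster_one, rootCluster_one, padOnes_append_one]

theorem IsRootOn.clusterValue_ne_zero {g : (Fin (r + (K + 1)) → ℂ) → ℂ}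
    (h : IsRootOn a (r + (K + 1)) ε g) (hε1 : ε ≤ 1) (hc : ∀ i, ‖c i - 1‖ ≤ ε) {q z : ℂ}
    (hq : q ∈ ball (1 : ℂ) (ε / 4)) (hz : z ∈ ball (1 : ℂ) (ε / 4)) :
    clusterValue K c (weightedSum a) q z ≠ 0 :=
  h.weightedSum_ne_zero fun j => norm_append_shiftedCluster_sub_one_le hε1 hc hq hz j

/-- Moving the first point of the cluster from `z` to `q z`, with `q - 1` of order `1 / N`, changes the
weighted sum at most by a factor independent of `N`. -/
theorem IsRootOn.norm_clusterValue_le {g : (Fin (r + (K + 1)) → ℂ) → ℂ}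
    (h : IsRootOn a (r + (K + 1)) ε g) (hN : 1 ≤ N) (hε : 0 < ε) (hε1 : ε ≤ 1)
    (hNε : 8 < ε * N) (hc : ∀ i, ‖c i - 1‖ ≤ ε / 2) {q z : ℂ} (hq : ‖q - 1‖ ≤ 2 / N)
    (hz : z ∈ ball (1 : ℂ) (ε / 4)) :
    ‖clusterValue K c (weightedSum a) q z‖ ≤
      Real.exp (16 / ε) * ‖clusterValue K c (weightedSum a) 1 z‖ := by
  have hN' : (0 : ℝ) < N := by exact_mod_cast hN
  have e : Fin.append c (shiftedCluster K q z) =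
      Function.update (Fin.append c (rootCluster K z)) (Fin.natAdd r 0) (q * z) := by
    ext j
    refine Fin.addCases (fun i => ?_) (fun i => ?_) j
    · rw [Fin.append_left, Function.update_of_ne, Fin.append_left]
      intro h
      have := congrArg Fin.val h
      simp at this
      omega
    · rw [Fin.append_right]
      by_cases hi : i = 0
      · subst hi; simp [shiftedCluster]
      · rw [Function.update_of_ne, Fin.append_right, shiftedCluster, Function.update_of_ne hi]
        simpa using hi
  have hz' : ‖z - 1‖ < ε / 4 := mem_ball_iff_norm.1 hz
  have hz2 : ‖z‖ ≤ 2 := by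
    have := norm_le_norm_add_norm_sub' z 1
    rw [norm_one] at this; linarith
  have h1 := h.norm_weightedSum_update_le hN hε (u := Fin.append c (rootCluster K z)) (b := 4)
    (norm_append_sub_one_le hc fun i => by rw [norm_rootCluster_sub_one]; linarith) (by norm_num)
    (by rw [div_lt_iff₀ hN']; linarith) (Fin.natAdd r 0) (t := q * z) (by
      rw [Fin.append_right, rootCluster_zero]
      have e : q * z - z = (q - 1) * z := by ring
      rw [e, norm_mul]
      calc ‖q - 1‖ * ‖z‖ ≤ 2 / N * 2 := by gcongr
        _ = 4 / N := by ring)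
  rw [clusterValue, clusterValue, shiftedCluster_one, e]
  refine h1.trans (le_of_eq ?_)
  norm_num

end ClusterValue

end RootBounds

/-! ### Concentration of the moments -/

section Concentration

open Metric Set

/-- The moment functional is the sum of the terms of the coordinates of `c` and of the contour integral
around `1`. -/
theorem momentFunctional_eq_add {N K k r : ℕ} {R ε : ℝ} {c : Fin r → ℂ} {f : (Fin N → ℂ) → ℂ}
    (hf : SeparatelyHolomorphic (clusterValue K c f) ε)
    (hfc : ∀ i, ContinuousOn
      (fun τ => f (padOnes N (Function.update c i (Complex.exp (τ / N) * c i)))) (sphere 0 1))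
    (hN : 1 ≤ N) (hNε : 2 < ε * N) (hR : 0 < R) (hR1 : R < 1) (hRε : R < ε)
    (hc : ∀ i, c i ∉ sphere (1 : ℂ) R) :
    momentFunctional N K k R c f =
      (2 * Real.pi * Complex.I : ℂ)⁻¹ * (∮ τ in C(0, 1), (τ ^ (k + 1))⁻¹ *
        ∑ i, padWeight N (Complex.exp (τ / N)) c i *
          f (padOnes N (Function.update c i (Complex.exp (τ / N) * c i)))) +
      contourMean N k R c (clusterValue K c f) := by
  unfold momentFunctional contourMean
  rw [← mul_add, ← circleIntegral.integral_add]
  · congr 1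
    refine circleIntegral.integral_congr zero_le_one fun τ _ => ?_
    rw [← mul_add]
    rfl
  · refine ContinuousOn.circleIntegrable zero_le_one (ContinuousOn.mul ?_
      (continuousOn_finsetSum _ fun i _ => ContinuousOn.mul ?_ (hfc i)))
    · exact ContinuousOn.inv₀ (by fun_prop) fun τ hτ => pow_ne_zero _ (by rintro rfl; simp at hτ)
    · exact ((continuous_padWeight N c i).comp
        (g := fun q => padWeight N q c i) (f := fun τ : ℂ => Complex.exp (τ / N))
        (by fun_prop)).continuousOn
  · exact hf.circleIntegrable_inner hN hNε hR hR1 hRε hc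

theorem norm_padWeight_le {r N : ℕ} (hN : 2 ≤ N) {R d : ℝ} (hR : 0 < R) (hd : 0 < d)
    (hd1 : d ≤ 1) {c : Fin r → ℂ} (hc : ∀ i, R ≤ ‖c i - 1‖) (hc1 : ∀ i, ‖c i - 1‖ ≤ 1 / 2)
    (hcd : ∀ i j, i ≠ j → d ≤ ‖c i - c j‖) {q : ℂ} (hq : ‖q - 1‖ ≤ 2 / N) (i : Fin r) :
    ‖padWeight N q c i‖ ≤ (4 / d) ^ r * Real.exp (3 / R) := by
  have hN' : (2 : ℝ) ≤ N := by exact_mod_cast hN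
  have hq1 : ‖q - 1‖ ≤ 1 := hq.trans (by rw [div_le_one] <;> linarith)
  have h1 : ∀ j ∈ Finset.univ.erase i, ‖(q * c i - c j) / (c i - c j)‖ ≤ 4 / d := by
    intro j hj
    have h3 : ‖q * c i - c j‖ ≤ 4 := by
      have h4 := norm_mul_sub_one_le hq1 (hc1 i)
      have h5 := norm_sub_le (q * c i - 1) (c j - 1)
      rw [sub_sub_sub_cancel_right] at h5
      linarith [hc1 j]
    have := hcd i j (Finset.ne_of_mem_erase hj).symm
    rw [norm_div]
    gcongr
  have h4 : 1 ≤ 4 / d := by rw [one_le_div hd]; linarith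
  rw [padWeight, norm_mul, norm_prod, norm_pow]
  refine mul_le_mul ?_ (norm_mul_sub_one_div_pow_le (by omega) (by omega) hR hq (hc i) (hc1 i))
    (by positivity) (by positivity)
  refine (Finset.prod_le_prod (fun j _ => norm_nonneg _) h1).trans ?_
  rw [Finset.prod_const]
  refine pow_le_pow_right₀ h4 ?_
  exact (Finset.card_le_univ _).trans (by simp)

/-- The weighted sum with the weights multiplied by a moment is bounded by a constant, independent of
`N`, times the weighted sum itself, at points `c` with separated coordinates away from `1`. Both parts
of the moment functional are compared with the value at `c`: the terms of the coordinates of `c`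
directly, and the contour integral after normalization. -/
theorem norm_moment_le {ε R d : ℝ} {r N K k : ℕ} (hk : k ≤ K) (hr : r + (K + 1) ≤ N) (hN : 2 ≤ N)
    (hε : 0 < ε) (hε2 : ε ≤ 1 / 2) (hNε : 16 ≤ ε * N) (hR : 0 < R) (hRε : R < ε / 4) (hd : 0 < d)
    (hd1 : d ≤ 1) {a : Signature N → ℂ} {g : (Fin (r + (K + 1)) → ℂ) → ℂ}
    (h : IsRootOn a (r + (K + 1)) ε g) {c : Fin r → ℂ} (hcε : ∀ i, ‖c i - 1‖ ≤ ε / 4)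
    (hcR : ∀ i, R + d ≤ ‖c i - 1‖) (hcd : ∀ i j, i ≠ j → d ≤ ‖c i - c j‖) :
    ‖weightedSum (fun l => a l * (l.powerMean k : ℂ)) (padOnes N c)‖ ≤
      k.factorial * ((r + 4) * ((4 / d) ^ r * Real.exp (3 / R) * Real.exp (16 / ε))) *
        ‖weightedSum a (padOnes N c)‖ := by
  have hN1 : 1 ≤ N := by omega
  have hN' : (2 : ℝ) ≤ N := by exact_mod_cast hN
  have hR1 : R < 1 := by linarith
  have hcε2 : ∀ i, ‖c i - 1‖ ≤ ε / 2 := fun i => (hcε i).trans (by linarith)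
  have hcε1 : ∀ i, ‖c i - 1‖ ≤ ε := fun i => (hcε i).trans (by linarith)
  have hc1 : ∀ i, ‖c i - 1‖ ≤ 1 / 2 := fun i => (hcε i).trans (by linarith)
  have hcinj : Function.Injective c := by
    intro i j hij
    by_contra hne
    have := hcd i j hne
    rw [hij, sub_self, norm_zero] at this
    linarith
  have hcb : ∀ i, c i ∉ closedBall (1 : ℂ) R := fun i hi => by
    have := mem_closedBall_iff_norm.1 hi
    linarith [hcR i]
  have hcs : ∀ i, c i ∉ sphere (1 : ℂ) R := fun i hi => hcb i (sphere_subset_closedBall hi)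
  have hc0 : ∀ i, c i ≠ 0 := fun i => ne_zero_of_norm_sub_one_le (by linarith) (hcε1 i)
  have hsum := hasSum_momentFunctional hk hr hε hε2 h.dominated (by linarith) hR hRε.le hcinj hcε
    fun i => by linarith [hcR i]
  have hS := h.dominated.separatelyHolomorphic_clusterValue (K := K) (by linarith) hcε1
  have hq : ∀ τ ∈ sphere (0 : ℂ) 1, ‖Complex.exp (τ / N) - 1‖ ≤ 2 / N := fun τ hτ =>
    norm_exp_div_sub_one_le (mem_sphere_zero_iff_norm.1 hτ).le hN1
  have hr' := h.of_append hε.le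
  set S := weightedSum a with hSdef
  set E := (4 / d) ^ r * Real.exp (3 / R) * Real.exp (16 / ε) with hE
  have hE0 : 0 < E := by positivity
  -- the residues at the coordinates of `c`
  have hup : ∀ τ ∈ sphere (0 : ℂ) 1, ∀ i j,
      ‖Function.update c i (Complex.exp (τ / N) * c i) j - 1‖ ≤ ε := by
    intro τ hτ i j
    by_cases hj : j = i
    · subst hj
      rw [Function.update_self]
      refine (norm_mul_sub_one_le (hq τ hτ) (hcε j)).trans ?_
      have : (2 : ℝ) / N ≤ ε / 8 := by rw [div_le_div_iff₀ (by linarith) (by norm_num)]; linarith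
      nlinarith
    · rw [Function.update_of_ne hj]
      exact hcε1 j
  have hfc : ∀ i, ContinuousOn
      (fun τ : ℂ => S (padOnes N (Function.update c i (Complex.exp (τ / N) * c i))))
      (sphere 0 1) := fun i =>
    (hr'.dominated.continuousOn (by linarith)).comp
      (f := fun τ : ℂ => Function.update c i (Complex.exp (τ / N) * c i))
      (continuous_const.update i (by fun_prop)).continuousOn fun τ hτ => hup τ hτ i
  have hA : ‖(2 * Real.pi * Complex.I : ℂ)⁻¹ * ∮ τ in C(0, 1), (τ ^ (k + 1))⁻¹ *
        ∑ i, padWeight N (Complex.exp (τ / N)) c i *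
          S (padOnes N (Function.update c i (Complex.exp (τ / N) * c i)))‖ ≤
      r * (E * ‖S (padOnes N c)‖) := by
    have h2 := circleIntegral.norm_two_pi_i_inv_smul_integral_le_of_norm_le_const zero_le_one
      (c := 0) (f := fun τ => (τ ^ (k + 1))⁻¹ * ∑ i, padWeight N (Complex.exp (τ / N)) c i *
          S (padOnes N (Function.update c i (Complex.exp (τ / N) * c i))))
      (C := r * (E * ‖S (padOnes N c)‖)) fun τ hτ => by
        have hτ1 : ‖τ‖ = 1 := by simpa using hτ
        rw [norm_mul, norm_inv, norm_pow, hτ1, one_pow, inv_one, one_mul]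
        refine (norm_sum_le_of_le (n := fun _ => E * ‖S (padOnes N c)‖) _ fun i _ => ?_).trans
          (le_of_eq (by simp))
        rw [norm_mul]
        have h3 := norm_padWeight_le hN hR hd hd1 (fun i => by linarith [hcR i]) hc1 hcd
          (hq τ hτ) i
        have h4 := hr'.norm_weightedSum_update_le hN1 hε hcε2 (b := 4) (by norm_num)
          (by rw [div_lt_iff₀ (by linarith)]; linarith) i (t := Complex.exp (τ / N) * c i) (by
            have e : Complex.exp (τ / N) * c i - c i = (Complex.exp (τ / N) - 1) * c i := by ring
            have h5 : ‖c i‖ ≤ 2 := by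
              have := norm_le_norm_add_norm_sub' (c i) 1
              rw [norm_one] at this; linarith [hc1 i]
            rw [e, norm_mul]
            calc _ ≤ 2 / N * (2 : ℝ) := mul_le_mul (hq τ hτ) h5 (norm_nonneg _) (by positivity)
              _ = 4 / N := by ring)
        rw [show (4 : ℝ) * 4 / ε = 16 / ε by norm_num] at h4
        calc _ ≤ ((4 / d) ^ r * Real.exp (3 / R)) *
              (Real.exp (16 / ε) * ‖S (padOnes N c)‖) := by gcongr
          _ = _ := by rw [hE]; ring
    rw [one_mul] at h2
    exact h2
  -- the contour integral
  have hball : closedBall (1 : ℂ) R ⊆ ball 1 (ε / 4) := closedBall_subset_ball hRε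
  have h1mem : (1 : ℂ) ∈ ball (1 : ℂ) (ε / 4) := mem_ball_self (by linarith)
  have hB : ‖contourMean N k R c (clusterValue K c S)‖ ≤ 4 * N * (E * ‖S (padOnes N c)‖) := by
    rw [contourMean_normalize hN1 (by omega) hk (by linarith : 2 < ε / 4 * N) hR hR1 hRε hcb
      (hS.right 1 h1mem) (fun z hz => h.clusterValue_ne_zero (by linarith) hcε1 h1mem hz)
      (fun z hz => clusterValue_rotate hr hc0 ((mem_ball_iff_norm.1 hz).trans (by linarith))) hS,
      clusterValue_one_one, norm_mul]
    have h2 := norm_contourMean_le (k := k) (c := c) hR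
      (h := fun q z => clusterValue K c S q z * (clusterValue K c S 1 z)⁻¹)
      (C := 4 * N * E) fun τ hτ z hz => by
        have hz' := hball (sphere_subset_closedBall hz)
        have h3 := norm_qShiftKernel_padOnes_le (by omega : r ≤ N) hN hR (by linarith) hd hcR hc1
          hτ hz
        have h4 := h.norm_clusterValue_le hN1 hε (by linarith) (by linarith) hcε2 (hq τ hτ) hz'
        have h5 : 0 < ‖clusterValue K c S 1 z‖ :=
          norm_pos_iff.2 (h.clusterValue_ne_zero (by linarith) hcε1 h1mem hz')
        rw [norm_mul, norm_mul, norm_inv]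
        calc _ ≤ ((4 / d) ^ r * Real.exp (3 / R) * (4 * N)) * Real.exp (16 / ε) := by
              refine mul_le_mul h3 ?_ (by positivity) (by positivity)
              rw [← div_eq_mul_inv, div_le_iff₀ h5]
              exact h4
          _ = _ := by rw [hE]; ring
    calc _ ≤ ‖S (padOnes N c)‖ * (1 * (4 * N * E)) := by
          gcongr
          exact h2.trans (by gcongr)
      _ = _ := by ring
  have hsplit := momentFunctional_eq_add (k := k) hS hfc hN1 (by linarith : 2 < ε / 4 * N) hR hR1
    hRε hcs
  have hval : momentFunctional N K k R c S =
      (N : ℂ) / k.factorial * weightedSum (fun l => a l * (l.powerMean k : ℂ)) (padOnes N c) := by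
    rw [← hsum.tsum_eq, weightedSum, ← tsum_mul_left]
    exact tsum_congr fun l => by ring
  have hk0 : (0 : ℝ) < k.factorial := by exact_mod_cast k.factorial_pos
  have h6 : (N : ℝ) / k.factorial *
      ‖weightedSum (fun l => a l * (l.powerMean k : ℂ)) (padOnes N c)‖ ≤
      r * (E * ‖S (padOnes N c)‖) + 4 * N * (E * ‖S (padOnes N c)‖) := by
    have h7 := norm_add_le_of_le hA hB
    rw [← hsplit, hval, norm_mul, norm_div, Complex.norm_natCast, Complex.norm_natCast] at h7
    exact h7
  have h8 : (r : ℝ) * (E * ‖S (padOnes N c)‖) ≤ r * N * (E * ‖S (padOnes N c)‖) := by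
    gcongr
    exact le_mul_of_one_le_right (by positivity) (by linarith)
  have h9 : ‖weightedSum (fun l => a l * (l.powerMean k : ℂ)) (padOnes N c)‖ =
      k.factorial / N * ((N : ℝ) / k.factorial *
      ‖weightedSum (fun l => a l * (l.powerMean k : ℂ)) (padOnes N c)‖) := by
    field_simp
  rw [h9]
  calc _ ≤ k.factorial / N * (r * N * (E * ‖S (padOnes N c)‖) +
        4 * N * (E * ‖S (padOnes N c)‖)) := by gcongr; linarith
    _ = _ := by field_simp

end Concentration

section Variance

open Metric Set

theorem contourMean_congr {N k r : ℕ} {R ε : ℝ} {c : Fin r → ℂ} {h g : ℂ → ℂ → ℂ} (hN : 1 ≤ N)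
    (hNε : 2 < ε * N) (hR : 0 ≤ R) (hRε : R < ε)
    (hhg : ∀ q ∈ ball (1 : ℂ) ε, ∀ z ∈ ball (1 : ℂ) ε, h q z = g q z) :
    contourMean N k R c h = contourMean N k R c g := by
  unfold contourMean
  congr 1
  refine circleIntegral.integral_congr zero_le_one fun τ hτ => ?_
  congr 2
  refine circleIntegral.integral_congr hR fun z hz => ?_
  rw [hhg _ (exp_div_mem_ball (sphere_subset_closedBall hτ) hN hNε) z
    (closedBall_subset_ball hRε (sphere_subset_closedBall hz))]

theorem cornerPoint_bounds {δ : ℝ} (hδ : 0 < δ) (hδ1 : δ ≤ 1) {k : ℕ} {δ' : Fin k → ℝ} {i : Fin k}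
    (hi : δ' i = δ) (s : Finset (Fin k)) :
    ‖cornerPoint δ' s i - 1‖ ≤ 2 * δ ∧ 1 - Real.exp (-δ) ≤ ‖cornerPoint δ' s i - 1‖ ∧
      |Real.log ‖cornerPoint δ' s i‖| = δ := by
  have h1 := Real.add_one_le_exp δ
  have h2 := Real.add_one_le_exp (-δ)
  have h3 : Real.exp δ - 1 ≤ 2 * δ := by
    have := Real.abs_exp_sub_one_le (x := δ) (by rwa [abs_of_pos hδ])
    rw [abs_of_pos hδ] at this
    exact (le_abs_self _).trans this
  have h4 : Real.exp (-δ) < 1 := Real.exp_lt_one_iff.2 (by linarith)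
  unfold cornerPoint
  rw [hi]
  have e : ∀ x : ℝ, ‖(x : ℂ) - 1‖ = |x - 1| := fun x => by
    rw [← Complex.ofReal_one, ← Complex.ofReal_sub, Complex.norm_real, Real.norm_eq_abs]
  split_ifs
  · rw [e, Complex.norm_real, Real.norm_of_nonneg (Real.exp_pos _).le, Real.log_exp,
      abs_of_pos hδ, abs_of_pos (by linarith)]
    exact ⟨h3, by linarith, rfl⟩
  · rw [e, Complex.norm_real, Real.norm_of_nonneg (Real.exp_pos _).le, Real.log_exp, abs_neg,
      abs_of_pos hδ, abs_of_neg (by linarith)]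
    exact ⟨by linarith, by linarith, rfl⟩

/-- Domination is inherited by the weights multiplied by a moment. The formula for the moments is
used at corner points with pairwise distinct coordinates. -/
theorem DominatedNear.moment {N K k r : ℕ} (hk : k ≤ K) (hr : r + (K + 1) ≤ N)
    {a : Signature N → ℂ} {ε : ℝ} (hε : 0 < ε) (hε2 : ε ≤ 1 / 2)
    (hdom : DominatedNear a (r + (K + 1)) ε) (hNε : 8 ≤ ε * N) :
    DominatedNear (fun l => a l * (l.powerMean k : ℂ)) r (1 - Real.exp (-(ε / (16 * r)))) := by
  rcases Nat.eq_zero_or_pos r with rfl | hr0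
  · have h1 := hasSum_momentFunctional hk hr hε hε2 hdom hNε (R := ε / 4) (by linarith) le_rfl
      (c := Fin.elim0) (fun i => i.elim0) (fun i => i.elim0) fun i => i.elim0
    refine dominatedNear_of_summable_corner (Nat.zero_le N) (δ := Fin.elim0) (fun i => i.elim0)
      fun s => ?_
    have hN : (N : ℂ) ≠ 0 := Nat.cast_ne_zero.2 (by omega)
    have hk0 : (k.factorial : ℂ) ≠ 0 := Nat.cast_ne_zero.2 k.factorial_ne_zero
    refine (h1.summable.mul_left ((k.factorial : ℂ) / N)).congr fun l => ?_
    rw [Subsingleton.elim (cornerPoint _ s) Fin.elim0]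
    field_simp
  have hr' : (1 : ℝ) ≤ r := by exact_mod_cast hr0
  set η := ε / (16 * r) with hη
  have hη0 : 0 < η := by positivity
  have hηr : η * r = ε / 16 := by rw [hη]; field_simp
  -- different distances for different coordinates, so that all corner points are injective
  set δ : Fin r → ℝ := fun i => η * ((i : ℕ) + 1) with hδ
  have hδη : ∀ i, η ≤ δ i := fun i => le_mul_of_one_le_right hη0.le (by simp)
  have hδε : ∀ i, δ i ≤ ε / 16 := fun i => by
    rw [← hηr]
    refine mul_le_mul_of_nonneg_left ?_ hη0.le
    exact_mod_cast i.isLt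
  have hexp : ∀ i, Real.exp (-δ i) ≤ Real.exp (-η) := fun i =>
    Real.exp_le_exp.2 (neg_le_neg (hδη i))
  have hb := fun s i => cornerPoint_bounds (hη0.trans_le (hδη i)) (by linarith [hδε i]) (i := i)
    (δ' := δ) rfl s
  have h4 : Real.exp (-η) < 1 := Real.exp_lt_one_iff.2 (by linarith)
  have h5 := Real.add_one_le_exp (-η)
  have h6 : η ≤ ε / 16 := by rw [← hηr]; exact le_mul_of_one_le_right hη0.le hr'
  refine dominatedNear_of_summable_corner (by omega) (δ := δ) (fun i => by linarith [hexp i])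
    fun s => ?_
  have hN : (N : ℂ) ≠ 0 := Nat.cast_ne_zero.2 (by omega)
  have hk0 : (k.factorial : ℂ) ≠ 0 := Nat.cast_ne_zero.2 k.factorial_ne_zero
  have h1 := hasSum_momentFunctional hk hr hε hε2 hdom hNε (R := (1 - Real.exp (-η)) / 2)
    (by linarith) (by linarith) (c := cornerPoint δ s) (fun i j hij => by
      have h7 := (hb s i).2.2
      rw [hij, (hb s j).2.2] at h7
      simp only [hδ] at h7
      have h8 := mul_left_cancel₀ hη0.ne' h7
      have h9 : ((j : ℕ) : ℝ) = (i : ℕ) := by linarith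
      exact Fin.ext (by exact_mod_cast h9.symm))
    (fun i => by linarith [(hb s i).1, hδε i]) fun i => by linarith [(hb s i).2.1, hexp i]
  refine (h1.summable.mul_left ((k.factorial : ℂ) / N)).congr fun l => ?_
  field_simp

/-- The powers of the root of unity are separated by a positive distance. -/
theorem exists_separation_rootW (K : ℕ) : ∃ δ : ℝ, 0 < δ ∧ δ ≤ 1 ∧ ∀ i j : Fin (K + 1), i ≠ j →
    δ ≤ ‖rootW (K + 1) ^ (i : ℕ) - rootW (K + 1) ^ (j : ℕ)‖ := by
  have h1 : ∀ᶠ δ : ℝ in 𝓝[>] 0, 0 < δ := self_mem_nhdsWithin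
  have h2 : ∀ᶠ δ : ℝ in 𝓝[>] 0, δ ≤ 1 :=
    (eventually_le_nhds zero_lt_one).filter_mono nhdsWithin_le_nhds
  have h3 : ∀ᶠ δ : ℝ in 𝓝[>] 0, ∀ i j : Fin (K + 1), i ≠ j →
      δ ≤ ‖rootW (K + 1) ^ (i : ℕ) - rootW (K + 1) ^ (j : ℕ)‖ := by
    refine eventually_all.2 fun i => eventually_all.2 fun j => eventually_all.2 fun hij => ?_
    refine (eventually_le_nhds (norm_pos_iff.2 (sub_ne_zero.2 fun h => hij ?_))).filter_mono
      nhdsWithin_le_nhds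
    exact Fin.ext ((isPrimitiveRoot_rootW K).pow_inj i.isLt j.isLt h)
  obtain ⟨δ, h⟩ := (h1.and (h2.and h3)).exists
  exact ⟨δ, h⟩

/-- For `z` on the circle of radius `ζ` around `1` and `q` close to `1`, the points of the shifted
cluster are separated from each other and stay away from `1`. -/
theorem shiftedCluster_separation {K : ℕ} {δ ζ : ℝ} (hδ : 0 < δ) (hδ1 : δ ≤ 1)
    (hsep : ∀ i j : Fin (K + 1), i ≠ j →
      δ ≤ ‖rootW (K + 1) ^ (i : ℕ) - rootW (K + 1) ^ (j : ℕ)‖) (hζ : 0 < ζ) (hζ1 : ζ ≤ 1 / 2)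
    {q z : ℂ} (hz : ‖z - 1‖ = ζ) (hq : ‖q - 1‖ ≤ ζ * δ / 4) :
    (∀ i j, i ≠ j → ζ * δ / 4 ≤ ‖shiftedCluster K q z i - shiftedCluster K q z j‖) ∧
      (∀ i, ζ / 4 + ζ * δ / 4 ≤ ‖shiftedCluster K q z i - 1‖) ∧
      ∀ i, ‖shiftedCluster K q z i - 1‖ ≤ 2 * ζ := by
  have h1 : ∀ i, ‖shiftedCluster K q z i - rootCluster K z i‖ ≤ 3 / 2 * (ζ * δ / 4) := by
    intro i
    by_cases hi : i = 0
    · subst hi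
      have e : q * z - z = (q - 1) * z := by ring
      have h2 : ‖z‖ ≤ 3 / 2 := by
        have := norm_le_norm_add_norm_sub' z 1
        rw [norm_one] at this; linarith
      rw [shiftedCluster, Function.update_self, rootCluster_zero, e, norm_mul, mul_comm]
      gcongr
    · rw [shiftedCluster, Function.update_of_ne hi, sub_self, norm_zero]
      positivity
  have hζδ : ζ * δ ≤ ζ := mul_le_of_le_one_right hζ.le hδ1
  refine ⟨fun i j hij => ?_, fun i => ?_, fun i => ?_⟩
  · by_cases hi : i = 0 ∨ j = 0
    · -- only the first point is displaced
      have h3 : ζ * δ ≤ ‖rootCluster K z i - rootCluster K z j‖ := by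
        have e : rootCluster K z i - rootCluster K z j =
          (z - 1) * (rootW (K + 1) ^ (i : ℕ) - rootW (K + 1) ^ (j : ℕ)) := by
          simp only [rootCluster]; ring
        rw [e, norm_mul, hz]
        gcongr
        exact hsep i j hij
      have key : ‖rootCluster K z i - rootCluster K z j‖ ≤
          ‖shiftedCluster K q z i - shiftedCluster K q z j‖ + 3 / 2 * (ζ * δ / 4) := by
        rcases hi with rfl | rfl
        · have e : shiftedCluster K q z j = rootCluster K z j := by
            rw [shiftedCluster, Function.update_of_ne hij.symm]
          rw [e]
          have h4 := norm_sub_le (shiftedCluster K q z 0 - rootCluster K z j)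
            (shiftedCluster K q z 0 - rootCluster K z 0)
          rw [sub_sub_sub_cancel_left] at h4
          linarith [h1 0]
        · have e : shiftedCluster K q z i = rootCluster K z i := by
            rw [shiftedCluster, Function.update_of_ne hij]
          rw [e]
          have h4 := norm_add_le (rootCluster K z i - shiftedCluster K q z 0)
            (shiftedCluster K q z 0 - rootCluster K z 0)
          rw [sub_add_sub_cancel] at h4
          linarith [h1 0]
      have : 0 < ζ * δ := by positivity
      linarith
    · push Not at hi
      rw [shiftedCluster, Function.update_of_ne hi.1, Function.update_of_ne hi.2]
      have e : rootCluster K z i - rootCluster K z j =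
          (z - 1) * (rootW (K + 1) ^ (i : ℕ) - rootW (K + 1) ^ (j : ℕ)) := by
        simp only [rootCluster]; ring
      rw [e, norm_mul, hz]
      have := mul_le_mul_of_nonneg_left (hsep i j hij) hζ.le
      have : 0 < ζ * δ := by positivity
      linarith
  · have h4 := norm_sub_le (shiftedCluster K q z i - 1)
      (shiftedCluster K q z i - rootCluster K z i)
    rw [sub_sub_sub_cancel_left, norm_rootCluster_sub_one, hz] at h4
    linarith [h1 i]
  · have h4 := norm_add_le (shiftedCluster K q z i - rootCluster K z i) (rootCluster K z i - 1)
    rw [sub_add_sub_cancel, norm_rootCluster_sub_one, hz] at h4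
    linarith [h1 i]

theorem IsRootOn.mono_radius {N m : ℕ} {a : Signature N → ℂ} {ε ε' : ℝ} {g : (Fin m → ℂ) → ℂ}
    (h : IsRootOn a m ε g) (hε : ε' ≤ ε) : IsRootOn a m ε' g :=
  ⟨h.dominated.mono_radius hε, fun u hu => h.differentiableAt u fun i => (hu i).trans hε,
    fun u hu => h.pow_eq u fun i => (hu i).trans hε,
    fun u hu => h.norm_sub_le u fun i => (hu i).trans hε⟩

theorem IsRootOn.exists_cast {N m m' : ℕ} {a : Signature N → ℂ} {ε : ℝ} {g : (Fin m → ℂ) → ℂ}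
    (h : IsRootOn a m ε g) (hm : m = m') : ∃ g', IsRootOn a m' ε g' := by
  subst hm; exact ⟨g, h⟩

/-- The averages of the moments as contour integrals. -/
theorem moment_eq_contourMean {N K k : ℕ} (hk : k ≤ K) (hr : 0 + (K + 1) ≤ N)
    {a : Signature N → ℂ} {ε : ℝ} (hε : 0 < ε) (hε2 : ε ≤ 1 / 2)
    (hdom : DominatedNear a (0 + (K + 1)) ε) (hNε : 8 < ε * N) {R : ℝ} (hR : 0 < R)
    (hRε : R < ε / 4) (c : Fin 0 → ℂ) :
    (N : ℂ) / k.factorial * weightedSum (fun l => a l * (l.powerMean k : ℂ)) 1 =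
      contourMean N k R c (clusterValue K c (weightedSum a)) := by
  have hN : 1 ≤ N := by omega
  have hsum := hasSum_momentFunctional hk hr hε hε2 hdom hNε.le hR hRε.le (c := c)
    (fun i => i.elim0) (fun i => i.elim0) fun i => i.elim0
  have hsplit := momentFunctional_eq_add (k := k)
    (hdom.separatelyHolomorphic_clusterValue (K := K) (c := c) (by linarith) fun i => i.elim0)
    (fun i => i.elim0) hN (by linarith : 2 < ε / 4 * N) hR (by linarith) hRε fun i => i.elim0
  have e : padOnes N c = 1 := by ext j; simp [padOnes]
  have e2 : (2 * Real.pi * Complex.I : ℂ)⁻¹ * (∮ τ in C(0, 1), (τ ^ (k + 1))⁻¹ *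
        ∑ i, padWeight N (Complex.exp (τ / N)) c i *
          weightedSum a (padOnes N (Function.update c i (Complex.exp (τ / N) * c i)))) = 0 := by
    simp [circleIntegral]
  rw [e2, zero_add] at hsplit
  rw [← hsplit, ← hsum.tsum_eq, e, weightedSum, ← tsum_mul_left]
  exact tsum_congr fun l => by ring

/-- If the `N`-th root of the generating function is close to `1`, the variance of the moments is
of order `1 / N`. -/
theorem exists_variance_le {K k : ℕ} (hk : k ≤ K) {ε : ℝ} (hε : 0 < ε) (hε2 : ε ≤ 1 / 2) :
    ∃ C : ℝ, ∀ᶠ N : ℕ in atTop, ∀ (a : Signature N → ℂ) (g : (Fin (K + 1 + (K + 1)) → ℂ) → ℂ),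
      IsRootOn a (K + 1 + (K + 1)) ε g → weightedSum a 1 = 1 →
      ‖weightedSum (fun l => a l * (l.powerMean k : ℂ) * (l.powerMean k : ℂ)) 1 -
        weightedSum (fun l => a l * (l.powerMean k : ℂ)) 1 ^ 2‖ ≤ C / N := by
  obtain ⟨δ, hδ, hδ1, hsep⟩ := exists_separation_rootW K
  have hlarge : ∀ {η : ℝ}, 0 < η → ∀ B : ℝ, ∀ᶠ N : ℕ in atTop, B < η * N := fun hη B =>
    (tendsto_natCast_atTop_atTop.const_mul_atTop hη).eventually_gt_atTop B
  -- the weights multiplied by a moment are dominated in the polydisc of radius `ε₁`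
  set ε₁ := 1 - Real.exp (-(ε / (16 * (K + 1 : ℕ)))) with hε₁
  have hK : (1 : ℝ) ≤ (K + 1 : ℕ) := by exact_mod_cast Nat.le_add_left 1 K
  have hx0 : 0 < ε / (16 * (K + 1 : ℕ)) := by positivity
  have hx1 : ε / (16 * (K + 1 : ℕ)) ≤ ε / 16 := by
    refine div_le_div_of_nonneg_left hε.le (by norm_num) (by linarith)
  have hε₁0 : 0 < ε₁ := by rw [hε₁, sub_pos]; exact Real.exp_lt_one_iff.2 (by linarith)
  have hε₁ε : ε₁ ≤ ε / 16 := by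
    have := Real.add_one_le_exp (-(ε / (16 * (K + 1 : ℕ))))
    linarith
  -- the radius of the contour, and the separation of the points of the clusters on it
  set ζ := ε₁ / 8 with hζ
  have hζ0 : 0 < ζ := by positivity
  set d := ζ * δ / 4 with hd
  have hd0 : 0 < d := by positivity
  have hdζ : d ≤ ζ / 4 := by
    rw [hd]; gcongr; exact mul_le_of_le_one_right hζ0.le hδ1
  -- the bound of `norm_moment_le` for `K + 1` points
  set C₁ : ℝ := k.factorial * (((K + 1 : ℕ) + 4) *
    ((4 / d) ^ (K + 1) * Real.exp (3 / (ζ / 4)) * Real.exp (16 / ε))) with hC₁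
  have hC₁0 : 0 < C₁ := by positivity
  refine ⟨k.factorial * (ζ * ((4 / 1) ^ 0 * Real.exp (3 / ζ) * 4 *
    ((2 * C₁) / d * 2 * Real.exp (16 / ε₁)))), ?_⟩
  filter_upwards [eventually_ge_atTop (K + 1 + (K + 1)), hlarge hε 16, hlarge hε₁0 8,
    hlarge hd0 2] with N hNK hN1 hN2 hN3 a g h ha
  have hN : 2 ≤ N := by omega
  have hN' : (0 : ℝ) < N := by exact_mod_cast (by omega : 0 < N)
  set b : Signature N → ℂ := fun l => a l * (l.powerMean k : ℂ) with hb
  have hbdom : DominatedNear b (0 + (K + 1)) ε₁ := by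
    rw [zero_add]
    exact h.dominated.moment hk hNK hε hε2 (by linarith)
  obtain ⟨g₁, h₁⟩ := ((h.of_append hε.le).mono_radius (by linarith : ε₁ ≤ ε)).exists_cast
    (zero_add (K + 1)).symm
  set c : Fin 0 → ℂ := Fin.elim0 with hc
  have hcN : padOnes N c = 1 := by ext j; simp [padOnes]
  have hV := h₁.dominated.separatelyHolomorphic_clusterValue (K := K) (c := c) (by linarith)
    fun i => i.elim0
  have hV0 : ∀ q ∈ ball (1 : ℂ) (ε₁ / 4), ∀ z ∈ ball (1 : ℂ) (ε₁ / 4),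
      clusterValue K c (weightedSum a) q z ≠ 0 := fun q hq z hz =>
    h₁.clusterValue_ne_zero (by linarith) (fun i => i.elim0) hq hz
  have hV1 := hbdom.separatelyHolomorphic_clusterValue (K := K) (c := c) (by linarith)
    fun i => i.elim0
  have h1mem : (1 : ℂ) ∈ ball (1 : ℂ) (ε₁ / 4) := mem_ball_self (by linarith)
  have hrotV : ∀ (f : Signature N → ℂ), ∀ z ∈ ball (1 : ℂ) (ε₁ / 4),
      clusterValue K c (weightedSum f) 1 (1 + (z - 1) * rootW (K + 1)) =
        clusterValue K c (weightedSum f) 1 z := fun f z hz =>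
    clusterValue_rotate (by omega) (fun i => i.elim0)
      ((mem_ball_iff_norm.1 hz).trans (by linarith))
  have hV11 : clusterValue K c (weightedSum a) 1 1 = 1 := by rw [clusterValue_one_one, hcN, ha]
  have hN2' : 2 < ε₁ / 4 * N := by linarith
  have hm1 := moment_eq_contourMean hk (by omega) hε₁0 (by linarith) h₁.dominated hN2 hζ0
    (by linarith) c
  have hm2 := moment_eq_contourMean hk (by omega) hε₁0 (by linarith) hbdom hN2 hζ0
    (by linarith) c
  set V := clusterValue K c (weightedSum a) with hVdef
  set V1 := clusterValue K c (weightedSum b) with hV1def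
  set E := weightedSum b 1 with hE
  have hV111 : V1 1 1 = E := by rw [hV1def, clusterValue_one_one, hcN]
  have hζlt : ζ < ε₁ / 4 := by linarith
  -- division by `V 1 z` does not change the contour integrals, because `V 1 1 = 1`
  rw [contourMean_normalize (by omega) (Nat.zero_le N) hk hN2' hζ0 (by linarith) hζlt
    (fun i => i.elim0) (hV.right 1 h1mem) (hV0 1 h1mem) (hrotV a) hV, hV11, one_mul] at hm1
  rw [contourMean_normalize (by omega) (Nat.zero_le N) hk hN2' hζ0 (by linarith) hζlt
    (fun i => i.elim0) (hV.right 1 h1mem) (hV0 1 h1mem) (hrotV a) hV1, hV11, one_mul] at hm2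
  have hVinv := (hV.at_one (by linarith)).inv fun q _ z hz => hV0 1 h1mem z hz
  have hT := hV.mul hVinv
  have hθ := hV1.mul (hV.inv hV0)
  set T : ℂ → ℂ → ℂ := fun q z => V q z * (V 1 z)⁻¹ with hTdef
  -- the quotient of the two generating functions; at `q = z = 1` it is the averaged moment `E`
  set θ : ℂ → ℂ → ℂ := fun q z => V1 q z * (V q z)⁻¹ with hθdef
  have hθ11 : θ 1 1 = E := by simp only [hθdef, hV111, hV11, inv_one, mul_one]
  -- the part of the difference which does not depend on `q` does not contribute
  have hkill := contourMean_mul_eq_zero (k := k) (c := c) (by omega) (Nat.zero_le N) hk hN2' hζ0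
    (by linarith) hζlt (fun i => i.elim0) (φ := fun z => θ 1 z - E)
    ((hθ.right 1 h1mem).sub_const _) (by simp only [hθ11, sub_self])
    (fun z hz => by simp only [hθdef, hVdef, hV1def, hrotV a z hz, hrotV b z hz]) hT
  have hφT := (SeparatelyHolomorphic.of_right ((hθ.right 1 h1mem).sub_const E)).mul hT
  -- the variance is a contour integral of the increment of `θ` between `1` and `q`
  have hdiff : (N : ℂ) / k.factorial *
      (weightedSum (fun l => b l * (l.powerMean k : ℂ)) 1 - E ^ 2) =
      contourMean N k ζ c (fun q z => (θ q z - θ 1 z) * T q z) := by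
    have e1 : (N : ℂ) / k.factorial *
      (weightedSum (fun l => b l * (l.powerMean k : ℂ)) 1 - E ^ 2) =
      contourMean N k ζ c (fun q z => V1 q z * (V 1 z)⁻¹) - E * contourMean N k ζ c T := by
      rw [← hm2, ← hm1]; ring
    rw [e1, ← contourMean_const_mul, ← contourMean_sub (hV1.mul hVinv)
      ((SeparatelyHolomorphic.const E _).mul hT) (by omega) hN2' hζ0 (by linarith) hζlt
      (fun i => i.elim0), ← sub_zero (contourMean N k ζ c _), ← hkill,
      ← contourMean_sub ((hV1.mul hVinv).sub ((SeparatelyHolomorphic.const E _).mul hT)) hφT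
      (by omega) hN2' hζ0 (by linarith) hζlt (fun i => i.elim0)]
    refine contourMean_congr (by omega) hN2' hζ0.le hζlt fun q hq z hz => ?_
    simp only [hTdef, hθdef]
    have h1 := hV0 q hq z hz
    have h2 := hV0 1 h1mem z hz
    field_simp
    ring
  have hbound := norm_contourMean_le (N := N) (k := k) (c := c) hζ0
    (h := fun q z => (θ q z - θ 1 z) * T q z) (C := (4 / 1) ^ 0 * Real.exp (3 / ζ) * (4 * N) *
      ((2 * C₁) / d * (2 / N) * Real.exp (16 / ε₁))) fun τ hτ z hz => by
    have hz' : z ∈ ball (1 : ℂ) (ε₁ / 4) :=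
      closedBall_subset_ball hζlt (sphere_subset_closedBall hz)
    have hzζ : ‖z - 1‖ = ζ := mem_sphere_iff_norm.1 hz
    have hq : ‖Complex.exp (τ / N) - 1‖ ≤ 2 / N :=
      norm_exp_div_sub_one_le (mem_sphere_zero_iff_norm.1 hτ).le (by omega)
    have hqd : Complex.exp (τ / N) ∈ ball (1 : ℂ) d := by
      rw [mem_ball_iff_norm]
      refine hq.trans_lt ?_
      rw [div_lt_iff₀ hN']; exact hN3
    have hdsub : ball (1 : ℂ) d ⊆ ball 1 (ε₁ / 4) := ball_subset_ball (by linarith)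
    have hk1 := norm_qShiftKernel_padOnes_le (Nat.zero_le N) hN hζ0 (by linarith) one_pos
      (c := c) (fun i => i.elim0) (fun i => i.elim0) hτ hz
    have hT1 : ‖T (Complex.exp (τ / N)) z‖ ≤ Real.exp (16 / ε₁) := by
      have h4 := h₁.norm_clusterValue_le (by omega) hε₁0 (by linarith) hN2 (c := c)
        (fun i => i.elim0) hq hz'
      simp only [hTdef]
      rw [norm_mul, norm_inv, ← div_eq_mul_inv, div_le_iff₀ (norm_pos_iff.2 (hV0 1 h1mem z hz'))]
      exact h4
    -- the points of the cluster play the role of `c` in `norm_moment_le`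
    have hθ1 : ∀ q ∈ ball (1 : ℂ) d, ‖θ q z‖ ≤ C₁ := by
      intro q hqd
      obtain ⟨s1, s2, s3⟩ := shiftedCluster_separation hδ hδ1 hsep hζ0 (by linarith) hzζ
        (mem_ball_iff_norm.1 hqd).le
      have h5 := norm_moment_le hk hNK hN hε hε2 hN1.le (by linarith : 0 < ζ / 4) (by linarith)
        hd0 (by linarith) h (fun i => (s3 i).trans (by linarith)) s2 s1
      simp only [hθdef, hVdef, hV1def, clusterValue, padOnes_elim0_append]
      have h6 := hV0 q (hdsub hqd) z hz'
      simp only [hVdef, clusterValue, padOnes_elim0_append] at h6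
      rw [norm_mul, norm_inv, ← div_eq_mul_inv, div_le_iff₀ (norm_pos_iff.2 h6)]
      exact h5
    -- the Schwarz lemma: since `q - 1` is of order `1 / N`, so is the increment of `θ`
    have hS := Complex.dist_le_div_mul_dist_of_mapsTo_ball (R₂ := 2 * C₁)
      ((hθ.left z hz').mono hdsub) (fun q hqd => by
        rw [mem_closedBall_iff_norm]
        have h7 := norm_sub_le (θ q z) (θ 1 z)
        linarith [hθ1 q hqd, hθ1 1 (mem_ball_self hd0)]) hqd
    rw [dist_eq_norm, dist_eq_norm] at hS
    rw [norm_mul, norm_mul]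
    refine mul_le_mul hk1 (mul_le_mul (hS.trans ?_) hT1 (norm_nonneg _) (by positivity))
      (by positivity) (by positivity)
    gcongr
  rw [← hdiff, norm_mul, norm_div, Complex.norm_natCast, Complex.norm_natCast] at hbound
  have hk0 : (0 : ℝ) < k.factorial := by exact_mod_cast k.factorial_pos
  have h8 := mul_le_mul_of_nonneg_left hbound (by positivity : (0 : ℝ) ≤ k.factorial / N)
  have h9 : (k.factorial : ℝ) / N * (N / k.factorial) = 1 := by field_simp
  rw [← mul_assoc, h9, one_mul] at h8
  refine h8.trans (le_of_eq ?_)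
  field_simp

end Variance

/-! ### The limit of the averaged moments -/

section MeanLimit

open Metric Set

/-- The probabilities of the signatures as complex weights. -/
noncomputable def sgfWeight {N : ℕ} (ρ : PMF (Signature N)) (l : Signature N) : ℂ :=
  ((ρ l).toReal : ℂ)

theorem sgfTerm_eq {N : ℕ} (ρ : PMF (Signature N)) {x : Fin N → ℂ} (hx : ∀ i, x i ≠ 0) :
    sgfTerm ρ x = fun l => sgfWeight ρ l * l.normalizedSchur x := by
  ext l
  rw [sgfTerm, l.schur_eq_schurSum hx, l.schur_eq_schurSum (x := 1) fun i => one_ne_zero]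
  rfl

theorem RootLimit.apply_one {ρ : ∀ N : ℕ, PMF (Signature N)} {m : ℕ} {f : (Fin m → ℂ) → ℂ}
    (h : RootLimit ρ f) : f 1 = 1 := by
  obtain ⟨U, -, h1U, G, hG, hlim⟩ := h
  refine tendsto_nhds_unique (hlim.tendsto_at h1U) ?_
  exact tendsto_const_nhds.congr' (hG.mono fun N hN => hN.2.1.symm)

/-- The convergence of the `N`-th roots, restated on a closed polydisc on which moreover the series is
dominated and the limit `f` is analytic without zeros. -/
theorem RootLimit.exists_isRootOn {ρ : ∀ N : ℕ, PMF (Signature N)} {m : ℕ} {f : (Fin m → ℂ) → ℂ}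
    (h : RootLimit ρ f) (hf : AnalyticAt ℂ f 1) :
    ∃ ε : ℝ, 0 < ε ∧ ε ≤ 1 / 2 ∧ ∃ G : ℕ → (Fin m → ℂ) → ℂ,
      (∀ᶠ N in atTop, IsRootOn (sgfWeight (ρ N)) m ε (G N) ∧
        weightedSum (sgfWeight (ρ N)) 1 = 1) ∧
      TendstoUniformlyOn G f atTop {u | ∀ i, ‖u i - 1‖ ≤ ε} ∧
      ∀ u : Fin m → ℂ, (∀ i, ‖u i - 1‖ ≤ ε) → AnalyticAt ℂ f u ∧ f u ≠ 0 := by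
  have hf1 := h.apply_one
  obtain ⟨U, hU, h1U, G, hG, hlim⟩ := h
  have hnear : ∀ᶠ u in 𝓝 (1 : Fin m → ℂ), u ∈ U ∧ AnalyticAt ℂ f u ∧ ‖f u - 1‖ < 1 / 4 := by
    refine (hU.eventually_mem h1U).and (hf.eventually_analyticAt.and ?_)
    have h2 : ContinuousAt (fun u => ‖f u - 1‖) 1 := (hf.continuousAt.sub continuousAt_const).norm
    refine h2.eventually (gt_mem_nhds ?_)
    simp only [hf1]; norm_num
  obtain ⟨ε₀, hε₀, hsub⟩ := nhds_basis_closedBall.mem_iff.1 hnear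
  have hmem : ∀ {u : Fin m → ℂ}, (∀ i, ‖u i - 1‖ ≤ ε₀) →
      u ∈ U ∧ AnalyticAt ℂ f u ∧ ‖f u - 1‖ < 1 / 4 := fun {u} hu =>
    hsub (mem_closedBall_iff_norm.2 ((pi_norm_le_iff_of_nonneg hε₀.le).2 hu))
  set δ := min (ε₀ / 2) (1 / 2) with hδ
  have hδ0 : 0 < δ := by positivity
  have hδ1 : δ ≤ 1 / 2 := min_le_right _ _
  have hδε : 2 * δ ≤ ε₀ := by linarith [min_le_left (ε₀ / 2) (1 / 2 : ℝ)]
  have hexp := Real.add_one_le_exp (-δ)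
  have hε0 : 0 < 1 - Real.exp (-δ) := sub_pos.2 (Real.exp_lt_one_iff.2 (by linarith))
  -- the points with coordinates `exp (± δ)` belong to the polydisc of radius `ε₀`, and summability
  -- there gives domination on the polydisc of radius `1 - exp (-δ)`
  refine ⟨1 - Real.exp (-δ), hε0, by linarith, G, ?_, hlim.mono fun u hu =>
    (hmem fun i => (hu i).trans (by linarith)).1, fun u hu => ?_⟩
  · filter_upwards [hG, eventually_ge_atTop m,
      Metric.tendstoUniformlyOn_iff.1 hlim (1 / 4) (by norm_num)] with N hN hmN hclose
    have hterm : ∀ {u : Fin m → ℂ}, (∀ i, u i ≠ 0) → ∑' l, sgfTerm (ρ N) (padOnes N u) l =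
        weightedSum (sgfWeight (ρ N)) (padOnes N u) := fun {u} hu => by
      rw [sgfTerm_eq _ (padOnes_ne_zero hu)]; rfl
    have hsmall : ∀ {u : Fin m → ℂ}, (∀ i, ‖u i - 1‖ ≤ 1 - Real.exp (-δ)) →
        u ∈ U ∧ AnalyticAt ℂ f u ∧ ‖f u - 1‖ < 1 / 4 := fun {u} hu =>
      hmem fun i => (hu i).trans (by linarith)
    have h0 : ∀ {u : Fin m → ℂ}, (∀ i, ‖u i - 1‖ ≤ 1 - Real.exp (-δ)) → ∀ i, u i ≠ 0 :=
      fun {u} hu i => ne_zero_of_norm_sub_one_le (by linarith) (hu i)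
    refine ⟨⟨?_, fun u hu => (hN.1 u (hsmall hu).1).differentiableAt, fun u hu => ?_,
      fun u hu => ?_⟩, ?_⟩
    · refine dominatedNear_of_summable_corner hmN (δ := fun _ => δ) (fun _ => le_rfl) fun s => ?_
      have hb := fun i => (cornerPoint_bounds hδ0 (by linarith) (δ' := fun _ : Fin m => δ) (i := i)
        rfl s)
      have hc0 : ∀ i, cornerPoint (fun _ : Fin m => δ) s i ≠ 0 := fun i => by
        unfold cornerPoint
        split_ifs <;> exact Complex.ofReal_ne_zero.2 (Real.exp_pos _).ne'
      have h3 := (hN.2.2 _ (hmem fun i => (hb i).1.trans hδε).1).1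
      rwa [sgfTerm_eq _ (padOnes_ne_zero hc0)] at h3
    · rw [(hN.2.2 u (hsmall hu).1).2, sgf, hterm (h0 hu)]
    · have h4 := hclose u (hsmall hu).1
      rw [dist_eq_norm, norm_sub_rev] at h4
      have h5 := norm_add_le (G N u - f u) (f u - 1)
      rw [sub_add_sub_cancel] at h5
      linarith [(hsmall hu).2.2]
    · have h6 := (hN.2.2 1 h1U).2
      rw [sgf, hterm (u := 1) fun i => one_ne_zero, hN.2.1, one_pow, padOnes_one] at h6
      exact h6.symm
  · have h7 := hmem fun i => (hu i).trans (by linarith : 1 - Real.exp (-δ) ≤ ε₀)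
    refine ⟨h7.2.1, fun h0 => ?_⟩
    have := h7.2.2
    rw [h0] at this
    norm_num at this

theorem partialFirst_eq_fderiv {k : ℕ} {f : (Fin (k + 1) → ℂ) → ℂ} {u : Fin (k + 1) → ℂ}
    (hf : DifferentiableAt ℂ f u) :
    partialFirst f u = fderiv ℂ f u (Pi.single 0 1) := by
  have h1 : HasFDerivAt f (fderiv ℂ f u) (Function.update u 0 (u 0)) := by
    rw [Function.update_eq_self]; exact hf.hasFDerivAt
  have h2 := h1.comp_hasDerivAt (u 0) (hasDerivAt_update u 0 (u 0))
  exact h2.deriv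

theorem analyticAt_partialFirst {k : ℕ} {f : (Fin (k + 1) → ℂ) → ℂ} {u : Fin (k + 1) → ℂ}
    (hf : AnalyticAt ℂ f u) : AnalyticAt ℂ (partialFirst f) u := by
  have h1 : AnalyticAt ℂ (fun v => fderiv ℂ f v (Pi.single 0 1)) u :=
    AnalyticAt.comp (g := fun L : (Fin (k + 1) → ℂ) →L[ℂ] ℂ => L (Pi.single 0 1))
      ((ContinuousLinearMap.apply ℂ ℂ (Pi.single (0 : Fin (k + 1)) (1 : ℂ) :
        Fin (k + 1) → ℂ)).analyticAt _) hf.fderiv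
  refine h1.congr ?_
  filter_upwards [hf.eventually_analyticAt] with v hv
  exact (partialFirst_eq_fderiv hv.differentiableAt).symm

theorem tendsto_natCast_mul_sub {φ : ℂ → ℂ} {φ' : ℂ} (h : HasDerivAt φ φ' 0) :
    Tendsto (fun N : ℕ => (N : ℂ) * (φ (1 / N) - φ 0)) atTop (𝓝 φ') := by
  have h1 := h.tendsto_slope_zero
  have h2 : Tendsto (fun N : ℕ => (N : ℂ)⁻¹) atTop (𝓝[≠] 0) := by
    refine tendsto_nhdsWithin_iff.2 ⟨tendsto_inv_atTop_nhds_zero_nat, ?_⟩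
    filter_upwards [eventually_ge_atTop 1] with N hN
    exact inv_ne_zero (Nat.cast_ne_zero.2 (by omega))
  refine (h1.comp h2).congr fun N => ?_
  simp

theorem tendsto_natCast_mul_exp_div_sub_one (τ : ℂ) :
    Tendsto (fun N : ℕ => (N : ℂ) * (Complex.exp (τ / N) - 1)) atTop (𝓝 τ) := by
  have h : HasDerivAt (fun t : ℂ => Complex.exp (τ * t)) τ 0 := by
    have := ((hasDerivAt_id (0 : ℂ)).const_mul τ).cexp
    simpa using this
  refine (tendsto_natCast_mul_sub h).congr fun N => ?_
  rw [mul_zero, Complex.exp_zero, mul_one_div]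

/-- The `N`-th power of the ratio of the values of `h N` at the points `exp (τ / N)` and `1` tends to
an exponential. -/
theorem tendsto_div_pow_of_tendstoUniformlyOn {h : ℕ → ℂ → ℂ} {f : ℂ → ℂ} {f' : ℂ} {η : ℝ}
    (hη : 0 < η) (hd : ∀ᶠ N in atTop, DifferentiableOn ℂ (h N) (ball 1 η))
    (hfd : DifferentiableOn ℂ f (ball 1 η)) (hf' : HasDerivAt f f' 1) (hf0 : f 1 ≠ 0)
    (hlim : TendstoUniformlyOn h f atTop (ball 1 η)) {τ : ℂ} (hτ : ‖τ‖ ≤ 1) :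
    Tendsto (fun N : ℕ => (h N (Complex.exp (τ / N)) / h N 1) ^ N) atTop
      (𝓝 (Complex.exp (τ * f' / f 1))) := by
  have h1mem : (1 : ℂ) ∈ ball (1 : ℂ) η := mem_ball_self hη
  have h1 : Tendsto (fun N => h N 1) atTop (𝓝 (f 1)) := hlim.tendsto_at h1mem
  have h2 : Tendsto (fun N : ℕ => (N : ℂ) * (f (Complex.exp (τ / N)) - f 1)) atTop
      (𝓝 (τ * f')) := by
    have hexp : HasDerivAt (fun t : ℂ => Complex.exp (τ * t)) τ 0 := by
      have := ((hasDerivAt_id (0 : ℂ)).const_mul τ).cexp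
      simpa using this
    have hcomp : HasDerivAt (fun t : ℂ => f (Complex.exp (τ * t))) (f' * τ) 0 :=
      HasDerivAt.comp (h₂ := f) (h := fun t : ℂ => Complex.exp (τ * t)) 0 (by simpa using hf') hexp
    rw [mul_comm τ]
    refine (tendsto_natCast_mul_sub hcomp).congr fun N => ?_
    rw [mul_zero, Complex.exp_zero, mul_one_div]
  -- the difference `h N - f` is uniformly small, hence has a small Lipschitz constant
  have h3 : Tendsto (fun N : ℕ => (N : ℂ) * ((h N (Complex.exp (τ / N)) - h N 1) -
      (f (Complex.exp (τ / N)) - f 1))) atTop (𝓝 0) := by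
    rw [tendsto_zero_iff_norm_tendsto_zero]
    refine Metric.tendsto_atTop.2 fun ε hε => ?_
    have hlarge : ∀ᶠ N : ℕ in atTop, 2 < η * N :=
      (tendsto_natCast_atTop_atTop.const_mul_atTop hη).eventually_gt_atTop 2
    have key : ∀ᶠ N : ℕ in atTop, ‖(N : ℂ) * ((h N (Complex.exp (τ / N)) - h N 1) -
      (f (Complex.exp (τ / N)) - f 1))‖ < ε := by
      filter_upwards [hd, Metric.tendstoUniformlyOn_iff.1 hlim (ε * η / 8) (by positivity),
        eventually_ge_atTop 1, hlarge] with N hN hclose hN1 hNη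
      have hN' : (0 : ℝ) < N := by exact_mod_cast hN1
      have hq : ‖Complex.exp (τ / N) - 1‖ ≤ 2 / N := norm_exp_div_sub_one_le hτ hN1
      have hqm : Complex.exp (τ / N) ∈ ball (1 : ℂ) η :=
        mem_ball_iff_norm.2 (hq.trans_lt (by rwa [div_lt_iff₀ hN']))
      have hS := Complex.dist_le_div_mul_dist_of_mapsTo_ball (R₂ := ε * η / 4) (hN.sub hfd)
        (fun q hq => by
          rw [mem_closedBall_iff_norm]
          have e1 := hclose q hq
          have e2 := hclose 1 h1mem
          rw [dist_eq_norm, norm_sub_rev] at e1 e2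
          have e3 := norm_sub_le (h N q - f q) (h N 1 - f 1)
          simp only [Pi.sub_apply]
          linarith) hqm
      rw [dist_eq_norm, dist_eq_norm] at hS
      simp only [Pi.sub_apply] at hS
      rw [norm_mul, Complex.norm_natCast, sub_sub_sub_comm]
      calc _ ≤ (N : ℝ) * (ε * η / 4 / η * (2 / N)) := by
            gcongr
            exact hS.trans (by gcongr)
        _ = ε / 2 := by field_simp; ring
        _ < ε := by linarith
    obtain ⟨N₀, hN₀⟩ := eventually_atTop.1 key
    exact ⟨N₀, fun N hN => by simpa using hN₀ N hN⟩
  have h4 : Tendsto (fun N : ℕ => (N : ℂ) * (h N (Complex.exp (τ / N)) / h N 1 - 1)) atTop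
      (𝓝 (τ * f' / f 1)) := by
    have h5 := ((h2.add h3).div h1 hf0)
    rw [add_zero] at h5
    refine h5.congr' ?_
    filter_upwards [h1.eventually_ne hf0] with N hN
    simp only [Pi.div_apply]
    field_simp
    ring
  refine (Complex.tendsto_one_add_pow_exp_of_tendsto h4).congr fun N => ?_
  rw [add_sub_cancel]

theorem tendsto_circleIntegral_of_dominated {F : ℕ → ℂ → ℂ} {f : ℂ → ℂ} {c : ℂ} {R C : ℝ}
    (hR : 0 ≤ R) (hF : ∀ᶠ N in atTop, ContinuousOn (F N) (sphere c R))
    (hC : ∀ᶠ N in atTop, ∀ z ∈ sphere c R, ‖F N z‖ ≤ C)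
    (hlim : ∀ z ∈ sphere c R, Tendsto (fun N => F N z) atTop (𝓝 (f z))) :
    Tendsto (fun N => ∮ z in C(c, R), F N z) atTop (𝓝 (∮ z in C(c, R), f z)) := by
  unfold circleIntegral
  have hmem : ∀ θ, circleMap c R θ ∈ sphere c R := fun θ => circleMap_mem_sphere c hR θ
  refine intervalIntegral.tendsto_integral_filter_of_dominated_convergence (fun _ => R * C) ?_ ?_
    intervalIntegrable_const ?_
  · filter_upwards [hF] with N hN
    have h1 : Continuous fun θ => circleMap 0 R θ * Complex.I := by fun_prop
    have h2 := hN.comp_continuous (continuous_circleMap c R) hmem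
    simp only [deriv_circleMap]
    exact (h1.smul h2).aestronglyMeasurable
  · filter_upwards [hC] with N hN
    refine ae_of_all _ fun θ _ => ?_
    rw [norm_smul]
    have : ‖deriv (circleMap c R) θ‖ = R := by simp [abs_of_nonneg hR]
    rw [this]
    exact mul_le_mul_of_nonneg_left (hN _ (hmem θ)) hR
  · exact ae_of_all _ fun θ _ => (hlim _ (hmem θ)).const_smul _

/-- The limit of the `k`-th moment as a contour integral. -/
noncomputable def limitMoment (K k : ℕ) (R : ℝ) (f : (Fin (K + 1) → ℂ) → ℂ) : ℂ :=
  ((k : ℂ) + 1)⁻¹ * ((2 * Real.pi * Complex.I : ℂ)⁻¹ * ∮ z in C(1, R), z⁻¹ *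
    (z / (z - 1) + z * partialFirst f (rootCluster K z) / f (rootCluster K z)) ^ (k + 1))

theorem continuous_rootCluster (K : ℕ) : Continuous (rootCluster K) :=
  continuous_pi fun j => by simp only [rootCluster]; fun_prop

/-- The averaged moments converge, by dominated convergence in the contour integral: the kernel divided
by `N` tends to `(τ z)⁻¹ exp (τ z / (z - 1))`, and the normalized generating function tends to an
exponential. -/
theorem tendsto_moment {ρ : ∀ N : ℕ, PMF (Signature N)} {K k : ℕ} (hk : k ≤ K) {ε : ℝ}
    (hε : 0 < ε) (hε2 : ε ≤ 1 / 2) {G : ℕ → (Fin (K + 1) → ℂ) → ℂ} {f : (Fin (K + 1) → ℂ) → ℂ}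
    (hG : ∀ᶠ N in atTop, IsRootOn (sgfWeight (ρ N)) (K + 1) ε (G N) ∧
        weightedSum (sgfWeight (ρ N)) 1 = 1)
    (hlim : TendstoUniformlyOn G f atTop {u | ∀ i, ‖u i - 1‖ ≤ ε})
    (hf : ∀ u : Fin (K + 1) → ℂ, (∀ i, ‖u i - 1‖ ≤ ε) → AnalyticAt ℂ f u ∧ f u ≠ 0)
    {R : ℝ} (hR : 0 < R) (hRε : R < ε / 4) :
    Tendsto (fun N => weightedSum
      (fun l => sgfWeight (ρ N) l * (l.powerMean k : ℂ)) 1) atTop (𝓝 (limitMoment K k R f)) := by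
  have h1mem : (1 : ℂ) ∈ ball (1 : ℂ) (ε / 4) := mem_ball_self (by linarith)
  have hRsub : sphere (1 : ℂ) R ⊆ ball 1 (ε / 4) :=
    sphere_subset_closedBall.trans (closedBall_subset_ball hRε)
  have hlarge : ∀ B : ℝ, ∀ᶠ N : ℕ in atTop, B < ε * N := fun B =>
    (tendsto_natCast_atTop_atTop.const_mul_atTop hε).eventually_gt_atTop B
  have hcl : ∀ q ∈ ball (1 : ℂ) (ε / 4), ∀ z ∈ ball (1 : ℂ) (ε / 4), ∀ i,
      ‖shiftedCluster K q z i - 1‖ ≤ ε := fun q hq z hz i =>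
    (norm_shiftedCluster_sub_one_le_of_mem_ball (by linarith) hq hz i).trans (by linarith)
  have hcl1 : ∀ z ∈ ball (1 : ℂ) (ε / 4), ∀ i, ‖rootCluster K z i - 1‖ ≤ ε := fun z hz i => by
    rw [← shiftedCluster_one]; exact hcl 1 h1mem z hz i
  set A : ℂ → ℂ := fun z => z / (z - 1) + z * partialFirst f (rootCluster K z) /
    f (rootCluster K z) with hA
  set c : Fin 0 → ℂ := Fin.elim0 with hc
  set V : ∀ N, ℂ → ℂ → ℂ := fun N => clusterValue (N := N) K c (weightedSum (sgfWeight (ρ N)))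
    with hV
  have hVG : ∀ᶠ N in atTop, ∀ q ∈ ball (1 : ℂ) (ε / 4), ∀ z ∈ ball (1 : ℂ) (ε / 4),
      V N q z = G N (shiftedCluster K q z) ^ N ∧ V N q z ≠ 0 := by
    filter_upwards [hG] with N hN q hq z hz
    have h2 : V N q z = weightedSum (sgfWeight (ρ N)) (padOnes N (shiftedCluster K q z)) := by
      simp only [hV, clusterValue, padOnes_elim0_append]
    rw [h2]
    exact ⟨(hN.1.pow_eq _ (hcl q hq z hz)).symm, hN.1.weightedSum_ne_zero (hcl q hq z hz)⟩
  have hz0 : ∀ z ∈ ball (1 : ℂ) (ε / 4), z ≠ 0 := fun z hz =>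
    ne_zero_of_norm_sub_one_lt ((mem_ball_iff_norm.1 hz).trans (by linarith))
  have hz1 : ∀ z ∈ sphere (1 : ℂ) R, z - 1 ≠ 0 := fun z hz h => by
    rw [mem_sphere_iff_norm, h, norm_zero] at hz; exact hR.ne hz
  have hτ0 : ∀ τ ∈ sphere (0 : ℂ) 1, τ ≠ 0 := by rintro τ hτ rfl; simp at hτ
  -- the integrand of the averaged moment, normalized
  set D : ℕ → ℂ → ℂ → ℂ := fun N τ z => (N : ℂ)⁻¹ *
    (qShiftKernel (Complex.exp (τ / N)) (padOnes N c) z *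
      (V N (Complex.exp (τ / N)) z * (V N 1 z)⁻¹)) with hD
  have hmean : ∀ᶠ N : ℕ in atTop, (k.factorial : ℂ) * ((2 * Real.pi * Complex.I : ℂ)⁻¹ *
      ∮ τ in C(0, 1), (τ ^ (k + 1))⁻¹ * ((2 * Real.pi * Complex.I : ℂ)⁻¹ *
        ∮ z in C(1, R), D N τ z)) =
      weightedSum (fun l => sgfWeight (ρ N) l * (l.powerMean k : ℂ)) 1 := by
    filter_upwards [hG, hVG, eventually_ge_atTop (K + 1), hlarge 8] with N hN hVN hNK hN8
    have hdom : DominatedNear (sgfWeight (ρ N)) (0 + (K + 1)) ε := by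
      rw [zero_add]; exact hN.1.dominated
    have hVh : SeparatelyHolomorphic (V N) (ε / 4) :=
      hdom.separatelyHolomorphic_clusterValue (by linarith) fun i => i.elim0
    have hV11 : V N 1 1 = 1 := by
      simp only [hV, clusterValue_one_one]
      rw [← hN.2, Subsingleton.elim c 1, padOnes_one]
    have hm := moment_eq_contourMean hk (by omega) hε hε2 hdom hN8 hR hRε c
    rw [contourMean_normalize (by omega) (Nat.zero_le N) hk (by linarith : 2 < ε / 4 * N) hR
      (by linarith) hRε (fun i => i.elim0) (hVh.right 1 h1mem) (fun z hz => (hVN 1 h1mem z hz).2)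
      (fun z hz => clusterValue_rotate (by omega) (fun i => i.elim0)
      ((mem_ball_iff_norm.1 hz).trans (by linarith))) hVh] at hm
    change _ = V N 1 1 * contourMean N k R c (fun q z => V N q z * (V N 1 z)⁻¹) at hm
    rw [hV11, one_mul] at hm
    have hN0 : (N : ℂ) ≠ 0 := Nat.cast_ne_zero.2 (by omega)
    have hk0 : (k.factorial : ℂ) ≠ 0 := Nat.cast_ne_zero.2 k.factorial_ne_zero
    have e1 : weightedSum (fun l => sgfWeight (ρ N) l * (l.powerMean k : ℂ)) 1 =
        k.factorial * ((N : ℂ)⁻¹ *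
          contourMean N k R c (fun q z => V N q z * (V N 1 z)⁻¹)) := by
      rw [← hm]; field_simp
    rw [e1]
    congr 1
    unfold contourMean
    simp only [hD, circleIntegral.integral_const_mul, mul_left_comm _ ((N : ℂ)⁻¹)]
  set B : ℝ := Real.exp (3 / R) * 4 * Real.exp (16 / ε) with hB
  have hDle : ∀ᶠ N : ℕ in atTop, ∀ τ ∈ sphere (0 : ℂ) 1, ∀ z ∈ sphere (1 : ℂ) R,
      ‖D N τ z‖ ≤ B := by
    filter_upwards [hG, hVG, eventually_ge_atTop 2, hlarge 8] with N hN hVN hN2 hN8 τ hτ z hz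
    obtain ⟨g', hg'⟩ := hN.1.exists_cast (zero_add (K + 1)).symm
    have hN' : (0 : ℝ) < N := by exact_mod_cast (by omega : 0 < N)
    have hq : ‖Complex.exp (τ / N) - 1‖ ≤ 2 / N :=
      norm_exp_div_sub_one_le (mem_sphere_zero_iff_norm.1 hτ).le (by omega)
    have h2 := norm_qShiftKernel_padOnes_le (Nat.zero_le N) hN2 hR (by linarith) one_pos
      (c := c) (fun i => i.elim0) (fun i => i.elim0) hτ hz
    have h3 : ‖V N (Complex.exp (τ / N)) z * (V N 1 z)⁻¹‖ ≤ Real.exp (16 / ε) := by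
      have h4 := hg'.norm_clusterValue_le (by omega) hε (by linarith) hN8 (c := c)
        (fun i => i.elim0) hq (hRsub hz)
      rw [norm_mul, norm_inv, ← div_eq_mul_inv,
        div_le_iff₀ (norm_pos_iff.2 (hVN 1 h1mem z (hRsub hz)).2)]
      exact h4
    simp only [hD]
    rw [norm_mul, norm_mul, norm_inv, Complex.norm_natCast]
    calc _ ≤ (N : ℝ)⁻¹ * (((4 / 1) ^ 0 * Real.exp (3 / R) * (4 * N)) * Real.exp (16 / ε)) := by
          gcongr
      _ = B := by rw [hB]; field_simp
  have hDc : ∀ᶠ N : ℕ in atTop, ContinuousOn (Function.uncurry (D N))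
      (sphere 0 1 ×ˢ sphere 1 R) := by
    filter_upwards [hG, hVG, eventually_ge_atTop 2, hlarge 8] with N hN hVN hN2 hN8
    have hdom : DominatedNear (sgfWeight (ρ N)) (0 + (K + 1)) ε := by
      rw [zero_add]; exact hN.1.dominated
    have hVh : SeparatelyHolomorphic (V N) (ε / 4) :=
      hdom.separatelyHolomorphic_clusterValue (by linarith) fun i => i.elim0
    have hT := hVh.mul ((hVh.at_one (by linarith)).inv fun q _ z hz => (hVN 1 h1mem z hz).2)
    exact continuousOn_const.mul (hT.continuousOn_kernel_mul (by omega)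
      (by linarith : 2 < ε / 4 * N) hR (by linarith) hRε fun i => i.elim0)
  have hDlim : ∀ τ ∈ sphere (0 : ℂ) 1, ∀ z ∈ sphere (1 : ℂ) R,
      Tendsto (fun N => D N τ z) atTop (𝓝 ((τ * z)⁻¹ * Complex.exp (τ * A z))) := by
    intro τ hτ z hz
    have hτ1 : ‖τ‖ ≤ 1 := (mem_sphere_zero_iff_norm.1 hτ).le
    have hzb := hRsub hz
    have hNq := tendsto_natCast_mul_exp_div_sub_one τ
    -- the factor `((q - 1) z)⁻¹` of the kernel
    have t1 : Tendsto (fun N : ℕ => ((N : ℂ) * (Complex.exp (τ / N) - 1) * z)⁻¹) atTop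
        (𝓝 ((τ * z)⁻¹)) :=
      (hNq.mul_const z).inv₀ (mul_ne_zero (hτ0 τ hτ) (hz0 z hzb))
    -- the factor of the kernel that belongs to the coordinates equal to `1`
    have t2 : Tendsto (fun N : ℕ => ((Complex.exp (τ / N) * z - 1) / (z - 1)) ^ N) atTop
        (𝓝 (Complex.exp (τ * (z / (z - 1))))) := by
      have h4 : Tendsto (fun N : ℕ => (N : ℂ) * ((Complex.exp (τ / N) - 1) * (z / (z - 1)))) atTop
          (𝓝 (τ * (z / (z - 1)))) := by
        refine (hNq.mul_const (z / (z - 1))).congr fun N => ?_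
        ring
      refine (Complex.tendsto_one_add_pow_exp_of_tendsto h4).congr fun N => ?_
      have := hz1 z hz
      congr 1
      field_simp
      ring
    -- the normalized generating function
    have t3 : Tendsto (fun N : ℕ => (G N (shiftedCluster K (Complex.exp (τ / N)) z) /
        G N (shiftedCluster K 1 z)) ^ N) atTop
        (𝓝 (Complex.exp (τ * (z * partialFirst f (rootCluster K z)) /
          f (shiftedCluster K 1 z)))) := by
      have hup : ∀ q, shiftedCluster K q z = Function.update (rootCluster K z) 0 (q * z) :=
        fun q => rfl
      have hdiff : ∀ q, HasDerivAt (fun q => shiftedCluster K q z)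
          (z • Pi.single (0 : Fin (K + 1)) (1 : ℂ)) q := fun q => by
        have h5 := (hasDerivAt_update (rootCluster K z) 0 (q * z)).scomp q
          (h := fun q : ℂ => q * z) (h' := z) (by simpa using (hasDerivAt_id q).mul_const z)
        exact h5
      refine tendsto_div_pow_of_tendstoUniformlyOn (h := fun N q => G N (shiftedCluster K q z))
        (f := fun q => f (shiftedCluster K q z)) (η := ε / 4) (by linarith) ?_ ?_ ?_ ?_ ?_ hτ1
      · filter_upwards [hG] with N hN q hq
        exact ((hN.1.differentiableAt _ (hcl q hq z hzb)).comp q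
          (hdiff q).differentiableAt).differentiableWithinAt
      · intro q hq
        exact ((hf _ (hcl q hq z hzb)).1.differentiableAt.comp q
          (hdiff q).differentiableAt).differentiableWithinAt
      · have h6 : HasFDerivAt f (fderiv ℂ f (rootCluster K z)) (shiftedCluster K 1 z) := by
          rw [shiftedCluster_one]
          exact (hf _ (hcl1 z hzb)).1.differentiableAt.hasFDerivAt
        have h7 := h6.comp_hasDerivAt 1 (hdiff 1)
        rw [map_smul, ← partialFirst_eq_fderiv (hf _ (hcl1 z hzb)).1.differentiableAt] at h7
        exact h7
      · exact (hf _ (hcl 1 h1mem z hzb)).2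
      · refine (hlim.comp fun q => shiftedCluster K q z).mono fun q hq => ?_
        exact hcl q hq z hzb
    have t4 := (t1.mul t2).mul t3
    rw [shiftedCluster_one, mul_assoc ((τ * z)⁻¹), ← Complex.exp_add, mul_div_assoc,
      ← mul_add] at t4
    refine t4.congr' ?_
    filter_upwards [hVG, eventually_ge_atTop 1, hlarge 8] with N hVN hN1 hN8
    have hqm : Complex.exp (τ / N) ∈ ball (1 : ℂ) (ε / 4) :=
      exp_div_mem_ball (sphere_subset_closedBall hτ) hN1 (by linarith)
    simp only [hD]
    rw [(hVN _ hqm z hzb).1, (hVN 1 h1mem z hzb).1, qShiftKernel_padOnes (Nat.zero_le N)]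
    simp only [Finset.univ_eq_empty, Finset.prod_empty, one_mul, Nat.sub_zero, div_pow,
      shiftedCluster_one]
    simp only [div_eq_mul_inv, mul_inv]
    ring
  have hinner : ∀ τ ∈ sphere (0 : ℂ) 1, Tendsto (fun N => (τ ^ (k + 1))⁻¹ *
      ((2 * Real.pi * Complex.I : ℂ)⁻¹ * ∮ z in C(1, R), D N τ z)) atTop
      (𝓝 ((τ ^ (k + 1))⁻¹ * ((2 * Real.pi * Complex.I : ℂ)⁻¹ *
        ∮ z in C(1, R), (τ * z)⁻¹ * Complex.exp (τ * A z)))) := fun τ hτ =>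
    ((tendsto_circleIntegral_of_dominated hR.le (hDc.mono fun N hN => hN.uncurry_left τ hτ)
      (hDle.mono fun N hN => hN τ hτ) (hDlim τ hτ)).const_mul _).const_mul _
  have hτinv : ContinuousOn (fun τ : ℂ => (τ ^ (k + 1))⁻¹) (sphere 0 1) :=
    ContinuousOn.inv₀ (by fun_prop) fun τ hτ => pow_ne_zero _ (hτ0 τ hτ)
  have houter := tendsto_circleIntegral_of_dominated (C := R * B) zero_le_one
    (hDc.mono fun N hN => hτinv.mul (continuousOn_const.mul
      (continuousOn_circleIntegral hR.le hN)))
    (hDle.mono fun N hN τ hτ => by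
      have hτ1 : ‖τ‖ = 1 := by simpa using hτ
      change ‖(τ ^ (k + 1))⁻¹ * ((2 * Real.pi * Complex.I : ℂ)⁻¹ * ∮ z in C(1, R), D N τ z)‖ ≤ _
      rw [norm_mul, norm_inv, norm_pow, hτ1, one_pow, inv_one, one_mul]
      exact circleIntegral.norm_two_pi_i_inv_smul_integral_le_of_norm_le_const hR.le
        fun z hz => hN τ hτ z hz) hinner
  have hfin := ((houter.const_mul ((2 * Real.pi * Complex.I : ℂ)⁻¹)).const_mul
    (k.factorial : ℂ)).congr' hmean
  convert hfin using 2
  -- interchange the integrals and extract the coefficient of the exponential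
  have hAc : ContinuousOn A (sphere 1 R) := by
    have hclc : ContinuousOn (rootCluster K) (sphere 1 R) := (continuous_rootCluster K).continuousOn
    have h8 : ContinuousOn (fun z => partialFirst f (rootCluster K z)) (sphere 1 R) := fun z hz =>
      ContinuousAt.comp_continuousWithinAt
        (analyticAt_partialFirst (hf _ (hcl1 z (hRsub hz))).1).continuousAt (hclc z hz)
    have h9 : ContinuousOn (fun z => f (rootCluster K z)) (sphere 1 R) := fun z hz =>
      ContinuousAt.comp_continuousWithinAt (hf _ (hcl1 z (hRsub hz))).1.continuousAt (hclc z hz)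
    exact (continuousOn_id.div (by fun_prop) hz1).add
      ((continuousOn_id.mul h8).div h9 fun z hz => (hf _ (hcl1 z (hRsub hz))).2)
  have e1 : (∮ τ in C(0, 1), (τ ^ (k + 1))⁻¹ * ((2 * Real.pi * Complex.I : ℂ)⁻¹ *
        ∮ z in C(1, R), (τ * z)⁻¹ * Complex.exp (τ * A z))) =
      (2 * Real.pi * Complex.I : ℂ)⁻¹ * ∮ τ in C(0, 1), ∮ z in C(1, R),
        z⁻¹ * ((τ ^ (k + 1 + 1))⁻¹ * Complex.exp (τ * A z)) := by
    rw [← circleIntegral.integral_const_mul]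
    refine circleIntegral.integral_congr zero_le_one fun τ hτ => ?_
    rw [mul_left_comm, ← circleIntegral.integral_const_mul]
    congr 1
    refine circleIntegral.integral_congr hR.le fun z hz => ?_
    have := hτ0 τ hτ
    have := hz0 z (hRsub hz)
    field_simp
    ring
  have e2 : (∮ z in C(1, R), ∮ τ in C(0, 1),
        z⁻¹ * ((τ ^ (k + 1 + 1))⁻¹ * Complex.exp (τ * A z))) =
      ∮ z in C(1, R), (2 * Real.pi * Complex.I : ℂ) / (k + 1).factorial *
        (z⁻¹ * A z ^ (k + 1)) := by
    refine circleIntegral.integral_congr hR.le fun z hz => ?_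
    rw [circleIntegral.integral_const_mul]
    have h10 := circleIntegral_exp_coeff (A z) (k + 1)
    rw [inv_mul_eq_iff_eq_mul₀ (by simp [Real.pi_ne_zero])] at h10
    rw [h10]
    ring
  have hlm : limitMoment K k R f = ((k : ℂ) + 1)⁻¹ * ((2 * Real.pi * Complex.I : ℂ)⁻¹ *
      ∮ z in C(1, R), z⁻¹ * A z ^ (k + 1)) := rfl
  rw [e1, circleIntegral_swap zero_le_one hR.le, e2, circleIntegral.integral_const_mul, hlm,
    Nat.factorial_succ]
  · have h11 : (2 * Real.pi * Complex.I : ℂ) ≠ 0 := by simp [Real.pi_ne_zero]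
    have hk0 : (k.factorial : ℂ) ≠ 0 := Nat.cast_ne_zero.2 k.factorial_ne_zero
    have hk1 : (k : ℂ) + 1 ≠ 0 := by exact_mod_cast k.succ_ne_zero
    generalize (∮ z in C(1, R), z⁻¹ * A z ^ (k + 1)) = J
    push_cast
    field_simp
  · have h12 : ContinuousOn (fun p : ℂ × ℂ => A p.2) (sphere (0 : ℂ) 1 ×ˢ sphere (1 : ℂ) R) :=
      hAc.comp continuousOn_snd fun p hp => hp.2
    refine ContinuousOn.mul (ContinuousOn.inv₀ continuousOn_snd fun p hp => hz0 _ (hRsub hp.2))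
      (ContinuousOn.mul (ContinuousOn.inv₀ (by fun_prop) fun p hp =>
        pow_ne_zero _ (hτ0 _ hp.1)) ?_)
    exact (continuousOn_fst.mul h12).cexp

end MeanLimit

/-! ### Measures with given moments -/

section MomentProblem

open Metric Set

/-- Chebyshev's inequality around an arbitrary centre `m`. -/
theorem pmf_chebyshev {α : Type*} (p : PMF α) {X : α → ℝ}
    (h1 : Summable fun l => (p l).toReal * X l) (h2 : Summable fun l => (p l).toReal * X l * X l)
    (m : ℝ) {ε : ℝ} (hε : 0 < ε) :
    p.toOuterMeasure {l | ε ≤ |X l - m|} ≤ ENNReal.ofReal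
      (((∑' l, (p l).toReal * X l * X l) - 2 * m * (∑' l, (p l).toReal * X l) + m ^ 2) / ε ^ 2) := by
  have h0 : Summable fun l => (p l).toReal := ENNReal.summable_toReal p.tsum_coe_ne_top
  have hp1 : ∑' l, (p l).toReal = 1 := by
    rw [← ENNReal.tsum_toReal_eq p.apply_ne_top, p.tsum_coe, ENNReal.toReal_one]
  have hsum := ((h2.hasSum.sub (h1.hasSum.mul_left (2 * m))).add
    (h0.hasSum.mul_left (m ^ 2))).div_const (ε ^ 2)
  rw [hp1, mul_one] at hsum
  have hterm : ∀ l, ((p l).toReal * X l * X l - 2 * m * ((p l).toReal * X l) +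
      m ^ 2 * (p l).toReal) / ε ^ 2 = (p l).toReal * ((X l - m) / ε) ^ 2 := fun l => by
    field_simp
    ring
  simp only [hterm] at hsum
  rw [← hsum.tsum_eq, ENNReal.ofReal_tsum_of_nonneg (fun l => by positivity) hsum.summable,
    PMF.toOuterMeasure_apply]
  refine ENNReal.tsum_le_tsum fun l => ?_
  by_cases hl : l ∈ {l | ε ≤ |X l - m|}
  · rw [indicator_of_mem hl, ← ENNReal.ofReal_toReal (p.apply_ne_top l)]
    refine ENNReal.ofReal_le_ofReal ?_
    rw [ENNReal.toReal_ofReal ENNReal.toReal_nonneg]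
    refine le_mul_of_one_le_right ENNReal.toReal_nonneg ?_
    rw [div_pow, one_le_div (by positivity), ← sq_abs (X l - m)]
    exact pow_le_pow_left₀ hε.le hl 2
  · rw [indicator_of_notMem hl]
    exact zero_le

/-- A nonnegative continuous function whose truncations have bounded integrals is integrable. -/
theorem integrable_of_integral_min_le {μ : Measure ℝ} [IsFiniteMeasure μ] {f : ℝ → ℝ}
    (hf : Continuous f) (hf0 : ∀ x, 0 ≤ f x) {C : ℝ}
    (hC : ∀ n : ℕ, ∫ x, min (f x) n ∂μ ≤ C) : Integrable f μ ∧ ∫ x, f x ∂μ ≤ C := by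
  have hmin0 : ∀ (n : ℕ) x, 0 ≤ min (f x) n := fun n x => le_min (hf0 x) n.cast_nonneg
  have hC0 : 0 ≤ C := (integral_nonneg fun x => hmin0 0 x).trans (hC 0)
  have hint : ∀ n : ℕ, Integrable (fun x => min (f x) n) μ := fun n =>
    Integrable.of_bound (hf.min continuous_const).aestronglyMeasurable n
      (ae_of_all _ fun x => by
        rw [Real.norm_of_nonneg (hmin0 n x)]; exact min_le_right _ _)
  have hlim : Tendsto (fun n : ℕ => ∫⁻ x, ENNReal.ofReal (min (f x) n) ∂μ) atTop
      (𝓝 (∫⁻ x, ENNReal.ofReal (f x) ∂μ)) := by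
    refine lintegral_tendsto_of_tendsto_of_monotone (fun n =>
      (hf.min continuous_const).measurable.ennreal_ofReal.aemeasurable)
      (ae_of_all _ fun x n n' hn => ENNReal.ofReal_le_ofReal
        (min_le_min_left _ (by exact_mod_cast hn))) (ae_of_all _ fun x => ?_)
    refine tendsto_const_nhds.congr' ?_
    filter_upwards [eventually_ge_atTop ⌈f x⌉₊] with n hn
    rw [min_eq_left (Nat.ceil_le.1 hn)]
  have hle : ∫⁻ x, ENNReal.ofReal (f x) ∂μ ≤ ENNReal.ofReal C := by
    refine le_of_tendsto' hlim fun n => ?_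
    rw [← ofReal_integral_eq_lintegral_ofReal (hint n) (ae_of_all _ (hmin0 n))]
    exact ENNReal.ofReal_le_ofReal (hC n)
  have hfi : Integrable f μ := ⟨hf.aestronglyMeasurable,
    (hasFiniteIntegral_iff_ofReal (ae_of_all _ hf0)).2 (hle.trans_lt ENNReal.ofReal_lt_top)⟩
  refine ⟨hfi, ?_⟩
  rw [← ofReal_integral_eq_lintegral_ofReal hfi (ae_of_all _ hf0)] at hle
  exact (ENNReal.ofReal_le_ofReal_iff hC0).1 hle

/-- The power `x ^ k` with `x` truncated to `[-n, n]`. -/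
noncomputable def truncPow (k n : ℕ) (x : ℝ) : ℝ :=
  (max (-(n : ℝ)) (min x n)) ^ k

theorem continuous_truncPow (k n : ℕ) : Continuous (truncPow k n) := by
  unfold truncPow; fun_prop

theorem abs_truncPow_le (k n : ℕ) (x : ℝ) : |truncPow k n x| ≤ (n : ℝ) ^ k := by
  rw [truncPow, abs_pow]
  refine pow_le_pow_left₀ (abs_nonneg _) (abs_le.2 ⟨le_max_left _ _, max_le ?_ (min_le_right _ _)⟩) k
  linarith [(Nat.cast_nonneg n : (0 : ℝ) ≤ n)]

/-- The error of the truncation is controlled by a higher even moment. -/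
theorem abs_pow_sub_truncPow_le (k : ℕ) {n : ℕ} (hn : 1 ≤ n) (x : ℝ) :
    |x ^ k - truncPow k n x| ≤ 2 / n * x ^ (2 * (k + 1)) := by
  have hn' : (1 : ℝ) ≤ n := by exact_mod_cast hn
  have hx0 : 0 ≤ x ^ (2 * (k + 1)) := by rw [pow_mul]; positivity
  rcases le_or_gt |x| n with hx | hx
  · have h := abs_le.1 hx
    rw [truncPow, min_eq_left h.2, max_eq_right h.1, sub_self, abs_zero]
    positivity
  · have h1 : |x ^ k - truncPow k n x| ≤ 2 * |x| ^ k := by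
      have h2 := abs_sub (x ^ k) (truncPow k n x)
      rw [abs_pow] at h2
      have h3 := pow_le_pow_left₀ (by positivity) hx.le k
      linarith [abs_truncPow_le k n x]
    have h4 : (n : ℝ) ≤ |x| ^ (k + 2) :=
      hx.le.trans (le_self_pow₀ (hn'.trans hx.le) (by omega))
    have h5 : x ^ (2 * (k + 1)) = |x| ^ k * |x| ^ (k + 2) := by
      rw [← pow_add, ← Even.pow_abs (n := 2 * (k + 1)) ⟨k + 1, by ring⟩]; congr 1; ring
    refine h1.trans ?_
    rw [h5, div_mul_eq_mul_div, le_div_iff₀ (by linarith)]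
    have h6 := mul_le_mul_of_nonneg_left h4 (by positivity : 0 ≤ 2 * |x| ^ k)
    linarith

/-- If all moments of a sequence of probability measures converge, there is a probability measure with
the limits as moments. The second moments give tightness; truncation shows that a weak limit along an
ultrafilter has the right moments. -/
theorem exists_probabilityMeasure_of_tendsto_moments (ν : ℕ → ProbabilityMeasure ℝ)
    (hint : ∀ j k, Integrable (fun x => x ^ k) (ν j : Measure ℝ)) {m : ℕ → ℝ}
    (hm : ∀ k, Tendsto (fun j => ∫ x, x ^ k ∂(ν j : Measure ℝ)) atTop (𝓝 (m k))) :
    ∃ μ : ProbabilityMeasure ℝ, ∀ k, Integrable (fun x => x ^ k) (μ : Measure ℝ) ∧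
      ∫ x, x ^ k ∂(μ : Measure ℝ) = m k := by
  have hbdd : ∀ k, ∃ C, ∀ j, ∫ x, x ^ k ∂(ν j : Measure ℝ) ≤ C := fun k => by
    obtain ⟨C, hC⟩ := (hm k).bddAbove_range
    exact ⟨C, fun j => hC ⟨j, rfl⟩⟩
  choose C hC using hbdd
  have heven : ∀ k (x : ℝ), 0 ≤ x ^ (2 * k) := fun k x => by rw [pow_mul]; positivity
  -- tightness by Markov's inequality for `x ^ 2`
  have htight : IsTightMeasureSet
      {x | ∃ μ ∈ range ν, ((μ : ProbabilityMeasure ℝ) : Measure ℝ) = x} := by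
    refine isTightMeasureSet_iff_exists_isCompact_measure_compl_le.2 fun ε hε => ?_
    have h1 : Tendsto (fun n : ℕ => ENNReal.ofReal (C 2 / n)) atTop (𝓝 0) := by
      rw [← ENNReal.ofReal_zero]
      exact ENNReal.tendsto_ofReal (tendsto_const_div_atTop_nhds_zero_nat _)
    obtain ⟨n, hn1, hn⟩ := ((eventually_ge_atTop 1).and (h1.eventually_lt_const hε)).exists
    have hn' : (1 : ℝ) ≤ n := by exact_mod_cast hn1
    refine ⟨closedBall 0 n, isCompact_closedBall _ _, ?_⟩
    rintro _ ⟨_, ⟨j, rfl⟩, rfl⟩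
    have h2 := mul_meas_ge_le_integral_of_nonneg (μ := (ν j : Measure ℝ)) (f := fun x => x ^ 2)
      (ae_of_all _ fun x => sq_nonneg x) (hint j 2) n
    have h3 : (ν j : Measure ℝ).real {x | (n : ℝ) ≤ x ^ 2} ≤ C 2 / n := by
      rw [le_div_iff₀ (by linarith), mul_comm]
      exact h2.trans (hC 2 j)
    refine le_trans ?_ hn.le
    refine (measure_mono (t := {x : ℝ | (n : ℝ) ≤ x ^ 2}) fun x hx => ?_).trans ?_
    · have h4 : (n : ℝ) < |x| := by simpa using hx
      have h5 : |x| ≤ |x| ^ 2 := le_self_pow₀ (by linarith) two_ne_zero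
      rw [sq_abs] at h5
      exact h4.le.trans h5
    · rw [← ofReal_measureReal]
      exact ENNReal.ofReal_le_ofReal h3
  obtain ⟨μ, -, hμ⟩ := (isCompact_closure_of_isTightMeasureSet htight).ultrafilter_le_nhds
    ((hyperfilter ℕ).map ν) (le_principal_iff.2 (Ultrafilter.mem_map.2
      (univ_mem' fun j => subset_closure (mem_range_self j))))
  have hμ' : Tendsto ν (hyperfilter ℕ) (𝓝 μ) := hμ
  rw [ProbabilityMeasure.tendsto_iff_forall_integral_tendsto] at hμ'
  have hm' : ∀ k, Tendsto (fun j => ∫ x, x ^ k ∂(ν j : Measure ℝ)) (hyperfilter ℕ) (𝓝 (m k)) :=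
    fun k => (hm k).mono_left Nat.hyperfilter_le_atTop
  -- the even moments of the limit
  have hμeven : ∀ k, Integrable (fun x => x ^ (2 * k)) (μ : Measure ℝ) ∧
      ∫ x, x ^ (2 * k) ∂(μ : Measure ℝ) ≤ C (2 * k) := fun k => by
    refine integrable_of_integral_min_le (by fun_prop) (heven k) fun n => ?_
    have h1 := hμ' (BoundedContinuousFunction.ofNormedAddCommGroup
      (fun x : ℝ => min (x ^ (2 * k)) (n : ℝ)) (by fun_prop) n fun x => by
        rw [Real.norm_of_nonneg (le_min (heven k x) n.cast_nonneg)]; exact min_le_right _ _)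
    refine le_of_tendsto' h1 fun j => ?_
    refine le_trans (integral_mono_of_nonneg (ae_of_all _ fun x =>
      le_min (heven k x) n.cast_nonneg) (hint j (2 * k)) (ae_of_all _ fun x =>
        min_le_left _ _)) (hC (2 * k) j)
  have hμint : ∀ k, Integrable (fun x => x ^ k) (μ : Measure ℝ) := fun k => by
    refine Integrable.mono' ((integrable_const (1 : ℝ)).add (hμeven k).1)
      (by fun_prop) (ae_of_all _ fun x => ?_)
    rw [Real.norm_eq_abs, abs_pow, Pi.add_apply, mul_comm 2 k, pow_mul, ← sq_abs, abs_pow]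
    nlinarith [sq_nonneg (|x| ^ k - 1)]
  -- truncation changes the moments by `O (1 / n)`, uniformly over the sequence and its limit
  have htrunc : ∀ k n, 1 ≤ n → ∀ P : ProbabilityMeasure ℝ,
      (∀ k, Integrable (fun x => x ^ k) (P : Measure ℝ)) →
      ∫ x, x ^ (2 * (k + 1)) ∂(P : Measure ℝ) ≤ C (2 * (k + 1)) →
      |∫ x, x ^ k ∂(P : Measure ℝ) - ∫ x, truncPow k n x ∂(P : Measure ℝ)| ≤
        2 / n * C (2 * (k + 1)) := by
    intro k n hn P hP hPC
    have htint : Integrable (truncPow k n) (P : Measure ℝ) :=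
      Integrable.of_bound (continuous_truncPow k n).aestronglyMeasurable ((n : ℝ) ^ k)
        (ae_of_all _ fun x => abs_truncPow_le k n x)
    rw [← integral_sub (hP k) htint]
    refine (abs_integral_le_integral_abs).trans ?_
    refine (integral_mono ((hP k).sub htint).abs ((hP (2 * (k + 1))).const_mul (2 / (n : ℝ)))
      fun x => abs_pow_sub_truncPow_le k hn x).trans ?_
    rw [integral_const_mul]
    gcongr
  refine ⟨μ, fun k => ⟨hμint k, ?_⟩⟩
  -- weak convergence applies to the truncated powers
  have hclose : ∀ n : ℕ, 1 ≤ n → |∫ x, x ^ k ∂(μ : Measure ℝ) - m k| ≤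
      4 * C (2 * (k + 1)) / n := by
    intro n hn
    have h1 := hμ' (BoundedContinuousFunction.ofNormedAddCommGroup (truncPow k n)
      (continuous_truncPow k n) ((n : ℝ) ^ k) (abs_truncPow_le k n))
    have h2 := ((tendsto_const_nhds (x := ∫ x, truncPow k n x ∂(μ : Measure ℝ))).sub h1).abs
    rw [BoundedContinuousFunction.coe_ofNormedAddCommGroup, sub_self, abs_zero] at h2
    have h3 := ((tendsto_const_nhds (x := ∫ x, x ^ k ∂(μ : Measure ℝ))).sub (hm' k)).abs
    have h4 := (tendsto_const_nhds (x := 4 * C (2 * (k + 1)) / (n : ℝ))).add h2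
    rw [add_zero] at h4
    refine le_of_tendsto_of_tendsto' h3 h4 fun j => ?_
    have h5 := htrunc k n hn μ hμint (hμeven (k + 1)).2
    have h6 := htrunc k n hn (ν j) (hint j) (hC _ j)
    have e : 4 * C (2 * (k + 1)) / (n : ℝ) = 2 / n * C (2 * (k + 1)) + 2 / n * C (2 * (k + 1)) := by
      ring
    rw [e]
    have h7 : |(∫ x, x ^ k ∂(μ : Measure ℝ)) - ∫ x, x ^ k ∂(ν j : Measure ℝ)| ≤
        |(∫ x, x ^ k ∂(μ : Measure ℝ)) - ∫ x, truncPow k n x ∂(μ : Measure ℝ)| +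
        |(∫ x, truncPow k n x ∂(μ : Measure ℝ)) - ∫ x, truncPow k n x ∂(ν j : Measure ℝ)| +
        |(∫ x, truncPow k n x ∂(ν j : Measure ℝ)) - ∫ x, x ^ k ∂(ν j : Measure ℝ)| :=
      (abs_sub_le _ (∫ x, truncPow k n x ∂(ν j : Measure ℝ)) _).trans
        (add_le_add_left (abs_sub_le _ _ _) _)
    rw [abs_sub_comm (∫ x, truncPow k n x ∂(ν j : Measure ℝ))] at h7
    linarith
  have h8 : |∫ x, x ^ k ∂(μ : Measure ℝ) - m k| ≤ 0 := by
    refine ge_of_tendsto (tendsto_const_div_atTop_nhds_zero_nat (4 * C (2 * (k + 1)))) ?_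
    filter_upwards [eventually_ge_atTop 1] with n hn using hclose n hn
  exact sub_eq_zero.1 (abs_nonpos_iff.1 h8)

end MomentProblem

/-! ### Convergence of the empirical measures -/

section EmpiricalMeasure

open Metric Set

namespace Signature

variable {N : ℕ} (l : Signature N)

theorem integrable_empiricalMeasure (hN : 1 ≤ N) (f : ℝ → ℝ) :
    Integrable f l.empiricalMeasure := by
  refine Integrable.smul_measure ?_ (ENNReal.inv_ne_top.2 (Nat.cast_ne_zero.2 (by omega)))
  exact integrable_finsetSum_measure.2 fun i _ => integrable_dirac (by simp)

theorem integral_empiricalMeasure (k : ℕ) :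
    ∫ x, x ^ k ∂l.empiricalMeasure = l.powerMean k := by
  rw [empiricalMeasure, integral_smul_measure, integral_finsetSum_measure fun i _ =>
    integrable_dirac (by simp)]
  simp [powerMean, div_eq_inv_mul]

theorem isProbabilityMeasure_empiricalMeasure (hN : 1 ≤ N) :
    IsProbabilityMeasure l.empiricalMeasure := by
  constructor
  simp only [empiricalMeasure, Measure.smul_apply, Measure.finsetSum_apply, measure_univ,
    Finset.sum_const, Finset.card_univ, Fintype.card_fin, smul_eq_mul, nsmul_eq_mul, mul_one]
  exact ENNReal.inv_mul_cancel (Nat.cast_ne_zero.2 (by omega)) (ENNReal.natCast_ne_top N)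

end Signature

theorem weightedSum_one {N : ℕ} (a : Signature N → ℂ) : weightedSum a 1 = ∑' l, a l := by
  simp only [weightedSum, Signature.normalizedSchur_one, mul_one]

theorem DominatedNear.summable_coeff {N m : ℕ} {a : Signature N → ℂ} {ε : ℝ}
    (h : DominatedNear a m ε) (hε : 0 ≤ ε) : Summable a := by
  have := h.summable (u := 1) fun i => by simpa using hε
  simpa only [padOnes_one, Signature.normalizedSchur_one, mul_one] using this

/-- The first two moments of `powerMean` are finite: `DominatedNear.moment` is applied twice, which costs
`k + 1` variables each time. -/
theorem IsRootOn.summable_moment {N k : ℕ} {a : Signature N → ℂ} {ε : ℝ}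
    {g : (Fin (k + 1 + (k + 1)) → ℂ) → ℂ} (h : IsRootOn a (k + 1 + (k + 1)) ε g) (hε : 0 < ε)
    (hε2 : ε ≤ 1 / 2) (hN : k + 1 + (k + 1) ≤ N) (hNε : 8 ≤ ε * N)
    (hNε1 : 8 ≤ (1 - Real.exp (-(ε / (16 * (k + 1 : ℕ))))) * N) :
    (Summable fun l => a l * (l.powerMean k : ℂ)) ∧
      Summable fun l => a l * (l.powerMean k : ℂ) * (l.powerMean k : ℂ) := by
  have hx0 : 0 < ε / (16 * (k + 1 : ℕ)) := by positivity
  have hε1 : 0 < 1 - Real.exp (-(ε / (16 * (k + 1 : ℕ)))) :=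
    sub_pos.2 (Real.exp_lt_one_iff.2 (by linarith))
  have hx1 : ε / (16 * (k + 1 : ℕ)) ≤ ε := by
    refine div_le_self hε.le ?_
    have : (1 : ℝ) ≤ (k + 1 : ℕ) := by exact_mod_cast Nat.le_add_left 1 k
    linarith
  have hexp := Real.add_one_le_exp (-(ε / (16 * (k + 1 : ℕ))))
  have h1 := h.dominated.moment le_rfl hN hε hε2 hNε
  have h2 : DominatedNear (fun l => a l * (l.powerMean k : ℂ)) (0 + (k + 1))
      (1 - Real.exp (-(ε / (16 * (k + 1 : ℕ))))) := by
    rw [zero_add]; exact h1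
  have h3 := h2.moment (k := k) le_rfl (by omega) hε1 (by linarith) hNε1
  refine ⟨h1.summable_coeff hε1.le, h3.summable_coeff (by simp)⟩

/-- Convergence in probability of the moments of the empirical measures to the limits of their
averages. -/
theorem tendsto_toOuterMeasure_moment {ρ : ∀ N : ℕ, PMF (Signature N)} {k : ℕ}
    {f : (Fin (k + 1 + (k + 1)) → ℂ) → ℂ} (hf : AnalyticAt ℂ f 1) (hlim : RootLimit ρ f) {M : ℂ}
    (hM : Tendsto (fun N => weightedSum (fun l => sgfWeight (ρ N) l * (l.powerMean k : ℂ)) 1) atTop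
      (𝓝 M)) :
    M = M.re ∧ ∀ ε : ℝ, 0 < ε → Tendsto
        (fun N : ℕ => (ρ N).toOuterMeasure {l | ε ≤ |l.powerMean k - M.re|}) atTop (𝓝 0) := by
  obtain ⟨ε₀, hε₀, hε₀2, G, hG, -, -⟩ := hlim.exists_isRootOn hf
  obtain ⟨C, hC⟩ := exists_variance_le (le_refl k) hε₀ hε₀2
  set e1 : ℕ → ℝ := fun N => ∑' l, ((ρ N) l).toReal * l.powerMean k with he1
  set e2 : ℕ → ℝ := fun N => ∑' l, ((ρ N) l).toReal * l.powerMean k * l.powerMean k with he2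
  have hw1 : ∀ N, weightedSum (fun l => sgfWeight (ρ N) l * (l.powerMean k : ℂ)) 1 = (e1 N : ℂ) :=
    fun N => by
      rw [weightedSum_one, he1, Complex.ofReal_tsum]
      exact tsum_congr fun l => by simp [sgfWeight]
  have hw2 : ∀ N, weightedSum (fun l => sgfWeight (ρ N) l * (l.powerMean k : ℂ) *
      (l.powerMean k : ℂ)) 1 = (e2 N : ℂ) := fun N => by
    rw [weightedSum_one, he2, Complex.ofReal_tsum]
    exact tsum_congr fun l => by simp [sgfWeight]
  simp only [hw1] at hM
  have hMre : Tendsto e1 atTop (𝓝 M.re) := by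
    have := (Complex.continuous_re.tendsto M).comp hM
    exact this
  have hMeq : M = M.re := by
    have h1 := (Complex.continuous_ofReal.tendsto M.re).comp hMre
    exact tendsto_nhds_unique hM h1
  refine ⟨hMeq, fun ε hε => ?_⟩
  -- the variance tends to zero
  have hvar : Tendsto (fun N => e2 N - e1 N ^ 2) atTop (𝓝 0) := by
    refine squeeze_zero_norm' ?_ (tendsto_const_div_atTop_nhds_zero_nat C)
    filter_upwards [hG, hC] with N hN hCN
    have h1 := hCN _ _ hN.1 hN.2
    rw [hw1, hw2, ← Complex.ofReal_pow, ← Complex.ofReal_sub, Complex.norm_real] at h1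
    exact h1
  have hcheb : Tendsto (fun N => ENNReal.ofReal
      ((e2 N - 2 * M.re * e1 N + M.re ^ 2) / ε ^ 2)) atTop (𝓝 0) := by
    rw [← ENNReal.ofReal_zero]
    refine ENNReal.tendsto_ofReal ?_
    have h1 := ((hvar.add ((hMre.sub_const M.re).pow 2))).div_const (ε ^ 2)
    rw [sub_self, zero_pow two_ne_zero, add_zero, zero_div] at h1
    refine h1.congr fun N => ?_
    ring
  have hlarge : ∀ {η : ℝ}, 0 < η → ∀ B : ℝ, ∀ᶠ N : ℕ in atTop, B < η * N := fun hη B =>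
    (tendsto_natCast_atTop_atTop.const_mul_atTop hη).eventually_gt_atTop B
  have hx0 : 0 < ε₀ / (16 * (k + 1 : ℕ)) := by positivity
  refine tendsto_of_tendsto_of_tendsto_of_le_of_le' tendsto_const_nhds hcheb
    (Eventually.of_forall fun _ => zero_le) ?_
  filter_upwards [hG, eventually_ge_atTop (k + 1 + (k + 1)), hlarge hε₀ 8,
    hlarge (sub_pos.2 (Real.exp_lt_one_iff.2 (neg_lt_zero.2 hx0))) 8] with N hN hNk h8 h8'
  obtain ⟨s1, s2⟩ := hN.1.summable_moment hε₀ hε₀2 hNk h8.le h8'.le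
  refine pmf_chebyshev (ρ N) ?_ ?_ M.re hε
  · refine Complex.summable_ofReal.1 (s1.congr fun l => ?_)
    simp [sgfWeight]
  · refine Complex.summable_ofReal.1 (s2.congr fun l => ?_)
    simp [sgfWeight]

/-- If the moments of the empirical measures converge in probability, they converge to the moments
of a probability measure, and the limits in the sense of moments are the measures with these
moments. -/
theorem isLimitInMoments_of_tendsto {ρ : ∀ N : ℕ, PMF (Signature N)} {m : ℕ → ℝ}
    (h : ∀ k, ∀ ε : ℝ, 0 < ε → Tendsto
        (fun N : ℕ => (ρ N).toOuterMeasure {l | ε ≤ |l.powerMean k - m k|}) atTop (𝓝 0)) :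
    (∃ μ : Measure ℝ, IsLimitInMoments ρ μ) ∧
      ∀ μ : Measure ℝ, IsLimitInMoments ρ μ → ∀ k, ∫ x, x ^ k ∂μ = m k := by
  -- a single signature for which finitely many moments are close to their limits
  have hex : ∀ j : ℕ, ∃ N, 1 ≤ N ∧ ∃ l : Signature N, ∀ k ≤ j,
      |l.powerMean k - m k| < 1 / ((j : ℝ) + 1) := by
    intro j
    have h1 : Tendsto (fun N => ∑ k ∈ Finset.range (j + 1),
        (ρ N).toOuterMeasure {l | 1 / ((j : ℝ) + 1) ≤ |l.powerMean k - m k|}) atTop (𝓝 0) := by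
      rw [← Finset.sum_const_zero (s := Finset.range (j + 1))]
      exact tendsto_finsetSum _ fun k _ => h k _ (by positivity)
    obtain ⟨N, hN, hlt⟩ := ((eventually_ge_atTop 1).and
      (h1.eventually_lt_const zero_lt_one)).exists
    refine ⟨N, hN, ?_⟩
    by_contra hcon
    push Not at hcon
    have h2 : (ρ N).toOuterMeasure univ ≤ ∑ k ∈ Finset.range (j + 1),
        (ρ N).toOuterMeasure {l | 1 / ((j : ℝ) + 1) ≤ |l.powerMean k - m k|} := by
      refine ((ρ N).toOuterMeasure.mono fun l _ => ?_).trans (measure_biUnion_finset_le _ _)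
      obtain ⟨k, hk, hkl⟩ := hcon l
      exact mem_biUnion (Finset.mem_coe.2 (Finset.mem_range.2 (by omega))) hkl
    have h3 : (ρ N).toOuterMeasure univ = 1 := by
      rw [PMF.toOuterMeasure_apply, indicator_univ, (ρ N).tsum_coe]
    rw [h3] at h2
    exact absurd hlt (not_lt.2 h2)
  choose N hN l hl using hex
  constructor
  · have hmom : ∀ k, Tendsto (fun j => (l j).powerMean k) atTop (𝓝 (m k)) := fun k => by
      rw [tendsto_iff_norm_sub_tendsto_zero]
      refine squeeze_zero' (Eventually.of_forall fun _ => norm_nonneg _) ?_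
        tendsto_one_div_add_atTop_nhds_zero_nat
      filter_upwards [eventually_ge_atTop k] with j hj
      exact (hl j k hj).le
    obtain ⟨μ, hμ⟩ := exists_probabilityMeasure_of_tendsto_moments
      (fun j => ⟨(l j).empiricalMeasure, (l j).isProbabilityMeasure_empiricalMeasure (hN j)⟩)
      (fun j k => (l j).integrable_empiricalMeasure (hN j) _) (m := m) (fun k => by
        simp only [ProbabilityMeasure.coe_mk, Signature.integral_empiricalMeasure]
        exact hmom k)
    refine ⟨μ, inferInstance, fun k => (hμ k).1, fun k ε hε => ?_⟩
    simp only [Signature.integral_empiricalMeasure, (hμ k).2]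
    exact h k ε hε
  · intro μ hμ k
    by_contra hne
    -- limits in probability are unique
    set δ := |(∫ x, x ^ k ∂μ) - m k| / 2 with hδ
    have hδ0 : 0 < δ := half_pos (abs_pos.2 (sub_ne_zero.2 hne))
    have h1 := hμ.2.2 k δ hδ0
    simp only [Signature.integral_empiricalMeasure] at h1
    have h2 := h1.add (h k δ hδ0)
    rw [add_zero] at h2
    obtain ⟨n, hn⟩ := (h2.eventually_lt_const zero_lt_one).exists
    have h3 : (ρ n).toOuterMeasure univ ≤
        (ρ n).toOuterMeasure {l | δ ≤ |l.powerMean k - ∫ x, x ^ k ∂μ|} +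
          (ρ n).toOuterMeasure {l | δ ≤ |l.powerMean k - m k|} := by
      refine ((ρ n).toOuterMeasure.mono fun l _ => ?_).trans (measure_union_le _ _)
      by_contra hcon
      simp only [mem_union, mem_ofPred_eq, not_or, not_le] at hcon
      have h4 := abs_sub_le (∫ x, x ^ k ∂μ) (l.powerMean k) (m k)
      rw [abs_sub_comm _ (l.powerMean k)] at h4
      linarith [hcon.1, hcon.2]
    have h4 : (ρ n).toOuterMeasure univ = 1 := by
      rw [PMF.toOuterMeasure_apply, indicator_univ, (ρ n).tsum_coe]
    rw [h4] at h3
    exact absurd hn (not_lt.2 h3)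

end EmpiricalMeasure

/-! ### Substituting the exponential in a residue -/

section ExpSubstitution

open Metric Set

theorem dslope_exp_zero :
    dslope Complex.exp 0 0 = 1 ∧ deriv (dslope Complex.exp 0) 0 = 1 / 2 := by
  refine ⟨by simp [dslope_same], ?_⟩
  have h : HasFPowerSeriesAt Complex.exp (NormedSpace.expSeries ℂ ℂ) 0 := by
    rw [Complex.exp_eq_exp_ℂ]
    exact NormedSpace.exp_hasFPowerSeriesAt_zero
  rw [h.has_fpower_series_dslope_fslope.deriv]
  change FormalMultilinearSeries.coeff _ 1 = _
  rw [FormalMultilinearSeries.coeff_fslope]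
  simp [FormalMultilinearSeries.coeff, NormedSpace.expSeries]

/-- With `exp v - 1 = v E v` and `exp v - E v = v D v`, the function `expKernel` is `D / E`; at `0` its
value is `D 0 = 1 - 1 / 2`. -/
theorem differentiableOn_expKernel : DifferentiableOn ℂ expKernel (ball 0 1) := by
  set E := dslope Complex.exp 0 with hE
  obtain ⟨hE0, hE1⟩ : E 0 = 1 ∧ deriv E 0 = 1 / 2 := dslope_exp_zero
  have hEd : Differentiable ℂ E := by
    rw [← differentiableOn_univ]
    exact (Complex.differentiableOn_dslope univ_mem).2 Complex.differentiable_exp.differentiableOn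
  have hEv : ∀ v, v * E v = Complex.exp v - 1 := fun v => by
    have := sub_smul_dslope Complex.exp 0 v
    simpa using this
  set g : ℂ → ℂ := fun v => Complex.exp v - E v with hg
  have hgd : Differentiable ℂ g := Complex.differentiable_exp.sub hEd
  have hDd : Differentiable ℂ (dslope g 0) := by
    rw [← differentiableOn_univ]
    exact (Complex.differentiableOn_dslope univ_mem).2 hgd.differentiableOn
  have hDv : ∀ v, v * dslope g 0 v = Complex.exp v - E v := fun v => by
    have := sub_smul_dslope g 0 v
    simpa [hg, hE0] using this
  have hEne : ∀ v ∈ ball (0 : ℂ) 1, E v ≠ 0 := by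
    intro v hv h
    rcases eq_or_ne v 0 with rfl | hv0
    · exact one_ne_zero (hE0.symm.trans h)
    · refine exp_ne_one_of_norm_le_one hv0 (mem_ball_zero_iff.1 hv).le ?_
      rw [← sub_eq_zero, ← hEv, h, mul_zero]
  refine (hDd.differentiableOn.div hEd.differentiableOn hEne).congr fun v hv => ?_
  rcases eq_or_ne v 0 with rfl | hv0
  · have : deriv g 0 = 1 / 2 := by
      rw [hg, deriv_fun_sub Complex.differentiableAt_exp hEd.differentiableAt, hE1,
        Complex.deriv_exp, Complex.exp_zero]
      norm_num
    simp [expKernel, dslope_same, this, hE0]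
  · have h1 := hEne v hv
    rw [expKernel, Function.update_of_ne hv0, ← hEv, Pi.div_apply, div_sub_div _ _ (mul_ne_zero hv0 h1) hv0,
      div_eq_div_iff (mul_ne_zero (mul_ne_zero hv0 h1) hv0) h1]
    linear_combination (-v * E v) * hDv v

/-- Substitution of `z = exp v` in the residue of `Ψ z / (z - 1) ^ n` at `1`. -/
theorem circleIntegral_exp_substitution {U : Set ℂ} (hU : IsOpen U) {r R : ℝ} (hr : 0 < r)
    (hr1 : r < 1) (hR : 0 < R) (hRU : closedBall 1 R ⊆ U)
    (hrU : ∀ v ∈ closedBall (0 : ℂ) r, Complex.exp v ∈ U) (n : ℕ) {Ψ : ℂ → ℂ} (hΨ : DifferentiableOn ℂ Ψ U) :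
    (∮ v in C(0, r), Complex.exp v * Ψ (Complex.exp v) / (Complex.exp v - 1) ^ n) =
      ∮ z in C(1, R), Ψ z / (z - 1) ^ n := by
  have hexp : ∀ v ∈ sphere (0 : ℂ) r, Complex.exp v - 1 ≠ 0 := fun v hv => by
    have hv' := mem_sphere_zero_iff_norm.1 hv
    exact sub_ne_zero.2 (exp_ne_one_of_norm_le_one (norm_pos_iff.1 (hv' ▸ hr)) (hv' ▸ hr1.le))
  have hz1 : ∀ z ∈ sphere (1 : ℂ) R, z - 1 ≠ 0 := fun z hz => by
    rw [← norm_pos_iff, mem_sphere_iff_norm.1 hz]; exact hR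
  have hcomp : ∀ {Φ : ℂ → ℂ}, DifferentiableOn ℂ Φ U →
      ContinuousOn (fun v => Φ (Complex.exp v)) (closedBall 0 r) := fun {Φ} hΦ v hv =>
    (ContinuousAt.comp (g := Φ) (f := Complex.exp) (hΦ.differentiableAt (hU.mem_nhds (hrU v hv))).continuousAt
      Complex.continuous_exp.continuousAt).continuousWithinAt
  induction n generalizing Ψ with
  | zero =>
    simp only [pow_zero, div_one]
    rw [Complex.circleIntegral_eq_zero_of_differentiable_on_off_countable hr.le countable_empty
        (f := fun v => Complex.exp v * Ψ (Complex.exp v)) (Complex.continuous_exp.continuousOn.mul (hcomp hΨ)) fun v hv => ?_,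
      Complex.circleIntegral_eq_zero_of_differentiable_on_off_countable hR.le countable_empty
        (hΨ.continuousOn.mono hRU) fun z hz =>
          hΨ.differentiableAt (hU.mem_nhds (hRU (ball_subset_closedBall hz.1)))]
    exact Complex.differentiableAt_exp.mul (DifferentiableAt.comp v
      (hΨ.differentiableAt (hU.mem_nhds (hrU v (ball_subset_closedBall hv.1)))) Complex.differentiableAt_exp)
  | succ n ih =>
    have hφ : DifferentiableOn ℂ (dslope Ψ 1) U :=
      (Complex.differentiableOn_dslope
        (hU.mem_nhds (hRU (mem_closedBall_self hR.le)))).2 hΨ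
    have hsplit : ∀ z, Ψ z = Ψ 1 + (z - 1) * dslope Ψ 1 z := fun z => by
      have := sub_smul_dslope Ψ 1 z
      rw [smul_eq_mul] at this
      rw [this]; ring
    -- the residues of the powers of `z - 1`
    have hpow : (∮ v in C(0, r), Complex.exp v / (Complex.exp v - 1) ^ (n + 1)) =
        ∮ z in C(1, R), ((z - 1) ^ (n + 1))⁻¹ := by
      rcases n with _ | n
      · have e1 : (∮ v in C(0, r), Complex.exp v / (Complex.exp v - 1) ^ (0 + 1)) =
            ∮ v in C(0, r), (expKernel v + (v - 0)⁻¹) := by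
          refine circleIntegral.integral_congr hr.le fun v hv => ?_
          have hv0 : v ≠ 0 := norm_pos_iff.1 (mem_sphere_zero_iff_norm.1 hv ▸ hr)
          simp only [expKernel, Function.update_of_ne hv0]
          simp
        have hsub : closedBall (0 : ℂ) r ⊆ ball 0 1 := closedBall_subset_ball hr1
        rw [e1, circleIntegral.integral_add (g := fun v => (v - 0)⁻¹)
          ((differentiableOn_expKernel.continuousOn.mono
            (sphere_subset_closedBall.trans hsub)).circleIntegrable hr.le)
          (ContinuousOn.circleIntegrable hr.le (ContinuousOn.inv₀ (by fun_prop) fun v hv => by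
            rw [sub_zero, ← norm_pos_iff, mem_sphere_zero_iff_norm.1 hv]; exact hr)),
          Complex.circleIntegral_eq_zero_of_differentiable_on_off_countable hr.le countable_empty
            (differentiableOn_expKernel.continuousOn.mono hsub) fun v hv =>
              differentiableOn_expKernel.differentiableAt
                (isOpen_ball.mem_nhds (hsub (ball_subset_closedBall hv.1))),
          circleIntegral.integral_sub_center_inv _ hr.ne', zero_add]
        simp only [zero_add, pow_one]
        rw [circleIntegral.integral_sub_center_inv _ hR.ne']
      · have e1 : (∮ v in C(0, r), Complex.exp v / (Complex.exp v - 1) ^ (n + 1 + 1)) = 0 := by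
          refine circleIntegral.integral_eq_zero_of_hasDerivWithinAt (f := fun v =>
            -((n : ℂ) + 1)⁻¹ * ((Complex.exp v - 1) ^ (n + 1))⁻¹) hr.le fun v hv => ?_
          have h1 := hexp v hv
          have h2 := ((((Complex.hasDerivAt_exp v).sub_const 1).fun_pow (n + 1)).fun_inv
            (pow_ne_zero _ h1)).const_mul (-((n : ℂ) + 1)⁻¹)
          refine (h2.congr_deriv ?_).hasDerivWithinAt
          have h3 : (n : ℂ) + 1 ≠ 0 := Nat.cast_add_one_ne_zero n
          push_cast
          field_simp
          ring
        have e2 : (∮ z in C(1, R), ((z - 1) ^ (n + 1 + 1))⁻¹) =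
            ∮ z in C(1, R), (z - 1) ^ (-((n : ℤ) + 2)) := by
          refine circleIntegral.integral_congr hR.le fun z hz => ?_
          rw [zpow_neg]
          norm_cast
        rw [e1, e2, circleIntegral.integral_sub_zpow_of_ne (by omega)]
    have e1 : (∮ v in C(0, r), Complex.exp v * Ψ (Complex.exp v) /
        (Complex.exp v - 1) ^ (n + 1)) = ∮ v in C(0, r), (Ψ 1 * (Complex.exp v /
          (Complex.exp v - 1) ^ (n + 1)) + Complex.exp v * dslope Ψ 1 (Complex.exp v) /
            (Complex.exp v - 1) ^ n) := by
      refine circleIntegral.integral_congr hr.le fun v hv => ?_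
      have h1 := hexp v hv
      rw [hsplit (Complex.exp v)]
      field_simp
      ring
    have e2 : (∮ z in C(1, R), Ψ z / (z - 1) ^ (n + 1)) =
        ∮ z in C(1, R), (Ψ 1 * ((z - 1) ^ (n + 1))⁻¹ + dslope Ψ 1 z / (z - 1) ^ n) := by
      refine circleIntegral.integral_congr hR.le fun z hz => ?_
      have h1 := hz1 z hz
      rw [hsplit z]
      field_simp
      ring
    have c1 : ∀ m : ℕ, ∀ v ∈ sphere (0 : ℂ) r, (Complex.exp v - 1) ^ m ≠ 0 := fun m v hv =>
      pow_ne_zero _ (hexp v hv)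
    have c2 : ∀ m : ℕ, ∀ z ∈ sphere (1 : ℂ) R, (z - 1) ^ m ≠ 0 := fun m z hz =>
      pow_ne_zero _ (hz1 z hz)
    rw [e1, e2, circleIntegral.integral_add, circleIntegral.integral_add,
      circleIntegral.integral_const_mul, circleIntegral.integral_const_mul, hpow, ih hφ]
    · exact ContinuousOn.circleIntegrable hR.le (continuousOn_const.mul
        (ContinuousOn.inv₀ (by fun_prop) (c2 _)))
    · exact ContinuousOn.circleIntegrable hR.le
        ((hφ.continuousOn.mono (sphere_subset_closedBall.trans hRU)).div (by fun_prop) (c2 _))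
    · exact ContinuousOn.circleIntegrable hr.le (continuousOn_const.mul
        (Complex.continuous_exp.continuousOn.div (by fun_prop) (c1 _)))
    · exact ContinuousOn.circleIntegrable hr.le ((Complex.continuous_exp.continuousOn.mul
        ((hcomp hφ).mono sphere_subset_closedBall)).div (by fun_prop) (c1 _))

end ExpSubstitution

/-! ### The limiting moments as Taylor coefficients -/

section LimitMoment

open Metric Set

/-- The Taylor series at `0` of a function of one complex variable. -/
noncomputable def taylorSeries (h : ℂ → ℂ) : PowerSeries ℂ :=
  PowerSeries.mk fun n => iteratedDeriv n h 0 / (n.factorial : ℂ)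

@[simp] theorem coeff_taylorSeries (h : ℂ → ℂ) (n : ℕ) :
    PowerSeries.coeff n (taylorSeries h) = iteratedDeriv n h 0 / (n.factorial : ℂ) :=
  PowerSeries.coeff_mk _ _

theorem taylorSeries_mul {g h : ℂ → ℂ} (hg : AnalyticAt ℂ g 0) (hh : AnalyticAt ℂ h 0) :
    taylorSeries (fun v => g v * h v) = taylorSeries g * taylorSeries h := by
  ext n
  rw [PowerSeries.coeff_mul, Finset.Nat.sum_antidiagonal_eq_sum_range_succ_mk, coeff_taylorSeries,
    iteratedDeriv_fun_mul hg.contDiffAt hh.contDiffAt, Finset.sum_div]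
  refine Finset.sum_congr rfl fun i hi => ?_
  have hi' : i ≤ n := Nat.lt_succ_iff.1 (Finset.mem_range.1 hi)
  have h0 : ∀ j : ℕ, (j.factorial : ℂ) ≠ 0 := fun j => Nat.cast_ne_zero.2 j.factorial_ne_zero
  simp only [coeff_taylorSeries]
  rw [Nat.cast_choose ℂ hi']
  have h1 := h0 i
  have h2 := h0 n
  have h3 := h0 (n - i)
  field_simp

theorem taylorSeries_const (c : ℂ) : taylorSeries (fun _ => c) = PowerSeries.C c := by
  ext n
  rw [coeff_taylorSeries, iteratedDeriv_const, PowerSeries.coeff_C]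
  split_ifs with h <;> simp [h]

theorem taylorSeries_id : taylorSeries (fun v => v) = PowerSeries.X := by
  ext n
  rw [coeff_taylorSeries, PowerSeries.coeff_X]
  rcases n with _ | _ | n
  · simp
  · simp
  · have : iteratedDeriv (n + 1 + 1) (fun v : ℂ => v) 0 = 0 := by
      rw [iteratedDeriv_succ', iteratedDeriv_succ']
      simp
    simp [this]

theorem taylorSeries_pow {h : ℂ → ℂ} (hh : AnalyticAt ℂ h 0) (n : ℕ) :
    taylorSeries (fun v => h v ^ n) = taylorSeries h ^ n := by
  induction n with
  | zero => simpa using taylorSeries_const 1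
  | succ n ih => simp only [pow_succ]; rw [taylorSeries_mul (hh.fun_pow n) hh, ih]

theorem taylorSeries_one_add_mul {h : ℂ → ℂ} (hh : AnalyticAt ℂ h 0) :
    taylorSeries (fun v => 1 + v * h v) = 1 + PowerSeries.X * taylorSeries h := by
  rw [← taylorSeries_id, ← taylorSeries_mul (g := fun v => v) analyticAt_id hh]
  ext n
  have h1 : AnalyticAt ℂ (fun v => v * h v) 0 := analyticAt_id.mul hh
  rw [map_add, coeff_taylorSeries, coeff_taylorSeries,
    iteratedDeriv_fun_add contDiffAt_const h1.contDiffAt, add_div, iteratedDeriv_const,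
    PowerSeries.coeff_one]
  congr 1
  split_ifs with h <;> simp [h]

/-- Cauchy's formula for the Taylor coefficients in terms of the Laurent expansion of
`(1 / v + h v) ^ (k + 1)`. -/
theorem circleIntegral_inv_add_pow {h : ℂ → ℂ} {r : ℝ} (hr : 0 < r)
    (hh : ∀ v ∈ closedBall (0 : ℂ) r, DifferentiableAt ℂ h v) (hh0 : AnalyticAt ℂ h 0) (k : ℕ) :
    (2 * Real.pi * Complex.I : ℂ)⁻¹ * (∮ v in C(0, r), (1 / v + h v) ^ (k + 1)) =
      PowerSeries.coeff k ((1 + PowerSeries.X * taylorSeries h) ^ (k + 1)) := by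
  have h1 : (∮ v in C(0, r), (1 / v + h v) ^ (k + 1)) =
      ∮ v in C(0, r), (1 / (v - 0) ^ (k + 1)) • (1 + v * h v) ^ (k + 1) := by
    refine circleIntegral.integral_congr hr.le fun v hv => ?_
    have hv0 : v ≠ 0 := norm_pos_iff.1 (mem_sphere_zero_iff_norm.1 hv ▸ hr)
    simp only [sub_zero, smul_eq_mul]
    rw [← one_div_pow, ← mul_pow]
    congr 1
    field_simp
  have h2 : AnalyticAt ℂ (fun v => 1 + v * h v) 0 := analyticAt_const.add (analyticAt_id.mul hh0)
  rw [h1, DifferentiableOn.circleIntegral_one_div_sub_center_pow_smul hr k fun v hv =>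
    (((differentiableAt_const (1 : ℂ)).fun_add (differentiableAt_fun_id.fun_mul (hh v hv))).fun_pow
      (k + 1)).differentiableWithinAt, ← taylorSeries_one_add_mul hh0, ← taylorSeries_pow h2,
    coeff_taylorSeries, smul_eq_mul]
  have := Complex.two_pi_I_ne_zero
  field_simp

theorem cumulantFunction_eq {K : ℕ} (f : (Fin (K + 1) → ℂ) → ℂ) (v : ℂ) :
    cumulantFunction f v = expKernel v +
      Complex.exp v * partialFirst f (rootCluster K (Complex.exp v)) := by
  rw [cumulantFunction]
  congr 3
  ext j
  rw [rootCluster]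
  ring

theorem differentiable_rootCluster (K : ℕ) : Differentiable ℂ (rootCluster K) :=
  differentiable_pi.2 fun j => by simp only [rootCluster]; fun_prop

theorem analyticAt_cumulantFunction {K : ℕ} {f : (Fin (K + 1) → ℂ) → ℂ} (hf : AnalyticAt ℂ f 1) :
    AnalyticAt ℂ (cumulantFunction f) 0 := by
  have h1 : AnalyticAt ℂ (fun v => partialFirst f (rootCluster K (Complex.exp v))) 0 := by
    refine AnalyticAt.comp (g := partialFirst f) (f := fun v => rootCluster K (Complex.exp v)) ?_
      (((differentiable_rootCluster K).comp Complex.differentiable_exp).analyticAt 0)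
    rw [Complex.exp_zero, rootCluster_one]
    exact analyticAt_partialFirst hf
  have h2 : cumulantFunction f = fun v => expKernel v +
      Complex.exp v * partialFirst f (rootCluster K (Complex.exp v)) :=
    funext (cumulantFunction_eq f)
  rw [h2]
  exact (differentiableOn_expKernel.analyticAt (ball_mem_nhds _ one_pos)).add
    (Complex.differentiable_exp.analyticAt 0 |>.mul h1)

/-- For symmetric `f` with `f 1 = 1`, the contour integrals that give the limiting moments are Taylor
coefficients of powers of `1 + v H v`, where `H` is the cumulant function of `f`. The denominator
`f (rootCluster K z) = 1 + O ((z - 1) ^ (K + 1))` does not contribute to moments of order `k ≤ K`. -/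
theorem eventually_limitMoment_eq {K : ℕ} {f : (Fin (K + 1) → ℂ) → ℂ} (hf : AnalyticAt ℂ f 1)
    (hf1 : f 1 = 1) (hsymm : ∀ᶠ u in 𝓝 (1 : Fin (K + 1) → ℂ), f (u ∘ finRotate (K + 1)) = f u) :
    ∀ᶠ R in 𝓝[>] (0 : ℝ), ∀ k ≤ K, limitMoment K k R f =
      ((k : ℂ) + 1)⁻¹ * PowerSeries.coeff k
        ((1 + PowerSeries.X * taylorSeries (cumulantFunction f)) ^ (k + 1)) := by
  have hnear : ∀ᶠ z in 𝓝 (1 : ℂ), z ≠ 0 ∧ AnalyticAt ℂ f (rootCluster K z) ∧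
      f (rootCluster K z) ≠ 0 ∧ f (rootCluster K z ∘ finRotate (K + 1)) = f (rootCluster K z) := by
    have h1 : Tendsto (rootCluster K) (𝓝 1) (𝓝 1) := by
      simpa using (continuous_rootCluster K).tendsto 1
    exact (eventually_ne_nhds one_ne_zero).and (h1.eventually (hf.eventually_analyticAt.and
      ((hf.continuousAt.eventually_ne (by simp [hf1])).and hsymm)))
  obtain ⟨R₀, hR₀, hsub⟩ := nhds_basis_ball.mem_iff.1 hnear
  filter_upwards [Ioo_mem_nhdsGT hR₀] with R hR k hk
  have hRU : closedBall (1 : ℂ) R ⊆ ball 1 R₀ := closedBall_subset_ball hR.2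
  set a : ℂ → ℂ := fun z => partialFirst f (rootCluster K z) with ha
  set b : ℂ → ℂ := fun z => f (rootCluster K z) with hb
  have had : DifferentiableOn ℂ a (ball 1 R₀) := fun z hz =>
    (DifferentiableAt.comp z (analyticAt_partialFirst (hsub hz).2.1).differentiableAt
      (differentiable_rootCluster K z)).differentiableWithinAt
  have hbd : DifferentiableOn ℂ b (ball 1 R₀) := fun z hz =>
    (DifferentiableAt.comp z (hsub hz).2.1.differentiableAt
      (differentiable_rootCluster K z)).differentiableWithinAt
  have hb0 : ∀ z ∈ ball (1 : ℂ) R₀, b z ≠ 0 := fun z hz => (hsub hz).2.2.1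
  have hz0 : ∀ z ∈ ball (1 : ℂ) R₀, z ≠ 0 := fun z hz => (hsub hz).1
  obtain ⟨g, hgd, hg⟩ := exists_eq_add_pow_mul_of_rotation_invariant hR₀ hbd fun z hz => by
    rw [hb]; simp only; rw [rootCluster_rotate]; exact (hsub hz).2.2.2
  have hb1 : b 1 = 1 := by simp [hb, hf1]
  rw [hb1] at hg
  set A : ℂ → ℂ := fun z => z + (z - 1) * z * a z / b z with hA
  set B : ℂ → ℂ := fun z => z + (z - 1) * z * a z with hB
  have hBd : DifferentiableOn ℂ B (ball 1 R₀) :=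
    differentiableOn_id.add (((differentiableOn_id.sub_const 1).mul differentiableOn_id).mul had)
  have hAd : DifferentiableOn ℂ A (ball 1 R₀) :=
    differentiableOn_id.add ((((differentiableOn_id.sub_const 1).mul differentiableOn_id).mul
      had).div hbd hb0)
  have hz1 : ∀ z ∈ sphere (1 : ℂ) R, z - 1 ≠ 0 := fun z hz => by
    rw [← norm_pos_iff, mem_sphere_iff_norm.1 hz]; exact hR.1
  -- the denominator may be dropped
  have hdrop : (∮ z in C(1, R), z⁻¹ * (z / (z - 1) + z * a z / b z) ^ (k + 1)) =
      ∮ z in C(1, R), z⁻¹ * B z ^ (k + 1) / (z - 1) ^ (k + 1) := by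
    set s : ℂ → ℂ := fun z => -(∑ i ∈ Finset.range (k + 1), A z ^ i * B z ^ (k + 1 - 1 - i)) *
      (a z * g z / b z) * (z - 1) ^ (K + 1 - k) with hs
    have hsd : DifferentiableOn ℂ s (ball 1 R₀) := by
      refine ((DifferentiableOn.fun_sum fun i _ => (hAd.pow i).mul (hBd.pow _)).neg.mul
        ((had.mul hgd).div hbd hb0)).mul ?_
      fun_prop
    have h0 : (∮ z in C(1, R), s z) = 0 :=
      Complex.circleIntegral_eq_zero_of_differentiable_on_off_countable hR.1.le countable_empty
        (hsd.continuousOn.mono hRU) fun z hz => hsd.differentiableAt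
          (isOpen_ball.mem_nhds (hRU (ball_subset_closedBall hz.1)))
    have h1 : (∮ z in C(1, R), z⁻¹ * (z / (z - 1) + z * a z / b z) ^ (k + 1)) =
        ∮ z in C(1, R), (z⁻¹ * B z ^ (k + 1) / (z - 1) ^ (k + 1) + s z) := by
      refine circleIntegral.integral_congr hR.1.le fun z hz => ?_
      have hzb := hRU (sphere_subset_closedBall hz)
      have e1 := hz1 z hz
      have e2 := hb0 z hzb
      have e3 := hz0 z hzb
      have e4 : z / (z - 1) + z * a z / b z = A z / (z - 1) := by
        simp only [hA]; field_simp
      have e5 := geom_sum₂_mul (A z) (B z) (k + 1)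
      have e6 : A z - B z = -((z - 1) ^ (k + 1) * z * ((a z * g z / b z) * (z - 1) ^ (K + 1 - k))) := by
        have e7 : (z - 1) ^ (k + 1) * (z - 1) ^ (K + 1 - k) = (z - 1) * (z - 1) ^ (K + 1) := by
          rw [← pow_add, ← pow_succ']; congr 1; omega
        have e8 := hg z hzb
        simp only [hA, hB]
        field_simp
        linear_combination (1 - z) * a z * e8 + a z * g z * e7
      rw [e4, div_pow, eq_comm]
      have e9 : s z * (z * (z - 1) ^ (k + 1)) = A z ^ (k + 1) - B z ^ (k + 1) := by
        rw [← e5, e6]; simp only [hs]; ring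
      field_simp
      linear_combination e9
    rw [h1, circleIntegral.integral_add, h0, add_zero]
    · refine ContinuousOn.circleIntegrable hR.1.le (ContinuousOn.div ((continuousOn_id.inv₀
        fun z hz => hz0 z (hRU (sphere_subset_closedBall hz))).mul ((hBd.continuousOn.mono
          (sphere_subset_closedBall.trans hRU)).pow _)) (by fun_prop) fun z hz =>
            pow_ne_zero _ (hz1 z hz))
    · exact ContinuousOn.circleIntegrable hR.1.le
        (hsd.continuousOn.mono (sphere_subset_closedBall.trans hRU))
  -- a small circle that the exponential maps into the domain of holomorphy
  obtain ⟨r, hr, hrsub⟩ := nhds_basis_closedBall.mem_iff.1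
    ((Complex.continuous_exp.tendsto 0).eventually
      (by rw [Complex.exp_zero]; exact ball_mem_nhds (1 : ℂ) hR₀) |>.and
      (ball_mem_nhds (0 : ℂ) one_pos))
  have hr1 : r < 1 := by
    have := (hrsub (show (r : ℂ) ∈ closedBall 0 r by simp [abs_of_pos hr])).2
    have h := mem_ball_zero_iff.1 this
    rwa [Complex.norm_real, Real.norm_of_nonneg hr.le] at h
  have hH : ∀ v ∈ closedBall (0 : ℂ) r, DifferentiableAt ℂ (cumulantFunction f) v := by
    intro v hv
    rw [show cumulantFunction f = fun v => expKernel v + Complex.exp v * a (Complex.exp v) from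
      funext (cumulantFunction_eq f)]
    refine (differentiableOn_expKernel.differentiableAt
      (isOpen_ball.mem_nhds (hrsub hv).2)).add (Complex.differentiableAt_exp.mul ?_)
    exact DifferentiableAt.comp v (had.differentiableAt (isOpen_ball.mem_nhds (hrsub hv).1))
      Complex.differentiableAt_exp
  have hsubst := circleIntegral_exp_substitution isOpen_ball hr hr1 hR.1 hRU
    (fun v hv => (hrsub hv).1) (k + 1) (Ψ := fun z => z⁻¹ * B z ^ (k + 1))
    ((differentiableOn_id.inv hz0).mul (hBd.pow _))
  rw [limitMoment, hdrop, ← hsubst,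
    ← circleIntegral_inv_add_pow hr hH (analyticAt_cumulantFunction hf)]
  congr 2
  refine circleIntegral.integral_congr hr.le fun v hv => ?_
  have hv' := mem_sphere_zero_iff_norm.1 hv
  have hv0 : v ≠ 0 := norm_pos_iff.1 (hv' ▸ hr)
  have e1 := sub_ne_zero.2 (exp_ne_one_of_norm_le_one hv0 (hv' ▸ hr1.le))
  have e2 := Complex.exp_ne_zero v
  rw [mul_inv_cancel_left₀ e2, ← div_pow, cumulantFunction_eq, expKernel,
    Function.update_of_ne hv0]
  congr 1
  simp only [hB, ha]
  field_simp
  ring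

/-- The limiting moments in terms of the derivatives of the powers of the cumulant function. -/
theorem coeff_one_add_X_mul_taylorSeries_pow {h : ℂ → ℂ} (hh : AnalyticAt ℂ h 0) (k : ℕ) :
    ((k : ℂ) + 1)⁻¹ * PowerSeries.coeff k ((1 + PowerSeries.X * taylorSeries h) ^ (k + 1)) =
      ∑ l ∈ Finset.range (k + 1), (k.choose l : ℂ) * (1 / ((l + 1).factorial : ℂ)) *
        iteratedDeriv l (fun v => h v ^ (k - l)) 0 := by
  rw [add_comm (1 : PowerSeries ℂ), add_pow, map_sum, Finset.mul_sum, Finset.sum_range_succ,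
    ← Finset.sum_range_reflect, Nat.add_sub_cancel]
  have hlast : PowerSeries.coeff k ((PowerSeries.X * taylorSeries h) ^ (k + 1) *
      1 ^ (k + 1 - (k + 1)) * ((k + 1).choose (k + 1) : PowerSeries ℂ)) = 0 := by
    simp [mul_pow, PowerSeries.coeff_X_pow_mul']
  rw [hlast, mul_zero, add_zero]
  refine Finset.sum_congr rfl fun l hl => ?_
  have hl' : l ≤ k := Nat.lt_succ_iff.1 (Finset.mem_range.1 hl)
  have e1 : (k + 1).choose (k - l) * (l + 1) = (k + 1) * k.choose l := by
    rw [Nat.add_one_mul_choose_eq, ← Nat.choose_symm (show l + 1 ≤ k + 1 by omega)]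
    congr 2
    omega
  rw [one_pow, mul_one, ← map_natCast (PowerSeries.C (R := ℂ)), PowerSeries.coeff_mul_C, mul_pow,
    PowerSeries.coeff_X_pow_mul', if_pos (Nat.sub_le k l), Nat.sub_sub_self hl',
    ← taylorSeries_pow hh, coeff_taylorSeries, Nat.factorial_succ]
  have e2 : ((k + 1).choose (k - l) : ℂ) * (l + 1) = (k + 1) * k.choose l := by exact_mod_cast e1
  have e3 : (k : ℂ) + 1 ≠ 0 := Nat.cast_add_one_ne_zero k
  have e4 : (l : ℂ) + 1 ≠ 0 := Nat.cast_add_one_ne_zero l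
  have e5 : (l.factorial : ℂ) ≠ 0 := Nat.cast_ne_zero.2 l.factorial_ne_zero
  push_cast
  field_simp
  linear_combination (iteratedDeriv l (fun v => h v ^ (k - l)) 0) * e2

end LimitMoment

/-! ### Coefficients of powers of a power series -/

section LagrangeCoefficients

open Finset Finset.Nat

theorem sum_antidiagonal_assoc {M : Type*} [AddCommMonoid M] (f : ℕ → ℕ → ℕ → M) (n : ℕ) :
    ∑ x ∈ antidiagonal n, ∑ y ∈ antidiagonal x.1, f y.1 y.2 x.2 =
      ∑ x ∈ antidiagonal n, ∑ y ∈ antidiagonal x.2, f x.1 y.1 y.2 := by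
  rw [sum_sigma', sum_sigma']
  refine sum_nbij' (fun p => ⟨(p.2.1, p.2.2 + p.1.2), (p.2.2, p.1.2)⟩)
    (fun p => ⟨(p.1.1 + p.2.1, p.2.2), (p.1.1, p.2.1)⟩) ?_ ?_ ?_ ?_ ?_
  · rintro ⟨⟨a, b⟩, c, d⟩ h
    simp only [mem_sigma, HasAntidiagonal.mem_antidiagonal] at h ⊢
    exact ⟨by omega, trivial⟩
  · rintro ⟨⟨a, b⟩, c, d⟩ h
    simp only [mem_sigma, HasAntidiagonal.mem_antidiagonal] at h ⊢
    exact ⟨by omega, trivial⟩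
  · rintro ⟨⟨a, b⟩, c, d⟩ h
    simp only [mem_sigma, HasAntidiagonal.mem_antidiagonal] at h
    obtain ⟨-, rfl⟩ := h
    rfl
  · rintro ⟨⟨a, b⟩, c, d⟩ h
    simp only [mem_sigma, HasAntidiagonal.mem_antidiagonal] at h
    obtain ⟨-, rfl⟩ := h
    rfl
  · rintro ⟨⟨a, b⟩, c, d⟩ _
    rfl

/-- The number `r / (n + r) [v ^ n] C ^ (n + r)`. By Lagrange inversion it is the coefficient of
`z ^ n` in `M ^ r`, where `M` solves `M = C (z M)`. -/
noncomputable def lagrangeCoeff (C : PowerSeries ℂ) (n r : ℕ) : ℂ :=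
  if n + r = 0 then 1 else (r : ℂ) / ((n : ℂ) + r) * PowerSeries.coeff n (C ^ (n + r))

theorem lagrangeCoeff_zero_right (C : PowerSeries ℂ) (n : ℕ) :
    lagrangeCoeff C n 0 = if n = 0 then 1 else 0 := by
  simp [lagrangeCoeff]

/-- Comparison of the coefficients of `(v C') C ^ m` and of `C ^ (m + 1)`. -/
theorem sum_antidiagonal_mul_coeff_pow (C : PowerSeries ℂ) (n m : ℕ) :
    ((m : ℂ) + 1) * ∑ x ∈ antidiagonal n, (x.1 : ℂ) * PowerSeries.coeff x.1 C *
      PowerSeries.coeff x.2 (C ^ m) = n * PowerSeries.coeff n (C ^ (m + 1)) := by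
  have hθ : ∀ (g : PowerSeries ℂ) (j : ℕ),
      PowerSeries.coeff j (PowerSeries.X * PowerSeries.derivative ℂ g) =
        j * PowerSeries.coeff j g := by
    intro g j
    rcases j with _ | j
    · simp
    · rw [PowerSeries.coeff_succ_X_mul, PowerSeries.coeff_derivative]
      push_cast
      ring
  rw [← hθ (C ^ (m + 1)), Derivation.leibniz_pow]
  have h1 : PowerSeries.X * ((m + 1) • C ^ (m + 1 - 1) • PowerSeries.derivative ℂ C) =
      PowerSeries.C ((m : ℂ) + 1) * ((PowerSeries.X * PowerSeries.derivative ℂ C) * C ^ m) := by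
    rw [Nat.add_sub_cancel, smul_eq_mul, nsmul_eq_mul]
    simp only [map_add, map_natCast, map_one]
    push_cast
    ring
  rw [h1, PowerSeries.coeff_C_mul, PowerSeries.coeff_mul]
  simp only [hθ]

/-- The equation `M ^ (r + 1) = M ^ r * C (z M)` for the coefficients. -/
theorem lagrangeCoeff_succ_right {C : PowerSeries ℂ} (hC : PowerSeries.coeff 0 C = 1) (n r : ℕ) :
    lagrangeCoeff C n (r + 1) =
      ∑ x ∈ antidiagonal n, PowerSeries.coeff x.1 C * lagrangeCoeff C x.2 (r + x.1) := by
  rcases Nat.eq_zero_or_pos (n + r) with h0 | h0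
  · obtain ⟨rfl, rfl⟩ : n = 0 ∧ r = 0 := by omega
    simp [lagrangeCoeff, hC]
  have hnr : (n : ℂ) + r ≠ 0 := by exact_mod_cast h0.ne'
  have hnr1 : (n : ℂ) + r + 1 ≠ 0 := by exact_mod_cast (n + r).succ_ne_zero
  have h1 : ∑ x ∈ antidiagonal n, PowerSeries.coeff x.1 C * lagrangeCoeff C x.2 (r + x.1) =
      ((n : ℂ) + r)⁻¹ * (r * PowerSeries.coeff n (C ^ (n + r + 1)) +
        ∑ x ∈ antidiagonal n, (x.1 : ℂ) * PowerSeries.coeff x.1 C *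
          PowerSeries.coeff x.2 (C ^ (n + r))) := by
    rw [pow_succ', PowerSeries.coeff_mul, mul_sum, ← sum_add_distrib, mul_sum]
    refine sum_congr rfl fun x hx => ?_
    have hx' := mem_antidiagonal.1 hx
    have e : x.2 + (r + x.1) = n + r := by omega
    have e' : (x.2 : ℂ) + ((r + x.1 : ℕ) : ℂ) = n + r := by exact_mod_cast e
    rw [lagrangeCoeff, if_neg (by omega), e, e']
    push_cast
    field_simp
  have h2 := sum_antidiagonal_mul_coeff_pow C n (n + r)
  push_cast at h2
  rw [h1, lagrangeCoeff, if_neg (by omega), ← add_assoc]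
  push_cast
  rw [← add_assoc]
  field_simp
  linear_combination -h2

/-- The equation `M ^ r * M ^ s = M ^ (r + s)` for the coefficients. -/
theorem sum_antidiagonal_lagrangeCoeff {C : PowerSeries ℂ} (hC : PowerSeries.coeff 0 C = 1)
    (n r s : ℕ) : ∑ x ∈ antidiagonal n, lagrangeCoeff C x.1 r * lagrangeCoeff C x.2 s =
      lagrangeCoeff C n (r + s) := by
  induction n using Nat.strong_induction_on generalizing r with
  | _ n ihn =>
    induction r with
    | zero =>
      rw [zero_add, sum_eq_single (0, n)]
      · simp [lagrangeCoeff_zero_right]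
      · rintro ⟨i, j⟩ hx hne
        rw [lagrangeCoeff_zero_right, if_neg, zero_mul]
        rintro rfl
        exact hne (by simpa using hx)
      · simp
    | succ r ihr =>
      have h1 : ∑ x ∈ antidiagonal n, lagrangeCoeff C x.1 (r + 1) * lagrangeCoeff C x.2 s =
          ∑ x ∈ antidiagonal n, ∑ y ∈ antidiagonal x.1, PowerSeries.coeff y.1 C *
            (lagrangeCoeff C y.2 (r + y.1) * lagrangeCoeff C x.2 s) := by
        refine sum_congr rfl fun x _ => ?_
        rw [lagrangeCoeff_succ_right hC, sum_mul]
        exact sum_congr rfl fun y _ => mul_assoc _ _ _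
      rw [h1, sum_antidiagonal_assoc fun a l m => PowerSeries.coeff a C *
        (lagrangeCoeff C l (r + a) * lagrangeCoeff C m s), add_right_comm,
        lagrangeCoeff_succ_right hC]
      refine sum_congr rfl fun x hx => ?_
      have hx' := mem_antidiagonal.1 hx
      rw [← mul_sum, add_right_comm]
      congr 1
      rcases Nat.eq_zero_or_pos x.1 with h0 | h0
      · rw [h0, show x.2 = n by omega]
        exact ihr
      · exact ihn x.2 (by omega) _

/-- With `M = C (z M)`, the coefficient of `z ^ (n + 1)` in `∑_j κ_{j + d} (z M) ^ j`, `j ≥ 1`, where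
`κ_j` are the coefficients of `C`. -/
noncomputable def shiftedLagrangeCoeff (C : PowerSeries ℂ) (d n : ℕ) : ℂ :=
  ∑ x ∈ antidiagonal n, PowerSeries.coeff (x.1 + 1 + d) C * lagrangeCoeff C x.2 (x.1 + 1)

theorem shiftedLagrangeCoeff_zero {C : PowerSeries ℂ} (hC : PowerSeries.coeff 0 C = 1) (n : ℕ) :
    shiftedLagrangeCoeff C 0 n = lagrangeCoeff C (n + 1) 1 := by
  rw [← zero_add 1, lagrangeCoeff_succ_right hC, sum_antidiagonal_succ, zero_add]
  simp only [zero_add, add_zero, lagrangeCoeff_zero_right, shiftedLagrangeCoeff]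
  simp

/-- The recursion obtained by splitting off the term `j = 1`. -/
theorem shiftedLagrangeCoeff_rec {C : PowerSeries ℂ} (hC : PowerSeries.coeff 0 C = 1) (d n : ℕ) :
    shiftedLagrangeCoeff C d n = PowerSeries.coeff (1 + d) C * lagrangeCoeff C n 1 +
      ∑ i ∈ range n, lagrangeCoeff C i 1 * shiftedLagrangeCoeff C (d + 1) (n - 1 - i) := by
  rcases n with _ | n
  · simp [shiftedLagrangeCoeff]
  rw [shiftedLagrangeCoeff, sum_antidiagonal_succ, Nat.add_sub_cancel,
    ← sum_antidiagonal_eq_sum_range_succ (fun i j =>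
      lagrangeCoeff C i 1 * shiftedLagrangeCoeff C (d + 1) j)]
  simp only [zero_add, shiftedLagrangeCoeff, mul_sum]
  congr 1
  have h1 : ∀ j m, lagrangeCoeff C m (j + 1 + 1) =
      ∑ y ∈ antidiagonal m, lagrangeCoeff C y.2 1 * lagrangeCoeff C y.1 (j + 1) := fun j m => by
    rw [← sum_antidiagonal_lagrangeCoeff hC]
    exact sum_congr rfl fun _ _ => mul_comm _ _
  simp only [h1, mul_sum]
  rw [← sum_antidiagonal_assoc fun j l i => PowerSeries.coeff (j + 1 + 1 + d) C *
      (lagrangeCoeff C i 1 * lagrangeCoeff C l (j + 1)), ← sum_antidiagonal_swap]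
  refine sum_congr rfl fun x _ => sum_congr rfl fun y _ => ?_
  simp only [Prod.snd_swap]
  rw [show y.1 + 1 + 1 + d = y.1 + 1 + (d + 1) by omega]
  ring

end LagrangeCoefficients

/-! ### Sums over non-crossing partitions -/

section NonCrossing

variable {α : Type*} [LinearOrder α]

/-- The family `P` is the set of blocks of a non-crossing partition of the finite set `S`. -/
structure IsNonCrossingFamily (S : Finset α) (P : Finset (Finset α)) : Prop where
  nonempty : ∀ B ∈ P, B.Nonempty
  mem_iff : ∀ x, x ∈ S ↔ ∃ B ∈ P, x ∈ B
  eq_of_mem : ∀ B ∈ P, ∀ C ∈ P, ∀ x, x ∈ B → x ∈ C → B = C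
  eq_of_lt : ∀ B ∈ P, ∀ C ∈ P, ∀ a ∈ B, ∀ b ∈ C, ∀ c ∈ B, ∀ d ∈ C, a < b → b < c → c < d → B = C

theorem IsNonCrossingFamily.subset {S : Finset α} {P : Finset (Finset α)}
    (h : IsNonCrossingFamily S P) {B : Finset α} (hB : B ∈ P) : B ⊆ S :=
  fun x hx => (h.mem_iff x).2 ⟨B, hB, hx⟩

open Classical in
/-- The non-crossing partitions of a finite set, given by their sets of blocks. -/
noncomputable def nonCrossingFamilies (S : Finset α) : Finset (Finset (Finset α)) :=
  S.powerset.powerset.filter (IsNonCrossingFamily S)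

theorem mem_nonCrossingFamilies {S : Finset α} {P : Finset (Finset α)} :
    P ∈ nonCrossingFamilies S ↔ IsNonCrossingFamily S P := by
  simp only [nonCrossingFamilies, Finset.mem_filter, Finset.mem_powerset, and_iff_right_iff_imp]
  exact fun h B hB => Finset.mem_powerset.2 (h.subset hB)

/-- The sum over the non-crossing partitions of `S` of the products of `κ |B|` over the blocks `B`,
where the block of `a` counts `d` additional elements. -/
noncomputable def nonCrossingSum (κ : ℕ → ℂ) (a : α) (d : ℕ) (S : Finset α) : ℂ :=
  ∑ P ∈ nonCrossingFamilies S, ∏ B ∈ P, κ (B.card + if a ∈ B then d else 0)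

theorem nonCrossingSum_zero (κ : ℕ → ℂ) (a b : α) (S : Finset α) :
    nonCrossingSum κ a 0 S = nonCrossingSum κ b 0 S := by
  simp only [nonCrossingSum, ite_self]

theorem nonCrossingSum_empty (κ : ℕ → ℂ) (a : α) : nonCrossingSum κ a 0 ∅ = 1 := by
  have : nonCrossingFamilies (∅ : Finset α) = {∅} := by
    ext P
    rw [mem_nonCrossingFamilies, Finset.mem_singleton]
    constructor
    · intro h
      rw [Finset.eq_empty_iff_forall_notMem]
      intro B hB
      obtain ⟨x, hx⟩ := h.nonempty B hB
      simpa using h.subset hB hx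
    · rintro rfl
      exact ⟨by simp, by simp, by simp, by simp⟩
  rw [nonCrossingSum, this]
  simp

/-- The non-crossing partitions of `S` with the singleton block `{a}`, `a = min S`. -/
theorem sum_nonCrossingFamilies_singleton (κ : ℕ → ℂ) (d : ℕ) {S : Finset α} {a : α} (ha : a ∈ S)
    (hmin : ∀ x ∈ S, a ≤ x) :
    ∑ P ∈ nonCrossingFamilies S with {a} ∈ P, ∏ B ∈ P, κ (B.card + if a ∈ B then d else 0) =
      κ (1 + d) * nonCrossingSum κ a 0 (S.erase a) := by
  rw [nonCrossingSum, Finset.mul_sum]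
  symm
  have hnot : ∀ P ∈ nonCrossingFamilies (S.erase a), ∀ B ∈ P, a ∉ B := fun P hP B hB haB =>
    Finset.notMem_erase a S ((mem_nonCrossingFamilies.1 hP).subset hB haB)
  have hnot' : ∀ P ∈ nonCrossingFamilies (S.erase a), {a} ∉ P := fun P hP h =>
    hnot P hP _ h (Finset.mem_singleton_self a)
  refine Finset.sum_nbij' (fun P => insert {a} P) (fun P => P.erase {a}) ?_ ?_ ?_ ?_ ?_
  · intro P hP
    rw [Finset.mem_filter, mem_nonCrossingFamilies]
    refine ⟨?_, Finset.mem_insert_self _ _⟩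
    have hP' := mem_nonCrossingFamilies.1 hP
    refine ⟨?_, fun x => ?_, ?_, ?_⟩
    · intro B hB
      rcases Finset.mem_insert.1 hB with rfl | hB
      · exact Finset.singleton_nonempty a
      · exact hP'.nonempty B hB
    · by_cases hx : x = a
      · subst hx
        simp [ha]
      · have := hP'.mem_iff x
        simp only [Finset.mem_erase, ne_eq, hx, not_false_eq_true, true_and] at this
        rw [this]
        simp [hx]
    · intro B hB C hC x hxB hxC
      rcases Finset.mem_insert.1 hB with rfl | hB <;> rcases Finset.mem_insert.1 hC with rfl | hC
      · rfl
      · exact absurd (Finset.mem_singleton.1 hxB ▸ hxC) (hnot P hP C hC)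
      · exact absurd (Finset.mem_singleton.1 hxC ▸ hxB) (hnot P hP B hB)
      · exact hP'.eq_of_mem B hB C hC x hxB hxC
    · intro B hB C hC x hx y hy z hz w hw h1 h2 h3
      rcases Finset.mem_insert.1 hB with rfl | hB
      · rw [Finset.mem_singleton] at hx hz
        exact absurd (h1.trans h2) (by rw [hx, hz]; exact lt_irrefl a)
      rcases Finset.mem_insert.1 hC with rfl | hC
      · rw [Finset.mem_singleton] at hy hw
        exact absurd (h2.trans h3) (by rw [hy, hw]; exact lt_irrefl a)
      exact hP'.eq_of_lt B hB C hC x hx y hy z hz w hw h1 h2 h3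
  · intro P hP
    rw [Finset.mem_filter, mem_nonCrossingFamilies] at hP
    obtain ⟨hP, haP⟩ := hP
    rw [mem_nonCrossingFamilies]
    refine ⟨fun B hB => hP.nonempty B (Finset.mem_of_mem_erase hB), fun x => ?_,
      fun B hB C hC => hP.eq_of_mem B (Finset.mem_of_mem_erase hB) C (Finset.mem_of_mem_erase hC),
      fun B hB C hC => hP.eq_of_lt B (Finset.mem_of_mem_erase hB) C (Finset.mem_of_mem_erase hC)⟩
    rw [Finset.mem_erase, hP.mem_iff]
    constructor
    · rintro ⟨hxa, B, hB, hxB⟩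
      refine ⟨B, Finset.mem_erase.2 ⟨?_, hB⟩, hxB⟩
      rintro rfl
      exact hxa (Finset.mem_singleton.1 hxB)
    · rintro ⟨B, hB, hxB⟩
      replace hB := Finset.mem_erase.1 hB
      obtain ⟨hBa, hB⟩ := hB
      refine ⟨?_, B, hB, hxB⟩
      rintro rfl
      exact hBa (hP.eq_of_mem B hB _ haP x hxB (Finset.mem_singleton_self x))
  · intro P hP
    exact Finset.erase_insert (hnot' P hP)
  · intro P hP
    exact Finset.insert_erase (Finset.mem_filter.1 hP).2
  · intro P hP
    rw [Finset.prod_insert (hnot' P hP)]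
    simp only [Finset.card_singleton, Finset.mem_singleton, if_true, ite_self]
    congr 1
    exact Finset.prod_congr rfl fun B hB => by rw [if_neg (hnot P hP B hB)]

/-- The non-crossing partitions of `S` in which `p` is the second element of the block of `a = min S`:
they consist of a non-crossing partition of the elements between `a` and `p` and of a non-crossing
partition of the elements from `p` on, with `a` added to the block of `p`. -/
theorem sum_nonCrossingFamilies_second (κ : ℕ → ℂ) (d : ℕ) {S : Finset α} {a p : α} (ha : a ∈ S)
    (hmin : ∀ x ∈ S, a ≤ x) (hp : p ∈ S) (hap : a < p) :
    ∑ P ∈ nonCrossingFamilies S with (∃ B ∈ P, a ∈ B ∧ p ∈ B ∧ ∀ x ∈ B, x = a ∨ p ≤ x),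
        ∏ B ∈ P, κ (B.card + if a ∈ B then d else 0) =
      nonCrossingSum κ p 0 ((S.erase a).filter (· < p)) *
        nonCrossingSum κ p (d + 1) (S.filter (p ≤ ·)) := by
  set S₁ := (S.erase a).filter (· < p) with hS₁
  set S₂ := S.filter (p ≤ ·) with hS₂
  have m1 : ∀ x, x ∈ S₁ ↔ (x ≠ a ∧ x ∈ S) ∧ x < p := fun x => by
    rw [hS₁, Finset.mem_filter, Finset.mem_erase]
  have m2 : ∀ x, x ∈ S₂ ↔ x ∈ S ∧ p ≤ x := fun x => by rw [hS₂, Finset.mem_filter]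
  -- the element `a` is added to the block of `p`
  set ins : Finset α → Finset α := fun B => if p ∈ B then insert a B else B with hins
  have hmem : ∀ B x, x ∈ ins B ↔ x ∈ B ∨ (x = a ∧ p ∈ B) := by
    intro B x
    simp only [hins]
    split_ifs with h <;> simp [h, or_comm]
  have ha2 : a ∉ S₂ := fun h => absurd ((m2 a).1 h).2 (not_le.2 hap)
  have herase : ∀ B, B ⊆ S₂ → (ins B).erase a = B := by
    intro B hB
    ext x
    rw [Finset.mem_erase, hmem]
    constructor
    · rintro ⟨hx, h | h⟩
      · exact h
      · exact absurd h.1 hx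
    · intro h
      exact ⟨fun hx => ha2 (hx ▸ hB h), Or.inl h⟩
  rw [nonCrossingSum, nonCrossingSum, Finset.sum_mul_sum, ← Finset.sum_product']
  symm
  -- the blocks of a partition of `S` in which `p` follows `a` in its block
  have hkey : ∀ P, IsNonCrossingFamily S P → ∀ B₀ ∈ P, a ∈ B₀ → p ∈ B₀ →
      (∀ x ∈ B₀, x = a ∨ p ≤ x) → ∀ B ∈ P, B = B₀ ∨ B ⊆ S₁ ∨ (B ⊆ S₂ ∧ p ∉ B) := by
    intro P hP B₀ hB₀ haB hpB hB₀x B hB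
    by_cases hBB : B = B₀
    · exact Or.inl hBB
    have hdisj : ∀ x ∈ B, x ∉ B₀ := fun x hx hx' => hBB (hP.eq_of_mem B hB B₀ hB₀ x hx hx')
    refine Or.inr ?_
    have hax : ∀ x ∈ B, a < x := fun x hx =>
      lt_of_le_of_ne (hmin x (hP.subset hB hx)) fun h => hdisj x hx (h ▸ haB)
    by_cases hlt : ∃ y ∈ B, y < p
    · obtain ⟨y, hy, hyp⟩ := hlt
      refine Or.inl fun x hx => (m1 x).2 ⟨⟨(hax x hx).ne', hP.subset hB hx⟩, ?_⟩
      by_contra hxp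
      have hpx : p < x := lt_of_le_of_ne (not_lt.1 hxp) fun h => hdisj x hx (h ▸ hpB)
      exact hBB (hP.eq_of_lt B₀ hB₀ B hB a haB y hy p hpB x hx (hax y hy) hyp hpx).symm
    · push Not at hlt
      exact Or.inr ⟨fun x hx => (m2 x).2 ⟨hP.subset hB hx, hlt x hx⟩, fun h => hdisj p h hpB⟩
  have hnot1 : ∀ B, B.Nonempty → B ⊆ S₂ → ¬ B ⊆ S₁ := by
    rintro B ⟨x, hx⟩ h2 h1
    exact absurd ((m1 x).1 (h1 hx)).2 (not_lt.2 ((m2 x).1 (h2 hx)).2)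
  have hins1 : ∀ B, B.Nonempty → B ⊆ S₂ → ¬ ins B ⊆ S₁ := fun B hB h2 h1 =>
    hnot1 B hB h2 fun x hx => h1 ((hmem B x).2 (Or.inl hx))
  refine Finset.sum_nbij' (fun Q => Q.1 ∪ Q.2.image ins)
    (fun P => (P.filter (· ⊆ S₁), (P.filter fun B => ¬ B ⊆ S₁).image (·.erase a)))
    ?_ ?_ ?_ ?_ ?_
  · rintro ⟨P₁, P₂⟩ hQ
    obtain ⟨h1, h2⟩ := Finset.mem_product.1 hQ
    replace h1 := mem_nonCrossingFamilies.1 h1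
    replace h2 := mem_nonCrossingFamilies.1 h2
    simp only at h1 h2 ⊢
    have hlow : ∀ B ∈ P₁, ∀ x ∈ B, x ≠ a ∧ x ∈ S ∧ x < p := fun B hB x hx => by
      have := (m1 x).1 (h1.subset hB hx)
      exact ⟨this.1.1, this.1.2, this.2⟩
    have hhigh : ∀ B ∈ P₂, ∀ x ∈ B, x ∈ S ∧ p ≤ x := fun B hB x hx =>
      (m2 x).1 (h2.subset hB hx)
    have hhigh' : ∀ B ∈ P₂, ∀ x ∈ ins B, x = a ∧ p ∈ B ∨ (x ∈ B ∧ p ≤ x) := fun B hB x hx => by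
      rcases (hmem B x).1 hx with h | h
      · exact Or.inr ⟨h, (hhigh B hB x h).2⟩
      · exact Or.inl h
    rw [Finset.mem_filter, mem_nonCrossingFamilies]
    refine ⟨⟨?_, fun x => ?_, ?_, ?_⟩, ?_⟩
    · intro B hB
      rcases Finset.mem_union.1 hB with hB | hB
      · exact h1.nonempty B hB
      · obtain ⟨C, hC, rfl⟩ := Finset.mem_image.1 hB
        obtain ⟨x, hx⟩ := h2.nonempty C hC
        exact ⟨x, (hmem C x).2 (Or.inl hx)⟩
    · constructor
      · intro hx
        rcases eq_or_ne x a with rfl | hxa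
        · obtain ⟨C, hC, hpC⟩ := (h2.mem_iff p).1 ((m2 p).2 ⟨hp, le_rfl⟩)
          exact ⟨ins C, Finset.mem_union_right _ (Finset.mem_image_of_mem _ hC),
            (hmem C x).2 (Or.inr ⟨rfl, hpC⟩)⟩
        rcases lt_or_ge x p with hxp | hxp
        · obtain ⟨C, hC, hxC⟩ := (h1.mem_iff x).1 ((m1 x).2 ⟨⟨hxa, hx⟩, hxp⟩)
          exact ⟨C, Finset.mem_union_left _ hC, hxC⟩
        · obtain ⟨C, hC, hxC⟩ := (h2.mem_iff x).1 ((m2 x).2 ⟨hx, hxp⟩)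
          exact ⟨ins C, Finset.mem_union_right _ (Finset.mem_image_of_mem _ hC),
            (hmem C x).2 (Or.inl hxC)⟩
      · rintro ⟨B, hB, hxB⟩
        rcases Finset.mem_union.1 hB with hB | hB
        · exact (hlow B hB x hxB).2.1
        · obtain ⟨C, hC, rfl⟩ := Finset.mem_image.1 hB
          rcases (hmem C x).1 hxB with h | h
          · exact (hhigh C hC x h).1
          · exact h.1 ▸ ha
    · intro B hB C hC x hxB hxC
      rw [Finset.mem_union] at hB hC
      rcases hB with hB | hB <;> rcases hC with hC | hC
      · exact h1.eq_of_mem B hB C hC x hxB hxC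
      · replace hC := Finset.mem_image.1 hC
        obtain ⟨C, hC, rfl⟩ := hC
        obtain ⟨h3, -, h5⟩ := hlow B hB x hxB
        rcases hhigh' C hC x hxC with h | h
        · exact absurd h.1 h3
        · exact absurd h5 (not_lt.2 h.2)
      · replace hB := Finset.mem_image.1 hB
        obtain ⟨B, hB, rfl⟩ := hB
        obtain ⟨h3, -, h5⟩ := hlow C hC x hxC
        rcases hhigh' B hB x hxB with h | h
        · exact absurd h.1 h3
        · exact absurd h5 (not_lt.2 h.2)
      · replace hB := Finset.mem_image.1 hB
        obtain ⟨B, hB, rfl⟩ := hB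
        replace hC := Finset.mem_image.1 hC
        obtain ⟨C, hC, rfl⟩ := hC
        congr 1
        rcases hhigh' B hB x hxB with h | h <;> rcases hhigh' C hC x hxC with h' | h'
        · exact h2.eq_of_mem B hB C hC p h.2 h'.2
        · exact absurd hap (not_lt.2 (h.1 ▸ h'.2))
        · exact absurd hap (not_lt.2 (h'.1 ▸ h.2))
        · exact h2.eq_of_mem B hB C hC x h.1 h'.1
    · intro B hB C hC x hx y hy z hz w hw hxy hyz hzw
      have hxS : ∀ u ∈ S, ¬ u < a := fun u hu => not_lt.2 (hmin u hu)
      rw [Finset.mem_union] at hB hC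
      -- two lower blocks, a lower and an upper block in either order (these cannot cross, because
      -- an upper block has no elements between `a` and `p`), two upper blocks
      rcases hB with hB | hB <;> rcases hC with hC | hC
      · exact h1.eq_of_lt B hB C hC x hx y hy z hz w hw hxy hyz hzw
      · replace hC := Finset.mem_image.1 hC
        obtain ⟨C, hC, rfl⟩ := hC
        obtain ⟨-, h4, -⟩ := hlow B hB x hx
        obtain ⟨-, -, h5⟩ := hlow B hB z hz
        rcases hhigh' C hC y hy with h | h
        · exact absurd (h.1 ▸ hxy) (hxS x h4)
        · exact absurd (hyz.trans h5) (not_lt.2 h.2)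
      · replace hB := Finset.mem_image.1 hB
        obtain ⟨B, hB, rfl⟩ := hB
        obtain ⟨-, h4, -⟩ := hlow C hC y hy
        obtain ⟨-, -, h5⟩ := hlow C hC w hw
        rcases hhigh' B hB z hz with h | h
        · exact absurd (h.1 ▸ hyz) (hxS y h4)
        · exact absurd (hzw.trans h5) (not_lt.2 h.2)
      · replace hB := Finset.mem_image.1 hB
        obtain ⟨B, hB, rfl⟩ := hB
        replace hC := Finset.mem_image.1 hC
        obtain ⟨C, hC, rfl⟩ := hC
        congr 1
        have hge : ∀ D ∈ P₂, ∀ u ∈ ins D, a ≤ u := fun D hD u hu => by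
          rcases hhigh' D hD u hu with h | h
          · exact h.1.ge
          · exact hap.le.trans h.2
        have hstrict : ∀ D ∈ P₂, ∀ u ∈ ins D, a < u → u ∈ D ∧ p ≤ u := fun D hD u hu h => by
          rcases hhigh' D hD u hu with h' | h'
          · exact absurd h'.1 h.ne'
          · exact h'
        have hy' := hstrict C hC y hy ((hge B hB x hx).trans_lt hxy)
        have hz' := hstrict B hB z hz ((hge C hC y hy).trans_lt hyz)
        have hw' := hstrict C hC w hw ((hge B hB z hz).trans_lt hzw)
        -- only the first of the four elements may be `a`, and then it can be replaced by `p`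
        rcases hhigh' B hB x hx with h | h
        · rcases hy'.2.eq_or_lt with hpy | hpy
          · exact h2.eq_of_mem B hB C hC p h.2 (hpy ▸ hy'.1)
          · exact h2.eq_of_lt B hB C hC p h.2 y hy'.1 z hz'.1 w hw'.1 hpy hyz hzw
        · exact h2.eq_of_lt B hB C hC x h.1 y hy'.1 z hz'.1 w hw'.1 hxy hyz hzw
    · obtain ⟨C, hC, hpC⟩ := (h2.mem_iff p).1 ((m2 p).2 ⟨hp, le_rfl⟩)
      refine ⟨ins C, Finset.mem_union_right _ (Finset.mem_image_of_mem _ hC),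
        (hmem C a).2 (Or.inr ⟨rfl, hpC⟩), (hmem C p).2 (Or.inl hpC), fun x hx => ?_⟩
      rcases hhigh' C hC x hx with h | h
      · exact Or.inl h.1
      · exact Or.inr h.2
  · intro P hP
    rw [Finset.mem_filter, mem_nonCrossingFamilies] at hP
    obtain ⟨hP, B₀, hB₀, haB, hpB, hB₀x⟩ := hP
    have hk := hkey P hP B₀ hB₀ haB hpB hB₀x
    rw [Finset.mem_product, mem_nonCrossingFamilies, mem_nonCrossingFamilies]
    have hin : ∀ B, B ∈ (P.filter fun B => ¬ B ⊆ S₁).image (·.erase a) →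
        ∃ C ∈ P, ¬ C ⊆ S₁ ∧ C.erase a = B := fun B hB => by
      obtain ⟨C, hC, rfl⟩ := Finset.mem_image.1 hB
      exact ⟨C, (Finset.mem_filter.1 hC).1, (Finset.mem_filter.1 hC).2, rfl⟩
    have hB₀1 : ¬ B₀ ⊆ S₁ := fun h => absurd ((m1 a).1 (h haB)).1.1 (fun h => h rfl)
    refine ⟨⟨fun B hB => hP.nonempty B (Finset.mem_filter.1 hB).1, fun x => ⟨fun hx => ?_, ?_⟩,
      fun B hB C hC => hP.eq_of_mem B (Finset.mem_filter.1 hB).1 C (Finset.mem_filter.1 hC).1,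
      fun B hB C hC => hP.eq_of_lt B (Finset.mem_filter.1 hB).1 C (Finset.mem_filter.1 hC).1⟩,
      ⟨fun B hB => ?_, fun x => ⟨fun hx => ?_, ?_⟩, ?_, ?_⟩⟩
    · have hx' := (m1 x).1 hx
      obtain ⟨B, hB, hxB⟩ := (hP.mem_iff x).1 hx'.1.2
      refine ⟨B, Finset.mem_filter.2 ⟨hB, ?_⟩, hxB⟩
      rcases hk B hB with rfl | h | h
      · rcases hB₀x x hxB with h | h
        · exact absurd h hx'.1.1
        · exact absurd hx'.2 (not_lt.2 h)
      · exact h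
      · exact absurd hx'.2 (not_lt.2 ((m2 x).1 (h.1 hxB)).2)
    · rintro ⟨B, hB, hxB⟩
      exact (Finset.mem_filter.1 hB).2 hxB
    · obtain ⟨C, hC, hC1, rfl⟩ := hin B hB
      rcases hk C hC with rfl | h | h
      · exact ⟨p, Finset.mem_erase.2 ⟨hap.ne', hpB⟩⟩
      · exact absurd h hC1
      · obtain ⟨x, hx⟩ := hP.nonempty C hC
        exact ⟨x, Finset.mem_erase.2 ⟨fun hxa => ha2 (hxa ▸ h.1 hx), hx⟩⟩
    · have hx' := (m2 x).1 hx
      obtain ⟨B, hB, hxB⟩ := (hP.mem_iff x).1 hx'.1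
      refine ⟨B.erase a, Finset.mem_image_of_mem _ (Finset.mem_filter.2 ⟨hB, fun h => ?_⟩),
        Finset.mem_erase.2 ⟨fun hxa => ha2 (hxa ▸ hx), hxB⟩⟩
      exact absurd ((m1 x).1 (h hxB)).2 (not_lt.2 hx'.2)
    · rintro ⟨B, hB, hxB⟩
      obtain ⟨C, hC, hC1, rfl⟩ := hin B hB
      obtain ⟨hxa, hxC⟩ := Finset.mem_erase.1 hxB
      rcases hk C hC with rfl | h | h
      · rcases hB₀x x hxC with h | h
        · exact absurd h hxa
        · exact (m2 x).2 ⟨hP.subset hC hxC, h⟩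
      · exact absurd h hC1
      · exact h.1 hxC
    · intro B hB C hC x hxB hxC
      replace hB := hin B hB
      obtain ⟨B, hB, -, rfl⟩ := hB
      replace hC := hin C hC
      obtain ⟨C, hC, -, rfl⟩ := hC
      rw [hP.eq_of_mem B hB C hC x (Finset.mem_of_mem_erase hxB) (Finset.mem_of_mem_erase hxC)]
    · intro B hB C hC x hx y hy z hz w hw hxy hyz hzw
      replace hB := hin B hB
      obtain ⟨B, hB, -, rfl⟩ := hB
      replace hC := hin C hC
      obtain ⟨C, hC, -, rfl⟩ := hC
      rw [hP.eq_of_lt B hB C hC x (Finset.mem_of_mem_erase hx) y (Finset.mem_of_mem_erase hy) z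
        (Finset.mem_of_mem_erase hz) w (Finset.mem_of_mem_erase hw) hxy hyz hzw]
  · rintro ⟨P₁, P₂⟩ hQ
    obtain ⟨h1, h2⟩ := Finset.mem_product.1 hQ
    replace h1 := mem_nonCrossingFamilies.1 h1
    replace h2 := mem_nonCrossingFamilies.1 h2
    simp only at h1 h2 ⊢
    have e1 : (P₁ ∪ P₂.image ins).filter (· ⊆ S₁) = P₁ := by
      rw [Finset.filter_union, Finset.filter_true_of_mem fun B hB => h1.subset hB,
        Finset.filter_false_of_mem, Finset.union_empty]
      intro B hB
      obtain ⟨C, hC, rfl⟩ := Finset.mem_image.1 hB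
      exact hins1 C (h2.nonempty C hC) (h2.subset hC)
    have e2 : (P₁ ∪ P₂.image ins).filter (fun B => ¬ B ⊆ S₁) = P₂.image ins := by
      rw [Finset.filter_union, Finset.filter_false_of_mem fun B hB h => h (h1.subset hB),
        Finset.empty_union, Finset.filter_true_of_mem]
      intro B hB
      obtain ⟨C, hC, rfl⟩ := Finset.mem_image.1 hB
      exact hins1 C (h2.nonempty C hC) (h2.subset hC)
    rw [e1, e2, Finset.image_image]
    congr 1
    conv_rhs => rw [← Finset.image_id (s := P₂)]
    exact Finset.image_congr fun B hB => herase B (h2.subset hB)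
  · intro P hP
    rw [Finset.mem_filter, mem_nonCrossingFamilies] at hP
    obtain ⟨hP, B₀, hB₀, haB, hpB, hB₀x⟩ := hP
    have hk := hkey P hP B₀ hB₀ haB hpB hB₀x
    simp only
    have e1 : ((P.filter fun B => ¬ B ⊆ S₁).image (·.erase a)).image ins =
        P.filter fun B => ¬ B ⊆ S₁ := by
      rw [Finset.image_image]
      conv_rhs => rw [← Finset.image_id (s := P.filter fun B => ¬ B ⊆ S₁)]
      refine Finset.image_congr fun B hB => ?_
      obtain ⟨hB, hB1⟩ := Finset.mem_filter.1 hB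
      simp only [Function.comp_apply, id_eq, hins]
      rcases hk B hB with rfl | h | h
      · rw [if_pos (Finset.mem_erase.2 ⟨hap.ne', hpB⟩), Finset.insert_erase haB]
      · exact absurd h hB1
      · rw [if_neg fun h' => h.2 (Finset.mem_of_mem_erase h'),
          Finset.erase_eq_of_notMem fun h' => ha2 (h.1 h')]
    rw [e1, Finset.filter_union_filter_not_eq]
  · rintro ⟨P₁, P₂⟩ hQ
    obtain ⟨h1, h2⟩ := Finset.mem_product.1 hQ
    replace h1 := mem_nonCrossingFamilies.1 h1
    replace h2 := mem_nonCrossingFamilies.1 h2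
    simp only at h1 h2 ⊢
    rw [Finset.prod_union, Finset.prod_image]
    · congr 1
      · refine Finset.prod_congr rfl fun B hB => ?_
        rw [ite_self, if_neg fun h => ((m1 a).1 (h1.subset hB h)).1.1 rfl]
      · refine Finset.prod_congr rfl fun B hB => ?_
        have haB : a ∉ B := fun h => ha2 (h2.subset hB h)
        by_cases hpB : p ∈ B
        · have e : ins B = insert a B := if_pos hpB
          rw [if_pos hpB, e, if_pos (Finset.mem_insert_self _ _),
            Finset.card_insert_of_notMem haB]
          congr 1
          omega
        · have e : ins B = B := if_neg hpB
          rw [if_neg hpB, e, if_neg haB]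
    · intro B hB C hC hBC
      rw [← herase B (h2.subset hB), ← herase C (h2.subset hC), hBC]
    · rw [Finset.disjoint_left]
      intro B hB1 hB2
      obtain ⟨C, hC, rfl⟩ := Finset.mem_image.1 hB2
      exact hins1 C (h2.nonempty C hC) (h2.subset hC) (h1.subset hB1)

end NonCrossing

/-! ### Free cumulants -/

section FreeCumulants

variable {α : Type*} [LinearOrder α]

/-- A partition is classified by the second element `p` of the block of `a = min S`, if there is
one. -/
theorem nonCrossingSum_rec (κ : ℕ → ℂ) (d : ℕ) {S : Finset α} {a : α} (ha : a ∈ S)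
    (hmin : ∀ x ∈ S, a ≤ x) :
    nonCrossingSum κ a d S = κ (1 + d) * nonCrossingSum κ a 0 (S.erase a) +
      ∑ p ∈ S.erase a, nonCrossingSum κ p 0 ((S.erase a).filter (· < p)) *
        nonCrossingSum κ p (d + 1) (S.filter (p ≤ ·)) := by
  classical
  rw [← sum_nonCrossingFamilies_singleton κ d ha hmin, nonCrossingSum,
    ← Finset.sum_filter_add_sum_filter_not _ (fun P => {a} ∈ P)]
  congr 1
  have hlt : ∀ p ∈ S.erase a, a < p := fun p hp =>
    lt_of_le_of_ne (hmin p (Finset.mem_of_mem_erase hp)) (Finset.ne_of_mem_erase hp).symm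
  rw [Finset.sum_congr rfl fun p hp => (sum_nonCrossingFamilies_second κ d ha hmin
    (Finset.mem_of_mem_erase hp) (hlt p hp)).symm]
  simp only [Finset.sum_filter]
  rw [Finset.sum_comm]
  refine Finset.sum_congr rfl fun P hP => ?_
  have hP' := mem_nonCrossingFamilies.1 hP
  obtain ⟨B₀, hB₀, haB⟩ := (hP'.mem_iff a).1 ha
  split_ifs with h
  · obtain rfl : B₀ = {a} := (hP'.eq_of_mem B₀ hB₀ _ h a haB (Finset.mem_singleton_self a))
    symm
    refine Finset.sum_eq_zero fun p hp => if_neg ?_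
    rintro ⟨B, hB, haB', hpB, -⟩
    rw [hP'.eq_of_mem B hB _ hB₀ a haB' haB, Finset.mem_singleton] at hpB
    exact (hlt p hp).ne' hpB
  · have hne : (B₀.erase a).Nonempty := by
      rw [Finset.nonempty_iff_ne_empty]
      intro he
      rw [Finset.erase_eq_empty_iff] at he
      rcases he with rfl | rfl
      · simp at haB
      · exact h hB₀
    -- the second element of the block of `a`
    set q := (B₀.erase a).min' hne with hq
    have hqB := (B₀.erase a).min'_mem hne
    rw [← hq] at hqB
    rw [Finset.sum_eq_single q, if_pos]
    · refine ⟨B₀, hB₀, haB, Finset.mem_of_mem_erase hqB, fun x hx => ?_⟩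
      by_cases hxa : x = a
      · exact Or.inl hxa
      · exact Or.inr (Finset.min'_le _ _ (Finset.mem_erase.2 ⟨hxa, hx⟩))
    · intro p hp hpq
      refine if_neg ?_
      rintro ⟨B, hB, haB', hpB, hBx⟩
      obtain rfl := hP'.eq_of_mem B hB _ hB₀ a haB' haB
      apply hpq
      refine le_antisymm ?_ (Finset.min'_le _ _ (Finset.mem_erase.2 ⟨(hlt p hp).ne', hpB⟩))
      exact (hBx q (Finset.mem_of_mem_erase hqB)).resolve_left (Finset.ne_of_mem_erase hqB)
    · intro hqS
      exact absurd (Finset.mem_erase.2 ⟨Finset.ne_of_mem_erase hqB,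
        hP'.subset hB₀ (Finset.mem_of_mem_erase hqB)⟩) hqS

theorem sum_card_filter_lt (f : ℕ → ℂ) (T : Finset α) :
    ∑ p ∈ T, f (T.filter (· < p)).card = ∑ i ∈ Finset.range T.card, f i := by
  induction T using Finset.induction_on_max with
  | empty => simp
  | insert m T hm ih =>
    have hmT : m ∉ T := fun h => lt_irrefl m (hm m h)
    rw [Finset.sum_insert hmT, Finset.card_insert_of_notMem hmT, Finset.sum_range_succ, ← ih,
      add_comm]
    congr 1
    · refine Finset.sum_congr rfl fun p hp => ?_
      rw [Finset.filter_insert, if_neg (hm p hp).not_gt]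
    · rw [Finset.filter_insert, if_neg (lt_irrefl m), Finset.filter_true_of_mem hm]

/-- The sums over non-crossing partitions are the coefficients given by Lagrange inversion. -/
theorem nonCrossingSum_eq {C : PowerSeries ℂ} (hC : PowerSeries.coeff 0 C = 1) (n : ℕ) :
    ∀ S : Finset α, S.card = n →
      (∀ a, nonCrossingSum (fun j => PowerSeries.coeff j C) a 0 S = lagrangeCoeff C n 1) ∧
      ∀ a ∈ S, (∀ x ∈ S, a ≤ x) → ∀ d,
        nonCrossingSum (fun j => PowerSeries.coeff j C) a d S = shiftedLagrangeCoeff C d (n - 1) := by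
  induction n using Nat.strong_induction_on with
  | _ n ih =>
    intro S hS
    -- both sides satisfy the same recursion, and the summands depend only on the number of elements
    -- below `p`
    have hsecond : ∀ a ∈ S, (∀ x ∈ S, a ≤ x) → ∀ d, nonCrossingSum (fun j => PowerSeries.coeff j C)
        a d S = shiftedLagrangeCoeff C d (n - 1) := by
      intro a ha hmin d
      have hpos : 0 < n := hS ▸ Finset.card_pos.2 ⟨a, ha⟩
      have hcard : (S.erase a).card = n - 1 := by rw [Finset.card_erase_of_mem ha, hS]
      rw [nonCrossingSum_rec _ d ha hmin, shiftedLagrangeCoeff_rec hC,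
        (ih (n - 1) (by omega) _ hcard).1 a]
      congr 1
      rw [← hcard, ← sum_card_filter_lt (fun i => lagrangeCoeff C i 1 *
        shiftedLagrangeCoeff C (d + 1) ((S.erase a).card - 1 - i)) (S.erase a)]
      refine Finset.sum_congr rfl fun p hp => ?_
      have hpS := Finset.mem_of_mem_erase hp
      have hap : a < p := lt_of_le_of_ne (hmin p hpS) (Finset.ne_of_mem_erase hp).symm
      have e1 : S.filter (p ≤ ·) = (S.erase a).filter (fun x => ¬ x < p) := by
        ext x
        simp only [Finset.mem_filter, Finset.mem_erase, not_lt]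
        constructor
        · rintro ⟨h1, h2⟩
          exact ⟨⟨(hap.trans_le h2).ne', h1⟩, h2⟩
        · rintro ⟨⟨-, h1⟩, h2⟩
          exact ⟨h1, h2⟩
      have e2 := Finset.card_filter_add_card_filter_not (s := S.erase a) (fun x => x < p)
      rw [← e1, hcard] at e2
      have e3 : 0 < (S.filter (p ≤ ·)).card :=
        Finset.card_pos.2 ⟨p, Finset.mem_filter.2 ⟨hpS, le_rfl⟩⟩
      rw [(ih _ (by omega) _ rfl).1 p, (ih (S.filter (p ≤ ·)).card (by omega) _ rfl).2 p
        (Finset.mem_filter.2 ⟨hpS, le_rfl⟩) (fun x hx => (Finset.mem_filter.1 hx).2) (d + 1)]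
      congr 2
      omega
    refine ⟨fun a => ?_, hsecond⟩
    rcases S.eq_empty_or_nonempty with rfl | hne
    · obtain rfl : n = 0 := by simpa using hS.symm
      rw [nonCrossingSum_empty]
      simp [lagrangeCoeff, hC]
    · have hpos : 0 < n := hS ▸ Finset.card_pos.2 hne
      rw [nonCrossingSum_zero _ a (S.min' hne), hsecond _ (S.min'_mem hne)
        (fun x hx => S.min'_le x hx) 0, shiftedLagrangeCoeff_zero hC, Nat.sub_add_cancel hpos]

open Classical in
theorem sum_isNonCrossing_eq {C : PowerSeries ℂ} (hC : PowerSeries.coeff 0 C = 1) {n : ℕ}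
    (hn : 1 ≤ n) :
    ∑ π : Finpartition (Finset.univ : Finset (Fin n)) with IsNonCrossing π,
      ∏ B ∈ π.parts, PowerSeries.coeff B.card C = lagrangeCoeff C n 1 := by
  have h0 : nonCrossingSum (fun j => PowerSeries.coeff j C) (⟨0, hn⟩ : Fin n) 0 Finset.univ =
      lagrangeCoeff C n 1 := (nonCrossingSum_eq hC n _ (by simp)).1 _
  rw [← h0, nonCrossingSum]
  refine Finset.sum_bij (fun π _ => π.parts) (fun π hπ => ?_) (fun π _ π' _ h =>
    Finpartition.ext h) (fun P hP => ?_) (fun π _ => by simp)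
  · rw [mem_nonCrossingFamilies]
    refine ⟨fun B hB => π.nonempty_of_mem_parts hB, fun x => ?_, fun B hB D hD x hxB hxD =>
      π.eq_of_mem_parts hB hD hxB hxD, (Finset.mem_filter.1 hπ).2⟩
    simpa using π.exists_mem (Finset.mem_univ x)
  · have hP' := mem_nonCrossingFamilies.1 hP
    refine ⟨Finpartition.ofExistsUnique P (fun _ _ => Finset.subset_univ _) (fun x hx => ?_)
      (fun h => by simpa using hP'.nonempty _ h), Finset.mem_filter.2 ⟨Finset.mem_univ _, ?_⟩, rfl⟩
    · obtain ⟨B, hB, hxB⟩ := (hP'.mem_iff x).1 hx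
      exact ⟨B, ⟨hB, hxB⟩, fun D hD => hP'.eq_of_mem D hD.1 B hB x hD.2 hxB⟩
    · exact hP'.eq_of_lt

/-- If the moments up to order `n` are `(k + 1)⁻¹ [v ^ k] C ^ (k + 1)`, the free cumulants up to
order `n` are the coefficients of `C`. -/
theorem freeCumulant_eq_coeff {m : ℕ → ℝ} {C : PowerSeries ℂ} (hC : PowerSeries.coeff 0 C = 1)
    {n : ℕ} (hm : ∀ k ≤ n, (m k : ℂ) = ((k : ℂ) + 1)⁻¹ * PowerSeries.coeff k (C ^ (k + 1))) :
    ∀ k, 1 ≤ k → k ≤ n → (freeCumulant m k : ℂ) = PowerSeries.coeff k C := by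
  classical
  intro k
  induction k using Nat.strong_induction_on with
  | _ k ih =>
    intro hk hkn
    have hL : lagrangeCoeff C k 1 = m k := by
      rw [hm k hkn, lagrangeCoeff, if_neg (by omega)]
      push_cast
      rw [one_div]
    -- both families of weights have the same sums over non-crossing partitions of `Fin k`
    have h1 : ∑ π : Finpartition (Finset.univ : Finset (Fin k)) with IsNonCrossing π,
        ∏ B ∈ π.parts, (freeCumulant m B.card : ℂ) =
        ∑ π : Finpartition (Finset.univ : Finset (Fin k)) with IsNonCrossing π,
          ∏ B ∈ π.parts, PowerSeries.coeff B.card C := by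
      rw [sum_isNonCrossing_eq hC hk, hL, moment_eq_sum_freeCumulant m k hk]
      push_cast
      rfl
    have hne : (Finset.univ : Finset (Fin k)) ≠ ⊥ := by
      have : Nonempty (Fin k) := ⟨⟨0, hk⟩⟩
      exact Finset.univ_nonempty.ne_empty
    -- in these sums only the term of the partition with one block is not known to be equal
    set τ : Finpartition (Finset.univ : Finset (Fin k)) := Finpartition.indiscrete hne with hτ
    have hτp : τ.parts = {Finset.univ} := rfl
    have hτmem : τ ∈ Finset.univ.filter fun π : Finpartition (Finset.univ : Finset (Fin k)) =>
        IsNonCrossing π := by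
      refine Finset.mem_filter.2 ⟨Finset.mem_univ _, ?_⟩
      intro B hB D hD a _ b _ c _ d _ _ _ _
      rw [hτp, Finset.mem_singleton] at hB hD
      rw [hB, hD]
    -- the blocks of all other partitions have fewer than `k` elements
    have hsmall : ∀ π : Finpartition (Finset.univ : Finset (Fin k)), π ≠ τ →
        ∀ B ∈ π.parts, B.card < k := by
      intro π hπ B hB
      by_contra hlt
      apply hπ
      have hBu : B = Finset.univ := by
        rw [← Finset.card_eq_iff_eq_univ, Fintype.card_fin]
        exact le_antisymm (by simpa using Finset.card_le_univ B) (not_lt.1 hlt)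
      subst hBu
      refine Finpartition.ext ?_
      rw [hτp, Finset.eq_singleton_iff_unique_mem]
      refine ⟨hB, fun D hD => ?_⟩
      obtain ⟨x, hx⟩ := π.nonempty_of_mem_parts hD
      exact π.eq_of_mem_parts hD hB hx (Finset.mem_univ x)
    rw [← Finset.add_sum_erase _ _ hτmem, ← Finset.add_sum_erase _ _ hτmem,
      Finset.sum_congr rfl fun π hπ => Finset.prod_congr rfl fun B hB => ih B.card
        (hsmall π (Finset.ne_of_mem_erase hπ) B hB)
        (Finset.card_pos.2 (π.nonempty_of_mem_parts hB))
        ((hsmall π (Finset.ne_of_mem_erase hπ) B hB).le.trans hkn)] at h1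
    have h2 := add_right_cancel h1
    rw [hτp, Finset.prod_singleton, Finset.prod_singleton, Finset.card_univ, Fintype.card_fin] at h2
    exact h2

end FreeCumulants

/-- The limit of the averaged moments of order `k ≤ K`, in terms of the cumulant function in `K + 1`
variables. -/
theorem tendsto_moment_cumulantFunction {ρ : ∀ N : ℕ, PMF (Signature N)} {K : ℕ}
    {f : (Fin (K + 1) → ℂ) → ℂ} (hf : AnalyticAt ℂ f 1)
    (hsymm : ∀ᶠ u in 𝓝 (1 : Fin (K + 1) → ℂ), f (u ∘ finRotate (K + 1)) = f u)
    (hlim : RootLimit ρ f) {k : ℕ} (hk : k ≤ K) :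
    Tendsto (fun N => weightedSum (fun l => sgfWeight (ρ N) l * (l.powerMean k : ℂ)) 1) atTop
      (𝓝 (((k : ℂ) + 1)⁻¹ * PowerSeries.coeff k
        ((1 + PowerSeries.X * taylorSeries (cumulantFunction f)) ^ (k + 1)))) := by
  obtain ⟨ε, hε, hε2, G, hG, hG2, hfε⟩ := hlim.exists_isRootOn hf
  obtain ⟨R, hR, hRε⟩ := ((eventually_limitMoment_eq hf hlim.apply_one hsymm).and
    (Ioo_mem_nhdsGT (show (0 : ℝ) < ε / 4 by positivity))).exists
  rw [← hR k hk]
  exact tendsto_moment hk hε hε2 hG hG2 hfε hRε.1 hRε.2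

theorem mainTheorem9
    (ρ : ∀ N : ℕ, PMF (Signature N))
    (hρ : ∀ N : ℕ, 1 ≤ N → ∀ᶠ x : Fin N → ℂ in 𝓝 1, Summable (sgfTerm (ρ N) x))
    (F : ∀ k : ℕ, (Fin k → ℂ) → ℂ)
    (hF_symm : ∀ k : ℕ, 1 ≤ k → ∀ σ : Equiv.Perm (Fin k),
      ∀ᶠ u : Fin k → ℂ in 𝓝 1, F k (u ∘ σ) = F k u)
    (hF_an : ∀ k : ℕ, 1 ≤ k → AnalyticAt ℂ (F k) 1)
    (hlim : ∀ k : ℕ, 1 ≤ k → RootLimit ρ (F k)) :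
    (∃ μ : Measure ℝ, IsLimitInMoments ρ μ) ∧
    ∀ μ : Measure ℝ, IsLimitInMoments ρ μ → ∀ k : ℕ, 1 ≤ k →
      ((∫ x, x ^ k ∂μ : ℝ) : ℂ) =
        ∑ l ∈ Finset.range (k + 1), (k.choose l : ℂ) * (1 / ((l + 1).factorial : ℂ)) *
          iteratedDeriv l (fun v => cumulantFunction (F (k + 1)) v ^ (k - l)) 0 ∧
      (freeCumulant (fun n => ∫ x, x ^ n ∂μ) k : ℂ) =
        1 / ((k - 1).factorial : ℂ) *
          iteratedDeriv (k - 1) (cumulantFunction (F (k + 1))) 0 := by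
  set C : ℕ → PowerSeries ℂ := fun K =>
    1 + PowerSeries.X * taylorSeries (cumulantFunction (F (K + 1))) with hC
  set L : ℕ → ℕ → ℂ := fun K k =>
    ((k : ℂ) + 1)⁻¹ * PowerSeries.coeff k (C K ^ (k + 1)) with hL
  have htend : ∀ K k, k ≤ K → Tendsto (fun N => weightedSum
      (fun l => sgfWeight (ρ N) l * (l.powerMean k : ℂ)) 1) atTop (𝓝 (L K k)) := fun K k hk =>
    tendsto_moment_cumulantFunction (hF_an _ K.succ_pos) (hF_symm _ K.succ_pos _)
      (hlim _ K.succ_pos) hk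
  have hconc := fun k => tendsto_toOuterMeasure_moment (hF_an (k + 1 + (k + 1)) (by omega))
    (hlim _ (by omega)) (htend k k le_rfl)
  -- the limiting moments may be computed with any sufficiently large number of variables
  have hLm : ∀ K k, k ≤ K → L K k = ((L k k).re : ℂ) := fun K k hk =>
    (tendsto_nhds_unique (htend K k hk) (htend k k le_rfl)).trans (hconc k).1
  obtain ⟨hex, huniq⟩ := isLimitInMoments_of_tendsto fun k => (hconc k).2
  refine ⟨hex, fun μ hμ k hk => ⟨?_, ?_⟩⟩
  · rw [huniq μ hμ k, ← hLm k k le_rfl,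
      ← coeff_one_add_X_mul_taylorSeries_pow (analyticAt_cumulantFunction (hF_an _ k.succ_pos))]
  · have hC0 : PowerSeries.coeff 0 (C k) = 1 := by simp [hC]
    rw [freeCumulant_eq_coeff hC0 (n := k) (fun j hj => by rw [huniq μ hμ j, ← hLm k j hj]) k hk
      le_rfl]
    obtain ⟨j, rfl⟩ : ∃ j, k = j + 1 := ⟨k - 1, by omega⟩
    simp only [hC, map_add, PowerSeries.coeff_succ_X_mul, coeff_taylorSeries, Nat.add_sub_cancel]
    rw [PowerSeries.coeff_one, if_neg (Nat.succ_ne_zero j), zero_add, one_div, div_eq_inv_mul]
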